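/- All manifolds, maps and curves are smooth. Let $\kappa,\tau\in\mathbb{R}$ with $\kappa-4\tau^2\neq 0$. Let $E(\kappa,\tau)$ be a connected oriented homogeneous Riemannian $3$-manifold with a Riemannian submersion $\Pi:E(\kappa,\tau)\to M^2(\kappa)$ onto the complete simply connected surface of constant curvature $\kappa$, whose fibres are the geodesic trajectories of a unit vertical Killing field $\xi$ with $\bar\nabla_V\xi=\tau\,V\wedge\xi$ for all $V$ (the homogeneous $3$-manifolds with $4$-dimensional isometry group, where $\kappa$ is the curvature of the base, $\tau$ the bundle curvature and $\kappa-4\tau^2\ne0$). For a closed regular curve $\gamma:\mathbb{S}^1\to M^2(\kappa)$, an immersed surface $\Phi:\Sigma\to E(\kappa,\tau)$ is called the Hopf torus $\Pi^{-1}(\gamma)$ if $\Sigma$ is diffeomorphic to $\mathbb{S}^1\times\mathbb{S}^1$ in such a way that, for each $s$, $\Phi$ maps $\{s\}\times\mathbb{S}^1$ onto the fibre $\Pi^{-1}(\gamma(s))$; in particular $\Phi(\Sigma)=\Pi^{-1}(\gamma)$. **Theorem.** Let $\Phi:\Sigma\to E(\kappa,\tau)$ be an immersion of a compact connected surface (orientable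 or not). Then the induced metric is flat (Gauss curvature $K=0$) if and only if $\Sigma$ is a Hopf torus $\Pi^{-1}(\gamma)$ for some closed regular curve $\gamma$ in $M^2(\kappa)$. If the fibres of $\Pi$ are compact, then for every closed regular curve $\gamma$ the inverse image $\Pi^{-1}(\gamma)$ is such an immersed flat torus, each fibre being covered once. In particular: 1. There are no flat compact surfaces in $M^2(\kappa)\times\mathbb{R}$ ($\kappa\ne 0$), in the Heisenberg group $\mathrm{Nil}_3$ with the metric $dx^2+dy^2+(dz+\tau(y\,dx-x\,dy))^2$ ($\tau\neq0$), or in the universal cover of $Sl(2,\mathbb{R})$ ($\kappa<0$, $\tau\ne0$). 2. In $M^2(\kappa)\times\mathbb{S}^1$, $\kappa\neq 0$, with a circle of any radius, the flat compact surfaces are exactly the products $\gamma\times\mathbb{S}^1$, where $\gamma$ is a closed regular curve in $M^2(\kappa)$. 3. In the Berger spheres ($\kappa>0$), in $Sl(2,\mathbb{R})$ ($\kappa<0$), with $\tau\neq0$ and $\kappa-4\tau^2\neq0$, and in their quotients $L_n=\mathbb{S}^3/\mathbb{Z}_n$ and $Sl(2,\mathbb{R})/\mathbb{Z}_n$, $n\ge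 2$, by the $n$-th roots of unity acting along the fibres, the flat compact surfaces are exactly the Hopf tori of the Hopf fibration. Here $\mathbb{S}^3$ and $Sl(2,\mathbb{R})$ are the sets $\{|z|^2+\varepsilon|w|^2=1\}\subset\mathbb{C}^2$, $\varepsilon=\operatorname{sign}\kappa$, with the metric $\frac4\kappa\big(\langle X,Y\rangle+(\frac{4\tau^2}{\kappa}-1)\langle V,X\rangle\langle V,Y\rangle\big)$, where $\langle X,Y\rangle=\mathrm{Re}(x_1\bar y_1)+\varepsilon\,\mathrm{Re}(x_2\bar y_2)$ and $V=(iz,iw)$; the Hopf fibration is $(z,w)\mapsto(2w\bar z,|z|^2-\varepsilon|w|^2)$. -/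

import Mathlib

open scoped Manifold ContDiff Topology
open Set Bundle

universe u v w x y

namespace HopfTori

noncomputable section

/-! ### Riemannian geometry in a coordinate domain -/

section Coordinates

variable {E : Type*} [NormedAddCommGroup E] [NormedSpace ℝ E]

/-- The Christoffel map `Γ_y(u, v)` of a metric `h` on a domain of `E`: the vector with
`h_y(Γ_y(u, v), w) = (D_u h(v, w) + D_v h(u, w) - D_w h(u, v)) / 2` for all `w`. -/
def christoffel (h : E → E →L[ℝ] E →L[ℝ] ℝ) (y u v : E) : E :=
  (h y).inverse ((1 / 2 : ℝ) • (fderiv ℝ h y u v + fderiv ℝ h y v u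
    - ((fderiv ℝ h y).flip u).flip v))

/-- The Riemann curvature tensor `R(u, v) w = ∇_u ∇_v w - ∇_v ∇_u w` (constant fields `u v w`). -/
def riemann (h : E → E →L[ℝ] E →L[ℝ] ℝ) (y u v w : E) : E :=
  fderiv ℝ (fun z => christoffel h z v w) y u - fderiv ℝ (fun z => christoffel h z u w) y v
    + christoffel h y u (christoffel h y v w) - christoffel h y v (christoffel h y u w)

/-- The bilinear form `b(L u, L v)`. -/
def pullbackForm {F : Type*} [NormedAddCommGroup F] [NormedSpace ℝ F]
    (b : F →L[ℝ] F →L[ℝ] ℝ) (L : E →L[ℝ] F) : E →L[ℝ] E →L[ℝ] ℝ := b.bilinearComp L L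

end Coordinates

/-! ### Metrics on manifolds, curvature, covariant derivative -/

section Manifolds

variable {E : Type*} [NormedAddCommGroup E] [NormedSpace ℝ E]
  {H : Type*} [TopologicalSpace H] (I : ModelWithCorners ℝ E H)
  {X : Type*} [TopologicalSpace X] [ChartedSpace H X]
  {E' : Type*} [NormedAddCommGroup E'] [NormedSpace ℝ E']
  {H' : Type*} [TopologicalSpace H'] (J : ModelWithCorners ℝ E' H')
  {Y : Type*} [TopologicalSpace Y] [ChartedSpace H' Y]

/-- A bilinear form on every tangent space. -/
abbrev MetricField (X : Type*) [TopologicalSpace X] [ChartedSpace H X] :=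
  (x : X) → TangentSpace I x →L[ℝ] TangentSpace I x →L[ℝ] ℝ

/-- A smooth Riemannian metric. -/
abbrev SmoothMetric (X : Type*) [TopologicalSpace X] [ChartedSpace H X] [IsManifold I ∞ X] :=
  ContMDiffRiemannianMetric I ∞ E (fun x : X => TangentSpace I x)

variable {I J}

/-- The metric `g` read in the chart at `x₀`. -/
def localMetric (g : MetricField I X) (x₀ : X) : E → E →L[ℝ] E →L[ℝ] ℝ := fun y =>
  pullbackForm (E := E) (F := E) (g ((extChartAt I x₀).symm y))
    (mfderiv 𝓘(ℝ, E) I (extChartAt I x₀).symm y)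

/-- At the point `x` of a surface, the Gauss curvature of `g` is `K`. -/
def HasGaussCurvatureAt (g : MetricField I X) (x : X) (K : ℝ) : Prop :=
  ∀ u v : E,
    localMetric g x (extChartAt I x x) (riemann (localMetric g x) (extChartAt I x x) u v v) u =
      K * (localMetric g x (extChartAt I x x) u u * localMetric g x (extChartAt I x x) v v
        - localMetric g x (extChartAt I x x) u v ^ 2)

/-- The covariant derivative `∇_v ξ` at `x` for the Levi-Civita connection of `g`. -/
def covDeriv (g : MetricField I X) (ξ : (x : X) → TangentSpace I x) (x : X)
    (v : TangentSpace I x) : TangentSpace I x :=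
  let φ := extChartAt I x
  let ξ' : E → E := fun y => mfderiv I 𝓘(ℝ, E) φ (φ.symm y) (ξ (φ.symm y))
  let v' : E := mfderiv I 𝓘(ℝ, E) φ x v
  (mfderiv I 𝓘(ℝ, E) φ x).inverse
    (fderiv ℝ ξ' (φ x) v' + christoffel (localMetric g x) (φ x) v' (ξ' (φ x)))

/-- The pull-back `f^* g`. -/
def pullbackMetric (g : MetricField J Y) (f : X → Y) : MetricField I X := fun x =>
  pullbackForm (E := E) (F := E') (g (f x)) (mfderiv I J f x)

/-- The Riemannian product metric. -/
def prodMetric (g : MetricField I X) (g' : MetricField J Y) :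
    MetricField (I.prod J) (X × Y) := fun p =>
  pullbackMetric (I := I.prod J) g Prod.fst p + pullbackMetric (I := I.prod J) g' Prod.snd p

variable (I J)

/-- The flat metric of a Euclidean space. -/
def euclideanMetric (F : Type*) [NormedAddCommGroup F] [InnerProductSpace ℝ F] :
    MetricField 𝓘(ℝ, F) F := fun _ => (innerSL ℝ : F →L[ℝ] F →L[ℝ] ℝ)

/-- The metric of the circle of radius `r`. -/
def circleMetric (r : ℝ) : MetricField (𝓡 1) Circle := fun z =>
  r ^ 2 • pullbackMetric (I := 𝓡 1) (euclideanMetric ℂ) (fun w : Circle => (w : ℂ)) z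

/-- Smooth immersions. -/
def IsSmoothImmersion (f : X → Y) : Prop :=
  ContMDiff I J ∞ f ∧ ∀ x, Function.Injective (mfderiv I J f x)

variable {I J}

/-- A smooth local isometry (between manifolds of the same dimension). -/
def IsLocalIsometry (g : MetricField I X) (g' : MetricField J Y) (f : X → Y) : Prop :=
  IsSmoothImmersion I J f ∧ ∀ x, pullbackMetric g' f x = g x

/-- Cauchy sequences for the Riemannian distance converge. -/
def IsCompleteMetric [IsManifold I ∞ X] (g : SmoothMetric I X) : Prop :=
  letI : RiemannianBundle (fun x : X => TangentSpace I x) := ⟨g.toRiemannianMetric⟩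
  ∀ c : ℕ → X,
    (∀ ε > 0, ∃ k, ∀ m ≥ k, ∀ n ≥ k, Manifold.riemannianEDist I (c m) (c n) < ε) →
    ∃ x, Filter.Tendsto c Filter.atTop (𝓝 x)

/-- The group of isometries acts transitively. -/
def IsHomogeneousMetric [IsManifold I ∞ X] (g : SmoothMetric I X) : Prop :=
  ∀ p q : X, ∃ f : X ≃ₘ^∞⟮I, I⟯ X,
    (∀ x, pullbackMetric (I := I) g.inner f x = g.inner x) ∧ f p = q

/-- `(X, g)` is the space form `M²(κ)`: a simply connected complete surface of constant Gauss
curvature `κ`. -/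
def IsSpaceForm [IsManifold I ∞ X] (κ : ℝ) (g : SmoothMetric I X) : Prop :=
  SimplyConnectedSpace X ∧ IsCompleteMetric g ∧ ∀ x, HasGaussCurvatureAt g.inner x κ

/-- `Π` is a Riemannian submersion onto `Y`. -/
def IsRiemannianSubmersion (g : MetricField I X) (g' : MetricField J Y) (Pr : X → Y) : Prop :=
  ContMDiff I J ∞ Pr ∧ Function.Surjective Pr ∧
    ∀ x, Function.Surjective (mfderiv I J Pr x) ∧
      ∀ v w : TangentSpace I x,
        (∀ k : TangentSpace I x, mfderiv I J Pr x k = 0 → g x v k = 0) →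
        (∀ k : TangentSpace I x, mfderiv I J Pr x k = 0 → g x w k = 0) →
        g' (Pr x) (mfderiv I J Pr x v) (mfderiv I J Pr x w) = g x v w

/-- `cross` is the vector product of a Riemannian `3`-manifold for one of its orientations:
`u ∧ v` is orthogonal to `u` and `v`, its length is the area spanned by `u` and `v`, and it depends
continuously on the point. -/
def IsVectorProduct (g : MetricField I X)
    (cross : (x : X) → TangentSpace I x →L[ℝ] TangentSpace I x →L[ℝ] TangentSpace I x)
    [IsManifold I ∞ X] : Prop :=
  Continuous (fun x : X => TotalSpace.mk' (E →L[ℝ] E →L[ℝ] E)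
    (E := fun x : X => TangentSpace I x →L[ℝ] TangentSpace I x →L[ℝ] TangentSpace I x)
    x (cross x)) ∧
  ∀ (x : X) (u v : TangentSpace I x), g x (cross x u v) u = 0 ∧ g x (cross x u v) v = 0 ∧
    g x (cross x u v) (cross x u v) = g x u u * g x v v - g x u v ^ 2

end Manifolds

/-! ### The spaces `E(κ, τ)` -/

section Spaces

variable {E : Type*} [NormedAddCommGroup E] [NormedSpace ℝ E]
  {H : Type*} [TopologicalSpace H] {I : ModelWithCorners ℝ E H}
  {N : Type*} [TopologicalSpace N] [ChartedSpace H N] [IsManifold I ∞ N]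
  {M : Type*} [TopologicalSpace M] [ChartedSpace (EuclideanSpace ℝ (Fin 2)) M]
  [IsManifold (𝓡 2) ∞ M]

/-- `(N, g)` is a space `E(κ, τ)` with fibration `Pr : N → M = M²(κ)`, vertical Killing field `ξ`
and vector product `cross`. The equation `∇_v ξ = τ (v ∧ ξ)` says that `ξ` is Killing, that its
trajectories are geodesics, and that `τ` is the bundle curvature. -/
structure IsEkt (κ τ : ℝ) (g : SmoothMetric I N) (gM : SmoothMetric (𝓡 2) M) (Pr : N → M)
    (ξ : (x : N) → TangentSpace I x)
    (cross : (x : N) → TangentSpace I x →L[ℝ] TangentSpace I x →L[ℝ] TangentSpace I x) :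
    Prop where
  dim : Module.finrank ℝ E = 3
  connected : ConnectedSpace N
  homogeneous : IsHomogeneousMetric g
  spaceForm : IsSpaceForm κ gM
  submersion : IsRiemannianSubmersion g.inner gM.inner Pr
  /-- each fibre is one geodesic -/
  fibre_connected : ∀ b, IsConnected (Pr ⁻¹' {b})
  smooth_field : ContMDiff I I.tangent ∞ (fun x : N => (⟨x, ξ x⟩ : TangentBundle I N))
  unit_field : ∀ x, g.inner x (ξ x) (ξ x) = 1
  vertical_field : ∀ x, mfderiv I (𝓡 2) Pr x (ξ x) = 0
  vectorProduct : IsVectorProduct g.inner cross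
  covDeriv_field : ∀ (x : N) (v : TangentSpace I x),
    covDeriv g.inner ξ x v = τ • cross x v (ξ x)
  ne : κ - 4 * τ ^ 2 ≠ 0

end Spaces

/-! ### Flat compact surfaces and Hopf tori -/

section Surfaces

variable {E : Type*} [NormedAddCommGroup E] [NormedSpace ℝ E]
  {H : Type*} [TopologicalSpace H] {I : ModelWithCorners ℝ E H}
  {N : Type*} [TopologicalSpace N] [ChartedSpace H N]
  {E' : Type*} [NormedAddCommGroup E'] [NormedSpace ℝ E']
  {H' : Type*} [TopologicalSpace H'] (J : ModelWithCorners ℝ E' H')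
  {B : Type*} [TopologicalSpace B] [ChartedSpace H' B]
  {E₂ : Type*} [NormedAddCommGroup E₂] [NormedSpace ℝ E₂]
  {H₂ : Type*} [TopologicalSpace H₂] (I₂ : ModelWithCorners ℝ E₂ H₂)
  {S : Type*} [TopologicalSpace S] [ChartedSpace H₂ S]

/-- The surface `Φ : S → N` is flat: the Gauss curvature of its induced metric vanishes. -/
def IsFlatSurface (g : MetricField I N) (Φ : S → N) : Prop :=
  ∀ x, HasGaussCurvatureAt (pullbackMetric (I := I₂) g Φ) x 0

/-- Closed regular curves. -/
def IsClosedRegularCurve (γ : Circle → B) : Prop := IsSmoothImmersion (𝓡 1) J γ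

/-- The surface `Φ : S → N` is the Hopf torus `Π⁻¹(γ)` over a closed regular curve `γ`: `S` is a
torus on which the second circle factor runs through the fibres over the points of `γ`.
In particular `Φ(S) = Π⁻¹(γ)`. -/
def IsHopfTorus (Pr : N → B) (Φ : S → N) : Prop :=
  ∃ γ : Circle → B, IsClosedRegularCurve J γ ∧
    ∃ ψ : Diffeomorph ((𝓡 1).prod (𝓡 1)) I₂ (Circle × Circle) S ∞,
      ∀ s, range (fun t => Φ (ψ (s, t))) = Pr ⁻¹' {γ s}

/-- The flat surfaces among the compact connected surfaces immersed in `(N, g)` are exactly the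
Hopf tori of `Pr`. -/
def FlatIffHopfTorus (g : MetricField I N) (Pr : N → B) : Prop :=
  ∀ (S : Type u) [TopologicalSpace S] [T2Space S] [CompactSpace S] [ConnectedSpace S]
    [ChartedSpace (EuclideanSpace ℝ (Fin 2)) S] [IsManifold (𝓡 2) ∞ S] (Φ : S → N),
    IsSmoothImmersion (𝓡 2) I Φ → (IsFlatSurface (𝓡 2) g Φ ↔ IsHopfTorus J (𝓡 2) Pr Φ)

/-- There are no flat compact surfaces in `(N, g)`. -/
def NoFlatCompactSurface (g : MetricField I N) : Prop :=
  ∀ (S : Type u) [TopologicalSpace S] [T2Space S] [CompactSpace S] [ConnectedSpace S]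
    [ChartedSpace (EuclideanSpace ℝ (Fin 2)) S] [IsManifold (𝓡 2) ∞ S] (Φ : S → N),
    IsSmoothImmersion (𝓡 2) I Φ → ¬ IsFlatSurface (𝓡 2) g Φ

/-- Over each closed regular curve `γ` of the base, `Π⁻¹(γ)` is an immersed flat torus, fibred by
the fibres of `Pr`. -/
def EveryHopfTorusIsFlat (g : MetricField I N) (Pr : N → B) : Prop :=
  ∀ γ : Circle → B, IsClosedRegularCurve J γ → range γ ⊆ range Pr →
    ∃ Φ : Circle × Circle → N, IsSmoothImmersion ((𝓡 1).prod (𝓡 1)) I Φ ∧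
      IsFlatSurface ((𝓡 1).prod (𝓡 1)) g Φ ∧
      ∀ s, Function.Injective (fun t => Φ (s, t)) ∧
        range (fun t => Φ (s, t)) = Pr ⁻¹' {γ s}

end Surfaces

/-! ### Explicit models -/

/-- The square of a linear form, as a bilinear form. -/
def tensorSq {F : Type*} [NormedAddCommGroup F] [NormedSpace ℝ F] (α : F →L[ℝ] ℝ) :
    F →L[ℝ] F →L[ℝ] ℝ := α.smulRight α

/-- The Heisenberg group `Nil₃`: `ℝ³` with the metric
`dx² + dy² + (dz + τ (y dx - x dy))²`. -/
def nilMetric (τ : ℝ) : MetricField 𝓘(ℝ, ℝ × ℝ × ℝ) (ℝ × ℝ × ℝ) := fun p =>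
  let dx : ℝ × ℝ × ℝ →L[ℝ] ℝ := ContinuousLinearMap.fst ℝ ℝ (ℝ × ℝ)
  let dy : ℝ × ℝ × ℝ →L[ℝ] ℝ :=
    (ContinuousLinearMap.fst ℝ ℝ ℝ).comp (ContinuousLinearMap.snd ℝ ℝ (ℝ × ℝ))
  let dz : ℝ × ℝ × ℝ →L[ℝ] ℝ :=
    (ContinuousLinearMap.snd ℝ ℝ ℝ).comp (ContinuousLinearMap.snd ℝ ℝ (ℝ × ℝ))
  (tensorSq dx + tensorSq dy + tensorSq (dz + τ • (p.2.1 • dx - p.1 • dy)) :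
    ℝ × ℝ × ℝ →L[ℝ] ℝ × ℝ × ℝ →L[ℝ] ℝ)

/-- For `κ > 0` the sphere `|z|² + |w|² = 1`. For `κ < 0` the set `|z|² - |w|² = 1`; it is
`Sl(2, ℝ)`, since `(z, w)` stands for the real-linear map `ζ ↦ z ζ + w ζ̄` of the plane, whose
determinant is `|z|² - |w|²`. -/
def quadric (κ : ℝ) : Set (ℂ × ℂ) := {p | ‖p.1‖ ^ 2 + Real.sign κ * ‖p.2‖ ^ 2 = 1}

/-- The real bilinear form `Re (z z̄') ± Re (w w̄')`, the sign being that of `κ`. -/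
def signedForm (κ : ℝ) : ℂ × ℂ →L[ℝ] ℂ × ℂ →L[ℝ] ℝ :=
  (innerSL ℝ : ℂ →L[ℝ] ℂ →L[ℝ] ℝ).bilinearComp
      (ContinuousLinearMap.fst ℝ ℂ ℂ) (ContinuousLinearMap.fst ℝ ℂ ℂ)
    + Real.sign κ • (innerSL ℝ : ℂ →L[ℝ] ℂ →L[ℝ] ℝ).bilinearComp
      (ContinuousLinearMap.snd ℝ ℂ ℂ) (ContinuousLinearMap.snd ℝ ℂ ℂ)

/-- The bilinear form `(4/κ) (⟨X, Y⟩ + (4τ²/κ - 1) ⟨V, X⟩ ⟨V, Y⟩)` at `p`, with `V = i p` tangent to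
the fibres of the Hopf map. On the tangent spaces of the quadric this is the Berger metric
(`κ > 0`), or the homogeneous metric of `Sl(2, ℝ)` (`κ < 0`), with parameters `κ`, `τ`. -/
def quadricMetric (κ τ : ℝ) : MetricField 𝓘(ℝ, ℂ × ℂ) (ℂ × ℂ) := fun p =>
  ((4 / κ) • (signedForm κ + (4 * τ ^ 2 / κ - 1) •
    tensorSq (signedForm κ (Complex.I * p.1, Complex.I * p.2))) :
    ℂ × ℂ →L[ℝ] ℂ × ℂ →L[ℝ] ℝ)

/-- The Hopf fibration of the quadric. It maps onto the unit sphere of `ℂ × ℝ` if `κ > 0` and onto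
the hyperboloid sheet `|a|² - b² = -1`, `b > 0`, if `κ < 0`. -/
def hopfMap (κ : ℝ) (p : ℂ × ℂ) : ℂ × ℝ :=
  (2 * p.2 * (starRingEnd ℂ) p.1, ‖p.1‖ ^ 2 - Real.sign κ * ‖p.2‖ ^ 2)

section Models

variable {Q : Type*} [TopologicalSpace Q] [ChartedSpace (EuclideanSpace ℝ (Fin 3)) Q]
  {N : Type*} [TopologicalSpace N] [ChartedSpace (EuclideanSpace ℝ (Fin 3)) N]

/-- `P : Q → ℂ × ℂ` identifies the Riemannian `3`-manifold `(Q, g)` with the quadric, carrying the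
Berger metric (`κ > 0`) or the homogeneous metric of `Sl(2, ℝ)` (`κ < 0`). -/
def IsQuadric (κ τ : ℝ) (g : MetricField (𝓡 3) Q) (P : Q → ℂ × ℂ) : Prop :=
  IsSmoothImmersion (𝓡 3) 𝓘(ℝ, ℂ × ℂ) P ∧ Topology.IsEmbedding P ∧ range P = quadric κ ∧
    ∀ x, g x = pullbackMetric (quadricMetric κ τ) P x

/-- `F : Q → N` presents `(N, gN)` as the quotient of the quadric `(Q, g)` by the group `ℤ_n` of
the `n`-th roots of unity, acting by `(z, w) ↦ (ζ z, ζ w)`. -/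
def IsCyclicQuotient (n : ℕ) (g : MetricField (𝓡 3) Q) (P : Q → ℂ × ℂ)
    (gN : MetricField (𝓡 3) N) (F : Q → N) : Prop :=
  IsLocalIsometry g gN F ∧ Function.Surjective F ∧
    ∀ x y, F x = F y ↔ ∃ ζ : ℂ, ζ ^ n = 1 ∧ P y = (ζ * (P x).1, ζ * (P x).2)

/-- `F : N → Q` presents `(N, gN)` as the Riemannian universal cover of `(Q, g)`. -/
def IsUniversalCover (g : MetricField (𝓡 3) Q) (gN : MetricField (𝓡 3) N) (F : N → Q) : Prop :=
  SimplyConnectedSpace N ∧ IsCoveringMap F ∧ Function.Surjective F ∧ IsLocalIsometry gN g F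

end Models

end

end HopfTori

open HopfTori

/-!
Near each of its points `E(κ, τ)` has an orthonormal coframe `a, b, c` and a `1`-form `ϖ` (the
connection form of the base) with `da = ϖ ∧ b`, `db = -ϖ ∧ a`, `dc = 2σ a ∧ b`, `dϖ = -κ a ∧ b`,
where `σ = ± τ` and `c` is the form dual to the vertical field `ξ`. Most of the argument uses
nothing else (`EktLike`); what concerns the fibres uses in addition that they are connected,
tangent to `ξ`, and separated by local coordinates of the base (`EktFibration`).

*Compact flat surfaces are vertical.* A compact flat surface has a developing map `D : ℂ → Σ`,
onto and locally isometric (`exists_developing_map`), and two points of the plane with the same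
image are exchanged by a rigid motion that preserves `D` (`exists_rigid_of_eq`). On the plane the
structure equations say that the two components of the pulled-back vertical form `η` have the
Jacobian `-(κ - 4τ²) (1 - |η|²)²` (`EktLike.jacobian_vertForm`): the second fundamental form drops
out. By the divergence theorem the integral of this Jacobian over a square of side `r` is `O(r)`,
since `η` and its derivative are bounded. If `|η| < 1` at one point, then, by compactness of `Σ`,
each disc of some fixed radius contains a disc of another fixed radius on which `(1 - |η|²)²`
exceeds a fixed positive number, so that the integral grows like `r²`. As `κ - 4τ² ≠ 0`, this is
absurd; hence `|η| = 1`, which means that `ξ` is tangent to the surface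
(`EktLike.norm_vertForm_eq_one`), and then the Jacobian equation is supplemented by `dη = 0`: after
a rotation of the plane, `ξ` is the image of the unit vector `i` everywhere
(`EktLike.exists_vertical_developing_map`). In particular a function on the ambient space whose
derivative along `ξ` never vanishes cannot exist beside a compact flat surface: it would have a
maximum on the surface. Such functions are the height on `M² × ℝ` and on `Nil₃`, and the argument of
`z` on the universal cover of `Sl(2, ℝ)`.

*They are Hopf tori.* Vertical lines of the plane are mapped to fibres, so the rigid motions
preserving `D` are translations, and form a cocompact group. Its real parts are not dense, because
otherwise the projection to the base would be constant; so the group is a lattice with a vertical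
generator (`exists_lattice`). The quotient is the torus, the vertical circles are closed
trajectories of `ξ`, which are whole fibres, and the projection of a transversal circle is `γ`
(`EktFibration.isHopfTorus_of_isFlatSurface`).

*Hopf tori are flat.* On a vertical surface the horizontal coframe has rank one, so that after
normalization it is closed, as is `c`; together they give flat coordinates
(`EktLike.isFlatSurface_of_vertical`). If the fibres are compact, a horizontal lift of `γ`, moved
along the fibres, is a map from the plane which is periodic along the fibres, and the quotient by
its periods is the immersed torus over `γ` (`EktFibration.everyHopfTorusIsFlat`).

*The models.* The coframe of an abstract `E(κ, τ)` comes from an orthonormal coframe of the base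
and from `∇ξ = τ · ∧ ξ`, which gives `dc` (`IsEkt.ektFibration`); that of a product is the product
coframe (`ektFibration_prod`). The coframe of the quadrics is explicit in the coordinates `w / z`
and `log z`, after an exchange of `z` and `w` where `z = 0` (`isEktCoframeOn_quadric`); quotients by
roots of unity look locally like the quadric, and their fibres are images of the circle
(`exists_ektFibration_quotient`).
-/

namespace HopfTori

noncomputable section

/-! ### Differential forms on normed spaces -/

section Forms

variable {V : Type*} [NormedAddCommGroup V] [NormedSpace ℝ V]
  {V' : Type*} [NormedAddCommGroup V'] [NormedSpace ℝ V']
  {W : Type*} [NormedAddCommGroup W] [NormedSpace ℝ W]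

/-- The exterior derivative of a `W`-valued `1`-form on `V`. -/
def extD (a : V → V →L[ℝ] W) (y u v : V) : W := fderiv ℝ a y u v - fderiv ℝ a y v u

/-- The wedge product of two covectors. -/
def wedge (a b : V →L[ℝ] ℝ) (u v : V) : ℝ := a u * b v - a v * b u

/-- The pull-back of a `1`-form. -/
def pullForm (F : V → V') (a : V' → V' →L[ℝ] W) : V → V →L[ℝ] W :=
  fun y => (a (F y)).comp (fderiv ℝ F y)

theorem extD_pullForm {F : V → V'} {a : V' → V' →L[ℝ] W} {y : V}
    (hF : ContDiffAt ℝ 2 F y) (ha : DifferentiableAt ℝ a (F y)) (u v : V) :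
    extD (pullForm F a) y u v = extD a (F y) (fderiv ℝ F y u) (fderiv ℝ F y v) := by
  have h1 : HasFDerivAt F (fderiv ℝ F y) y := (hF.differentiableAt (by norm_num)).hasFDerivAt
  have h2 : HasFDerivAt (fderiv ℝ F) (fderiv ℝ (fderiv ℝ F) y) y :=
    ((hF.fderiv_right (m := 1) (by norm_num)).differentiableAt (by norm_num)).hasFDerivAt
  have h3 := (ha.hasFDerivAt.comp y h1).clm_comp h2
  have hs : IsSymmSndFDerivAt ℝ F y := hF.isSymmSndFDerivAt (by simp)
  have h4 : fderiv ℝ (pullForm F a) y = _ := h3.fderiv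
  unfold extD
  rw [h4]
  have := hs u v
  simp [this]

theorem ContDiffOn.pullForm {F : V → V'} {a : V' → V' →L[ℝ] W} {U : Set V} {O : Set V'}
    (hF : ContDiffOn ℝ ∞ F U) (hU : IsOpen U) (ha : ContDiffOn ℝ ∞ a O) (h : MapsTo F U O) :
    ContDiffOn ℝ ∞ (pullForm F a) U :=
  (ha.comp hF h).clm_comp (hF.fderiv_of_isOpen hU (by simp))

/-- A primitive of a closed `1`-form on an open convex set. -/
theorem exists_primitive [CompleteSpace W] {a : V → V →L[ℝ] W} {U : Set V} (hU : IsOpen U)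
    (hc : Convex ℝ U) (ha : ContDiffOn ℝ ∞ a U) (hd : ∀ y ∈ U, ∀ u v, extD a y u v = 0) :
    ∃ f : V → W, ContDiffOn ℝ ∞ f U ∧ ∀ y ∈ U, HasFDerivAt f (a y) y := by
  obtain ⟨f, hf⟩ := hc.exists_forall_hasFDerivAt_of_fderiv_symmetric hU
    (ha.differentiableOn (by simp)) (fun y hy u v => sub_eq_zero.1 (hd y hy u v))
  refine ⟨f, ?_, hf⟩
  rw [contDiffOn_infty_iff_fderiv_of_isOpen hU]
  exact ⟨fun y hy => (hf y hy).differentiableAt.differentiableWithinAt,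
    ha.congr fun y hy => (hf y hy).fderiv⟩

/-- The structure equations of `E(κ, σ)`: `a`, `b`, `c` play the roles of the horizontal coframe
and of the form dual to the vertical field, `ϖ` is the connection form of the base. -/
structure IsEktCoframeOn (κ σ : ℝ) (a b c ϖ : V → V →L[ℝ] ℝ) (O : Set V) : Prop where
  isOpen : IsOpen O
  smooth_a : ContDiffOn ℝ ∞ a O
  smooth_b : ContDiffOn ℝ ∞ b O
  smooth_c : ContDiffOn ℝ ∞ c O
  smooth_ϖ : ContDiffOn ℝ ∞ ϖ O
  d_a : ∀ y ∈ O, ∀ u v, extD a y u v = wedge (ϖ y) (b y) u v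
  d_b : ∀ y ∈ O, ∀ u v, extD b y u v = - wedge (ϖ y) (a y) u v
  d_c : ∀ y ∈ O, ∀ u v, extD c y u v = 2 * σ * wedge (a y) (b y) u v
  d_ϖ : ∀ y ∈ O, ∀ u v, extD ϖ y u v = - κ * wedge (a y) (b y) u v

theorem IsEktCoframeOn.pull {κ σ : ℝ} {a b c ϖ : V' → V' →L[ℝ] ℝ} {O : Set V'}
    (h : IsEktCoframeOn κ σ a b c ϖ O) {F : V → V'} {U : Set V} (hU : IsOpen U)
    (hF : ContDiffOn ℝ ∞ F U) (hm : MapsTo F U O) :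
    IsEktCoframeOn κ σ (pullForm F a) (pullForm F b) (pullForm F c) (pullForm F ϖ) U := by
  have key : ∀ {a : V' → V' →L[ℝ] ℝ}, ContDiffOn ℝ ∞ a O → ∀ y ∈ U, ∀ u v,
      extD (pullForm F a) y u v = extD a (F y) (fderiv ℝ F y u) (fderiv ℝ F y v) := by
    intro a ha y hy u v
    refine extD_pullForm ((hF.contDiffAt (hU.mem_nhds hy)).of_le ?_) ?_ u v
    · exact ENat.LEInfty.out
    · exact (ha.contDiffAt (h.isOpen.mem_nhds (hm hy))).differentiableAt (by simp)
  refine ⟨hU, ContDiffOn.pullForm hF hU h.smooth_a hm, ContDiffOn.pullForm hF hU h.smooth_b hm,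
    ContDiffOn.pullForm hF hU h.smooth_c hm, ContDiffOn.pullForm hF hU h.smooth_ϖ hm, ?_, ?_, ?_, ?_⟩
  · intro y hy u v; rw [key h.smooth_a y hy, h.d_a _ (hm hy)]; rfl
  · intro y hy u v; rw [key h.smooth_b y hy, h.d_b _ (hm hy)]; rfl
  · intro y hy u v; rw [key h.smooth_c y hy, h.d_c _ (hm hy)]; rfl
  · intro y hy u v; rw [key h.smooth_ϖ y hy, h.d_ϖ _ (hm hy)]; rfl

theorem IsEktCoframeOn.mono {κ σ : ℝ} {a b c ϖ : V → V →L[ℝ] ℝ} {O U : Set V}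
    (h : IsEktCoframeOn κ σ a b c ϖ O) (hU : IsOpen U) (hUO : U ⊆ O) :
    IsEktCoframeOn κ σ a b c ϖ U :=
  ⟨hU, h.smooth_a.mono hUO, h.smooth_b.mono hUO, h.smooth_c.mono hUO, h.smooth_ϖ.mono hUO,
    fun y hy => h.d_a y (hUO hy), fun y hy => h.d_b y (hUO hy), fun y hy => h.d_c y (hUO hy),
    fun y hy => h.d_ϖ y (hUO hy)⟩

end Forms

/-! ### The angle function of a flat surface -/

section Angle

/-- The rows of an orthonormal frame `p, q, p × q` of `ℝ³` being orthonormal, so are the columns. -/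
theorem columns_orthonormal {p1 p2 p3 q1 q2 q3 : ℝ}
    (hp : p1 * p1 + p2 * p2 + p3 * p3 = 1) (hq : q1 * q1 + q2 * q2 + q3 * q3 = 1)
    (hpq : p1 * q1 + p2 * q2 + p3 * q3 = 0) :
    let n1 := p2 * q3 - p3 * q2; let n2 := p3 * q1 - p1 * q3; let n3 := p1 * q2 - q1 * p2
    (p1 * p1 + q1 * q1 + n1 * n1 = 1 ∧ p2 * p2 + q2 * q2 + n2 * n2 = 1 ∧
      p3 * p3 + q3 * q3 + n3 * n3 = 1) ∧
    (p1 * p2 + q1 * q2 + n1 * n2 = 0 ∧ p1 * p3 + q1 * q3 + n1 * n3 = 0 ∧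
      p2 * p3 + q2 * q3 + n2 * n3 = 0) := by
  intro n1 n2 n3
  have h : !![p1, p2, p3; q1, q2, q3; n1, n2, n3] * !![p1, q1, n1; p2, q2, n2; p3, q3, n3]
      = (1 : Matrix (Fin 3) (Fin 3) ℝ) := by
    ext i j
    fin_cases i <;> fin_cases j <;>
      simp [Matrix.mul_apply, Fin.sum_univ_three, n1, n2, n3]
    · linarith
    · linarith
    · ring
    · linarith
    · linarith
    · ring
    · ring
    · ring
    · linear_combination (q1 * q1 + q2 * q2 + q3 * q3) * hp + hq -
        (p1 * q1 + p2 * q2 + p3 * q3) * hpq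
  have h' := mul_eq_one_comm.1 h
  have e : ∀ i j, (!![p1, q1, n1; p2, q2, n2; p3, q3, n3] *
    !![p1, p2, p3; q1, q2, q3; n1, n2, n3]) i j = (1 : Matrix (Fin 3) (Fin 3) ℝ) i j := by
    rw [h']; simp
  have e00 := e 0 0
  have e11 := e 1 1
  have e22 := e 2 2
  have e01 := e 0 1
  have e02 := e 0 2
  have e12 := e 1 2
  simp [Matrix.mul_apply, Fin.sum_univ_three] at e00 e11 e22 e01 e02 e12
  exact ⟨⟨e00, e11, e22⟩, e01, e02, e12⟩

/-- The components of a vector in the orthonormal frame `p, q, n`, given those along `p` and `q`. -/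
theorem frame_expand {p1 p2 p3 q1 q2 q3 n1 n2 n3 : ℝ}
    (c : (p1 * p1 + q1 * q1 + n1 * n1 = 1 ∧ p2 * p2 + q2 * q2 + n2 * n2 = 1 ∧
      p3 * p3 + q3 * q3 + n3 * n3 = 1) ∧
    (p1 * p2 + q1 * q2 + n1 * n2 = 0 ∧ p1 * p3 + q1 * q3 + n1 * n3 = 0 ∧
      p2 * p3 + q2 * q3 + n2 * n3 = 0)) {v1 v2 v3 s t : ℝ}
    (hs : v1 * p1 + v2 * p2 + v3 * p3 = s) (ht : v1 * q1 + v2 * q2 + v3 * q3 = t) :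
    ∃ z, v1 = s * p1 + t * q1 + z * n1 ∧ v2 = s * p2 + t * q2 + z * n2 ∧
      v3 = s * p3 + t * q3 + z * n3 := by
  obtain ⟨⟨c1, c2, c3⟩, c4, c5, c6⟩ := c
  refine ⟨v1 * n1 + v2 * n2 + v3 * n3, ?_, ?_, ?_⟩
  · linear_combination p1 * hs + q1 * ht - v1 * c1 - v2 * c4 - v3 * c5
  · linear_combination p2 * hs + q2 * ht - v1 * c4 - v2 * c2 - v3 * c6
  · linear_combination p3 * hs + q3 * ht - v1 * c5 - v2 * c6 - v3 * c3

/-- The pointwise algebra behind the Jacobian of the vertical components `p₃`, `q₃` of an orthonormal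
frame `p, q` with normal `n`. The derivatives of the frame have arbitrary components along `n`; those
along `p` and `q` and the relation `hS` between them come from the structure equations. -/
theorem jacobian_algebra {p1 p2 p3 q1 q2 q3 n1 n2 n3 : ℝ}
    (c : (p1 * p1 + q1 * q1 + n1 * n1 = 1 ∧ p2 * p2 + q2 * q2 + n2 * n2 = 1 ∧
      p3 * p3 + q3 * q3 + n3 * n3 = 1) ∧
    (p1 * p2 + q1 * q2 + n1 * n2 = 0 ∧ p1 * p3 + q1 * q3 + n1 * n3 = 0 ∧
      p2 * p3 + q2 * q3 + n2 * n3 = 0))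
    (hn1 : n1 = p2 * q3 - p3 * q2) (hn2 : n2 = p3 * q1 - p1 * q3) (hn3 : n3 = p1 * q2 - q1 * p2)
    (hp : p1 * p1 + p2 * p2 + p3 * p3 = 1) (hq : q1 * q1 + q2 * q2 + q3 * q3 = 1)
    (hpq : p1 * q1 + p2 * q2 + p3 * q3 = 0)
    {a1 a2 a3 b1 b2 b3 c1 c2 c3 d1 d2 d3 r1 r2 k : ℝ}
    -- `a = ∂₁p`, `b = ∂₂p`, `c = ∂₁q`, `d = ∂₂q`
    (hap : a1 * p1 + a2 * p2 + a3 * p3 = 0) (haq : a1 * q1 + a2 * q2 + a3 * q3 = - n3 * r1)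
    (hbp : b1 * p1 + b2 * p2 + b3 * p3 = 0) (hbq : b1 * q1 + b2 * q2 + b3 * q3 = - n3 * r2)
    (hcp : c1 * p1 + c2 * p2 + c3 * p3 = n3 * r1) (hcq : c1 * q1 + c2 * q2 + c3 * q3 = 0)
    (hdp : d1 * p1 + d2 * p2 + d3 * p3 = n3 * r2) (hdq : d1 * q1 + d2 * q2 + d3 * q3 = 0)
    (hS : a1 * d1 + a2 * d2 + a3 * d3 - (b1 * c1 + b2 * c2 + b3 * c3) = - k * n3 ^ 2
      + r2 * (p1 * c2 + q2 * a1 - (q1 * a2 + p2 * c1))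
      - r1 * (p1 * d2 + q2 * b1 - (q1 * b2 + p2 * d1))) :
    a3 * d3 - b3 * c3 = - k * n3 ^ 4 ∧ (n3 = 0 → a3 = 0 ∧ b3 = 0 ∧ c3 = 0 ∧ d3 = 0) := by
  obtain ⟨y1, ea1, ea2, ea3⟩ := frame_expand c hap haq
  obtain ⟨y2, eb1, eb2, eb3⟩ := frame_expand c hbp hbq
  obtain ⟨z1, ec1, ec2, ec3⟩ := frame_expand c hcp hcq
  obtain ⟨z2, ed1, ed2, ed3⟩ := frame_expand c hdp hdq
  obtain ⟨⟨k1, k2, k3⟩, k4, k5, k6⟩ := c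
  have hnn : n1 * n1 + n2 * n2 + n3 * n3 = 1 := by linear_combination k1 + k2 + k3 - hp - hq
  have hnp : n1 * p1 + n2 * p2 + n3 * p3 = 0 := by rw [hn1, hn2, hn3]; ring
  have hnq : n1 * q1 + n2 * q2 + n3 * q3 = 0 := by rw [hn1, hn2, hn3]; ring
  constructor
  · have hS1 : a1 * d1 + a2 * d2 + a3 * d3 - (b1 * c1 + b2 * c2 + b3 * c3) = y1 * z2 - y2 * z1 := by
      rw [ea1, ea2, ea3, eb1, eb2, eb3, ec1, ec2, ec3, ed1, ed2, ed3]
      linear_combination (y1 * z2 - y2 * z1) * hnn + (-n3 * r1 * z2 + n3 * r2 * z1) * hnq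
        + (y1 * n3 * r2 - y2 * n3 * r1) * hnp
    have hC1 : p1 * c2 + q2 * a1 - (q1 * a2 + p2 * c1) = - (y1 * p3 + z1 * q3) := by
      have e1 : n1 * q2 - n2 * q1 = - p3 := by
        rw [hn1, hn2]; linear_combination - p3 * hq + q3 * hpq
      have e2 : p1 * n2 - p2 * n1 = - q3 := by
        rw [hn1, hn2]; linear_combination - q3 * hp + p3 * hpq
      rw [ea1, ea2, ec1, ec2]
      linear_combination y1 * e1 + z1 * e2
    have hC2 : p1 * d2 + q2 * b1 - (q1 * b2 + p2 * d1) = - (y2 * p3 + z2 * q3) := by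
      have e1 : n1 * q2 - n2 * q1 = - p3 := by
        rw [hn1, hn2]; linear_combination - p3 * hq + q3 * hpq
      have e2 : p1 * n2 - p2 * n1 = - q3 := by
        rw [hn1, hn2]; linear_combination - q3 * hp + p3 * hpq
      rw [eb1, eb2, ed1, ed2]
      linear_combination y2 * e1 + z2 * e2
    rw [hS1, hC1, hC2] at hS
    rw [ea3, eb3, ec3, ed3]
    linear_combination n3 ^ 2 * hS
  · intro h0
    rw [ea3, eb3, ec3, ed3, h0]
    simp

theorem jacobian_frame {p1 p2 p3 q1 q2 q3 a1 a2 a3 b1 b2 b3 c1 c2 c3 d1 d2 d3 w1 w2 dw1 dw2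
    A1 A2 A3 B1 B2 B3 k s : ℝ}
    (g11 : p1 * p1 + p2 * p2 + p3 * p3 = 1) (g12 : p1 * q1 + p2 * q2 + p3 * q3 = 0)
    (g22 : q1 * q1 + q2 * q2 + q3 * q3 = 1)
    (o11 : a1 * p1 + p1 * a1 + (a2 * p2 + p2 * a2) + (a3 * p3 + p3 * a3) = 0)
    (o21 : b1 * p1 + p1 * b1 + (b2 * p2 + p2 * b2) + (b3 * p3 + p3 * b3) = 0)
    (o12 : a1 * q1 + p1 * c1 + (a2 * q2 + p2 * c2) + (a3 * q3 + p3 * c3) = 0)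
    (o22 : b1 * q1 + p1 * d1 + (b2 * q2 + p2 * d2) + (b3 * q3 + p3 * d3) = 0)
    (o13 : c1 * q1 + q1 * c1 + (c2 * q2 + q2 * c2) + (c3 * q3 + q3 * c3) = 0)
    (o23 : d1 * q1 + q1 * d1 + (d2 * q2 + q2 * d2) + (d3 * q3 + q3 * d3) = 0)
    (x1 : q1 * a1 + q2 * a2 + q3 * a3 = -(p1 * q2 - q1 * p2) * (w1 + 2 * s * p3))
    (x2 : q1 * b1 + q2 * b2 + q3 * b3 = -(p1 * q2 - q1 * p2) * (w2 + 2 * s * q3))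
    (e3 : c3 - b3 = 2 * s * (p1 * q2 - q1 * p2))
    (e4 : dw2 - dw1 = -k * (p1 * q2 - q1 * p2))
    (sa : A2 = A1) (sb : B2 = B1) (sc : A3 = B3)
    (E1 : q1 * A1 + a1 * d1 + (q2 * B1 + a2 * d2) + (q3 * B3 + a3 * d3)
      = -(p1 * q2 - q1 * p2) * (dw1 + 2 * s * b3)
        + (w1 + 2 * s * p3) * -(p1 * d2 + q2 * b1 - (q1 * b2 + p2 * d1)))
    (E2 : q1 * A2 + b1 * c1 + (q2 * B2 + b2 * c2) + (q3 * A3 + b3 * c3)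
      = -(p1 * q2 - q1 * p2) * (dw2 + 2 * s * c3)
        + (w2 + 2 * s * q3) * -(p1 * c2 + q2 * a1 - (q1 * a2 + p2 * c1))) :
    a3 * d3 - b3 * c3 = -(k - 4 * s ^ 2) * (p1 * q2 - q1 * p2) ^ 4 ∧
      (p1 * q2 - q1 * p2 = 0 → a3 = 0 ∧ b3 = 0 ∧ c3 = 0 ∧ d3 = 0) := by
  refine jacobian_algebra (columns_orthonormal g11 g22 g12) rfl rfl rfl g11 g22 g12
    (a1 := a1) (a2 := a2) (b1 := b1) (b2 := b2) (c1 := c1) (c2 := c2) (d1 := d1) (d2 := d2)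
    (r1 := w1 + 2 * s * p3) (r2 := w2 + 2 * s * q3)
    (by linarith) (by linarith) (by linarith) (by linarith) (by linarith) (by linarith)
    (by linarith) (by linarith) ?_
  linear_combination E1 - E2 + q1 * sa + q2 * sb + q3 * sc
        + (p1 * q2 - q1 * p2) * (e4 + 2 * s * e3)

variable {κ σ : ℝ} {a b c ϖ : ℂ → ℂ →L[ℝ] ℝ} {U : Set ℂ}

/-- The Jacobian of the components of the vertical form along a flat surface, in flat
coordinates: it is `-(κ - 4σ²) C⁴`, where `C` is the angle function. The first derivatives of the
frame are determined by the structure equations up to the second fundamental form, which enters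
only through `ϖ + 2σ c` and drops out. -/
theorem jacobian_vertical (h : IsEktCoframeOn κ σ a b c ϖ U)
    (hg : ∀ y ∈ U, ∀ u v : ℂ, a y u * a y v + b y u * b y v + c y u * c y v = inner ℝ u v)
    {y : ℂ} (hy : y ∈ U) :
    (fderiv ℝ c y 1 1 * fderiv ℝ c y Complex.I Complex.I
      - fderiv ℝ c y Complex.I 1 * fderiv ℝ c y 1 Complex.I
      = -(κ - 4 * σ ^ 2) * wedge (a y) (b y) 1 Complex.I ^ 4) ∧
    ((wedge (a y) (b y) 1 Complex.I = 0) → fderiv ℝ c y = 0) := by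
  have hU := h.isOpen
  have dd : ∀ {f : ℂ → ℂ →L[ℝ] ℝ}, ContDiffOn ℝ ∞ f U → ∀ z ∈ U, ∀ u : ℂ,
      HasFDerivAt (fun z => f z u) ((fderiv ℝ f z).flip u) z := by
    intro f hf z hz u
    have h1 := ((hf.contDiffAt (hU.mem_nhds hz)).differentiableAt (by simp)).hasFDerivAt
    have h2 := h1.clm_apply (hasFDerivAt_const u z)
    convert! h2 using 1
    ext v; simp
  have da := fun z hz u => dd h.smooth_a z hz u
  have db := fun z hz u => dd h.smooth_b z hz u
  have dc := fun z hz u => dd h.smooth_c z hz u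
  have dϖ := fun z hz u => dd h.smooth_ϖ z hz u
  -- the derivatives of the orthonormality relations
  have don : ∀ z ∈ U, ∀ w u v : ℂ, fderiv ℝ a z w u * a z v + a z u * fderiv ℝ a z w v
      + (fderiv ℝ b z w u * b z v + b z u * fderiv ℝ b z w v)
      + (fderiv ℝ c z w u * c z v + c z u * fderiv ℝ c z w v) = 0 := by
    intro z hz w u v
    have h1 := (((da z hz u).mul (da z hz v)).add ((db z hz u).mul (db z hz v))).add
      ((dc z hz u).mul (dc z hz v))
    have h2 : HasFDerivAt (fun z => a z u * a z v + b z u * b z v + c z u * c z v)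
        (0 : ℂ →L[ℝ] ℝ) z := by
      refine (hasFDerivAt_const (inner ℝ u v : ℝ) z).congr_of_eventuallyEq ?_
      filter_upwards [hU.mem_nhds hz] with x hx using hg x hx u v
    have h3 := congrArg (fun L : ℂ →L[ℝ] ℝ => L w) (h1.unique h2)
    simp at h3
    linarith
  -- the tangential part of the derivative of the frame
  set C : ℂ → ℝ := fun z => a z 1 * b z Complex.I - a z Complex.I * b z 1 with hC
  have hx : ∀ z ∈ U, (a z Complex.I * fderiv ℝ a z 1 1 + b z Complex.I * fderiv ℝ b z 1 1
      + c z Complex.I * fderiv ℝ c z 1 1 = - C z * (ϖ z 1 + 2 * σ * c z 1)) ∧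
      (a z Complex.I * fderiv ℝ a z Complex.I 1 + b z Complex.I * fderiv ℝ b z Complex.I 1
      + c z Complex.I * fderiv ℝ c z Complex.I 1
        = - C z * (ϖ z Complex.I + 2 * σ * c z Complex.I)) := by
    intro z hz
    have e1 := h.d_a z hz 1 Complex.I
    have e2 := h.d_b z hz 1 Complex.I
    have e3 := h.d_c z hz 1 Complex.I
    simp only [extD, wedge] at e1 e2 e3
    have o1 := don z hz 1 1 Complex.I
    have o2 := don z hz Complex.I 1 1
    have o3 := don z hz 1 Complex.I Complex.I
    have o4 := don z hz Complex.I 1 Complex.I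
    constructor
    · simp only [hC]
      linear_combination -(a z 1) * e1 - b z 1 * e2 - c z 1 * e3 + o1 - (1 / 2) * o2
    · simp only [hC]
      linear_combination -(a z Complex.I) * e1 - b z Complex.I * e2 - c z Complex.I * e3
        + (1 / 2) * o3
  have dC : HasFDerivAt C _ y := ((da y hy 1).mul (db y hy Complex.I)).sub
    ((da y hy Complex.I).mul (db y hy 1))
  -- the second derivatives of the frame are symmetric
  have d2 : ∀ {f : ℂ → ℂ →L[ℝ] ℝ}, ContDiffOn ℝ ∞ f U → ∀ w u : ℂ,
      HasFDerivAt (fun z => fderiv ℝ f z w u) (((fderiv ℝ (fderiv ℝ f) y).flip w).flip u) y := by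
    intro f hf w u
    have h0 : ContDiffAt ℝ ∞ (fderiv ℝ f) y :=
      (hf.fderiv_of_isOpen (m := ∞) hU (by simp)).contDiffAt (hU.mem_nhds hy)
    have h1 := (h0.differentiableAt (by simp)).hasFDerivAt
    have h2 := (h1.clm_apply (hasFDerivAt_const w y)).clm_apply (hasFDerivAt_const u y)
    convert! h2 using 1
    ext v; simp
  have sy : ∀ {f : ℂ → ℂ →L[ℝ] ℝ}, ContDiffOn ℝ ∞ f U → ∀ u v w : ℂ,
      fderiv ℝ (fderiv ℝ f) y u v w = fderiv ℝ (fderiv ℝ f) y v u w := by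
    intro f hf u v w
    have h0 : ContDiffAt ℝ 2 f y := (hf.contDiffAt (hU.mem_nhds hy)).of_le ENat.LEInfty.out
    rw [h0.isSymmSndFDerivAt (by simp) u v]
  -- the exterior derivative of the tangential part
  have X1 : HasFDerivAt (fun z => a z Complex.I * fderiv ℝ a z 1 1
      + b z Complex.I * fderiv ℝ b z 1 1 + c z Complex.I * fderiv ℝ c z 1 1) _ y :=
    (((da y hy Complex.I).mul (d2 h.smooth_a 1 1)).add
      ((db y hy Complex.I).mul (d2 h.smooth_b 1 1))).add
      ((dc y hy Complex.I).mul (d2 h.smooth_c 1 1))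
  have X2 : HasFDerivAt (fun z => a z Complex.I * fderiv ℝ a z Complex.I 1
      + b z Complex.I * fderiv ℝ b z Complex.I 1 + c z Complex.I * fderiv ℝ c z Complex.I 1) _ y :=
    (((da y hy Complex.I).mul (d2 h.smooth_a Complex.I 1)).add
      ((db y hy Complex.I).mul (d2 h.smooth_b Complex.I 1))).add
      ((dc y hy Complex.I).mul (d2 h.smooth_c Complex.I 1))
  have Y1 : HasFDerivAt (fun z => - C z * (ϖ z 1 + 2 * σ * c z 1)) _ y :=
    dC.neg.mul ((dϖ y hy 1).add ((dc y hy 1).const_mul (2 * σ)))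
  have Y2 : HasFDerivAt (fun z => - C z * (ϖ z Complex.I + 2 * σ * c z Complex.I)) _ y :=
    dC.neg.mul ((dϖ y hy Complex.I).add ((dc y hy Complex.I).const_mul (2 * σ)))
  have E1 := congrArg (fun L : ℂ →L[ℝ] ℝ => L Complex.I)
    (X1.unique (Y1.congr_of_eventuallyEq (by
      filter_upwards [hU.mem_nhds hy] with z hz using (hx z hz).1)))
  have E2 := congrArg (fun L : ℂ →L[ℝ] ℝ => L 1)
    (X2.unique (Y2.congr_of_eventuallyEq (by
      filter_upwards [hU.mem_nhds hy] with z hz using (hx z hz).2)))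
  obtain ⟨x1, x2⟩ := hx y hy
  have e4 := h.d_ϖ y hy 1 Complex.I
  have e3 := h.d_c y hy 1 Complex.I
  have sa := sy h.smooth_a 1 Complex.I 1
  have sb := sy h.smooth_b 1 Complex.I 1
  have sc := sy h.smooth_c 1 Complex.I 1
  have g11 := hg y hy 1 1
  have g12 := hg y hy 1 Complex.I
  have g22 := hg y hy Complex.I Complex.I
  have o11 := don y hy 1 1 1
  have o21 := don y hy Complex.I 1 1
  have o12 := don y hy 1 1 Complex.I
  have o22 := don y hy Complex.I 1 Complex.I
  have o13 := don y hy 1 Complex.I Complex.I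
  have o23 := don y hy Complex.I Complex.I Complex.I
  simp only [add_apply, sub_apply, smul_apply, neg_apply, ContinuousLinearMap.flip_apply,
    smul_eq_mul] at E1 E2
  simp at g11 g12 g22
  simp only [extD, wedge] at e3 e4 ⊢
  have hCy : C y = a y 1 * b y Complex.I - a y Complex.I * b y 1 := rfl
  rw [hCy] at x1 x2
  have hCn : (-C) y = -(a y 1 * b y Complex.I - a y Complex.I * b y 1) := rfl
  rw [hCn] at E1 E2
  have key := jacobian_frame (k := κ) (s := σ) g11 g12 g22 o11 o21 o12 o22 o13 o23 x1 x2 e3 e4 sa sb sc E1 E2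
  refine ⟨key.1, fun h0 => ?_⟩
  obtain ⟨k1, k2, k3, k4⟩ := key.2 h0
  ext u v
  have hu : u = u.re • (1 : ℂ) + u.im • Complex.I := by
    simp
  have hv : v = v.re • (1 : ℂ) + v.im • Complex.I := by
    simp
  rw [hu, hv]
  simp only [map_add, map_smul, add_apply, smul_apply, k1, k2, k3, k4]
  simp

end Angle

/-! ### Developing maps -/

section Development

variable {P X : Type*} [NormedAddCommGroup P] [NormedSpace ℝ P] [TopologicalSpace X] [T2Space X]
  {Adm : (P → X) → P → Prop}

omit [NormedSpace ℝ P] in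
/-- Two admissible maps on a connected set that agree near one of its points agree near each. -/
theorem germ_eq_of_isPreconnected
    (hcont : ∀ D p, Adm D p → ContinuousAt D p)
    (huniq : ∀ D D' p, Adm D p → Adm D' p → D p = D' p →
      ∀ᶠ q in 𝓝 p, (D =ᶠ[𝓝 q] D' → D =ᶠ[𝓝 p] D'))
    {C : Set P} (hC : IsPreconnected C) {D D' : P → X} (hD : ∀ q ∈ C, Adm D q)
    (hD' : ∀ q ∈ C, Adm D' q) {p : P} (hp : p ∈ C) (h : D =ᶠ[𝓝 p] D') :
    ∀ q ∈ C, D =ᶠ[𝓝 q] D' := by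
  have hopen : IsOpen {q | D =ᶠ[𝓝 q] D'} := isOpen_setOfPred_eventually_nhds
  refine hC.subset_of_closure_inter_subset hopen ⟨p, hp, h⟩ ?_
  rintro q ⟨hq, hqC⟩
  have hfreq : ∃ᶠ x in 𝓝 q, D =ᶠ[𝓝 x] D' := mem_closure_iff_frequently.1 hq
  have heq : D q = D' q := by
    by_contra hne
    have := ((hcont D q (hD q hqC)).prodMk (hcont D' q (hD' q hqC))).preimage_mem_nhds
      (t := {z : X × X | z.1 ≠ z.2}) (isClosed_diagonal.isOpen_compl.mem_nhds hne)
    obtain ⟨x, hx1, hx2⟩ := (hfreq.and_eventually this).exists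
    exact hx2 hx1.self_of_nhds
  obtain ⟨x, hx1, hx2⟩ := (hfreq.and_eventually
    (huniq D D' q (hD q hqC) (hD' q hqC) heq)).exists
  exact hx2 hx1

/-- Monodromy: if each admissible germ extends to a ball of a fixed radius, and admissible maps are
determined by their germs, then each admissible germ extends to the whole space. The germ is
continued along the segments from `0`, on tubes of a fixed width. -/
theorem exists_development
    (hgerm : ∀ D D' p, D =ᶠ[𝓝 p] D' → Adm D p → Adm D' p)
    (hcont : ∀ D p, Adm D p → ContinuousAt D p)
    (huniq : ∀ D D' p, Adm D p → Adm D' p → D p = D' p →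
      ∀ᶠ q in 𝓝 p, (D =ᶠ[𝓝 q] D' → D =ᶠ[𝓝 p] D'))
    {r : ℝ} (hr : 0 < r)
    (hext : ∀ D p, Adm D p → ∃ D', D' =ᶠ[𝓝 p] D ∧ ∀ q ∈ Metric.ball p r, Adm D' q)
    {D₀ : P → X} (h₀ : Adm D₀ 0) : ∃ D, D =ᶠ[𝓝 0] D₀ ∧ ∀ p, Adm D p := by
  set T : P → Set P := fun p => Metric.thickening (r / 2) (segment ℝ 0 p) with hT
  have hTo : ∀ p, IsOpen (T p) := fun p => Metric.isOpen_thickening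
  have hTc : ∀ p, Convex ℝ (T p) := fun p => (convex_segment 0 p).thickening _
  have hself : ∀ p, segment ℝ 0 p ⊆ T p := fun p => Metric.self_subset_thickening (by linarith) _
  have hT0 : ∀ p, (0 : P) ∈ T p := fun p => hself p (left_mem_segment ℝ 0 p)
  have hTp : ∀ p, p ∈ T p := fun p => hself p (right_mem_segment ℝ 0 p)
  have hmem : ∀ {p x : P}, x ∈ segment ℝ 0 p ↔ ∃ t : ℝ, 0 ≤ t ∧ t ≤ 1 ∧ x = t • p := by
    intro p x
    rw [segment_eq_image]
    constructor
    · rintro ⟨t, ht, rfl⟩; exact ⟨t, ht.1, ht.2, by simp⟩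
    · rintro ⟨t, h0, h1, rfl⟩; exact ⟨t, ⟨h0, h1⟩, by simp⟩
  have tube : ∀ n : ℕ, ∀ p : P, ‖p‖ ≤ n * (r / 4) →
      ∃ D, D =ᶠ[𝓝 0] D₀ ∧ ∀ q ∈ T p, Adm D q := by
    intro n
    induction n with
    | zero =>
      intro p hp
      have hp0 : p = 0 := by simpa using hp
      obtain ⟨D, hD, hD'⟩ := hext D₀ 0 h₀
      refine ⟨D, hD, fun q hq => hD' q ?_⟩
      subst hp0
      obtain ⟨x, hx, hqx⟩ := Metric.mem_thickening_iff.1 hq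
      have hx0 : x = 0 := by simpa using hx
      rw [hx0] at hqx
      exact Metric.mem_ball.2 (by linarith)
    | succ n ih =>
      intro p hp
      have hn : (0 : ℝ) < n + 1 := by positivity
      set s : ℝ := n / (n + 1) with hs
      have hs0 : 0 ≤ s := by positivity
      have hs1 : s ≤ 1 := by rw [hs, div_le_one hn]; linarith
      have hs2 : (1 - s) * ‖p‖ ≤ r / 4 := by
        have : 1 - s = 1 / (n + 1) := by rw [hs]; field_simp; ring
        rw [this, one_div, inv_mul_le_iff₀ hn]
        simpa using hp
      have hs3 : ‖s • p‖ ≤ n * (r / 4) := by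
        rw [norm_smul, Real.norm_of_nonneg hs0, hs, div_mul_eq_mul_div, div_le_iff₀ hn]
        push_cast at hp
        nlinarith [norm_nonneg p]
      obtain ⟨D₁, h1, h1'⟩ := ih (s • p) hs3
      obtain ⟨D₂, h2, h2'⟩ := hext D₁ (s • p) (h1' _ (hTp _))
      have hag : ∀ q ∈ T (s • p) ∩ Metric.ball (s • p) r, D₂ =ᶠ[𝓝 q] D₁ :=
        germ_eq_of_isPreconnected hcont huniq
          ((hTc _).inter (convex_ball _ _)).isPreconnected (fun q hq => h2' q hq.2)
          (fun q hq => h1' q hq.1) ⟨hTp _, Metric.mem_ball_self hr⟩ h2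
      classical
      set D : P → X := fun q => if q ∈ T (s • p) then D₁ q else D₂ q with hD
      have e1 : ∀ q ∈ T (s • p), D₁ =ᶠ[𝓝 q] D := by
        intro q hq
        filter_upwards [(hTo _).mem_nhds hq] with x hx
        simp [hD, hx]
      have e2 : ∀ q ∈ Metric.ball (s • p) r, D₂ =ᶠ[𝓝 q] D := by
        intro q hq
        filter_upwards [Metric.isOpen_ball.mem_nhds hq] with x hx
        by_cases hxT : x ∈ T (s • p)
        · simpa [hD, hxT] using (hag x ⟨hxT, hx⟩).self_of_nhds
        · simp [hD, hxT]
      refine ⟨D, (e1 0 (hT0 _)).symm.trans h1, fun q hq => ?_⟩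
      by_cases hqT : q ∈ T (s • p)
      · exact hgerm _ _ _ (e1 q hqT) (h1' q hqT)
      · obtain ⟨x, hx, hqx⟩ := Metric.mem_thickening_iff.1 hq
        obtain ⟨t, ht0, ht1, rfl⟩ := hmem.1 hx
        have hts : s ≤ t := by
          by_contra hlt
          push Not at hlt
          refine hqT (Metric.mem_thickening_iff.2 ⟨t • p, hmem.2 ⟨t / s, ?_, ?_, ?_⟩, hqx⟩)
          · positivity
          · exact div_le_one_of_le₀ hlt.le hs0
          · rw [smul_smul, div_mul_cancel₀ _ (by linarith)]
        have hqb : q ∈ Metric.ball (s • p) r := by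
          rw [Metric.mem_ball]
          have h3 : dist (t • p) (s • p) ≤ r / 4 := by
            rw [dist_eq_norm, ← sub_smul, norm_smul, Real.norm_of_nonneg (by linarith)]
            refine le_trans ?_ hs2
            gcongr
          linarith [dist_triangle q (t • p) (s • p)]
        exact hgerm _ _ _ (e2 q hqb) (h2' q hqb)
  have tube' : ∀ p : P, ∃ D, D =ᶠ[𝓝 0] D₀ ∧ ∀ q ∈ T p, Adm D q := by
    intro p
    obtain ⟨n, hn⟩ := exists_nat_ge (‖p‖ / (r / 4))
    exact tube n p ((div_le_iff₀ (by linarith)).1 hn)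
  choose D hD hD' using tube'
  have hloc : ∀ p, D p =ᶠ[𝓝 p] fun q => D q q := by
    intro p
    filter_upwards [Metric.ball_mem_nhds p (half_pos hr)] with q hq
    have hqT : q ∈ T p := Metric.mem_thickening_iff.2 ⟨p, right_mem_segment ℝ 0 p, hq⟩
    exact (germ_eq_of_isPreconnected hcont huniq ((hTc p).inter (hTc q)).isPreconnected
      (fun x hx => hD' p x hx.1) (fun x hx => hD' q x hx.2) ⟨hT0 p, hT0 q⟩
      ((hD p).trans (hD q).symm) q ⟨hqT, hTp q⟩).self_of_nhds
  exact ⟨fun q => D q q, (hloc 0).symm.trans (hD 0),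
    fun p => hgerm _ _ _ (hloc p) (hD' p p (hTp p))⟩

end Development

/-! ### Growth of the area -/

section Growth

open intervalIntegral MeasureTheory

/-- The divergence theorem on a square, for the Jacobian of two functions. -/
theorem abs_integral_jacobian_le {A B : ℂ → ℝ} (hA : ContDiff ℝ 2 A) (hB : ContDiff ℝ 2 B) {M : ℝ}
    (hA1 : ∀ z, |A z| ≤ 1)
    (hM : ∀ z, |fderiv ℝ B z 1| ≤ M ∧ |fderiv ℝ B z Complex.I| ≤ M) {Q : ℂ → ℝ}
    (hQ : Continuous Q)
    (hJ : ∀ z, fderiv ℝ A z 1 * fderiv ℝ B z Complex.I - fderiv ℝ A z Complex.I * fderiv ℝ B z 1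
      = Q z) {L : ℝ} (hL : 0 ≤ L) :
    |∫ x in 0..L, ∫ y in 0..L, Q (Complex.equivRealProdCLM.symm (x, y))| ≤ 4 * (M * L) := by
  set e : ℝ × ℝ →L[ℝ] ℂ := (Complex.equivRealProdCLM.symm : ℝ × ℝ →L[ℝ] ℂ) with he
  have e10 : e (1, 0) = 1 := by simp [he, Complex.ext_iff]
  have e01 : e (0, 1) = Complex.I := by simp [he, Complex.ext_iff]
  have hA' : ∀ w, HasFDerivAt (fun w => A (e w)) ((fderiv ℝ A (e w)).comp e) w := fun w =>
    ((hA.differentiable (by norm_num)) _).hasFDerivAt.comp w e.hasFDerivAt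
  have hdB : ContDiff ℝ 1 (fderiv ℝ B) := hB.fderiv_right (by norm_num)
  have hB' : ∀ (u : ℂ) w, HasFDerivAt (fun w => fderiv ℝ B (e w) u)
      (((fderiv ℝ (fderiv ℝ B) (e w)).flip u).comp e) w := by
    intro u w
    have h1 := ((hdB.differentiable (by norm_num)) (e w)).hasFDerivAt.clm_apply
      (hasFDerivAt_const u (e w))
    have h2 := h1.comp w e.hasFDerivAt
    convert! h2 using 1
    ext <;> simp
  have hf := fun w => (hA' w).mul (hB' Complex.I w)
  have hg := fun w => ((hA' w).mul (hB' 1 w)).neg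
  have hsym : ∀ z, fderiv ℝ (fderiv ℝ B) z 1 Complex.I = fderiv ℝ (fderiv ℝ B) z Complex.I 1 :=
    fun z => (hB.contDiffAt.isSymmSndFDerivAt (by simp)) 1 Complex.I
  have hcB : ∀ u : ℂ, Continuous fun w => fderiv ℝ B (e w) u := fun u =>
    (hdB.continuous.comp e.continuous).clm_apply continuous_const
  have hcA : Continuous fun w => A (e w) := hA.continuous.comp e.continuous
  have hdiv := integral2_divergence_prod_of_hasFDerivAt (fun w => A (e w) * fderiv ℝ B (e w) Complex.I)
    (fun w => -(A (e w) * fderiv ℝ B (e w) 1)) _ _ 0 0 L L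
    (hcA.mul (hcB _)).continuousOn (hcA.mul (hcB _)).neg.continuousOn
    (fun w _ => hf w) (fun w _ => hg w) (by
      have : (fun w : ℝ × ℝ => Q (e w)) = fun w => (A (e w) •
          ((fderiv ℝ (fderiv ℝ B) (e w)).flip Complex.I).comp e
          + fderiv ℝ B (e w) Complex.I • (fderiv ℝ A (e w)).comp e) (1, 0)
          + (-(A (e w) • ((fderiv ℝ (fderiv ℝ B) (e w)).flip 1).comp e
          + fderiv ℝ B (e w) 1 • (fderiv ℝ A (e w)).comp e)) (0, 1) := by
        ext w
        simp only [add_apply, neg_apply, smul_apply, ContinuousLinearMap.comp_apply,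
          ContinuousLinearMap.flip_apply, e10, e01, smul_eq_mul, hsym, ← hJ]
        ring
      rw [← this]
      exact (hQ.comp e.continuous).continuousOn.integrableOn_compact
        (isCompact_uIcc.prod isCompact_uIcc))
  have hI := (Eq.trans (integral_congr fun x _ => integral_congr fun y _ => by
    simp only [add_apply, neg_apply, smul_apply, ContinuousLinearMap.comp_apply,
      ContinuousLinearMap.flip_apply, e10, e01, smul_eq_mul, hsym, ← hJ]
    ring) hdiv : (∫ x in 0..L, ∫ y in 0..L, Q (e (x, y))) = _)
  have bd : ∀ u : ℂ, (∀ z, |fderiv ℝ B z u| ≤ M) → ∀ c : ℝ → ℂ,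
      |∫ x in 0..L, A (c x) * fderiv ℝ B (c x) u| ≤ M * L := by
    intro u hu c
    have := norm_integral_le_of_norm_le_const (a := 0) (b := L) (C := M)
      (f := fun x => A (c x) * fderiv ℝ B (c x) u) (fun x _ => by
        rw [Real.norm_eq_abs, abs_mul]
        calc _ ≤ 1 * M := mul_le_mul (hA1 _) (hu _) (abs_nonneg _) zero_le_one
          _ = M := one_mul _)
    rwa [sub_zero, abs_of_nonneg hL, Real.norm_eq_abs] at this
  have h1 := bd 1 (fun z => (hM z).1) (fun x => e (x, L))
  have h2 := bd 1 (fun z => (hM z).1) (fun x => e (x, 0))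
  have h3 := bd Complex.I (fun z => (hM z).2) (fun y => e (L, y))
  have h4 := bd Complex.I (fun z => (hM z).2) (fun y => e (0, y))
  change |∫ x in 0..L, ∫ y in 0..L, Q (e (x, y))| ≤ _
  rw [hI, intervalIntegral.integral_neg, intervalIntegral.integral_neg]
  rw [abs_le] at h1 h2 h3 h4 ⊢
  constructor <;> linarith [h1.1, h1.2, h2.1, h2.2, h3.1, h3.2, h4.1, h4.2]

/-- If two bounded functions with bounded derivatives have a Jacobian of constant sign, then this
Jacobian is not bounded away from zero in a uniformly recurrent way: its integral over a square of
side `L` is `O(L)`, by the divergence theorem. -/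
theorem not_recurrent_of_jacobian {A B : ℂ → ℝ} (hA : ContDiff ℝ 2 A) (hB : ContDiff ℝ 2 B) {M : ℝ}
    (hA1 : ∀ z, |A z| ≤ 1)
    (hM : ∀ z, |fderiv ℝ B z 1| ≤ M ∧ |fderiv ℝ B z Complex.I| ≤ M) {q : ℂ → ℝ}
    (hq : Continuous q) (hq0 : ∀ z, 0 ≤ q z) {k : ℝ} (hk : k ≠ 0)
    (hJ : ∀ z, fderiv ℝ A z 1 * fderiv ℝ B z Complex.I - fderiv ℝ A z Complex.I * fderiv ℝ B z 1
      = k * q z) {d ρ ε : ℝ} (hd : 0 < d) (hρ : 0 < ρ) (hε : 0 < ε)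
    (hrec : ∀ p : ℂ, ∃ p' ∈ Metric.ball p d, ∀ y ∈ Metric.ball p' ρ, ε ≤ q y) : False := by
  set e : ℝ × ℝ →L[ℝ] ℂ := (Complex.equivRealProdCLM.symm : ℝ × ℝ →L[ℝ] ℂ) with he
  set F : ℝ → ℝ → ℝ := fun x y => q (e (x, y)) with hF
  have hFc : Continuous F.uncurry := by
    change Continuous fun w : ℝ × ℝ => q (e (w.1, w.2))
    fun_prop
  have hF1 : ∀ x, Continuous (F x) := fun x => hFc.uncurry_left x
  have hF2 : ∀ a b : ℝ, Continuous fun x => ∫ y in a..b, F x y := fun a b =>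
    continuous_parametric_intervalIntegral_of_continuous' hFc a b
  have hF0 : ∀ x y, 0 ≤ F x y := fun x y => hq0 _
  set l : ℝ := 2 * (d + ρ) with hl
  have hl0 : 0 < l := by positivity
  have cell : ∀ x0 y0 : ℝ, ε * ρ * ρ ≤ ∫ x in x0..x0 + l, ∫ y in y0..y0 + l, F x y := by
    intro x0 y0
    obtain ⟨p, hp, hpq⟩ := hrec (e (x0 + l / 2, y0 + l / 2))
    have hp' : ‖p - e (x0 + l / 2, y0 + l / 2)‖ < d := by rwa [← dist_eq_norm]
    have hre := (Complex.abs_re_le_norm _).trans_lt hp'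
    have him := (Complex.abs_im_le_norm _).trans_lt hp'
    simp only [he, Complex.sub_re, Complex.sub_im, ContinuousLinearEquiv.coe_coe,
      Complex.equivRealProdCLM_symm_apply_re, Complex.equivRealProdCLM_symm_apply_im, abs_lt]
      at hre him
    have hsq : ∀ x ∈ Icc (p.re - ρ / 2) (p.re + ρ / 2), ∀ y ∈ Icc (p.im - ρ / 2) (p.im + ρ / 2),
        ε ≤ F x y := by
      intro x hx y hy
      refine hpq _ ?_
      rw [Metric.mem_ball, dist_eq_norm]
      refine (Complex.norm_le_sqrt_two_mul_max _).trans_lt ?_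
      have h1 : max |(e (x, y) - p).re| |(e (x, y) - p).im| ≤ ρ / 2 := by
        simp only [he, Complex.sub_re, Complex.sub_im, ContinuousLinearEquiv.coe_coe,
          Complex.equivRealProdCLM_symm_apply_re, Complex.equivRealProdCLM_symm_apply_im]
        refine max_le ?_ ?_ <;> rw [abs_le] <;> constructor <;>
          linarith [hx.1, hx.2, hy.1, hy.2]
      have h2 : √2 < 2 := by
        rw [Real.sqrt_lt' (by norm_num)]; norm_num
      nlinarith [Real.sqrt_nonneg 2]
    have hinner : ∀ x ∈ Icc (p.re - ρ / 2) (p.re + ρ / 2), ε * ρ ≤ ∫ y in y0..y0 + l, F x y := by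
      intro x hx
      calc ε * ρ = ∫ y in (p.im - ρ / 2)..(p.im + ρ / 2), ε := by
            rw [intervalIntegral.integral_const, smul_eq_mul]; ring
        _ ≤ ∫ y in (p.im - ρ / 2)..(p.im + ρ / 2), F x y :=
            integral_mono_on (by linarith) (by simp) ((hF1 x).intervalIntegrable _ _)
              (fun y hy => hsq x hx y hy)
        _ ≤ _ := integral_mono_interval (by linarith) (by linarith) (by linarith)
            (Filter.Eventually.of_forall (hF0 x)) ((hF1 x).intervalIntegrable _ _)
    calc ε * ρ * ρ = ∫ x in (p.re - ρ / 2)..(p.re + ρ / 2), ε * ρ := by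
          rw [intervalIntegral.integral_const, smul_eq_mul]; ring
      _ ≤ ∫ x in (p.re - ρ / 2)..(p.re + ρ / 2), ∫ y in y0..y0 + l, F x y :=
          integral_mono_on (by linarith) (by simp) ((hF2 _ _).intervalIntegrable _ _) hinner
      _ ≤ _ := integral_mono_interval (by linarith) (by linarith) (by linarith)
          (Filter.Eventually.of_forall fun x => integral_nonneg (by linarith) fun y _ => hF0 x y)
          ((hF2 _ _).intervalIntegrable _ _)
  have total : ∀ n : ℕ, n ^ 2 * (ε * ρ * ρ) ≤ ∫ x in 0..n * l, ∫ y in 0..n * l, F x y := by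
    intro n
    have hrow : ∀ x, ∑ j ∈ Finset.range n, ∫ y in (j : ℕ) * l..((j + 1 : ℕ) : ℝ) * l, F x y
        = ∫ y in 0..n * l, F x y := by
      intro x
      have := sum_integral_adjacent_intervals (a := fun j : ℕ => (j : ℝ) * l) (n := n)
        (fun k _ => (hF1 x).intervalIntegrable (μ := volume) _ _)
      simpa using this
    have hcol := sum_integral_adjacent_intervals (a := fun j : ℕ => (j : ℝ) * l) (n := n)
      (fun k _ => (hF2 0 (n * l)).intervalIntegrable (μ := volume) _ _)
    simp only [Nat.cast_zero, zero_mul] at hcol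
    rw [← hcol]
    have hle : ∀ i ∈ Finset.range n, n * (ε * ρ * ρ) ≤
        ∫ x in (i : ℕ) * l..((i + 1 : ℕ) : ℝ) * l, ∫ y in 0..n * l, F x y := by
      intro i _
      simp_rw [← hrow]
      rw [intervalIntegral.integral_finsetSum
        (fun j _ => (hF2 _ _).intervalIntegrable (μ := volume) _ _)]
      have : ∑ j ∈ Finset.range n, ε * ρ * ρ = n * (ε * ρ * ρ) := by simp
      rw [← this]
      refine Finset.sum_le_sum fun j _ => ?_
      have := cell (i * l) (j * l)
      push_cast
      rwa [add_one_mul, add_one_mul]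
    calc (n : ℝ) ^ 2 * (ε * ρ * ρ) = ∑ i ∈ Finset.range n, n * (ε * ρ * ρ) := by
          simp; ring
      _ ≤ _ := Finset.sum_le_sum hle
  have hkey : ∀ n : ℕ, |k| * (n ^ 2 * (ε * ρ * ρ)) ≤ 4 * (M * (n * l)) := by
    intro n
    have h1 := abs_integral_jacobian_le hA hB hA1 hM (Q := fun z => k * q z)
      (continuous_const.mul hq) hJ (L := n * l) (by positivity)
    have h2 : (∫ x in 0..n * l, ∫ y in 0..n * l, k * F x y)
        = k * ∫ x in 0..n * l, ∫ y in 0..n * l, F x y := by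
      simp_rw [intervalIntegral.integral_const_mul]
    have h3 : |∫ x in 0..n * l, ∫ y in 0..n * l, k * F x y| ≤ 4 * (M * (n * l)) := h1
    rw [h2, abs_mul] at h3
    refine le_trans ?_ h3
    gcongr
    exact (total n).trans (le_abs_self _)
  set m := |k| * (ε * ρ * ρ) with hm
  have hm0 : 0 < m := by positivity
  obtain ⟨n, hn⟩ := exists_nat_gt (4 * M * l / m + 1)
  have hM0 : 0 ≤ M := (abs_nonneg _).trans (hM 0).1
  have hn0 : 0 < (n : ℝ) := by
    have : 0 ≤ 4 * M * l / m := by positivity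
    linarith
  have h1 := hkey n
  have h2 : (n : ℝ) * m ≤ 4 * M * l := by
    have : n * (n * m) ≤ n * (4 * M * l) := by rw [hm]; nlinarith
    exact le_of_mul_le_mul_left this hn0
  have h3 : 4 * M * l / m < n := by linarith
  rw [div_lt_iff₀ hm0] at h3
  linarith

end Growth

/-! ### Curvature of a surface in a complex coframe -/

section Coframe

variable {E : Type*} [NormedAddCommGroup E] [NormedSpace ℝ E]
  {F : Type*} [NormedAddCommGroup F] [NormedSpace ℝ F]

/-- An injective map between spaces of the same finite dimension is invertible. -/
theorem isInvertible_of_injective [FiniteDimensional ℝ E] [FiniteDimensional ℝ F]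
    (h : Module.finrank ℝ E = Module.finrank ℝ F) {L : E →L[ℝ] F}
    (hL : Function.Injective L) : L.IsInvertible :=
  ⟨(LinearMap.linearEquivOfInjective (L : E →ₗ[ℝ] F) hL h).toContinuousLinearEquiv, by ext; rfl⟩

/-- A positive definite bilinear form on a space of finite dimension is non-degenerate. -/
theorem isInvertible_of_pos [FiniteDimensional ℝ E] {h : E →L[ℝ] E →L[ℝ] ℝ}
    (hp : ∀ u, u ≠ 0 → 0 < h u u) : h.IsInvertible := by
  have e : Module.finrank ℝ E = Module.finrank ℝ (E →L[ℝ] ℝ) := by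
    rw [← (LinearMap.toContinuousLinearMap (𝕜 := ℝ) (E := E) (F' := ℝ)).finrank_eq]
    exact (Subspace.dual_finrank_eq (K := ℝ) (V := E)).symm
  refine isInvertible_of_injective e ?_
  rw [injective_iff_map_eq_zero]
  intro u hu
  by_contra hne
  have h1 := hp u hne
  rw [hu] at h1
  exact lt_irrefl _ h1

/-- On `U`, the metric `h` is `|Ψ|²`, and `ϖ` is the connection form of the complex coframe `Ψ`,
that is, `dΨ = i ϖ ∧ Ψ`. -/
structure IsComplexCoframeOn (h : E → E →L[ℝ] E →L[ℝ] ℝ) (Ψ : E → E →L[ℝ] ℂ)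
    (ϖ : E → E →L[ℝ] ℝ) (U : Set E) : Prop where
  isOpen : IsOpen U
  smooth : ContDiffOn ℝ ∞ Ψ U
  smooth_connection : ContDiffOn ℝ ∞ ϖ U
  metric : ∀ y ∈ U, ∀ u v, h y u v = inner ℝ (Ψ y u) (Ψ y v)
  injective : ∀ y ∈ U, Function.Injective (Ψ y)
  d_eq : ∀ y ∈ U, ∀ u v, extD Ψ y u v
    = Complex.I * ((ϖ y u : ℂ) * Ψ y v - (ϖ y v : ℂ) * Ψ y u)

variable {h : E → E →L[ℝ] E →L[ℝ] ℝ} {Ψ : E → E →L[ℝ] ℂ} {ϖ : E → E →L[ℝ] ℝ} {U : Set E}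

theorem hasFDerivAt_form {W : Type*} [NormedAddCommGroup W] [NormedSpace ℝ W] {a : E → E →L[ℝ] W}
    (hU : IsOpen U) (ha : ContDiffOn ℝ ∞ a U) {y : E} (hy : y ∈ U) (v : E) :
    HasFDerivAt (fun z => a z v) ((fderiv ℝ a y).flip v) y := by
  have h1 := ((ha.contDiffAt (hU.mem_nhds hy)).differentiableAt (by simp)).hasFDerivAt
  have h2 := h1.clm_apply (hasFDerivAt_const v y)
  convert! h2 using 1
  ext v; simp

theorem IsComplexCoframeOn.smooth_metric (H : IsComplexCoframeOn h Ψ ϖ U)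
    [FiniteDimensional ℝ E] : ContDiffOn ℝ ∞ h U := by
  rw [contDiffOn_clm_apply]; intro u
  rw [contDiffOn_clm_apply]; intro v
  have h1 : ContDiffOn ℝ ∞ (fun y => inner ℝ (Ψ y u) (Ψ y v)) U :=
    ((contDiffOn_clm_apply.1 H.smooth u)).inner ℝ (contDiffOn_clm_apply.1 H.smooth v)
  exact h1.congr fun y hy => H.metric y hy u v

theorem IsComplexCoframeOn.isInvertible_metric (H : IsComplexCoframeOn h Ψ ϖ U)
    [FiniteDimensional ℝ E] {y : E} (hy : y ∈ U) : (h y).IsInvertible := by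
  refine isInvertible_of_pos fun u hu => ?_
  rw [H.metric y hy]
  exact real_inner_self_pos.2 ((map_ne_zero_iff _ (H.injective y hy)).2 hu)

theorem IsComplexCoframeOn.christoffel_eq (H : IsComplexCoframeOn h Ψ ϖ U)
    [FiniteDimensional ℝ E] (hE : Module.finrank ℝ E = 2) {y : E} (hy : y ∈ U) (u v : E) :
    christoffel h y u v = (Ψ y).inverse (fderiv ℝ Ψ y u v - Complex.I * ϖ y u * Ψ y v) := by
  have hinv : (Ψ y).IsInvertible :=
    isInvertible_of_injective (by rw [hE, Complex.finrank_real_complex]) (H.injective y hy)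
  unfold christoffel
  rw [(H.isInvertible_metric hy).inverse_apply_eq]
  have dh : ∀ u v w, fderiv ℝ h y u v w = inner ℝ (fderiv ℝ Ψ y u v) (Ψ y w)
      + inner ℝ (Ψ y v) (fderiv ℝ Ψ y u w) := by
    intro u v w
    have h1 := ((H.smooth_metric.contDiffAt (H.isOpen.mem_nhds hy)).differentiableAt
      (by simp)).hasFDerivAt
    have h2 := (h1.clm_apply (hasFDerivAt_const v y)).clm_apply (hasFDerivAt_const w y)
    have h3 := (hasFDerivAt_form H.isOpen H.smooth hy v).inner ℝ
      (hasFDerivAt_form H.isOpen H.smooth hy w)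
    have h4 := (h3.congr_of_eventuallyEq (by
      filter_upwards [H.isOpen.mem_nhds hy] with z hz using H.metric z hz v w)).unique h2
    have h5 := congrArg (fun L : E →L[ℝ] ℝ => L u) h4
    simp at h5
    rw [← h5]
    simp
    ring
  ext w
  rw [H.metric y hy, hinv.self_apply_inverse]
  have d1 := H.d_eq y hy u v
  have d2 := H.d_eq y hy u w
  have d3 := H.d_eq y hy v w
  simp only [extD] at d1 d2 d3
  simp only [smul_apply, sub_apply, add_apply, ContinuousLinearMap.flip_apply, dh, smul_eq_mul]
  have i1 := Complex.ext_iff.1 d1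
  have i2 := Complex.ext_iff.1 d2
  have i3 := Complex.ext_iff.1 d3
  simp at i1 i2 i3
  simp [Complex.inner]
  obtain ⟨i1, i1'⟩ := i1
  obtain ⟨i2, i2'⟩ := i2
  obtain ⟨i3, i3'⟩ := i3
  linear_combination (-1/2) * (Ψ y w).re * i1 - (1/2) * (Ψ y w).im * i1'
    + (1/2) * (Ψ y v).re * i2 + (1/2) * (Ψ y v).im * i2'
    + (1/2) * (Ψ y u).re * i3 + (1/2) * (Ψ y u).im * i3'

/-- The curvature tensor in a complex coframe: the curvature form is `-i dϖ`. -/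
theorem IsComplexCoframeOn.riemann_eq (H : IsComplexCoframeOn h Ψ ϖ U)
    [FiniteDimensional ℝ E] (hE : Module.finrank ℝ E = 2) {y : E} (hy : y ∈ U) (u v w : E) :
    Ψ y (riemann h y u v w) = - Complex.I * extD ϖ y u v * Ψ y w := by
  have hinv : ∀ z ∈ U, (Ψ z).IsInvertible := fun z hz =>
    isInvertible_of_injective (by rw [hE, Complex.finrank_real_complex]) (H.injective z hz)
  have hch : ∀ z ∈ U, ∀ u v, Ψ z (christoffel h z u v)
      = fderiv ℝ Ψ z u v - Complex.I * ϖ z u * Ψ z v := by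
    intro z hz u v
    rw [H.christoffel_eq hE hz, (hinv z hz).self_apply_inverse]
  have d2 : ∀ v w, HasFDerivAt (fun z => fderiv ℝ Ψ z v w)
      (((fderiv ℝ (fderiv ℝ Ψ) y).flip v).flip w) y := by
    intro v w
    have h0 : ContDiffAt ℝ ∞ (fderiv ℝ Ψ) y :=
      (H.smooth.fderiv_of_isOpen (m := ∞) H.isOpen (by simp)).contDiffAt (H.isOpen.mem_nhds hy)
    have h1 := (h0.differentiableAt (by simp)).hasFDerivAt
    have h2 := (h1.clm_apply (hasFDerivAt_const v y)).clm_apply (hasFDerivAt_const w y)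
    convert! h2 using 1
    ext v; simp
  have dg : ∀ v w, HasFDerivAt (fun z => fderiv ℝ Ψ z v w - Complex.I * ϖ z v * Ψ z w) _ y :=
    fun v w => (d2 v w).sub ((((Complex.ofRealCLM.hasFDerivAt.comp y
      (hasFDerivAt_form H.isOpen H.smooth_connection hy v)).const_mul Complex.I)).mul
        (hasFDerivAt_form H.isOpen H.smooth hy w))
  have dinv : DifferentiableAt ℝ (fun z => (Ψ z).inverse) y := by
    obtain ⟨e, he⟩ := hinv y hy
    have : FiniteDimensional ℝ E := inferInstance
    have : CompleteSpace E := FiniteDimensional.complete ℝ E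
    have h1 := contDiffAt_map_inverse (n := ∞) e
    rw [he] at h1
    exact (h1.comp y (H.smooth.contDiffAt (H.isOpen.mem_nhds hy))).differentiableAt (by simp)
  have dV : ∀ v w, DifferentiableAt ℝ (fun z => christoffel h z v w) y := by
    intro v w
    refine DifferentiableAt.congr_of_eventuallyEq (dinv.clm_apply (dg v w).differentiableAt) ?_
    filter_upwards [H.isOpen.mem_nhds hy] with z hz
    rw [H.christoffel_eq hE hz]
  have key : ∀ u v w, Ψ y (fderiv ℝ (fun z => christoffel h z v w) y u) =
      (fderiv ℝ (fderiv ℝ Ψ) y u v w - (Complex.I * ϖ y v * fderiv ℝ Ψ y u w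
        + Complex.I * fderiv ℝ ϖ y u v * Ψ y w)) - fderiv ℝ Ψ y u (christoffel h y v w) := by
    intro u v w
    have h1 := ((H.smooth.contDiffAt (H.isOpen.mem_nhds hy)).differentiableAt
      (by simp)).hasFDerivAt
    have h2 := h1.clm_apply (dV v w).hasFDerivAt
    have h3 := h2.unique ((dg v w).congr_of_eventuallyEq (by
      filter_upwards [H.isOpen.mem_nhds hy] with z hz using hch z hz v w))
    have h5 := congrArg (fun L : E →L[ℝ] ℂ => L u) h3
    simp at h5
    rw [eq_sub_iff_add_eq, h5]
    ring
  have sym : fderiv ℝ (fderiv ℝ Ψ) y u v = fderiv ℝ (fderiv ℝ Ψ) y v u := by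
    have h0 : ContDiffAt ℝ 2 Ψ y :=
      (H.smooth.contDiffAt (H.isOpen.mem_nhds hy)).of_le ENat.LEInfty.out
    exact h0.isSymmSndFDerivAt (by simp) u v
  unfold riemann
  simp only [map_sub, map_add, key, hch y hy, sym, extD]
  push_cast
  linear_combination (-(ϖ y u : ℂ) * ϖ y v * Ψ y w + (ϖ y u : ℂ) * ϖ y v * Ψ y w) * Complex.I_sq

/-- The Gauss equation `dϖ = K dA` in a complex coframe. -/
theorem IsComplexCoframeOn.gauss (H : IsComplexCoframeOn h Ψ ϖ U)
    [FiniteDimensional ℝ E] (hE : Module.finrank ℝ E = 2) {y : E} (hy : y ∈ U) (u v : E) :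
    h y (riemann h y u v v) u = extD ϖ y u v * ((starRingEnd ℂ) (Ψ y u) * Ψ y v).im ∧
    h y u u * h y v v - h y u v ^ 2 = ((starRingEnd ℂ) (Ψ y u) * Ψ y v).im ^ 2 := by
  constructor
  · rw [H.metric y hy, H.riemann_eq hE hy]
    simp [Complex.inner]
    ring
  · simp only [H.metric y hy, Complex.inner, Complex.mul_re, Complex.mul_im, Complex.conj_re,
      Complex.conj_im]
    ring

/-- At `y`, the Gauss curvature of a metric on a domain is `K`. -/
def GaussAt (h : E → E →L[ℝ] E →L[ℝ] ℝ) (y : E) (K : ℝ) : Prop :=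
  ∀ u v : E, h y (riemann h y u v v) u = K * (h y u u * h y v v - h y u v ^ 2)

theorem IsComplexCoframeOn.gaussAt_iff (H : IsComplexCoframeOn h Ψ ϖ U)
    [FiniteDimensional ℝ E] (hE : Module.finrank ℝ E = 2) {y : E} (hy : y ∈ U) {K : ℝ} :
    GaussAt h y K ↔ ∀ u v, extD ϖ y u v = K * ((starRingEnd ℂ) (Ψ y u) * Ψ y v).im := by
  have key : ∀ u v, h y (riemann h y u v v) u = K * (h y u u * h y v v - h y u v ^ 2) ↔
      extD ϖ y u v * ((starRingEnd ℂ) (Ψ y u) * Ψ y v).im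
        = K * ((starRingEnd ℂ) (Ψ y u) * Ψ y v).im ^ 2 := by
    intro u v
    rw [(H.gauss hE hy u v).1, (H.gauss hE hy u v).2]
  constructor
  · intro hG u v
    by_cases h0 : ((starRingEnd ℂ) (Ψ y u) * Ψ y v).im = 0
    · -- `u` and `v` are linearly dependent
      rw [h0, mul_zero]
      have hdep : ∃ s t : ℝ, (s ≠ 0 ∨ t ≠ 0) ∧ s • u + t • v = 0 := by
        by_cases hu : Ψ y u = 0
        · exact ⟨1, 0, Or.inl one_ne_zero, by
            simpa using (injective_iff_map_eq_zero _).1 (H.injective y hy) u hu⟩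
        · refine ⟨-((starRingEnd ℂ) (Ψ y u) * Ψ y v).re, Complex.normSq (Ψ y u),
            Or.inr (by simpa using hu), (injective_iff_map_eq_zero _).1 (H.injective y hy) _ ?_⟩
          rw [map_add, map_smul, map_smul]
          have h1 : (((starRingEnd ℂ) (Ψ y u) * Ψ y v).re : ℂ) = (starRingEnd ℂ) (Ψ y u) * Ψ y v := by
            apply Complex.ext <;> simp at h0 ⊢
            linarith
          rw [Complex.real_smul, Complex.real_smul, Complex.ofReal_neg, h1,
            Complex.normSq_eq_conj_mul_self]
          ring
      obtain ⟨s, t, hst, h1⟩ := hdep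
      have h2 := congrArg (fun x => extD ϖ y u x) h1
      have h3 := congrArg (fun x => extD ϖ y x v) h1
      simp [extD] at h2 h3 ⊢
      rcases hst with hs | ht
      · have : s * (fderiv ℝ ϖ y u v - fderiv ℝ ϖ y v u) = 0 := by linarith
        simpa [hs] using this
      · have : t * (fderiv ℝ ϖ y u v - fderiv ℝ ϖ y v u) = 0 := by linarith
        simpa [ht] using this
    · have h1 := (key u v).1 (hG u v)
      refine mul_right_cancel₀ h0 (h1.trans ?_)
      ring
  · intro h1 u v
    rw [key, h1]
    ring

theorem pullForm_complexCoframe {h' : F → F →L[ℝ] F →L[ℝ] ℝ} {Ψ' : F → F →L[ℝ] ℂ}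
    {ϖ' : F → F →L[ℝ] ℝ} {U' : Set F} (H : IsComplexCoframeOn h' Ψ' ϖ' U') {f : E → F}
    (hU : IsOpen U) (hf : ContDiffOn ℝ ∞ f U) (hm : MapsTo f U U')
    (hi : ∀ y ∈ U, Function.Injective (fderiv ℝ f y))
    (hh : ∀ y ∈ U, ∀ u v, h y u v = h' (f y) (fderiv ℝ f y u) (fderiv ℝ f y v)) :
    IsComplexCoframeOn h (pullForm f Ψ') (pullForm f ϖ') U := by
  refine ⟨hU, ContDiffOn.pullForm hf hU H.smooth hm,
    ContDiffOn.pullForm hf hU H.smooth_connection hm, ?_, ?_, ?_⟩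
  · intro y hy u v; rw [hh y hy, H.metric _ (hm hy)]; rfl
  · intro y hy
    exact (H.injective _ (hm hy)).comp (hi y hy)
  · intro y hy u v
    rw [extD_pullForm ((hf.contDiffAt (hU.mem_nhds hy)).of_le ENat.LEInfty.out)
      ((H.smooth.contDiffAt (H.isOpen.mem_nhds (hm hy))).differentiableAt (by simp)),
      H.d_eq _ (hm hy)]
    rfl

/-- Curvature is invariant under changes of coordinates. -/
theorem GaussAt.pull {h' : F → F →L[ℝ] F →L[ℝ] ℝ} {Ψ' : F → F →L[ℝ] ℂ}
    {ϖ' : F → F →L[ℝ] ℝ} {U' : Set F} (H : IsComplexCoframeOn h' Ψ' ϖ' U') {f : E → F}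
    [FiniteDimensional ℝ E] (hE : Module.finrank ℝ E = 2)
    [FiniteDimensional ℝ F] (hF : Module.finrank ℝ F = 2)
    (hU : IsOpen U) (hf : ContDiffOn ℝ ∞ f U) (hm : MapsTo f U U')
    (hi : ∀ y ∈ U, Function.Injective (fderiv ℝ f y))
    (hh : ∀ y ∈ U, ∀ u v, h y u v = h' (f y) (fderiv ℝ f y u) (fderiv ℝ f y v))
    {y : E} (hy : y ∈ U) {K : ℝ} (hG : GaussAt h' (f y) K) : GaussAt h y K := by
  have H' := pullForm_complexCoframe H hU hf hm hi hh
  rw [H'.gaussAt_iff hE hy]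
  intro u v
  rw [extD_pullForm ((hf.contDiffAt (hU.mem_nhds hy)).of_le ENat.LEInfty.out)
      ((H.smooth_connection.contDiffAt (H.isOpen.mem_nhds (hm hy))).differentiableAt (by simp)),
      (H.gaussAt_iff hF (hm hy)).1 hG]
  rfl

end Coframe

/-! ### Construction of complex coframes -/

section CoframeExistence

variable {E : Type*} [NormedAddCommGroup E] [NormedSpace ℝ E]
  {h : E → E →L[ℝ] E →L[ℝ] ℝ} {U : Set E}

/-- Linear coordinates on a plane. -/
theorem exists_linear_coordinates [FiniteDimensional ℝ E] (hE : Module.finrank ℝ E = 2) :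
    ∃ (e₀ e₁ : E) (l₀ l₁ : E →L[ℝ] ℝ), l₀ e₀ = 1 ∧ l₀ e₁ = 0 ∧ l₁ e₀ = 0 ∧ l₁ e₁ = 1 ∧
      ∀ u, u = l₀ u • e₀ + l₁ u • e₁ := by
  let b := Module.finBasisOfFinrankEq ℝ E hE
  refine ⟨b 0, b 1, LinearMap.toContinuousLinearMap (b.coord 0),
    LinearMap.toContinuousLinearMap (b.coord 1), by simp, by simp, by simp, by simp, fun u => ?_⟩
  have := b.sum_repr u
  rw [Fin.sum_univ_two] at this
  simpa using this.symm

/-- A smooth metric on a plane domain has a complex coframe, by the Gram–Schmidt process. -/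
theorem exists_complexCoframe [FiniteDimensional ℝ E] (hE : Module.finrank ℝ E = 2)
    (hU : IsOpen U) (hh : ContDiffOn ℝ ∞ h U) (hs : ∀ y ∈ U, ∀ u v, h y u v = h y v u)
    (hp : ∀ y ∈ U, ∀ u, u ≠ 0 → 0 < h y u u) : ∃ Ψ ϖ, IsComplexCoframeOn h Ψ ϖ U := by
  obtain ⟨e₀, e₁, l₀, l₁, h00, h01, h10, h11, hexp⟩ := exists_linear_coordinates hE
  have he₀ : e₀ ≠ 0 := by rintro rfl; simp at h00
  have he₁ : e₁ ≠ 0 := by rintro rfl; simp at h11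
  have sm : ∀ u v, ContDiffOn ℝ ∞ (fun y => h y u v) U := fun u v =>
    contDiffOn_clm_apply.1 (contDiffOn_clm_apply.1 hh u) v
  have p0 : ∀ y ∈ U, 0 < h y e₀ e₀ := fun y hy => hp y hy _ he₀
  have pd : ∀ y ∈ U, 0 < h y e₀ e₀ * h y e₁ e₁ - h y e₀ e₁ ^ 2 := by
    intro y hy
    have hne : h y e₀ e₀ • e₁ - h y e₀ e₁ • e₀ ≠ 0 := by
      intro h0
      have := congrArg l₁ h0
      simp [h10, h11] at this
      exact (p0 y hy).ne' this
    have h1 := hp y hy _ hne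
    simp only [map_sub, map_smul, sub_apply, smul_apply, smul_eq_mul, hs y hy e₁ e₀] at h1
    have h2 : 0 < h y e₀ e₀ * (h y e₀ e₀ * h y e₁ e₁ - h y e₀ e₁ ^ 2) := by
      convert h1 using 1; ring
    exact pos_of_mul_pos_right h2 (p0 y hy).le
  set s : E → ℝ := fun y => √(h y e₀ e₀) with hs'
  set δ : E → ℝ := fun y => √(h y e₀ e₀ * h y e₁ e₁ - h y e₀ e₁ ^ 2) with hδ
  have s0 : ∀ y ∈ U, 0 < s y := fun y hy => Real.sqrt_pos.2 (p0 y hy)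
  have δ0 : ∀ y ∈ U, 0 < δ y := fun y hy => Real.sqrt_pos.2 (pd y hy)
  have ss : ContDiffOn ℝ ∞ s U := (sm e₀ e₀).sqrt fun y hy => (p0 y hy).ne'
  have sδ : ContDiffOn ℝ ∞ δ U :=
    (((sm e₀ e₀).mul (sm e₁ e₁)).sub ((sm e₀ e₁).pow 2)).sqrt fun y hy => (pd y hy).ne'
  set Ψ : E → E →L[ℝ] ℂ := fun y => l₀.smulRight (s y : ℂ)
    + l₁.smulRight (((h y e₀ e₁ / s y : ℝ) : ℂ) + ((δ y / s y : ℝ) : ℂ) * Complex.I) with hΨ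
  have re : ∀ y u, (Ψ y u).re = l₀ u * s y + l₁ u * (h y e₀ e₁ / s y) := by
    intro y u; simp [hΨ, -Complex.ofReal_div]
  have im : ∀ y u, (Ψ y u).im = l₁ u * (δ y / s y) := by
    intro y u; simp [hΨ, -Complex.ofReal_div]
  have sΨ : ContDiffOn ℝ ∞ Ψ U := by
    rw [contDiffOn_clm_apply]; intro u
    have hc : ∀ {f : E → ℝ}, ContDiffOn ℝ ∞ f U → ContDiffOn ℝ ∞ (fun y => (f y : ℂ)) U :=
      fun hf => Complex.ofRealCLM.contDiff.comp_contDiffOn hf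
    exact (contDiffOn_const.smul (hc ss)).add (contDiffOn_const.smul
      ((hc ((sm e₀ e₁).div ss fun y hy => (s0 y hy).ne')).add
        ((hc (sδ.div ss fun y hy => (s0 y hy).ne')).mul contDiffOn_const)))
  have met : ∀ y ∈ U, ∀ u v, h y u v = inner ℝ (Ψ y u) (Ψ y v) := by
    intro y hy u v
    have e1 : s y ^ 2 = h y e₀ e₀ := Real.sq_sqrt (p0 y hy).le
    have e2 : δ y ^ 2 = h y e₀ e₀ * h y e₁ e₁ - h y e₀ e₁ ^ 2 := Real.sq_sqrt (pd y hy).le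
    conv_lhs => rw [hexp u, hexp v]
    simp only [Complex.inner, Complex.mul_re, Complex.conj_re, Complex.conj_im, re, im, map_add,
      map_smul, add_apply, smul_apply, smul_eq_mul, hs y hy e₁ e₀]
    have := (s0 y hy).ne'
    field_simp
    rw [← e1] at e2
    linear_combination (-l₀ u * l₀ v * s y ^ 2) * e1 - l₁ u * l₁ v * e2
  have inj : ∀ y ∈ U, Function.Injective (Ψ y) := by
    intro y hy
    rw [injective_iff_map_eq_zero]
    intro u hu
    by_contra h0
    have := hp y hy u h0
    rw [met y hy, hu] at this
    simp at this
  have sdΨ : ∀ u v, ContDiffOn ℝ ∞ (fun y => extD Ψ y u v) U := fun u v =>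
    have := sΨ.fderiv_of_isOpen (m := ∞) hU (by simp)
    ((contDiffOn_clm_apply.1 (contDiffOn_clm_apply.1 this u) v)).sub
      (contDiffOn_clm_apply.1 (contDiffOn_clm_apply.1 this v) u)
  set m : E → ℂ := fun y => (δ y)⁻¹ • extD Ψ y e₀ e₁ with hm
  have smm : ContDiffOn ℝ ∞ m U :=
    (sδ.inv fun y hy => (δ0 y hy).ne').smul (sdΨ e₀ e₁)
  refine ⟨Ψ, fun y => -((innerSL ℝ (m y)).comp (Ψ y)), hU, sΨ, ?_, met, inj, ?_⟩
  · rw [contDiffOn_clm_apply]; intro u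
    exact (smm.inner ℝ (contDiffOn_clm_apply.1 sΨ u)).neg
  · intro y hy u v
    have hb : extD Ψ y u v = ((l₀ u * l₁ v - l₀ v * l₁ u : ℝ) : ℂ) * extD Ψ y e₀ e₁ := by
      conv_lhs => rw [hexp u, hexp v]
      simp only [extD, map_add, map_smul, add_apply, smul_apply, Complex.real_smul]
      push_cast
      ring
    have hmy : extD Ψ y e₀ e₁ = m y * δ y := by
      have : (δ y : ℂ) ≠ 0 := by simpa using (δ0 y hy).ne'
      simp only [hm, Complex.real_smul, Complex.ofReal_inv]
      field_simp
    have hsδ : s y * (δ y / s y) = δ y := by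
      field_simp [(s0 y hy).ne']
    rw [hb, hmy]
    apply Complex.ext <;>
    simp only [Complex.inner, innerSL_apply_apply, neg_apply, ContinuousLinearMap.comp_apply,
      Complex.mul_re, Complex.mul_im, Complex.ofReal_re, Complex.ofReal_im, Complex.I_re,
      Complex.I_im, Complex.sub_re, Complex.sub_im, Complex.conj_re, Complex.conj_im, re, im]
    · linear_combination (-(l₀ u * l₁ v - l₀ v * l₁ u) * (m y).re) * hsδ
    · linear_combination (-(l₀ u * l₁ v - l₀ v * l₁ u) * (m y).im) * hsδ

/-- A flat metric has flat coordinates: once the connection form is `dλ`, the form `e^{-iλ} Ψ` is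
closed. -/
theorem IsComplexCoframeOn.exists_flat_coordinates {Ψ : E → E →L[ℝ] ℂ} {ϖ : E → E →L[ℝ] ℝ}
    (H : IsComplexCoframeOn h Ψ ϖ U) (hc : ∀ y ∈ U, ∀ u v, extD ϖ y u v = 0) {y₀ : E}
    (hy₀ : y₀ ∈ U) : ∃ r > 0, Metric.ball y₀ r ⊆ U ∧ ∃ Ξ : E → ℂ,
      ContDiffOn ℝ ∞ Ξ (Metric.ball y₀ r) ∧ ∀ y ∈ Metric.ball y₀ r, ∀ u v,
        inner ℝ (fderiv ℝ Ξ y u) (fderiv ℝ Ξ y v) = h y u v := by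
  obtain ⟨r, hr, hrU⟩ := Metric.isOpen_iff.1 H.isOpen y₀ hy₀
  have hb : IsOpen (Metric.ball y₀ r) := Metric.isOpen_ball
  obtain ⟨l, hl, hl'⟩ := exists_primitive hb (convex_ball _ _) (H.smooth_connection.mono hrU)
    fun y hy => hc y (hrU hy)
  have hE : ContDiffOn ℝ ∞ (fun y => Complex.exp (-(Complex.I * l y))) (Metric.ball y₀ r) :=
    (contDiffOn_const.mul (Complex.ofRealCLM.contDiff.comp_contDiffOn hl)).neg.cexp
  have hd : ∀ y ∈ Metric.ball y₀ r, HasFDerivAt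
      (fun y => Complex.exp (-(Complex.I * l y)) • Ψ y) _ y := fun y hy =>
    ((((Complex.ofRealCLM.hasFDerivAt.comp y (hl' y hy)).const_mul Complex.I).neg).cexp).smul
      ((H.smooth.contDiffAt (H.isOpen.mem_nhds (hrU hy))).differentiableAt (by simp)).hasFDerivAt
  obtain ⟨Ξ, h1, h2⟩ := exists_primitive (a := fun y => Complex.exp (-(Complex.I * l y)) • Ψ y)
    hb (convex_ball _ _) (hE.smul (H.smooth.mono hrU)) (by
      intro y hy u v
      have e := H.d_eq y (hrU hy) u v
      simp only [extD] at e ⊢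
      rw [(hd y hy).fderiv]
      simp
      linear_combination Complex.exp (-(Complex.I * l y)) * e)
  refine ⟨r, hr, hrU, Ξ, h1, fun y hy u v => ?_⟩
  rw [(h2 y hy).fderiv, H.metric y (hrU hy)]
  have hn : ‖Complex.exp (-(Complex.I * l y))‖ = 1 := by
    have : -(Complex.I * l y) = ((-l y : ℝ) : ℂ) * Complex.I := by push_cast; ring
    rw [this, Complex.norm_exp_ofReal_mul_I]
  have hn' : (Complex.exp (-(Complex.I * l y))).re ^ 2 + (Complex.exp (-(Complex.I * l y))).im ^ 2
      = 1 := by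
    have := Complex.sq_norm (Complex.exp (-(Complex.I * l y)))
    rw [hn, Complex.normSq_apply] at this
    linarith
  simp only [smul_apply, smul_eq_mul, Complex.inner, Complex.mul_re, Complex.mul_im,
    Complex.conj_re, Complex.conj_im]
  linear_combination ((Ψ y u).re * (Ψ y v).re + (Ψ y u).im * (Ψ y v).im) * hn'

/-- A surface tangent to the vertical field is flat: the horizontal part of its coframe has rank
one, and is closed when normalized. -/
theorem gaussAt_zero_of_wedge_eq_zero [FiniteDimensional ℝ E] (hE : Module.finrank ℝ E = 2)
    {κ σ : ℝ} {a b c ϖ : E → E →L[ℝ] ℝ} (H : IsEktCoframeOn κ σ a b c ϖ U)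
    (hw : ∀ y ∈ U, ∀ u v, wedge (a y) (b y) u v = 0)
    (hh : ∀ y ∈ U, ∀ u v, h y u v = a y u * a y v + b y u * b y v + c y u * c y v)
    (hp : ∀ y ∈ U, ∀ u, h y u u = 0 → u = 0) {y₀ : E} (hy₀ : y₀ ∈ U) : GaussAt h y₀ 0 := by
  -- a vector that is not vertical at `y₀`
  obtain ⟨e, he⟩ : ∃ e, a y₀ e ^ 2 + b y₀ e ^ 2 ≠ 0 := by
    by_contra hne
    push Not at hne
    have ha : ∀ e, a y₀ e = 0 ∧ b y₀ e = 0 := by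
      intro e
      have := hne e
      constructor <;> nlinarith [sq_nonneg (a y₀ e), sq_nonneg (b y₀ e)]
    obtain ⟨e₀, e₁, l₀, l₁, h00, h01, h10, h11, -⟩ := exists_linear_coordinates hE
    have h1 := hp y₀ hy₀ (c y₀ e₁ • e₀ - c y₀ e₀ • e₁) (by
      rw [hh y₀ hy₀, (ha _).1, (ha _).2]
      simp
      ring)
    have h2 := congrArg l₀ h1
    have h3 : c y₀ e₁ = 0 := by simpa [h00, h01] using h2
    have h4 := hp y₀ hy₀ e₁ (by rw [hh y₀ hy₀, (ha _).1, (ha _).2, h3]; ring)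
    rw [h4] at h11
    simp at h11
  have hU := H.isOpen
  have sa : ContDiffOn ℝ ∞ (fun y => a y e) U := contDiffOn_clm_apply.1 H.smooth_a e
  have sb : ContDiffOn ℝ ∞ (fun y => b y e) U := contDiffOn_clm_apply.1 H.smooth_b e
  have hN : IsOpen (U ∩ (fun y => a y e ^ 2 + b y e ^ 2) ⁻¹' {0}ᶜ) :=
    ((sa.pow 2).add (sb.pow 2)).continuousOn.isOpen_inter_preimage hU isOpen_compl_singleton
  set U' := U ∩ (fun y => a y e ^ 2 + b y e ^ 2) ⁻¹' {0}ᶜ with hU'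
  set n : E → ℝ := fun y => √(a y e ^ 2 + b y e ^ 2) with hn
  have n0 : ∀ y ∈ U', 0 < a y e ^ 2 + b y e ^ 2 := fun y hy =>
    lt_of_le_of_ne (by positivity) (Ne.symm hy.2)
  have n1 : ∀ y ∈ U', 0 < n y := fun y hy => Real.sqrt_pos.2 (n0 y hy)
  have n2 : ∀ y ∈ U', n y ^ 2 = a y e ^ 2 + b y e ^ 2 := fun y hy => Real.sq_sqrt (n0 y hy).le
  have sn : ContDiffOn ℝ ∞ n U' :=
    (((sa.pow 2).add (sb.pow 2)).mono inter_subset_left).sqrt fun y hy => (n0 y hy).ne'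
  set p : E → ℝ := fun y => a y e / n y with hpp
  set q : E → ℝ := fun y => b y e / n y with hqq
  have sp : ContDiffOn ℝ ∞ p U' :=
    (sa.mono inter_subset_left).div sn fun y hy => (n1 y hy).ne'
  have sq : ContDiffOn ℝ ∞ q U' :=
    (sb.mono inter_subset_left).div sn fun y hy => (n1 y hy).ne'
  have pq : ∀ y ∈ U', p y ^ 2 + q y ^ 2 = 1 := by
    intro y hy
    simp only [hpp, hqq, div_pow, ← add_div, n2 y hy]
    exact div_self (n0 y hy).ne'
  set φ : E → E →L[ℝ] ℝ := fun y => p y • a y + q y • b y with hφ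
  have sφ : ContDiffOn ℝ ∞ φ U' :=
    (sp.smul (H.smooth_a.mono inter_subset_left)).add (sq.smul (H.smooth_b.mono inter_subset_left))
  have ea : ∀ y ∈ U', ∀ v, a y v = p y * φ y v := by
    intro y hy v
    have h1 := hw y hy.1 e v
    have h2 := n2 y hy
    have h3 := (n1 y hy).ne'
    simp only [wedge] at h1
    simp only [hφ, hpp, hqq, add_apply, smul_apply, smul_eq_mul]
    field_simp
    rw [h2]
    linear_combination - b y e * h1
  have eb : ∀ y ∈ U', ∀ v, b y v = q y * φ y v := by
    intro y hy v
    have h1 := hw y hy.1 e v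
    have h2 := n2 y hy
    have h3 := (n1 y hy).ne'
    simp only [wedge] at h1
    simp only [hφ, hpp, hqq, add_apply, smul_apply, smul_eq_mul]
    field_simp
    rw [h2]
    linear_combination a y e * h1
  have dφ : ∀ y ∈ U', ∀ u v, extD φ y u v = 0 := by
    intro y hy u v
    have hyU := hN.mem_nhds hy
    have hp' := ((sp.contDiffAt hyU).differentiableAt (by simp)).hasFDerivAt
    have hq' := ((sq.contDiffAt hyU).differentiableAt (by simp)).hasFDerivAt
    have ha' := ((H.smooth_a.contDiffAt (hU.mem_nhds hy.1)).differentiableAt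
      (by simp)).hasFDerivAt
    have hb' := ((H.smooth_b.contDiffAt (hU.mem_nhds hy.1)).differentiableAt
      (by simp)).hasFDerivAt
    have h1 := ((hp'.smul ha').add (hq'.smul hb')).fderiv
    have h2 : ∀ w, p y * fderiv ℝ p y w + q y * fderiv ℝ q y w = 0 := by
      intro w
      have h3 := ((hp'.mul hp').add (hq'.mul hq')).unique
        ((hasFDerivAt_const (1 : ℝ) y).congr_of_eventuallyEq (by
          filter_upwards [hyU] with z hz
          simpa [pow_two] using pq z hz))
      have h4 := congrArg (fun L : E →L[ℝ] ℝ => L w) h3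
      simp at h4
      linarith
    have e1 := H.d_a y hy.1 u v
    have e2 := H.d_b y hy.1 u v
    simp only [extD, wedge] at e1 e2 ⊢
    have h1' : fderiv ℝ φ y = _ := h1
    rw [h1']
    simp
    rw [ea y hy v, eb y hy v, ea y hy u, eb y hy u] at *
    linear_combination φ y v * h2 u - φ y u * h2 v + p y * e1 + q y * e2
  have key : IsComplexCoframeOn h
      (fun y => Complex.ofRealCLM.comp (φ y) + Complex.I • Complex.ofRealCLM.comp (c y))
      (fun _ => 0) U' := by
    have sc := H.smooth_c.mono (inter_subset_left : U' ⊆ U)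
    have met : ∀ y ∈ U', ∀ u v, h y u v = inner ℝ
        ((Complex.ofRealCLM.comp (φ y) + Complex.I • Complex.ofRealCLM.comp (c y)) u)
        ((Complex.ofRealCLM.comp (φ y) + Complex.I • Complex.ofRealCLM.comp (c y)) v) := by
      intro y hy u v
      rw [hh y hy.1, ea y hy u, ea y hy v, eb y hy u, eb y hy v]
      simp [Complex.inner]
      linear_combination φ y u * φ y v * pq y hy
    refine ⟨hN, ?_, contDiffOn_const, met, ?_, ?_⟩
    · rw [contDiffOn_clm_apply]; intro u
      exact (Complex.ofRealCLM.contDiff.comp_contDiffOn (contDiffOn_clm_apply.1 sφ u)).add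
        (contDiffOn_const.smul
          (Complex.ofRealCLM.contDiff.comp_contDiffOn (contDiffOn_clm_apply.1 sc u)))
    · intro y hy
      rw [injective_iff_map_eq_zero]
      intro u hu
      exact hp y hy.1 u (by rw [met y hy, hu]; simp)
    · intro y hy u v
      have hyU := hN.mem_nhds hy
      have h1 := ((sφ.contDiffAt hyU).differentiableAt (by simp)).hasFDerivAt
      have h2 := ((sc.contDiffAt hyU).differentiableAt (by simp)).hasFDerivAt
      have h3 := (((hasFDerivAt_const Complex.ofRealCLM y).clm_comp h1).add
        (((hasFDerivAt_const Complex.ofRealCLM y).clm_comp h2).const_smul Complex.I)).fderiv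
      have e1 := dφ y hy u v
      have e2 := H.d_c y hy.1 u v
      rw [hw y hy.1] at e2
      simp only [extD] at e1 e2 ⊢
      erw [h3]
      simp
      have e1' : ((fderiv ℝ φ y u v - fderiv ℝ φ y v u : ℝ) : ℂ) = 0 := by rw [e1]; simp
      have e2' : ((fderiv ℝ c y u v - fderiv ℝ c y v u : ℝ) : ℂ) = 0 := by rw [e2]; simp
      push_cast at e1' e2'
      linear_combination e1' + Complex.I * e2'
  rw [key.gaussAt_iff hE ⟨hy₀, he⟩]
  intro u v
  simp [extD]

end CoframeExistence

/-! ### Rigid motions of the plane -/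

section Rigid

/-- An isometric map of a convex plane domain is the restriction of a rigid motion. -/
theorem exists_rigid_motion {F : ℂ → ℂ} {U : Set ℂ} (hU : IsOpen U) (hc : Convex ℝ U)
    (hF : ContDiffOn ℝ ∞ F U)
    (hi : ∀ y ∈ U, ∀ u v, inner ℝ (fderiv ℝ F y u) (fderiv ℝ F y v) = inner ℝ u v) {p : ℂ}
    (hp : p ∈ U) : ∃ L : ℂ ≃ₗᵢ[ℝ] ℂ, ∀ y ∈ U, F y = F p + L (y - p) := by
  have hdF : ContDiffOn ℝ ∞ (fderiv ℝ F) U := hF.fderiv_of_isOpen hU (by simp)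
  have hnorm : ∀ y ∈ U, ∀ u, ‖fderiv ℝ F y u‖ = ‖u‖ := by
    intro y hy u
    have := hi y hy u u
    rw [real_inner_self_eq_norm_sq, real_inner_self_eq_norm_sq] at this
    exact (sq_eq_sq₀ (norm_nonneg _) (norm_nonneg _)).1 this
  have hsurj : ∀ y ∈ U, Function.Surjective (fderiv ℝ F y) := by
    intro y hy
    have : Function.Injective (fderiv ℝ F y) := by
      rw [injective_iff_map_eq_zero]
      intro u hu
      rw [← norm_eq_zero, ← hnorm y hy, hu, norm_zero]
    exact LinearMap.surjective_of_injective (f := (fderiv ℝ F y : ℂ →ₗ[ℝ] ℂ)) this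
  have hD2 : ∀ y ∈ U, fderiv ℝ (fderiv ℝ F) y = 0 := by
    intro y hy
    have sym : ∀ u v, fderiv ℝ (fderiv ℝ F) y u v = fderiv ℝ (fderiv ℝ F) y v u := by
      intro u v
      have h0 : ContDiffAt ℝ 2 F y :=
        (hF.contDiffAt (hU.mem_nhds hy)).of_le ENat.LEInfty.out
      exact h0.isSymmSndFDerivAt (by simp) u v
    have anti : ∀ w u v, inner ℝ (fderiv ℝ (fderiv ℝ F) y w u) (fderiv ℝ F y v)
        = - inner ℝ (fderiv ℝ (fderiv ℝ F) y w v) (fderiv ℝ F y u) := by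
      intro w u v
      have h3 := (hasFDerivAt_form hU hdF hy u).inner ℝ (hasFDerivAt_form hU hdF hy v)
      have h4 := h3.unique ((hasFDerivAt_const (inner ℝ u v : ℝ) y).congr_of_eventuallyEq (by
        filter_upwards [hU.mem_nhds hy] with z hz using hi z hz u v))
      have h5 := congrArg (fun L : ℂ →L[ℝ] ℝ => L w) h4
      simp [-Complex.inner] at h5
      rw [real_inner_comm (fderiv ℝ F y u)]
      linarith
    ext1 w
    ext1 u
    obtain ⟨v, hv⟩ := hsurj y hy (fderiv ℝ (fderiv ℝ F) y w u)
    have h0 : inner ℝ (fderiv ℝ (fderiv ℝ F) y w u) (fderiv ℝ F y v) = (0 : ℝ) := by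
      have a1 := anti w u v
      have a2 := anti v w u
      have a3 := anti u v w
      rw [sym w v] at a1
      rw [sym v u] at a2
      rw [sym u w] at a3
      linarith
    rw [hv, real_inner_self_eq_norm_sq] at h0
    simpa using h0
  have hconst : ∀ y ∈ U, fderiv ℝ F y = fderiv ℝ F p := by
    intro y hy
    refine hc.is_const_of_fderivWithin_eq_zero (𝕜 := ℝ) (hdF.differentiableOn (by simp)) ?_ hy hp
    intro z hz
    rw [fderivWithin_of_isOpen hU hz, hD2 z hz]
  let L : ℂ ≃ₗᵢ[ℝ] ℂ := LinearIsometryEquiv.ofSurjective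
    ⟨(fderiv ℝ F p : ℂ →ₗ[ℝ] ℂ), hnorm p hp⟩ (hsurj p hp)
  refine ⟨L, fun y hy => ?_⟩
  have h1 : ∀ z ∈ U, HasFDerivAt (fun z => F z - fderiv ℝ F p z) (0 : ℂ →L[ℝ] ℂ) z := by
    intro z hz
    have h2 := ((hF.contDiffAt (hU.mem_nhds hz)).differentiableAt (by simp)).hasFDerivAt
    rw [hconst z hz] at h2
    have := h2.sub (fderiv ℝ F p).hasFDerivAt
    rwa [sub_self] at this
  have h2 := hc.is_const_of_fderivWithin_eq_zero (𝕜 := ℝ)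
    (fun z hz => (h1 z hz).differentiableAt.differentiableWithinAt)
    (fun z hz => by rw [fderivWithin_of_isOpen hU hz, (h1 z hz).fderiv]) hy hp
  have h3 : L (y - p) = fderiv ℝ F p y - fderiv ℝ F p p := map_sub (fderiv ℝ F p) y p
  rw [h3]
  linear_combination h2

end Rigid

/-! ### Metrics pulled back to coordinate domains -/

section Induced

variable {E : Type*} [NormedAddCommGroup E] [NormedSpace ℝ E]
  {H : Type*} [TopologicalSpace H] {I : ModelWithCorners ℝ E H}
  {N : Type*} [TopologicalSpace N] [ChartedSpace H N]
  {E₁ : Type*} [NormedAddCommGroup E₁] [NormedSpace ℝ E₁]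
  {H₁ : Type*} [TopologicalSpace H₁] {I₁ : ModelWithCorners ℝ E₁ H₁}
  {N₁ : Type*} [TopologicalSpace N₁] [ChartedSpace H₁ N₁]
  {E₂ : Type*} [NormedAddCommGroup E₂] [NormedSpace ℝ E₂]
  {H₂ : Type*} [TopologicalSpace H₂] {I₂ : ModelWithCorners ℝ E₂ H₂}
  {S : Type*} [TopologicalSpace S] [ChartedSpace H₂ S]
  {W : Type*} [NormedAddCommGroup W] [NormedSpace ℝ W]
  {W' : Type*} [NormedAddCommGroup W'] [NormedSpace ℝ W']

variable (I I₁) in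
/-- The derivative of a map between manifolds, as a map between the model spaces, to which the
tangent spaces are equal by definition. -/
def modelDeriv (f : N → N₁) (x : N) : E →L[ℝ] E₁ := mfderiv I I₁ f x

theorem modelDeriv_comp {f : N₁ → S} {F : N → N₁} {x : N} (hf : MDifferentiableAt I₁ I₂ f (F x))
    (hF : MDifferentiableAt I I₁ F x) :
    modelDeriv I I₂ (f ∘ F) x = (modelDeriv I₁ I₂ f (F x)).comp (modelDeriv I I₁ F x) :=
  mfderiv_comp x hf hF

theorem modelDeriv_eq_fderiv (f : W → W') : modelDeriv 𝓘(ℝ, W) 𝓘(ℝ, W') f = fderiv ℝ f := by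
  ext x v
  exact congrArg (fun L : W →L[ℝ] W' => L v) (mfderiv_eq_fderiv (f := f) (x := x))

theorem modelDeriv_congr {f f' : N → N₁} {x : N} (h : f =ᶠ[𝓝 x] f') :
    modelDeriv I I₁ f x = modelDeriv I I₁ f' x :=
  h.mfderiv_eq

theorem modelDeriv_id (x : N) : modelDeriv I I (fun x : N => x) x = ContinuousLinearMap.id ℝ E :=
  mfderiv_id

/-- The pull-back of the metric `g` by a map from a normed space. -/
def indMetric (I : ModelWithCorners ℝ E H) (g : N → E →L[ℝ] E →L[ℝ] ℝ) (F : W → N) :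
    W → W →L[ℝ] W →L[ℝ] ℝ := fun y => pullbackForm (g (F y)) (modelDeriv 𝓘(ℝ, W) I F y)

variable {g : N → E →L[ℝ] E →L[ℝ] ℝ}

theorem indMetric_apply (F : W → N) (y u v : W) :
    indMetric I g F y u v
      = g (F y) (modelDeriv 𝓘(ℝ, W) I F y u) (modelDeriv 𝓘(ℝ, W) I F y v) := rfl

theorem modelDeriv_comp_coord {F : W → N} {f : W' → W} {y : W'}
    (hF : MDifferentiableAt 𝓘(ℝ, W) I F (f y)) (hf : DifferentiableAt ℝ f y) :
    modelDeriv 𝓘(ℝ, W') I (F ∘ f) y = (modelDeriv 𝓘(ℝ, W) I F (f y)).comp (fderiv ℝ f y) := by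
  rw [modelDeriv_comp hF hf.mdifferentiableAt, modelDeriv_eq_fderiv]

theorem indMetric_comp {F : W → N} {f : W' → W} {y : W'}
    (hF : MDifferentiableAt 𝓘(ℝ, W) I F (f y)) (hf : DifferentiableAt ℝ f y) (u v : W') :
    indMetric I g (F ∘ f) y u v = indMetric I g F (f y) (fderiv ℝ f y u) (fderiv ℝ f y v) := by
  rw [indMetric_apply, modelDeriv_comp_coord hF hf]
  rfl

theorem indMetric_congr {F F' : W → N} {y : W} (h : F =ᶠ[𝓝 y] F') :
    indMetric I g F y = indMetric I g F' y := by
  unfold indMetric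
  rw [modelDeriv_congr h, h.self_of_nhds]

variable (I I₂) in
/-- The metric induced by a map between manifolds. -/
def pullMetric (g : N → E →L[ℝ] E →L[ℝ] ℝ) (Φ : S → N) : S → E₂ →L[ℝ] E₂ →L[ℝ] ℝ := fun x =>
  pullbackForm (g (Φ x)) (modelDeriv I₂ I Φ x)

theorem indMetric_pullMetric {Φ : S → N} {D : W → S} {y : W}
    (hΦ : MDifferentiableAt I₂ I Φ (D y)) (hD : MDifferentiableAt 𝓘(ℝ, W) I₂ D y) :
    indMetric I₂ (pullMetric I I₂ g Φ) D y = indMetric I g (Φ ∘ D) y := by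
  ext u v
  rw [indMetric_apply, indMetric_apply, modelDeriv_comp hΦ hD]
  rfl

theorem localMetric_eq_indMetric (g : MetricField I₂ S) (x : S) :
    localMetric g x = indMetric I₂ g (extChartAt I₂ x).symm := rfl

theorem christoffel_congr {h h' : W → W →L[ℝ] W →L[ℝ] ℝ} {y : W} (e : h =ᶠ[𝓝 y] h') (u v : W) :
    christoffel h y u v = christoffel h' y u v := by
  unfold christoffel
  rw [e.fderiv_eq, e.self_of_nhds]

theorem GaussAt.congr {h h' : W → W →L[ℝ] W →L[ℝ] ℝ} {y : W} (e : h =ᶠ[𝓝 y] h') {K : ℝ}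
    (hG : GaussAt h y K) : GaussAt h' y K := by
  have e1 : ∀ u v, (fun z => christoffel h z u v) =ᶠ[𝓝 y] fun z => christoffel h' z u v :=
    fun u v => by
      filter_upwards [e.eventuallyEq_nhds] with z hz using christoffel_congr hz u v
  intro u v
  have := hG u v
  unfold riemann at this ⊢
  simpa only [(e1 _ _).fderiv_eq, christoffel_congr e, e.self_of_nhds] using this

theorem hasGaussCurvatureAt_iff {g : MetricField I₂ S} {x : S} {K : ℝ} :
    HasGaussCurvatureAt g x K ↔ GaussAt (localMetric g x) (extChartAt I₂ x x) K := Iff.rfl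

end Induced

/-! ### Coframes of `E(κ, τ)` on manifolds -/

section Coframes

variable {E : Type*} [NormedAddCommGroup E] [NormedSpace ℝ E]
  {H : Type*} [TopologicalSpace H] {I : ModelWithCorners ℝ E H}
  {N : Type*} [TopologicalSpace N] [ChartedSpace H N]
  {E₂ : Type*} [NormedAddCommGroup E₂] [NormedSpace ℝ E₂]
  {H₂ : Type*} [TopologicalSpace H₂] {I₂ : ModelWithCorners ℝ E₂ H₂}
  {S : Type*} [TopologicalSpace S] [ChartedSpace H₂ S]
  {W : Type*} [NormedAddCommGroup W] [NormedSpace ℝ W]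
  {κ τ : ℝ} {g : N → E →L[ℝ] E →L[ℝ] ℝ} {ξ : N → E}

/-- Near `q`, the metric `g` and the form dual to the field `ξ` come, by a map `χ` to a normed
space `V`, from a coframe which satisfies the structure equations of `E(κ, τ)`. The sign of the
bundle curvature depends on an orientation, so that only `τ²` is prescribed. -/
def HasEktCoframeAt (I : ModelWithCorners ℝ E H) (V : Type*) [NormedAddCommGroup V] [NormedSpace ℝ V] (κ τ : ℝ)
    (g : N → E →L[ℝ] E →L[ℝ] ℝ) (ξ : N → E) (q : N) : Prop :=
  ∃ σ : ℝ, σ ^ 2 = τ ^ 2 ∧ ∃ (χ : N → V) (B : Set N) (a b c ϖ : V → V →L[ℝ] ℝ) (O : Set V),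
    IsOpen B ∧ q ∈ B ∧ ContMDiffOn I 𝓘(ℝ, V) ∞ χ B ∧ MapsTo χ B O ∧
    IsEktCoframeOn κ σ a b c ϖ O ∧ ∀ x ∈ B,
      (∀ v w : E, g x v w
        = a (χ x) (modelDeriv I 𝓘(ℝ, V) χ x v) * a (χ x) (modelDeriv I 𝓘(ℝ, V) χ x w)
          + b (χ x) (modelDeriv I 𝓘(ℝ, V) χ x v) * b (χ x) (modelDeriv I 𝓘(ℝ, V) χ x w)
          + c (χ x) (modelDeriv I 𝓘(ℝ, V) χ x v) * c (χ x) (modelDeriv I 𝓘(ℝ, V) χ x w)) ∧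
      ∀ v : E, g x (ξ x) v = c (χ x) (modelDeriv I 𝓘(ℝ, V) χ x v)

/-- The coframe on the domain of a map into `N`. -/
theorem HasEktCoframeAt.pull {V : Type*} [NormedAddCommGroup V] [NormedSpace ℝ V]
    {F : W → N} {p : W} (h : HasEktCoframeAt I V κ τ g ξ (F p))
    (hF : ∀ᶠ q in 𝓝 p, ContMDiffAt 𝓘(ℝ, W) I ∞ F q) :
    ∃ σ : ℝ, σ ^ 2 = τ ^ 2 ∧ ∃ (a b c ϖ : W → W →L[ℝ] ℝ) (U : Set W), p ∈ U ∧
      IsEktCoframeOn κ σ a b c ϖ U ∧ ∀ y ∈ U, ContMDiffAt 𝓘(ℝ, W) I ∞ F y ∧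
        (∀ u v, indMetric I g F y u v = a y u * a y v + b y u * b y v + c y u * c y v) ∧
        ∀ v, g (F y) (ξ (F y)) (modelDeriv 𝓘(ℝ, W) I F y v) = c y v := by
  obtain ⟨σ, hσ, χ, B, a, b, c, ϖ, O, hB, hq, hχ, hm, hc, hg⟩ := h
  have h1 : ∀ᶠ q in 𝓝 p, F q ∈ B :=
    hF.self_of_nhds.continuousAt.preimage_mem_nhds (hB.mem_nhds hq)
  obtain ⟨U, hU, hUo, hpU⟩ := eventually_nhds_iff.1 (hF.and h1)
  have hχ' : ∀ y ∈ U, ContMDiffAt I 𝓘(ℝ, V) ∞ χ (F y) := fun y hy =>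
    hχ.contMDiffAt (hB.mem_nhds (hU y hy).2)
  have hs : ContDiffOn ℝ ∞ (χ ∘ F) U := by
    rw [← contMDiffOn_iff_contDiffOn]
    exact fun y hy => ((hχ' y hy).comp y (hU y hy).1).contMDiffWithinAt
  have hd : ∀ y ∈ U, ∀ u, fderiv ℝ (χ ∘ F) y u
      = modelDeriv I 𝓘(ℝ, V) χ (F y) (modelDeriv 𝓘(ℝ, W) I F y u) := by
    intro y hy u
    rw [← modelDeriv_eq_fderiv, modelDeriv_comp ((hχ' y hy).mdifferentiableAt (by simp))
      ((hU y hy).1.mdifferentiableAt (by simp))]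
    rfl
  refine ⟨σ, hσ, _, _, _, _, U, hpU, hc.pull hUo hs (fun y hy => hm (hU y hy).2),
    fun y hy => ⟨(hU y hy).1, ?_, ?_⟩⟩
  · intro u v
    rw [indMetric_apply, (hg _ (hU y hy).2).1]
    simp only [pullForm, ContinuousLinearMap.comp_apply, hd y hy, Function.comp_apply]
  · intro v
    rw [(hg _ (hU y hy).2).2]
    simp only [pullForm, ContinuousLinearMap.comp_apply, hd y hy, Function.comp_apply]

/-- What the classification uses of the local geometry of `E(κ, τ)`. -/
structure EktLike (I : ModelWithCorners ℝ E H) (κ τ : ℝ) (g : N → E →L[ℝ] E →L[ℝ] ℝ) (ξ : N → E) : Prop where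
  pos : ∀ (x : N) (v : E), v ≠ 0 → 0 < g x v v
  unit : ∀ x : N, g x (ξ x) (ξ x) = 1
  coframe : ∀ q : N, HasEktCoframeAt I E κ τ g ξ q

/-- The coframe can be taken on the model space of the manifold. -/
theorem HasEktCoframeAt.toModel [I.Boundaryless] [IsManifold I ∞ N]
    {V : Type*} [NormedAddCommGroup V] [NormedSpace ℝ V] {q : N}
    (h : HasEktCoframeAt I V κ τ g ξ q) : HasEktCoframeAt I E κ τ g ξ q := by
  set φ := extChartAt I q with hφ
  have hqs : q ∈ φ.source := mem_extChartAt_source q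
  have hto : IsOpen φ.target := isOpen_extChartAt_target q
  have hs : ∀ y ∈ φ.target, ContMDiffAt 𝓘(ℝ, E) I ∞ φ.symm y := fun y hy =>
    (contMDiffOn_extChartAt_symm q).contMDiffAt (hto.mem_nhds hy)
  have hs' : ∀ x ∈ φ.source, ContMDiffAt I 𝓘(ℝ, E) ∞ φ x := fun x hx =>
    (contMDiffOn_extChartAt (x := q)).contMDiffAt
      (by simpa using (isOpen_extChartAt_source (I := I) q).mem_nhds hx)
  rw [← φ.left_inv hqs] at h
  obtain ⟨σ, hσ, a, b, c, ϖ, U, hpU, hc, hg⟩ := h.pull (F := φ.symm) (p := φ q) (by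
    filter_upwards [hto.mem_nhds (φ.map_source hqs)] with y hy using hs y hy)
  refine ⟨σ, hσ, φ, φ.source ∩ φ ⁻¹' U, a, b, c, ϖ, U,
    isOpen_extChartAt_preimage' q hc.isOpen, ⟨hqs, hpU⟩,
    fun x hx => (hs' x hx.1).contMDiffWithinAt, fun x hx => hx.2, hc, ?_⟩
  rintro x ⟨hx, hxU⟩
  have hid : ∀ v : E, modelDeriv 𝓘(ℝ, E) I φ.symm (φ x)
      (modelDeriv I 𝓘(ℝ, E) φ x v) = v := by
    intro v
    have h1 := modelDeriv_comp ((hs _ (φ.map_source hx)).mdifferentiableAt (by simp))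
      ((hs' x hx).mdifferentiableAt (by simp))
    have h2 : (φ.symm ∘ φ) =ᶠ[𝓝 x] fun x => x := by
      filter_upwards [(isOpen_extChartAt_source (I := I) q).mem_nhds hx] with z hz
        using φ.left_inv hz
    rw [modelDeriv_congr h2, modelDeriv_id] at h1
    exact (congrArg (fun L : E →L[ℝ] E => L v) h1).symm
  obtain ⟨-, h1, h2⟩ := hg _ hxU
  simp only [indMetric_apply, φ.left_inv hx] at h1 h2
  refine ⟨fun v w => ?_, fun v => ?_⟩
  · rw [← h1, hid, hid]
  · rw [← h2, hid]

theorem EktLike.complexCoframe (K : EktLike I κ τ g ξ) [FiniteDimensional ℝ W]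
    (hW : Module.finrank ℝ W = 2) {F : W → N} {p : W}
    (hF : ∀ᶠ q in 𝓝 p, ContMDiffAt 𝓘(ℝ, W) I ∞ F q ∧
      Function.Injective (modelDeriv 𝓘(ℝ, W) I F q)) :
    ∃ (Ψ : W → W →L[ℝ] ℂ) (ϖ : W → W →L[ℝ] ℝ) (U : Set W), p ∈ U ∧
      IsComplexCoframeOn (indMetric I g F) Ψ ϖ U := by
  obtain ⟨σ, -, a, b, c, ϖ₀, U, hpU, hc, hg⟩ := (K.coframe (F p)).pull (hF.mono fun _ h => h.1)
  obtain ⟨U', hU', hUo', hpU'⟩ := eventually_nhds_iff.1 hF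
  have hh : ContDiffOn ℝ ∞ (indMetric I g F) (U ∩ U') := by
    rw [contDiffOn_clm_apply]; intro u
    rw [contDiffOn_clm_apply]; intro v
    have s : ∀ {f : W → W →L[ℝ] ℝ}, ContDiffOn ℝ ∞ f U → ∀ u,
        ContDiffOn ℝ ∞ (fun y => f y u) (U ∩ U') := fun hf u =>
      contDiffOn_clm_apply.1 (hf.mono inter_subset_left) u
    refine ((((s hc.smooth_a u).mul (s hc.smooth_a v)).add
      ((s hc.smooth_b u).mul (s hc.smooth_b v))).add
      ((s hc.smooth_c u).mul (s hc.smooth_c v))).congr fun y hy => (hg y hy.1).2.1 u v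
  obtain ⟨Ψ, ϖ, h⟩ := exists_complexCoframe hW (hc.isOpen.inter hUo') hh
    (fun y hy u v => by rw [(hg y hy.1).2.1, (hg y hy.1).2.1]; ring)
    (fun y hy u hu => K.pos _ _ fun h0 => hu ((injective_iff_map_eq_zero _).1 (hU' y hy.2).2 u h0))
  exact ⟨Ψ, ϖ, U ∩ U', ⟨hpU, hpU'⟩, h⟩

/-- A surface is flat at the points near which it is tangent to the vertical field. -/
theorem EktLike.gaussAt_zero_of_vertical (K : EktLike I κ τ g ξ) [FiniteDimensional ℝ W]
    (hW : Module.finrank ℝ W = 2) {F : W → N} {p : W}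
    (hF : ∀ᶠ q in 𝓝 p, ContMDiffAt 𝓘(ℝ, W) I ∞ F q ∧
      Function.Injective (modelDeriv 𝓘(ℝ, W) I F q) ∧ ∃ v, modelDeriv 𝓘(ℝ, W) I F q v = ξ (F q)) :
    GaussAt (indMetric I g F) p 0 := by
  obtain ⟨σ, -, a, b, c, ϖ, U, hpU, hc, hg⟩ := (K.coframe (F p)).pull (hF.mono fun _ h => h.1)
  obtain ⟨U', hU', hUo', hpU'⟩ := eventually_nhds_iff.1 hF
  refine gaussAt_zero_of_wedge_eq_zero hW (hc.mono (hc.isOpen.inter hUo') inter_subset_left)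
    ?_ (fun y hy u v => (hg y hy.1).2.1 u v) ?_ ⟨hpU, hpU'⟩
  · rintro y ⟨hy, hy'⟩ u v
    obtain ⟨-, hinj, w, hw⟩ := hU' y hy'
    have h1 : c y w = 1 := by rw [← (hg y hy).2.2, hw, K.unit]
    have h2 : a y w * a y w + b y w * b y w + c y w * c y w = 1 := by
      rw [← (hg y hy).2.1, indMetric_apply, hw, K.unit]
    rw [h1] at h2
    have ha : a y w = 0 := by nlinarith [sq_nonneg (a y w), sq_nonneg (b y w)]
    have hb : b y w = 0 := by nlinarith [sq_nonneg (a y w), sq_nonneg (b y w)]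
    have hw0 : w ≠ 0 := by rintro rfl; simp at h1
    -- `a` and `b` vanish on the line spanned by `w`, so that `a ∧ b = 0` on the plane
    obtain ⟨e₀, e₁, l₀, l₁, h00, h01, h10, h11, hexp⟩ := exists_linear_coordinates hW
    have key : wedge (a y) (b y) e₀ e₁ = 0 := by
      have ew := hexp w
      have a1 := congrArg (a y) ew
      have b1 := congrArg (b y) ew
      simp only [map_add, map_smul, smul_eq_mul, ha, hb] at a1 b1
      by_cases h0 : l₀ w = 0
      · have h3 : l₁ w ≠ 0 := by
          intro h3; rw [h0, h3] at ew; simp at ew; exact hw0 ew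
        have : l₁ w * wedge (a y) (b y) e₀ e₁ = 0 := by
          simp only [wedge]; rw [h0] at a1 b1
          linear_combination (-a y e₀) * b1 + b y e₀ * a1
        exact (mul_eq_zero.1 this).resolve_left h3
      · have : l₀ w * wedge (a y) (b y) e₀ e₁ = 0 := by
          simp only [wedge]
          linear_combination (-b y e₁) * a1 + a y e₁ * b1
        exact (mul_eq_zero.1 this).resolve_left h0
    have : wedge (a y) (b y) u v = (l₀ u * l₁ v - l₀ v * l₁ u) * wedge (a y) (b y) e₀ e₁ := by
      conv_lhs => rw [hexp u, hexp v]
      simp only [wedge, map_add, map_smul, smul_eq_mul]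
      ring
    rw [this, key, mul_zero]
  · rintro y ⟨hy, hy'⟩ u hu
    by_contra h0
    exact (K.pos _ _ fun h1 => h0 ((injective_iff_map_eq_zero _).1 (hU' y hy').2.1 u h1)).ne' hu

variable [I₂.Boundaryless] [IsManifold I₂ ∞ S]

theorem contMDiffAt_extChartAt_symm {x : S} {y : E₂} (hy : y ∈ (extChartAt I₂ x).target) :
    ContMDiffAt 𝓘(ℝ, E₂) I₂ ∞ (extChartAt I₂ x).symm y :=
  (contMDiffOn_extChartAt_symm x).contMDiffAt ((isOpen_extChartAt_target x).mem_nhds hy)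

omit [I₂.Boundaryless] in
theorem contMDiffAt_extChartAt_of_mem {x x' : S} (hx : x' ∈ (extChartAt I₂ x).source) :
    ContMDiffAt I₂ 𝓘(ℝ, E₂) ∞ (extChartAt I₂ x) x' :=
  (contMDiffOn_extChartAt (x := x)).contMDiffAt
    (by simpa using (isOpen_extChartAt_source (I := I₂) x).mem_nhds hx)

theorem injective_modelDeriv_extChartAt_symm {x : S} {y : E₂} (hy : y ∈ (extChartAt I₂ x).target) :
    Function.Injective (modelDeriv 𝓘(ℝ, E₂) I₂ (extChartAt I₂ x).symm y) := by
  set φ := extChartAt I₂ x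
  have h1 := modelDeriv_comp
    ((contMDiffAt_extChartAt_of_mem (φ.map_target hy)).mdifferentiableAt (by simp))
    ((contMDiffAt_extChartAt_symm hy).mdifferentiableAt (by simp))
  have h2 : (φ ∘ φ.symm) =ᶠ[𝓝 y] fun y => y := by
    filter_upwards [(isOpen_extChartAt_target (I := I₂) x).mem_nhds hy] with z hz
      using φ.right_inv hz
  rw [modelDeriv_congr h2, modelDeriv_id] at h1
  intro u v huv
  have h3 := congrArg (fun L : E₂ →L[ℝ] E₂ => L u) h1
  have h4 := congrArg (fun L : E₂ →L[ℝ] E₂ => L v) h1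
  refine h3.trans (Eq.trans ?_ h4.symm)
  exact congrArg (modelDeriv I₂ 𝓘(ℝ, E₂) φ (φ.symm y)) huv

theorem localMetric_pullbackMetric {Φ : S → N} (hΦ : ContMDiff I₂ I ∞ Φ) {x : S} {y : E₂}
    (hy : y ∈ (extChartAt I₂ x).target) :
    localMetric (pullbackMetric (I := I₂) (J := I) g Φ) x y
      = indMetric I g (Φ ∘ (extChartAt I₂ x).symm) y := by
  rw [localMetric_eq_indMetric]
  exact indMetric_pullMetric ((hΦ _).mdifferentiableAt (by simp))
    ((contMDiffAt_extChartAt_symm hy).mdifferentiableAt (by simp))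

theorem immersion_comp_chart {Φ : S → N} (hΦ : IsSmoothImmersion I₂ I Φ) {x : S} {y : E₂}
    (hy : y ∈ (extChartAt I₂ x).target) :
    ∀ᶠ z in 𝓝 y, ContMDiffAt 𝓘(ℝ, E₂) I ∞ (Φ ∘ (extChartAt I₂ x).symm) z ∧
      Function.Injective (modelDeriv 𝓘(ℝ, E₂) I (Φ ∘ (extChartAt I₂ x).symm) z) := by
  filter_upwards [(isOpen_extChartAt_target (I := I₂) x).mem_nhds hy] with z hz
  have h1 := contMDiffAt_extChartAt_symm hz
  refine ⟨(hΦ.1 _).comp z h1, ?_⟩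
  rw [modelDeriv_comp ((hΦ.1 _).mdifferentiableAt (by simp)) (h1.mdifferentiableAt (by simp))]
  exact (hΦ.2 _).comp (injective_modelDeriv_extChartAt_symm hz)

/-- Flatness can be read in any chart. -/
theorem EktLike.gaussAt_of_isFlatSurface (K : EktLike I κ τ g ξ) [FiniteDimensional ℝ E₂]
    (hE : Module.finrank ℝ E₂ = 2) {Φ : S → N} (hΦ : IsSmoothImmersion I₂ I Φ)
    (hf : IsFlatSurface (I := I) I₂ g Φ) {x : S} {y : E₂} (hy : y ∈ (extChartAt I₂ x).target) :
    GaussAt (indMetric I g (Φ ∘ (extChartAt I₂ x).symm)) y 0 := by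
  set φ := extChartAt I₂ x with hφ
  set x' := φ.symm y with hx'
  set ψ := extChartAt I₂ x' with hψ
  have hx's : x' ∈ ψ.source := mem_extChartAt_source x'
  have hyt : ψ x' ∈ ψ.target := ψ.map_source hx's
  obtain ⟨Ψ, ϖ, U, hpU, hc⟩ := K.complexCoframe hE (immersion_comp_chart hΦ hyt)
  have hgauss : GaussAt (indMetric I g (Φ ∘ ψ.symm)) (ψ x') 0 :=
    GaussAt.congr (by
      filter_upwards [(isOpen_extChartAt_target (I := I₂) x').mem_nhds hyt] with z hz
        using localMetric_pullbackMetric hΦ.1 hz) (hasGaussCurvatureAt_iff.1 (hf x'))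
  have hev : ∀ᶠ z in 𝓝 y, z ∈ φ.target ∧ φ.symm z ∈ ψ.source ∧ ψ (φ.symm z) ∈ U := by
    have hc1 : ContinuousAt φ.symm y := (contMDiffAt_extChartAt_symm hy).continuousAt
    have hc2 : ContinuousAt ψ (φ.symm y) := (contMDiffAt_extChartAt_of_mem hx's).continuousAt
    filter_upwards [(isOpen_extChartAt_target (I := I₂) x).mem_nhds hy,
      hc1.preimage_mem_nhds ((isOpen_extChartAt_source (I := I₂) x').mem_nhds hx's),
      (hc2.comp hc1).preimage_mem_nhds (hc.isOpen.mem_nhds hpU)] with z h1 h2 h3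
      using ⟨h1, h2, h3⟩
  obtain ⟨A, hA, hAo, hyA⟩ := eventually_nhds_iff.1 hev
  have hsm : ∀ z ∈ A, ContDiffAt ℝ ∞ (ψ ∘ φ.symm) z := fun z hz =>
    ((contMDiffAt_extChartAt_of_mem (hA z hz).2.1).comp z
      (contMDiffAt_extChartAt_symm (hA z hz).1)).contDiffAt
  have heq : ∀ z ∈ A, Φ ∘ φ.symm =ᶠ[𝓝 z] (Φ ∘ ψ.symm) ∘ (ψ ∘ φ.symm) := by
    intro z hz
    filter_upwards [hAo.mem_nhds hz] with w hw
    simp only [Function.comp_apply]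
    rw [ψ.left_inv (hA w hw).2.1]
  have hmd : ∀ z ∈ A, MDifferentiableAt 𝓘(ℝ, E₂) I (Φ ∘ ψ.symm) ((ψ ∘ φ.symm) z) := fun z hz =>
    ((hΦ.1 _).comp _ (contMDiffAt_extChartAt_symm (ψ.map_source (hA z hz).2.1))).mdifferentiableAt
      (by simp)
  refine GaussAt.pull hc hE hE hAo (fun z hz => (hsm z hz).contDiffWithinAt)
    (fun z hz => (hA z hz).2.2) ?_ ?_ hyA (h := indMetric I g (Φ ∘ φ.symm)) hgauss
  · intro z hz
    have h1 := (immersion_comp_chart hΦ (hA z hz).1).self_of_nhds.2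
    rw [modelDeriv_congr (heq z hz)] at h1
    intro u v huv
    apply h1
    rw [modelDeriv_comp_coord (hmd z hz) ((hsm z hz).differentiableAt (by simp))]
    exact congrArg (modelDeriv 𝓘(ℝ, E₂) I (Φ ∘ ψ.symm) ((ψ ∘ φ.symm) z)) huv
  · intro z hz u v
    rw [indMetric_congr (heq z hz), indMetric_comp (hmd z hz)
      ((hsm z hz).differentiableAt (by simp))]

/-- A surface which is everywhere tangent to the vertical field is flat. -/
theorem EktLike.isFlatSurface_of_vertical (K : EktLike I κ τ g ξ) [FiniteDimensional ℝ E₂]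
    (hE : Module.finrank ℝ E₂ = 2) {Φ : S → N} (hΦ : IsSmoothImmersion I₂ I Φ)
    (hv : ∀ x, ∃ v, modelDeriv I₂ I Φ x v = ξ (Φ x)) : IsFlatSurface (I := I) I₂ g Φ := by
  intro x
  rw [hasGaussCurvatureAt_iff]
  set φ := extChartAt I₂ x with hφ
  have hyt : φ x ∈ φ.target := φ.map_source (mem_extChartAt_source x)
  refine GaussAt.congr (h := indMetric I g (Φ ∘ φ.symm)) (by
      filter_upwards [(isOpen_extChartAt_target (I := I₂) x).mem_nhds hyt] with z hz
        using (localMetric_pullbackMetric hΦ.1 hz).symm) (K.gaussAt_zero_of_vertical hE ?_)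
  filter_upwards [immersion_comp_chart hΦ hyt,
    (isOpen_extChartAt_target (I := I₂) x).mem_nhds hyt] with z hz hzt
  refine ⟨hz.1, hz.2, ?_⟩
  obtain ⟨v, hv⟩ := hv (φ.symm z)
  have hsurj : Function.Surjective (modelDeriv 𝓘(ℝ, E₂) I₂ φ.symm z) :=
    LinearMap.surjective_of_injective (V := E₂)
      (f := (modelDeriv 𝓘(ℝ, E₂) I₂ φ.symm z).toLinearMap)
      (injective_modelDeriv_extChartAt_symm hzt)
  obtain ⟨u, hu⟩ := hsurj v
  refine ⟨u, ?_⟩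
  rw [modelDeriv_comp ((hΦ.1 _).mdifferentiableAt (by simp))
    ((contMDiffAt_extChartAt_symm hzt).mdifferentiableAt (by simp))]
  change modelDeriv I₂ I Φ (φ.symm z) (modelDeriv 𝓘(ℝ, E₂) I₂ φ.symm z u) = _
  rw [hu, hv]
  rfl

end Coframes

/-! ### The developing map of a compact flat surface -/

section FlatSurfaces

variable {E₂ : Type*} [NormedAddCommGroup E₂] [NormedSpace ℝ E₂]
  {H₂ : Type*} [TopologicalSpace H₂] {I₂ : ModelWithCorners ℝ E₂ H₂}
  {S : Type*} [TopologicalSpace S] [ChartedSpace H₂ S]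
  {G : S → E₂ →L[ℝ] E₂ →L[ℝ] ℝ}

/-- Near `p`, the map `D` from the plane is smooth and isometric. -/
def IsFlatMapAt (I₂ : ModelWithCorners ℝ E₂ H₂) (G : S → E₂ →L[ℝ] E₂ →L[ℝ] ℝ) (D : ℂ → S)
    (p : ℂ) : Prop :=
  ∀ᶠ q in 𝓝 p, ContMDiffAt 𝓘(ℝ, ℂ) I₂ ∞ D q ∧ ∀ u v, indMetric I₂ G D q u v = inner ℝ u v

/-- An isometric parametrization `D` of a neighbourhood `O` of `x` by a ball of the plane, with
its inverse `Ξ`. -/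
structure IsFlatParam (I₂ : ModelWithCorners ℝ E₂ H₂) (G : S → E₂ →L[ℝ] E₂ →L[ℝ] ℝ) (x : S)
    (ρ : ℝ) (D : ℂ → S) (Ξ : S → ℂ) (O : Set S) : Prop where
  pos : 0 < ρ
  isOpen : IsOpen O
  mem : x ∈ O
  map_zero : D 0 = x
  map_mem : ∀ z ∈ Metric.ball 0 ρ, D z ∈ O
  left_inv : ∀ z ∈ Metric.ball 0 ρ, Ξ (D z) = z
  smooth : ∀ z ∈ Metric.ball 0 ρ, ContMDiffAt 𝓘(ℝ, ℂ) I₂ ∞ D z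
  isometric : ∀ z ∈ Metric.ball 0 ρ, ∀ u v, indMetric I₂ G D z u v = inner ℝ u v
  smooth_inv : ∀ x' ∈ O, ContMDiffAt I₂ 𝓘(ℝ, ℂ) ∞ Ξ x'
  inv_mem : ∀ x' ∈ O, Ξ x' ∈ Metric.ball 0 ρ
  right_inv : ∀ x' ∈ O, D (Ξ x') = x'

variable {D D' : ℂ → S} {p p' : ℂ}

theorem IsFlatMapAt.congr (h : IsFlatMapAt I₂ G D p) (e : D =ᶠ[𝓝 p] D') :
    IsFlatMapAt I₂ G D' p := by
  filter_upwards [h, e.eventuallyEq_nhds] with q h1 h2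
  exact ⟨h1.1.congr_of_eventuallyEq h2.symm, fun u v => by rw [← indMetric_congr h2, h1.2]⟩

theorem IsFlatMapAt.comp_rigid (a b : ℂ) (L : ℂ ≃ₗᵢ[ℝ] ℂ)
    (h : IsFlatMapAt I₂ G D (a + L (p - b))) : IsFlatMapAt I₂ G (fun q => D (a + L (q - b))) p := by
  have hA : ContDiff ℝ ∞ fun q : ℂ => a + L (q - b) :=
    contDiff_const.add (L.contDiff.comp (contDiff_id.sub contDiff_const))
  have hA' : ∀ q, HasFDerivAt (fun q : ℂ => a + L (q - b)) (L.toContinuousLinearEquiv : ℂ →L[ℝ] ℂ)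
      q := fun q => ((L.toContinuousLinearEquiv.hasFDerivAt.comp q
        ((hasFDerivAt_id q).sub_const b)).const_add a)
  filter_upwards [hA.continuous.continuousAt.preimage_mem_nhds h] with q hq
  refine ⟨ContMDiffAt.comp q hq.1 hA.contMDiff.contMDiffAt, fun u v => ?_⟩
  have := indMetric_comp (g := G) (f := fun q => a + L (q - b)) (hq.1.mdifferentiableAt (by simp)) (hA' q).differentiableAt u v
  rw [(hA' q).fderiv, hq.2] at this
  exact this.trans (L.inner_map_map u v)

theorem IsFlatParam.isFlatMapAt {x : S} {ρ : ℝ} {P : ℂ → S} {Ξ : S → ℂ} {O : Set S}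
    (hP : IsFlatParam I₂ G x ρ P Ξ O) {z : ℂ} (hz : z ∈ Metric.ball 0 ρ) :
    IsFlatMapAt I₂ G P z := by
  filter_upwards [Metric.isOpen_ball.mem_nhds hz] with q hq
  exact ⟨hP.smooth q hq, hP.isometric q hq⟩

/-- A flat map is a rigid motion in a flat parametrization. -/
theorem IsFlatParam.local_form {x : S} {ρ : ℝ} {P : ℂ → S} {Ξ : S → ℂ} {O : Set S}
    (hP : IsFlatParam I₂ G x ρ P Ξ O) (hD : IsFlatMapAt I₂ G D p) (hp : D p ∈ O) :
    ∃ L : ℂ ≃ₗᵢ[ℝ] ℂ, ∀ᶠ q in 𝓝 p, D q ∈ O ∧ Ξ (D q) = Ξ (D p) + L (q - p) := by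
  have hO : ∀ᶠ q in 𝓝 p, D q ∈ O :=
    hD.self_of_nhds.1.continuousAt.preimage_mem_nhds (hP.isOpen.mem_nhds hp)
  obtain ⟨r, hr, hball⟩ := Metric.eventually_nhds_iff_ball.1 (hD.and hO)
  have hs : ∀ y ∈ Metric.ball p r, ContDiffAt ℝ ∞ (Ξ ∘ D) y := fun y hy =>
    ((hP.smooth_inv _ (hball y hy).2).comp y (hball y hy).1.1).contDiffAt
  obtain ⟨L, hL⟩ := exists_rigid_motion Metric.isOpen_ball (convex_ball p r)
    (fun y hy => (hs y hy).contDiffWithinAt) (by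
      intro y hy u v
      have e : D =ᶠ[𝓝 y] P ∘ (Ξ ∘ D) := by
        filter_upwards [Metric.isOpen_ball.mem_nhds hy] with z hz
        exact (hP.right_inv _ (hball z hz).2).symm
      have h1 := (hball y hy).1.2 u v
      have hy' := hP.inv_mem _ (hball y hy).2
      rw [indMetric_congr e, indMetric_comp (f := Ξ ∘ D) ((hP.smooth _ hy').mdifferentiableAt (by simp))
        ((hs y hy).differentiableAt (by simp))] at h1
      exact (hP.isometric _ hy' _ _).symm.trans h1) (Metric.mem_ball_self hr)
  refine ⟨L, Metric.eventually_nhds_iff_ball.2 ⟨r, hr, fun q hq => ⟨(hball q hq).2, hL q hq⟩⟩⟩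

variable (hS : ∀ x : S, ∃ ρ P Ξ O, IsFlatParam I₂ G x ρ P Ξ O)
include hS

/-- Two flat maps differ by a rigid motion. -/
theorem exists_rigid_of_isFlatMapAt (hD : IsFlatMapAt I₂ G D p) (hD' : IsFlatMapAt I₂ G D' p')
    (h : D p = D' p') : ∃ L : ℂ ≃ₗᵢ[ℝ] ℂ, D =ᶠ[𝓝 p] fun q => D' (p' + L (q - p)) := by
  obtain ⟨ρ, P, Ξ, O, hP⟩ := hS (D p)
  obtain ⟨L, hL⟩ := hP.local_form hD hP.mem
  obtain ⟨L', hL'⟩ := hP.local_form hD' (h ▸ hP.mem)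
  refine ⟨L.trans L'.symm, ?_⟩
  have hc : ContinuousAt (fun q => p' + (L.trans L'.symm) (q - p)) p :=
    (continuous_const.add ((L.trans L'.symm).continuous.comp
      (continuous_id.sub continuous_const))).continuousAt
  have h2 := hc.preimage_mem_nhds (t := {q | D' q ∈ O ∧ Ξ (D' q) = Ξ (D' p') + L' (q - p')})
    (by
      rw [sub_self, map_zero, add_zero]
      exact hL')
  filter_upwards [hL, h2] with q h1 h2
  rw [← hP.right_inv _ h1.1, ← hP.right_inv _ h2.1, h1.2, h2.2, h]
  simp

theorem isFlatMapAt_unique (hD : IsFlatMapAt I₂ G D p) (hD' : IsFlatMapAt I₂ G D' p)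
    (h : D p = D' p) : ∀ᶠ q in 𝓝 p, (D =ᶠ[𝓝 q] D' → D =ᶠ[𝓝 p] D') := by
  obtain ⟨ρ, P, Ξ, O, hP⟩ := hS (D p)
  obtain ⟨L, hL⟩ := hP.local_form hD hP.mem
  obtain ⟨L', hL'⟩ := hP.local_form hD' (h ▸ hP.mem)
  filter_upwards [hL.eventually_nhds, hL'.eventually_nhds] with q h1 h2 he
  have h3 : (fun y => L (y - p)) =ᶠ[𝓝 q] fun y => L' (y - p) := by
    filter_upwards [h1, h2, he] with y a1 a2 a3
    have := a1.2
    rw [a3, a2.2, h] at this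
    exact (add_left_cancel this).symm
  have hd : ∀ M : ℂ ≃ₗᵢ[ℝ] ℂ, HasFDerivAt (fun y : ℂ => M (y - p))
      (M.toContinuousLinearEquiv : ℂ →L[ℝ] ℂ) q := fun M =>
    M.toContinuousLinearEquiv.hasFDerivAt.comp q ((hasFDerivAt_id q).sub_const p)
  have h4 := (hd L).unique ((hd L').congr_of_eventuallyEq h3)
  have h5 : ∀ z, L z = L' z := fun z => congrArg (fun M : ℂ →L[ℝ] ℂ => M z) h4
  filter_upwards [hL, hL'] with y a1 a2
  rw [← hP.right_inv _ a1.1, ← hP.right_inv _ a2.1, a1.2, a2.2, h, h5]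

theorem flatMap_eq_of_germ [T2Space S] {C : Set ℂ} (hC : IsPreconnected C)
    (hD : ∀ q ∈ C, IsFlatMapAt I₂ G D q) (hD' : ∀ q ∈ C, IsFlatMapAt I₂ G D' q) (hp : p ∈ C)
    (h : D =ᶠ[𝓝 p] D') : ∀ q ∈ C, D q = D' q := fun q hq =>
  (germ_eq_of_isPreconnected (Adm := IsFlatMapAt I₂ G)
    (fun _ _ h => h.self_of_nhds.1.continuousAt)
    (fun _ _ _ h1 h2 h3 => isFlatMapAt_unique hS h1 h2 h3) hC hD hD' hp h q hq).self_of_nhds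

/-- Points of the plane with the same image under a developing map are exchanged by a rigid motion
which preserves the developing map. -/
theorem exists_rigid_of_eq [T2Space S] (hD : ∀ q, IsFlatMapAt I₂ G D q) (h : D p = D p') :
    ∃ L : ℂ ≃ₗᵢ[ℝ] ℂ, ∀ q, D q = D (p' + L (q - p)) := by
  obtain ⟨L, hL⟩ := exists_rigid_of_isFlatMapAt hS (hD p) (hD p') h
  exact ⟨L, fun q => flatMap_eq_of_germ hS isPreconnected_univ (fun q _ => hD q)
    (fun q _ => (hD _).comp_rigid p' p L) (mem_univ p) hL q (mem_univ q)⟩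

/-- A developing map is onto. -/
theorem surjective_of_isFlatMapAt [T2Space S] [PreconnectedSpace S]
    (hD : ∀ q, IsFlatMapAt I₂ G D q) : Function.Surjective D := by
  have key : ∀ {x ρ P Ξ O}, IsFlatParam I₂ G x ρ P Ξ O → ∀ p, D p ∈ O → O ⊆ range D := by
    intro x ρ P Ξ O hP p hp x' hx'
    obtain ⟨L, hL⟩ := hP.local_form (hD p) hp
    have hconv : Convex ℝ ((fun q => Ξ (D p) + L (q - p)) ⁻¹' Metric.ball 0 ρ) := by
      have : (fun q => Ξ (D p) + L (q - p)) ⁻¹' Metric.ball 0 ρ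
          = (L.toLinearEquiv : ℂ →ₗ[ℝ] ℂ) ⁻¹' ((fun z => (Ξ (D p) - L p) + z) ⁻¹' Metric.ball 0 ρ) := by
        ext q
        simp only [mem_preimage, map_sub]
        rw [show Ξ (D p) + (L q - L p) = Ξ (D p) - L p + L q by ring]
        rfl
      rw [this]
      exact ((convex_ball 0 ρ).translate_preimage_right _).linear_preimage _
    have h1 := flatMap_eq_of_germ hS (D := D) (D' := fun q => P (Ξ (D p) + L (q - p)))
      hconv.isPreconnected (fun q _ => hD q)
      (fun q hq => (hP.isFlatMapAt hq).comp_rigid _ _ L) (p := p)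
      (by simpa using hP.inv_mem _ hp) (by
        filter_upwards [hL] with q hq
        rw [← hq.2, hP.right_inv _ hq.1])
    refine ⟨p + L.symm (Ξ x' - Ξ (D p)), ?_⟩
    rw [h1 _ (by simpa using hP.inv_mem _ hx')]
    simpa using hP.right_inv _ hx'
  have hcl : IsClopen (range D) := by
    constructor
    · refine isClosed_of_closure_subset fun x hx => ?_
      obtain ⟨ρ, P, Ξ, O, hP⟩ := hS x
      obtain ⟨_, h1, p, rfl⟩ := mem_closure_iff.1 hx O hP.isOpen hP.mem
      exact key hP p h1 hP.mem
    · rw [isOpen_iff_mem_nhds]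
      rintro _ ⟨p, rfl⟩
      obtain ⟨ρ, P, Ξ, O, hP⟩ := hS (D p)
      exact Filter.mem_of_superset (hP.isOpen.mem_nhds hP.mem) (key hP p hP.mem)
  have := hcl.eq_univ ⟨D 0, mem_range_self 0⟩
  exact range_eq_univ.1 this

/-- On a compact surface, flat maps extend to balls of a fixed radius. -/
theorem exists_uniform_flatMap [CompactSpace S] : ∃ r > 0, ∀ x : S, ∃ D : ℂ → S, D 0 = x ∧
    ∀ z ∈ Metric.ball 0 r, IsFlatMapAt I₂ G D z := by
  have := isCompact_univ.induction_on (X := S) (p := fun s => ∃ r > 0, ∀ x ∈ s, ∃ D : ℂ → S,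
    D 0 = x ∧ ∀ z ∈ Metric.ball 0 r, IsFlatMapAt I₂ G D z) ⟨1, one_pos, by simp⟩
    (fun s t hst ⟨r, hr, h⟩ => ⟨r, hr, fun x hx => h x (hst hx)⟩) ?_ ?_
  · simpa using this
  · rintro s t ⟨r, hr, h⟩ ⟨r', hr', h'⟩
    refine ⟨min r r', lt_min hr hr', ?_⟩
    rintro x (hx | hx)
    · obtain ⟨D, h1, h2⟩ := h x hx
      exact ⟨D, h1, fun z hz => h2 z (Metric.ball_subset_ball (min_le_left _ _) hz)⟩
    · obtain ⟨D, h1, h2⟩ := h' x hx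
      exact ⟨D, h1, fun z hz => h2 z (Metric.ball_subset_ball (min_le_right _ _) hz)⟩
  · intro x _
    obtain ⟨ρ, P, Ξ, O, hP⟩ := hS x
    have hρ := hP.pos
    have hx0 : Ξ x = 0 := by
      rw [← hP.map_zero, hP.left_inv 0 (Metric.mem_ball_self hρ)]
    have hn : O ∩ Ξ ⁻¹' Metric.ball 0 (ρ / 2) ∈ 𝓝 x :=
      Filter.inter_mem (hP.isOpen.mem_nhds hP.mem)
        ((hP.smooth_inv x hP.mem).continuousAt.preimage_mem_nhds
          (Metric.isOpen_ball.mem_nhds (by rw [hx0]; exact Metric.mem_ball_self (by linarith))))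
    refine ⟨_, mem_nhdsWithin_of_mem_nhds hn, ρ / 2, by linarith, ?_⟩
    rintro x' ⟨h1, h2⟩
    refine ⟨fun q => P (Ξ x' + LinearIsometryEquiv.refl ℝ ℂ (q - 0)), by
      simpa using hP.right_inv _ h1, fun z hz => (hP.isFlatMapAt ?_).comp_rigid _ _ _⟩
    simp only [mem_preimage, mem_ball_zero_iff] at h2 hz ⊢
    calc ‖Ξ x' + LinearIsometryEquiv.refl ℝ ℂ (z - 0)‖ ≤ ‖Ξ x'‖ + ‖z‖ := by
          simpa using norm_add_le (Ξ x') z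
      _ < ρ := by linarith

/-- The developing map of a compact flat surface. -/
theorem exists_developing_map [CompactSpace S] [T2Space S] (x : S) :
    ∃ D : ℂ → S, D 0 = x ∧ ∀ p, IsFlatMapAt I₂ G D p := by
  obtain ⟨r, hr, hext⟩ := exists_uniform_flatMap hS
  obtain ⟨D₀, h0, h0'⟩ := hext x
  obtain ⟨D, hD, hD'⟩ := exists_development (Adm := IsFlatMapAt I₂ G)
    (fun _ _ _ e h => h.congr e) (fun _ _ h => h.self_of_nhds.1.continuousAt)
    (fun _ _ _ h1 h2 h3 => isFlatMapAt_unique hS h1 h2 h3) hr (by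
      intro D p hD
      obtain ⟨D₁, h1, h1'⟩ := hext (D p)
      obtain ⟨L, hL⟩ := exists_rigid_of_isFlatMapAt hS hD (h1' 0 (Metric.mem_ball_self hr)) h1.symm
      refine ⟨_, hL.symm, fun q hq => (h1' _ ?_).comp_rigid _ _ L⟩
      rw [mem_ball_iff_norm] at hq
      rwa [mem_ball_zero_iff, zero_add, L.norm_map]) (h0' 0 (Metric.mem_ball_self hr))
  exact ⟨D, by rw [hD.self_of_nhds, h0], hD'⟩

end FlatSurfaces

/-! ### Flat parametrizations -/

section FlatParametrizations

variable {E : Type*} [NormedAddCommGroup E] [NormedSpace ℝ E]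
  {H : Type*} [TopologicalSpace H] {I : ModelWithCorners ℝ E H}
  {N : Type*} [TopologicalSpace N] [ChartedSpace H N]
  {E₂ : Type*} [NormedAddCommGroup E₂] [NormedSpace ℝ E₂] [FiniteDimensional ℝ E₂]
  {H₂ : Type*} [TopologicalSpace H₂] {I₂ : ModelWithCorners ℝ E₂ H₂} [I₂.Boundaryless]
  {S : Type*} [TopologicalSpace S] [ChartedSpace H₂ S] [IsManifold I₂ ∞ S]
  {κ τ : ℝ} {g : N → E →L[ℝ] E →L[ℝ] ℝ} {ξ : N → E}

/-- Flat coordinates, and the inverse function theorem. -/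
theorem EktLike.exists_flatParam (K : EktLike I κ τ g ξ) (hE : Module.finrank ℝ E₂ = 2)
    {Φ : S → N} (hΦ : IsSmoothImmersion I₂ I Φ) (hf : IsFlatSurface (I := I) I₂ g Φ) (x : S) :
    ∃ ρ P Ξ O, IsFlatParam I₂ (pullMetric I I₂ g Φ) x ρ P Ξ O := by
  set φ := extChartAt I₂ x with hφ
  have hxs : x ∈ φ.source := mem_extChartAt_source x
  have hyt : φ x ∈ φ.target := φ.map_source hxs
  have hto : IsOpen φ.target := isOpen_extChartAt_target x
  obtain ⟨Ψ, ϖ, U, hpU, hc⟩ := K.complexCoframe hE (immersion_comp_chart hΦ hyt)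
  have hc' : IsComplexCoframeOn (indMetric I g (Φ ∘ φ.symm)) Ψ ϖ (U ∩ φ.target) :=
    ⟨hc.isOpen.inter hto, hc.smooth.mono inter_subset_left,
      hc.smooth_connection.mono inter_subset_left, fun y hy => hc.metric y hy.1,
      fun y hy => hc.injective y hy.1, fun y hy => hc.d_eq y hy.1⟩
  obtain ⟨r, hr, hrU, Θ, hΘ, hΘ'⟩ := hc'.exists_flat_coordinates (fun y hy u v => by
    have := (hc'.gaussAt_iff hE hy).1 (K.gaussAt_of_isFlatSurface hE hΦ hf hy.2) u v
    simpa using this) ⟨hpU, hyt⟩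
  have hinv : ∀ y ∈ Metric.ball (φ x) r, (fderiv ℝ Θ y).IsInvertible := by
    intro y hy
    refine isInvertible_of_injective (by rw [hE, Complex.finrank_real_complex]) ?_
    rw [injective_iff_map_eq_zero]
    intro u hu
    have h1 := hΘ' y hy u u
    rw [hu, inner_zero_left, hc'.metric y (hrU hy), eq_comm, inner_self_eq_zero] at h1
    exact (injective_iff_map_eq_zero _).1 (hc'.injective y (hrU hy)) u h1
  have hΘs : ∀ y ∈ Metric.ball (φ x) r, ContDiffAt ℝ ∞ Θ y := fun y hy =>
    hΘ.contDiffAt (Metric.isOpen_ball.mem_nhds hy)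
  have hxb : φ x ∈ Metric.ball (φ x) r := Metric.mem_ball_self hr
  obtain ⟨e₀, he₀⟩ := hinv _ hxb
  have : CompleteSpace E₂ := FiniteDimensional.complete ℝ E₂
  have hd0 : HasFDerivAt Θ (e₀ : E₂ →L[ℝ] ℂ) (φ x) := by
    rw [he₀]; exact ((hΘs _ hxb).differentiableAt (by simp)).hasFDerivAt
  set e := ((hΘs _ hxb).toOpenPartialHomeomorph Θ hd0 (by simp)).restrOpen
    (Metric.ball (φ x) r) Metric.isOpen_ball with he
  have hecoe : ∀ y, e y = Θ y := fun y => rfl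
  have hes : e.source ⊆ Metric.ball (φ x) r := by
    rw [he, OpenPartialHomeomorph.restrOpen_source]; exact inter_subset_right
  have hxe : φ x ∈ e.source := by
    rw [he, OpenPartialHomeomorph.restrOpen_source]
    exact ⟨(hΘs _ hxb).mem_toOpenPartialHomeomorph_source hd0 (by simp), hxb⟩
  have hsymm : ∀ z ∈ e.target, ContDiffAt ℝ ∞ e.symm z := by
    intro z hz
    have hz' := hes (e.map_target hz)
    obtain ⟨e', he'⟩ := hinv _ hz'
    refine e.contDiffAt_symm hz (f₀' := e') ?_ (hΘs _ hz')
    rw [he']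
    exact ((hΘs _ hz').differentiableAt (by simp)).hasFDerivAt
  obtain ⟨ρ, hρ, hρt⟩ := Metric.isOpen_iff.1 e.open_target (e (φ x)) (e.map_source hxe)
  set c := e (φ x) with hcdef
  have hmem : ∀ z ∈ Metric.ball (0 : ℂ) ρ, z + c ∈ e.target := fun z hz =>
    hρt (by simpa using hz)
  have hmem' : ∀ z ∈ Metric.ball (0 : ℂ) ρ, e.symm (z + c) ∈ φ.target := fun z hz =>
    (hrU (hes (e.map_target (hmem z hz)))).2
  have hsub : IsOpen (e.source ∩ e ⁻¹' Metric.ball c ρ) :=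
    e.isOpen_inter_preimage Metric.isOpen_ball
  have hsm : ∀ z ∈ Metric.ball (0 : ℂ) ρ, ContDiffAt ℝ ∞ (fun z => e.symm (z + c)) z :=
    fun z hz => (hsymm _ (hmem z hz)).comp z (contDiffAt_id.add contDiffAt_const)
  have hO : ∀ x' ∈ φ.source ∩ φ ⁻¹' (e.source ∩ (e : E₂ → ℂ) ⁻¹' Metric.ball c ρ),
      e (φ x') - c ∈ Metric.ball (0 : ℂ) ρ := by
    intro x' hx'
    have := hx'.2.2
    rw [mem_preimage, mem_ball_iff_norm] at this
    simpa using this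
  refine ⟨ρ, fun z => φ.symm (e.symm (z + c)), fun x' => e (φ x') - c,
    φ.source ∩ φ ⁻¹' (e.source ∩ e ⁻¹' Metric.ball c ρ), hρ,
    isOpen_extChartAt_preimage' x hsub, ⟨hxs, hxe, Metric.mem_ball_self hρ⟩, ?_, ?_, ?_, ?_, ?_,
    ?_, hO, ?_⟩
  · rw [zero_add, hcdef, e.left_inv hxe, φ.left_inv hxs]
  · intro z hz
    refine ⟨φ.map_target (hmem' z hz), ?_⟩
    change φ (φ.symm (e.symm (z + c))) ∈ (e.source ∩ (e : E₂ → ℂ) ⁻¹' Metric.ball c ρ)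
    rw [φ.right_inv (hmem' z hz)]
    refine ⟨e.map_target (hmem z hz), ?_⟩
    rw [mem_preimage, e.right_inv (hmem z hz)]
    simpa using hz
  · intro z hz
    rw [φ.right_inv (hmem' z hz), e.right_inv (hmem z hz), add_sub_cancel_right]
  · intro z hz
    exact ContMDiffAt.comp z (contMDiffAt_extChartAt_symm (hmem' z hz)) (hsm z hz).contMDiffAt
  · intro z hz u v
    have hb := hes (e.map_target (hmem z hz))
    have h1 := (contMDiffAt_extChartAt_symm (I₂ := I₂) (hmem' z hz)).mdifferentiableAt (by simp)
    have h2 := (hsm z hz).differentiableAt (by simp)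
    have h3 : MDifferentiableAt I₂ I Φ (φ.symm (e.symm (z + c))) :=
      (hΦ.1 _).mdifferentiableAt (by simp)
    have h4 : indMetric I₂ (pullMetric I I₂ g Φ) (fun z => φ.symm (e.symm (z + c))) z
        = indMetric I g ((Φ ∘ φ.symm) ∘ fun z => e.symm (z + c)) z :=
      indMetric_pullMetric h3 (h1.comp z h2.mdifferentiableAt)
    rw [h4, indMetric_comp (f := fun z => e.symm (z + c)) (h3.comp _ h1) h2, ← hΘ' _ hb]
    -- the differential of `Θ` inverts that of `e.symm`
    have h5 : ∀ u, fderiv ℝ Θ (e.symm (z + c)) (fderiv ℝ (fun z => e.symm (z + c)) z u) = u := by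
      intro u
      have h6 := ((hΘs _ hb).differentiableAt (by simp)).hasFDerivAt.comp z h2.hasFDerivAt
      have h7 : (Θ ∘ fun z => e.symm (z + c)) =ᶠ[𝓝 z] fun z => z + c := by
        filter_upwards [Metric.isOpen_ball.mem_nhds hz] with w hw
        exact e.right_inv (hmem w hw)
      have h8 := h6.unique (((hasFDerivAt_id z).add_const c).congr_of_eventuallyEq h7)
      exact congrArg (fun L : ℂ →L[ℝ] ℂ => L u) h8
    rw [h5, h5]
  · rintro x' ⟨h1, h2, h3⟩
    exact (ContMDiffAt.comp x' (hΘs _ (hes h2)).contMDiffAt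
      (contMDiffAt_extChartAt_of_mem h1)).sub contMDiffAt_const
  · rintro x' ⟨h1, h2, h3⟩
    rw [sub_add_cancel, e.left_inv h2, φ.left_inv h1]

end FlatParametrizations

/-! ### Compact flat surfaces are vertical -/

section Vertical

theorem norm_sq_eq_of_functional (η : ℂ →L[ℝ] ℝ) : ‖η‖ ^ 2 = η 1 ^ 2 + η Complex.I ^ 2 := by
  obtain ⟨w, rfl⟩ := (InnerProductSpace.toDual ℝ ℂ).surjective η
  rw [LinearIsometryEquiv.norm_map, Complex.sq_norm, Complex.normSq_apply]
  simp [Complex.inner]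
  ring

variable {E : Type*} [NormedAddCommGroup E] [NormedSpace ℝ E]
  {H : Type*} [TopologicalSpace H] {I : ModelWithCorners ℝ E H}
  {N : Type*} [TopologicalSpace N] [ChartedSpace H N]
  {E₂ : Type*} [NormedAddCommGroup E₂] [NormedSpace ℝ E₂]
  {H₂ : Type*} [TopologicalSpace H₂] {I₂ : ModelWithCorners ℝ E₂ H₂}
  {S : Type*} [TopologicalSpace S] [ChartedSpace H₂ S]
  {W : Type*} [NormedAddCommGroup W] [NormedSpace ℝ W]
  {κ τ : ℝ} {g : N → E →L[ℝ] E →L[ℝ] ℝ} {ξ : N → E}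

theorem EktLike.symm (K : EktLike I κ τ g ξ) (x : N) (v w : E) : g x v w = g x w v := by
  obtain ⟨σ, -, χ, B, a, b, c, ϖ, O, hB, hq, hχ, hm, hc, hg⟩ := K.coframe x
  rw [(hg x hq).1, (hg x hq).1]
  ring

/-- Unit vectors with inner product `1` are equal. -/
theorem EktLike.eq_of_unit (K : EktLike I κ τ g ξ) {x : N} {v : E} (h1 : g x v v = 1)
    (h2 : g x (ξ x) v = 1) : v = ξ x := by
  by_contra hne
  have h3 := K.pos x (v - ξ x) (sub_ne_zero.2 hne)
  simp only [map_sub, sub_apply, h1, h2, K.symm x v (ξ x), K.unit] at h3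
  linarith

/-- The pull-back of the form dual to the field `ξ`. -/
def vertForm (I : ModelWithCorners ℝ E H) (g : N → E →L[ℝ] E →L[ℝ] ℝ) (ξ : N → E) (F : W → N) :
    W → W →L[ℝ] ℝ := fun y => (g (F y) (ξ (F y))).comp (modelDeriv 𝓘(ℝ, W) I F y)

theorem EktLike.contDiff_vertForm (K : EktLike I κ τ g ξ) {F : W → N}
    (hF : ∀ q, ContMDiffAt 𝓘(ℝ, W) I ∞ F q) : ContDiff ℝ ∞ (vertForm I g ξ F) := by
  rw [contDiff_iff_contDiffAt]
  intro p
  obtain ⟨σ, hσ, a, b, c, ϖ, U, hpU, hc, hg⟩ :=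
    (K.coframe (F p)).pull (Filter.Eventually.of_forall hF)
  have : vertForm I g ξ F =ᶠ[𝓝 p] c := by
    filter_upwards [hc.isOpen.mem_nhds hpU] with q hq
    ext v
    exact (hg q hq).2.2 v
  exact (hc.smooth_c.contDiffAt (hc.isOpen.mem_nhds hpU)).congr_of_eventuallyEq this

/-- The differential equation for the vertical form of a flat immersed plane. Its norm is the sine
of the angle between the surface and the horizontal planes. -/
theorem EktLike.jacobian_vertForm (K : EktLike I κ τ g ξ) {F : ℂ → N}
    (hF : ∀ q, ContMDiffAt 𝓘(ℝ, ℂ) I ∞ F q)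
    (hi : ∀ q u v, indMetric I g F q u v = inner ℝ u v) (p : ℂ) :
    ‖vertForm I g ξ F p‖ ≤ 1 ∧
    (fderiv ℝ (vertForm I g ξ F) p 1 1 * fderiv ℝ (vertForm I g ξ F) p Complex.I Complex.I
      - fderiv ℝ (vertForm I g ξ F) p Complex.I 1 * fderiv ℝ (vertForm I g ξ F) p 1 Complex.I
      = -(κ - 4 * τ ^ 2) * (1 - ‖vertForm I g ξ F p‖ ^ 2) ^ 2) ∧
    (‖vertForm I g ξ F p‖ = 1 → fderiv ℝ (vertForm I g ξ F) p = 0) := by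
  obtain ⟨σ, hσ, a, b, c, ϖ, U, hpU, hc, hg⟩ :=
    (K.coframe (F p)).pull (Filter.Eventually.of_forall hF)
  have e : vertForm I g ξ F =ᶠ[𝓝 p] c := by
    filter_upwards [hc.isOpen.mem_nhds hpU] with q hq
    ext v
    exact (hg q hq).2.2 v
  have hg' : ∀ y ∈ U, ∀ u v : ℂ, a y u * a y v + b y u * b y v + c y u * c y v = inner ℝ u v :=
    fun y hy u v => by rw [← (hg y hy).2.1, hi]
  have hj := jacobian_vertical hc hg' hpU
  rw [e.fderiv_eq, e.self_of_nhds]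
  have hw : wedge (a p) (b p) 1 Complex.I ^ 2 = 1 - ‖c p‖ ^ 2 := by
    have g11 := hg' p hpU 1 1
    have g12 := hg' p hpU 1 Complex.I
    have g22 := hg' p hpU Complex.I Complex.I
    simp [Complex.inner] at g11 g12 g22
    have h3 := (columns_orthonormal g11 g22 g12).1.2.2
    rw [norm_sq_eq_of_functional]
    simp only [wedge]
    linear_combination h3
  refine ⟨?_, ?_, ?_⟩
  · have := sq_nonneg (wedge (a p) (b p) 1 Complex.I)
    rw [hw] at this
    nlinarith [norm_nonneg (c p)]
  · rw [hj.1, ← hw, hσ]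
    ring
  · intro h1
    refine hj.2 ?_
    rw [h1] at hw
    simpa using hw

variable {Φ : S → N} {D : ℂ → S}

theorem vertForm_comp_rigid {F : ℂ → N} (hF : ∀ q, ContMDiffAt 𝓘(ℝ, ℂ) I ∞ F q) (a b : ℂ)
    (L : ℂ ≃ₗᵢ[ℝ] ℂ) (q : ℂ) : vertForm I g ξ (fun q => F (a + L (q - b))) q
      = (vertForm I g ξ F (a + L (q - b))).comp (L.toContinuousLinearEquiv : ℂ →L[ℝ] ℂ) := by
  have hA' : HasFDerivAt (fun q : ℂ => a + L (q - b)) (L.toContinuousLinearEquiv : ℂ →L[ℝ] ℂ)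
      q := ((L.toContinuousLinearEquiv.hasFDerivAt.comp q
        ((hasFDerivAt_id q).sub_const b)).const_add a)
  have h1 := modelDeriv_comp_coord (I := I) (F := F) (f := fun q => a + L (q - b)) (y := q)
    ((hF _).mdifferentiableAt (by simp)) hA'.differentiableAt
  rw [hA'.fderiv] at h1
  unfold vertForm
  change ContinuousLinearMap.comp _ (modelDeriv 𝓘(ℝ, ℂ) I (F ∘ fun q => a + L (q - b)) q) = _
  rw [h1]
  rfl

theorem norm_comp_rigid {X : Type*} [NormedAddCommGroup X] [NormedSpace ℝ X] (η : ℂ →L[ℝ] X)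
    (L : ℂ ≃ₗᵢ[ℝ] ℂ) : ‖η.comp (L.toContinuousLinearEquiv : ℂ →L[ℝ] ℂ)‖ = ‖η‖ :=
  η.opNorm_comp_linearIsometryEquiv L

/-- A compact surface is the image of a disc under its developing map. -/
theorem exists_radius [T2Space S] [CompactSpace S] [PreconnectedSpace S]
    {G : S → E₂ →L[ℝ] E₂ →L[ℝ] ℝ} (hS : ∀ x : S, ∃ ρ P Ξ O, IsFlatParam I₂ G x ρ P Ξ O)
    (hD : ∀ q, IsFlatMapAt I₂ G D q) : ∃ R : ℝ, ∀ x, ∃ q, ‖q‖ < R ∧ D q = x := by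
  have := isCompact_univ.induction_on (X := S)
    (p := fun s => ∃ R : ℝ, ∀ x ∈ s, ∃ q, ‖q‖ < R ∧ D q = x) ⟨0, by simp⟩
    (fun s t hst ⟨R, h⟩ => ⟨R, fun x hx => h x (hst hx)⟩) ?_ ?_
  · simpa using this
  · rintro s t ⟨r, h⟩ ⟨r', h'⟩
    refine ⟨max r r', ?_⟩
    rintro x (hx | hx)
    · obtain ⟨q, h1, h2⟩ := h x hx
      exact ⟨q, lt_max_of_lt_left h1, h2⟩
    · obtain ⟨q, h1, h2⟩ := h' x hx
      exact ⟨q, lt_max_of_lt_right h1, h2⟩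
  · intro x _
    obtain ⟨p, rfl⟩ := surjective_of_isFlatMapAt hS hD x
    obtain ⟨ρ, P, Ξ, O, hP⟩ := hS (D p)
    obtain ⟨L, hL⟩ := exists_rigid_of_isFlatMapAt hS (hP.isFlatMapAt (Metric.mem_ball_self hP.pos))
      (hD p) hP.map_zero
    refine ⟨O, mem_nhdsWithin_of_mem_nhds (hP.isOpen.mem_nhds hP.mem), ‖p‖ + ρ, fun x hx => ?_⟩
    have hx' := hP.inv_mem x hx
    have h1 := flatMap_eq_of_germ hS (convex_ball 0 ρ).isPreconnected
      (fun q hq => hP.isFlatMapAt hq) (fun q _ => (hD _).comp_rigid p 0 L)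
      (Metric.mem_ball_self hP.pos) hL (Ξ x) hx'
    rw [hP.right_inv x hx] at h1
    refine ⟨_, ?_, h1.symm⟩
    rw [mem_ball_zero_iff] at hx'
    refine (norm_add_le _ _).trans_lt ?_
    rw [L.norm_map, sub_zero]
    linarith

variable [FiniteDimensional ℝ E₂] [I₂.Boundaryless] [IsManifold I₂ ∞ S]

omit [FiniteDimensional ℝ E₂] [I₂.Boundaryless] [IsManifold I₂ ∞ S] in
set_option synthInstance.maxHeartbeats 200000 in
/-- A compact flat surface is tangent to the vertical field: otherwise, by the differential
equation of the vertical form, the integral of a recurrent positive function over large squares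
would be bounded by a multiple of their perimeter. -/
theorem EktLike.norm_vertForm_eq_one (K : EktLike I κ τ g ξ) (hk : κ - 4 * τ ^ 2 ≠ 0)
    [T2Space S] [CompactSpace S] [PreconnectedSpace S] (hΦ : IsSmoothImmersion I₂ I Φ)
    (hS : ∀ x : S, ∃ ρ P Ξ O, IsFlatParam I₂ (pullMetric I I₂ g Φ) x ρ P Ξ O)
    (hD : ∀ q, IsFlatMapAt I₂ (pullMetric I I₂ g Φ) D q) (z₀ : ℂ) :
    ‖vertForm I g ξ (Φ ∘ D) z₀‖ = 1 := by
  have hDs : ∀ q, ContMDiffAt 𝓘(ℝ, ℂ) I₂ ∞ D q := fun q => (hD q).self_of_nhds.1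
  have hF : ∀ q, ContMDiffAt 𝓘(ℝ, ℂ) I ∞ (Φ ∘ D) q := fun q => (hΦ.1 _).comp q (hDs q)
  have hi : ∀ q u v, indMetric I g (Φ ∘ D) q u v = inner ℝ u v := fun q u v => by
    rw [← indMetric_pullMetric ((hΦ.1 _).mdifferentiableAt (by simp))
      ((hDs q).mdifferentiableAt (by simp)), (hD q).self_of_nhds.2]
  set η := vertForm I g ξ (Φ ∘ D) with hη
  have hηs : ContDiff ℝ ∞ η := K.contDiff_vertForm hF
  have hj := K.jacobian_vertForm hF hi
  by_contra hne
  obtain ⟨R, hR⟩ := exists_radius hS hD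
  -- invariance under the rigid motions which preserve `D`
  have hinv : ∀ (a b : ℂ) (L : ℂ ≃ₗᵢ[ℝ] ℂ), (∀ q, D q = D (a + L (q - b))) → ∀ q,
      ‖η q‖ = ‖η (a + L (q - b))‖ ∧ ∀ u, ‖fderiv ℝ η q u‖ ≤ ‖fderiv ℝ η (a + L (q - b))‖ * ‖u‖ := by
    intro a b L hL q
    have h1 : ∀ q, η q = (η (a + L (q - b))).comp (L.toContinuousLinearEquiv : ℂ →L[ℝ] ℂ) := by
      intro q
      rw [← vertForm_comp_rigid hF a b L q]
      have : Φ ∘ D = fun q => (Φ ∘ D) (a + L (q - b)) := by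
        ext q; exact congrArg Φ (hL q)
      rw [← this]
    refine ⟨by rw [h1 q, norm_comp_rigid], fun u => ?_⟩
    have hA' : HasFDerivAt (fun q : ℂ => a + L (q - b)) (L.toContinuousLinearEquiv : ℂ →L[ℝ] ℂ)
      q := ((L.toContinuousLinearEquiv.hasFDerivAt.comp q
        ((hasFDerivAt_id q).sub_const b)).const_add a)
    have h2 := ((hηs.differentiable (by simp)) (a + L (q - b))).hasFDerivAt.comp q hA'
    have h3 := h2.clm_comp (hasFDerivAt_const (L.toContinuousLinearEquiv : ℂ →L[ℝ] ℂ) q)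
    have h4 : fderiv ℝ η q u = (fderiv ℝ η (a + L (q - b)) (L u)).comp
        (L.toContinuousLinearEquiv : ℂ →L[ℝ] ℂ) := by
      have h5 : HasFDerivAt η _ q := h3.congr_of_eventuallyEq (Filter.Eventually.of_forall h1)
      rw [h5.fderiv]
      ext v
      simp
    rw [h4, norm_comp_rigid, ← L.norm_map u]
    exact ContinuousLinearMap.le_opNorm _ _
  have hc1 : Continuous (fderiv ℝ η) := hηs.continuous_fderiv (by simp)
  obtain ⟨M, hM⟩ := (isCompact_closedBall (0 : ℂ) R).exists_bound_of_continuousOn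
    ((continuous_norm (E := ℂ →L[ℝ] ℂ →L[ℝ] ℝ)).comp hc1).continuousOn
  have hM' : ∀ z u, ‖fderiv ℝ η z u‖ ≤ M * ‖u‖ := by
    intro z u
    obtain ⟨q, hq, hqz⟩ := hR (D z)
    obtain ⟨L, hL⟩ := exists_rigid_of_eq hS hD hqz.symm
    refine ((hinv q z L hL z).2 u).trans ?_
    rw [sub_self, map_zero, add_zero]
    gcongr
    exact (le_abs_self _).trans (hM q (by simpa using hq.le))
  have sA : ∀ u, ContDiff ℝ 2 fun z => η z u := fun u =>
    ((hηs.of_le ENat.LEInfty.out).clm_apply contDiff_const)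
  have dA : ∀ u z v, fderiv ℝ (fun z => η z u) z v = fderiv ℝ η z v u := by
    intro u z v
    rw [((hηs.differentiable (by simp)) z).hasFDerivAt.clm_apply (hasFDerivAt_const u z)
      |>.fderiv]
    simp
  have bA : ∀ z (L : ℂ →L[ℝ] ℝ) (u : ℂ), ‖u‖ = 1 → ‖L‖ ≤ z → |L u| ≤ z := by
    intro z L u hu hL
    have := L.le_opNorm u
    rw [hu, mul_one] at this
    exact this.trans hL
  have hM1 : ∀ z (v : ℂ), ‖v‖ = 1 → |fderiv ℝ η z v Complex.I| ≤ M := fun z v hv => by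
    have h1 := hM' z v
    rw [hv, mul_one] at h1
    exact bA _ _ _ (by simp) h1
  have hpos : 0 < (1 - ‖η z₀‖ ^ 2) ^ 2 := by
    have h1 := (hj z₀).1
    have : ‖η z₀‖ < 1 := lt_of_le_of_ne h1 hne
    have : 0 < 1 - ‖η z₀‖ ^ 2 := by nlinarith [norm_nonneg (η z₀)]
    positivity
  have hqc : Continuous fun z => (1 - ‖η z‖ ^ 2) ^ 2 := by
    have := hηs.continuous
    fun_prop
  obtain ⟨ρ, hρ, hρ'⟩ := Metric.eventually_nhds_iff_ball.1
    (hqc.continuousAt.eventually (lt_mem_nhds (half_lt_self hpos)))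
  refine not_recurrent_of_jacobian (sA 1) (sA Complex.I) (M := M)
    (fun z => bA _ _ _ (by simp) (hj z).1)
    (fun z => by
      rw [dA, dA]
      exact ⟨hM1 z 1 (by simp), hM1 z Complex.I (by simp)⟩)
    hqc (fun z => by positivity) (neg_ne_zero.2 hk) (fun z => by
      rw [dA, dA, dA, dA]
      exact (hj z).2.1) (d := ‖z₀‖ + |R| + 1) (by positivity) hρ (half_pos hpos) ?_
  intro p
  obtain ⟨p₀, hp₀, hpp⟩ := hR (D p)
  obtain ⟨L, hL⟩ := exists_rigid_of_eq hS hD hpp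
  refine ⟨p + L (z₀ - p₀), ?_, fun y hy => ?_⟩
  · rw [mem_ball_iff_norm, add_sub_cancel_left, L.norm_map]
    have := norm_sub_le z₀ p₀
    have := le_abs_self R
    linarith
  · have hy' : y = p + L ((p₀ + L.symm (y - p)) - p₀) := by simp
    rw [hy', ← (hinv p p₀ L hL _).1]
    refine (hρ' _ ?_).le
    rw [mem_ball_iff_norm] at hy ⊢
    rw [← L.norm_map]
    convert hy using 2
    simp
    ring

omit [FiniteDimensional ℝ E₂] [I₂.Boundaryless] [IsManifold I₂ ∞ S] in
/-- A compact flat surface is developed on the plane in such a way that the imaginary axis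
corresponds to the vertical field. -/
theorem EktLike.exists_vertical_developing_map (K : EktLike I κ τ g ξ) (hk : κ - 4 * τ ^ 2 ≠ 0)
    [T2Space S] [CompactSpace S] [ConnectedSpace S] (hΦ : IsSmoothImmersion I₂ I Φ)
    (hS : ∀ x : S, ∃ ρ P Ξ O, IsFlatParam I₂ (pullMetric I I₂ g Φ) x ρ P Ξ O) :
    ∃ D : ℂ → S, (∀ q, IsFlatMapAt I₂ (pullMetric I I₂ g Φ) D q) ∧
      ∀ q, modelDeriv 𝓘(ℝ, ℂ) I (Φ ∘ D) q Complex.I = ξ (Φ (D q)) := by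
  obtain ⟨D, -, hD⟩ := exists_developing_map hS (Classical.arbitrary S)
  have hFD : ∀ {D : ℂ → S}, (∀ q, IsFlatMapAt I₂ (pullMetric I I₂ g Φ) D q) →
      (∀ q, ContMDiffAt 𝓘(ℝ, ℂ) I ∞ (Φ ∘ D) q) ∧
      ∀ q u v, indMetric I g (Φ ∘ D) q u v = inner ℝ u v := by
    intro D hD
    have hDs : ∀ q, ContMDiffAt 𝓘(ℝ, ℂ) I₂ ∞ D q := fun q => (hD q).self_of_nhds.1
    refine ⟨fun q => (hΦ.1 _).comp q (hDs q), fun q u v => ?_⟩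
    rw [← indMetric_pullMetric ((hΦ.1 _).mdifferentiableAt (by simp))
      ((hDs q).mdifferentiableAt (by simp)), (hD q).self_of_nhds.2]
  obtain ⟨hF, hi⟩ := hFD hD
  set η := vertForm I g ξ (Φ ∘ D) with hη
  have h1 := K.norm_vertForm_eq_one hk hΦ hS hD
  have hconst : ∀ z, η z = η 0 := fun z =>
    is_const_of_fderiv_eq_zero ((K.contDiff_vertForm hF).differentiable (by simp))
      (fun z => (K.jacobian_vertForm hF hi z).2.2 (h1 z)) z 0
  obtain ⟨w, hw⟩ := (InnerProductSpace.toDual ℝ ℂ).surjective (η 0)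
  have hw1 : ‖w‖ = 1 := by
    rw [← LinearIsometryEquiv.norm_map (InnerProductSpace.toDual ℝ ℂ), hw, h1]
  -- the rotation that takes `i` to the dual vector of the vertical form
  let r : Circle := ⟨w * (-Complex.I), mem_sphere_zero_iff_norm.2 (by simp [hw1])⟩
  have hr : rotation r Complex.I = w := by
    rw [rotation_apply]
    change w * (-Complex.I) * Complex.I = w
    linear_combination (-w) * Complex.I_mul_I
  refine ⟨fun q => D (0 + rotation r (q - 0)), fun q => (hD _).comp_rigid _ _ _, fun q => ?_⟩
  have hD' : ∀ q, IsFlatMapAt I₂ (pullMetric I I₂ g Φ) (fun q => D (0 + rotation r (q - 0))) q :=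
    fun q => (hD _).comp_rigid _ _ _
  refine K.eq_of_unit ?_ ?_
  · have := (hFD hD').2 q Complex.I Complex.I
    rw [indMetric_apply] at this
    exact this.trans (by simp)
  · have h2 := vertForm_comp_rigid (g := g) (ξ := ξ) hF 0 0 (rotation r) q
    have h3 := congrArg (fun L : ℂ →L[ℝ] ℝ => L Complex.I) h2
    refine h3.trans ?_
    change η _ (rotation r Complex.I) = 1
    rw [hr, hconst, ← hw, InnerProductSpace.toDual_apply_apply, real_inner_self_eq_norm_sq, hw1]
    norm_num

/-- If some function increases along the vertical field, there are no compact flat surfaces. -/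
theorem EktLike.noFlatCompactSurface_of_monotone (K : EktLike I κ τ g ξ)
    (hk : κ - 4 * τ ^ 2 ≠ 0) {f : N → ℝ} (hf : ContMDiff I 𝓘(ℝ, ℝ) ∞ f)
    (hfξ : ∀ x, modelDeriv I 𝓘(ℝ, ℝ) f x (ξ x) ≠ 0)
    [T2Space S] [CompactSpace S] [ConnectedSpace S] (hE : Module.finrank ℝ E₂ = 2)
    (hΦ : IsSmoothImmersion I₂ I Φ) (hflat : IsFlatSurface (I := I) I₂ g Φ) : False := by
  obtain ⟨D, hD, hv⟩ := K.exists_vertical_developing_map hk hΦ (K.exists_flatParam hE hΦ hflat)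
  have hsurj := surjective_of_isFlatMapAt (K.exists_flatParam hE hΦ hflat) hD
  obtain ⟨x, -, hx⟩ := isCompact_univ.exists_isMaxOn univ_nonempty
    (hf.continuous.comp hΦ.1.continuous).continuousOn
  obtain ⟨q, rfl⟩ := hsurj x
  have hs : ContMDiffAt 𝓘(ℝ, ℂ) I ∞ (Φ ∘ D) q := (hΦ.1 _).comp q (hD q).self_of_nhds.1
  have hmax : IsLocalMax (f ∘ (Φ ∘ D)) q :=
    Filter.Eventually.of_forall fun z => hx (mem_univ (D z))
  have h1 := hmax.fderiv_eq_zero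
  rw [← modelDeriv_eq_fderiv, modelDeriv_comp ((hf _).mdifferentiableAt (by simp))
    (hs.mdifferentiableAt (by simp))] at h1
  have h2 := congrArg (fun L : ℂ →L[ℝ] ℝ => L Complex.I) h1
  simp only [ContinuousLinearMap.comp_apply, hv] at h2
  exact hfξ _ h2

end Vertical

/-! ### The fibration -/

section InverseFunction

variable {E : Type*} [NormedAddCommGroup E] [NormedSpace ℝ E] [CompleteSpace E]
  {F : Type*} [NormedAddCommGroup F] [NormedSpace ℝ F]

/-- The inverse function theorem, with an inverse that is smooth on its domain. -/
theorem exists_smooth_local_inverse {f : E → F} {U : Set E} (hU : IsOpen U)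
    (hf : ContDiffOn ℝ ∞ f U) {y : E} (hy : y ∈ U) (hinv : (fderiv ℝ f y).IsInvertible) :
    ∃ e : OpenPartialHomeomorph E F, (∀ z, e z = f z) ∧ y ∈ e.source ∧ e.source ⊆ U ∧
      ∀ z ∈ e.target, ContDiffAt ℝ ∞ e.symm z := by
  have hfs : ∀ z ∈ U, ContDiffAt ℝ ∞ f z := fun z hz => hf.contDiffAt (hU.mem_nhds hz)
  have hdc : ContinuousOn (fderiv ℝ f) U := hf.continuousOn_fderiv_of_isOpen hU (by simp)
  obtain ⟨e₀, he₀⟩ := hinv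
  have hV : IsOpen (U ∩ fderiv ℝ f ⁻¹' range ((↑) : (E ≃L[ℝ] F) → E →L[ℝ] F)) :=
    hdc.isOpen_inter_preimage hU ContinuousLinearEquiv.isOpen
  set V := U ∩ fderiv ℝ f ⁻¹' range ((↑) : (E ≃L[ℝ] F) → E →L[ℝ] F) with hVdef
  have hyV : y ∈ V := ⟨hy, e₀, he₀⟩
  have hd0 : HasFDerivAt f (e₀ : E →L[ℝ] F) y := by
    rw [he₀]; exact ((hfs _ hy).differentiableAt (by simp)).hasFDerivAt
  set e := ((hfs _ hy).toOpenPartialHomeomorph f hd0 (by simp)).restrOpen V hV with he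
  have hes : e.source ⊆ V := by
    rw [he, OpenPartialHomeomorph.restrOpen_source]; exact inter_subset_right
  refine ⟨e, fun _ => rfl, ?_, hes.trans inter_subset_left, fun z hz => ?_⟩
  · rw [he, OpenPartialHomeomorph.restrOpen_source]
    exact ⟨(hfs _ hy).mem_toOpenPartialHomeomorph_source hd0 (by simp), hyV⟩
  · have hz' := hes (e.map_target hz)
    obtain ⟨e', he'⟩ := hz'.2
    refine e.contDiffAt_symm hz (f₀' := e') ?_ (hfs _ hz'.1)
    rw [he']
    exact ((hfs _ hz'.1).differentiableAt (by simp)).hasFDerivAt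

end InverseFunction

section Fibration

variable {E : Type*} [NormedAddCommGroup E] [NormedSpace ℝ E]
  {H : Type*} [TopologicalSpace H] {I : ModelWithCorners ℝ E H}
  {N : Type*} [TopologicalSpace N] [ChartedSpace H N]
  {E' : Type*} [NormedAddCommGroup E'] [NormedSpace ℝ E']
  {H' : Type*} [TopologicalSpace H'] {J : ModelWithCorners ℝ E' H'}
  {B : Type*} [TopologicalSpace B] [ChartedSpace H' B]
  {κ τ : ℝ} {g : N → E →L[ℝ] E →L[ℝ] ℝ} {ξ : N → E} {Pr : N → B}

/-- What the classification uses of the fibration of `E(κ, τ)`. The base is allowed to be a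
surface in a larger manifold `B`; it has local coordinates which extend to `B`. -/
structure EktFibration (I : ModelWithCorners ℝ E H) (J : ModelWithCorners ℝ E' H') (κ τ : ℝ)
    (g : N → E →L[ℝ] E →L[ℝ] ℝ) (ξ : N → E) (Pr : N → B) : Prop extends EktLike I κ τ g ξ where
  dim : Module.finrank ℝ E = 3
  smooth_proj : ContMDiff I J ∞ Pr
  vertical : ∀ x, modelDeriv I J Pr x (ξ x) = 0
  fibre_connected : ∀ x, IsPreconnected (Pr ⁻¹' {Pr x})
  base_coordinates : ∀ x, ∃ (ζ : B → ℂ) (O : Set B), IsOpen O ∧ Pr x ∈ O ∧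
    ContMDiffOn J 𝓘(ℝ, ℂ) ∞ ζ O ∧ InjOn ζ (O ∩ range Pr) ∧
    Function.Surjective (modelDeriv I 𝓘(ℝ, ℂ) (ζ ∘ Pr) x)

theorem EktLike.ne_zero (K : EktLike I κ τ g ξ) (x : N) : ξ x ≠ 0 := by
  intro h
  have := K.unit x
  rw [h] at this
  simp at this

theorem EktFibration.finiteDimensional (K : EktFibration I J κ τ g ξ Pr) :
    FiniteDimensional ℝ E :=
  FiniteDimensional.of_finrank_pos (by rw [K.dim]; norm_num)

theorem EktFibration.ker_of_coordinates (K : EktFibration I J κ τ g ξ Pr) {x : N} {ζ : B → ℂ}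
    {O : Set B} (hO : IsOpen O) (hx : Pr x ∈ O) (hζ : ContMDiffOn J 𝓘(ℝ, ℂ) ∞ ζ O)
    (hs : Function.Surjective (modelDeriv I 𝓘(ℝ, ℂ) (ζ ∘ Pr) x)) {v : E}
    (hv : modelDeriv I 𝓘(ℝ, ℂ) (ζ ∘ Pr) x v = 0) : ∃ c : ℝ, v = c • ξ x := by
  have := K.finiteDimensional
  have hξ : modelDeriv I 𝓘(ℝ, ℂ) (ζ ∘ Pr) x (ξ x) = 0 := by
    rw [modelDeriv_comp ((hζ.contMDiffAt (hO.mem_nhds hx)).mdifferentiableAt (by simp))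
      ((K.smooth_proj x).mdifferentiableAt (by simp)), ContinuousLinearMap.comp_apply,
      K.vertical, map_zero]
  set L : E →ₗ[ℝ] ℂ := (modelDeriv I 𝓘(ℝ, ℂ) (ζ ∘ Pr) x).toLinearMap
  have h1 := L.finrank_range_add_finrank_ker
  rw [LinearMap.range_eq_top.2 hs, finrank_top, Complex.finrank_real_complex, K.dim] at h1
  have h2 : Module.finrank ℝ (LinearMap.ker L) = 1 := by omega
  have h3 : (⟨ξ x, hξ⟩ : LinearMap.ker L) ≠ 0 := fun h => K.ne_zero x (congrArg Subtype.val h)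
  obtain ⟨c, hc⟩ := (finrank_eq_one_iff_of_nonzero' _ h3).1 h2 ⟨v, hv⟩
  exact ⟨c, (congrArg Subtype.val hc).symm⟩

/-- The vertical field spans the kernel of the projection. -/
theorem EktFibration.ker (K : EktFibration I J κ τ g ξ Pr) {x : N} {v : E}
    (hv : modelDeriv I J Pr x v = 0) : ∃ c : ℝ, v = c • ξ x := by
  obtain ⟨ζ, O, hO, hx, hζ, -, hs⟩ := K.base_coordinates x
  refine K.ker_of_coordinates hO hx hζ hs ?_
  rw [modelDeriv_comp ((hζ.contMDiffAt (hO.mem_nhds hx)).mdifferentiableAt (by simp))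
      ((K.smooth_proj x).mdifferentiableAt (by simp)), ContinuousLinearMap.comp_apply,
      hv, map_zero]

/-- Local coordinates `(ζ ∘ Pr, T)` on `A`, adapted to the fibration, with inverse `Y`. -/
structure IsFibreChart (I : ModelWithCorners ℝ E H) (J : ModelWithCorners ℝ E' H') (Pr : N → B)
    (ζ : B → ℂ) (O : Set B) (T : N → ℝ) (Y : ℂ × ℝ → N) (A : Set N) (V : Set (ℂ × ℝ)) : Prop where
  isOpen_base : IsOpen O
  smooth_base : ContMDiffOn J 𝓘(ℝ, ℂ) ∞ ζ O
  injOn_base : InjOn ζ (O ∩ range Pr)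
  isOpen : IsOpen A
  isOpen_target : IsOpen V
  proj_mem : ∀ x ∈ A, Pr x ∈ O
  smooth : ∀ x ∈ A, ContMDiffAt I 𝓘(ℝ, ℝ) ∞ T x
  map_mem : ∀ x ∈ A, (ζ (Pr x), T x) ∈ V
  left_inv : ∀ x ∈ A, Y (ζ (Pr x), T x) = x
  smooth_inv : ∀ w ∈ V, ContMDiffAt 𝓘(ℝ, ℂ × ℝ) I ∞ Y w
  inv_mem : ∀ w ∈ V, Y w ∈ A
  proj_inv : ∀ w ∈ V, ζ (Pr (Y w)) = w.1
  height_inv : ∀ w ∈ V, T (Y w) = w.2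

theorem EktFibration.exists_fibreChart [I.Boundaryless] [IsManifold I ∞ N]
    (K : EktFibration I J κ τ g ξ Pr) (q : N) :
    ∃ ζ O T Y A V, IsFibreChart I J Pr ζ O T Y A V ∧ q ∈ A ∧
      modelDeriv I 𝓘(ℝ, ℝ) T q (ξ q) ≠ 0 := by
  have := K.finiteDimensional
  have : CompleteSpace E := FiniteDimensional.complete ℝ E
  obtain ⟨ζ, O, hO, hq, hζ, hζi, hs⟩ := K.base_coordinates q
  set φ := extChartAt I q with hφ
  have hqs : q ∈ φ.source := mem_extChartAt_source q
  have hyt : φ q ∈ φ.target := φ.map_source hqs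
  have hto : IsOpen φ.target := isOpen_extChartAt_target q
  have hφs : ∀ {x}, x ∈ φ.source → ContMDiffAt I 𝓘(ℝ, E) ∞ φ x := contMDiffAt_extChartAt_of_mem
  have hφs' : ∀ {y}, y ∈ φ.target → ContMDiffAt 𝓘(ℝ, E) I ∞ φ.symm y :=
    contMDiffAt_extChartAt_symm
  have hid : ∀ v, modelDeriv I 𝓘(ℝ, E) φ q (modelDeriv 𝓘(ℝ, E) I φ.symm (φ q) v) = v := by
    intro v
    have h1 := modelDeriv_comp (I := 𝓘(ℝ, E)) (x := φ q) (I₁ := I) (F := φ.symm) (f := φ)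
      (I₂ := 𝓘(ℝ, E)) ((hφs (φ.map_target hyt)).mdifferentiableAt (by simp))
      ((hφs' hyt).mdifferentiableAt (by simp))
    have h2 : (φ ∘ φ.symm) =ᶠ[𝓝 (φ q)] fun y => y := by
      filter_upwards [hto.mem_nhds hyt] with z hz using φ.right_inv hz
    rw [modelDeriv_congr h2, modelDeriv_id, φ.left_inv hqs] at h1
    exact (congrArg (fun L : E →L[ℝ] E => L v) h1).symm
  have hsurj : Function.Surjective (modelDeriv 𝓘(ℝ, E) I φ.symm (φ q)) :=
    LinearMap.surjective_of_injective (f := (modelDeriv 𝓘(ℝ, E) I φ.symm (φ q)).toLinearMap)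
      (Function.LeftInverse.injective hid)
  have hne : modelDeriv I 𝓘(ℝ, E) φ q (ξ q) ≠ 0 := by
    obtain ⟨v, hv⟩ := hsurj (ξ q)
    rw [← hv, hid]
    rintro rfl
    exact K.ne_zero q (by rw [← hv, map_zero])
  obtain ⟨l, -, hl⟩ := exists_dual_vector ℝ _ (norm_ne_zero_iff.2 hne)
  have hl : l (modelDeriv I 𝓘(ℝ, E) φ q (ξ q)) ≠ 0 := by
    rw [hl]; simpa using hne
  set T : N → ℝ := fun x => l (φ x) with hT
  have hTs : ∀ x ∈ φ.source, ContMDiffAt I 𝓘(ℝ, ℝ) ∞ T x := fun x hx =>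
    ContMDiffAt.comp x l.contDiff.contMDiff.contMDiffAt (hφs hx)
  have hTd : ∀ v, modelDeriv I 𝓘(ℝ, ℝ) T q v = l (modelDeriv I 𝓘(ℝ, E) φ q v) := by
    intro v
    have h1 := modelDeriv_comp (I := I) (I₁ := 𝓘(ℝ, E)) (I₂ := 𝓘(ℝ, ℝ)) (x := q) (F := φ)
      (f := l) l.differentiableAt.mdifferentiableAt ((hφs hqs).mdifferentiableAt (by simp))
    rw [modelDeriv_eq_fderiv, l.fderiv] at h1
    exact congrArg (fun L : E →L[ℝ] ℝ => L v) h1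
  set U : Set E := φ.target ∩ φ.symm ⁻¹' (Pr ⁻¹' O) with hU
  have hUo : IsOpen U := by
    have h1 : ContinuousOn (Pr ∘ φ.symm) φ.target :=
      K.smooth_proj.continuous.comp_continuousOn (continuousOn_extChartAt_symm q)
    exact h1.isOpen_inter_preimage hto hO
  have hqU : φ q ∈ U := ⟨hyt, by
    change Pr (φ.symm (φ q)) ∈ O
    rwa [φ.left_inv hqs]⟩
  set P : N → ℂ := ζ ∘ Pr with hP
  have hPs : ∀ x, Pr x ∈ O → ContMDiffAt I 𝓘(ℝ, ℂ) ∞ P x := fun x hx =>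
    (hζ.contMDiffAt (hO.mem_nhds hx)).comp x (K.smooth_proj x)
  set f : E → ℂ × ℝ := fun y => (P (φ.symm y), l y) with hf
  have hPφ : ∀ y ∈ U, ContDiffAt ℝ ∞ (fun y => P (φ.symm y)) y := fun y hy =>
    ((hPs _ hy.2).comp y (hφs' hy.1)).contDiffAt
  have hfs : ContDiffOn ℝ ∞ f U := fun y hy =>
    ((hPφ y hy).prodMk l.contDiff.contDiffAt).contDiffWithinAt
  have hfd : ∀ v, fderiv ℝ f (φ q) v
      = (modelDeriv I 𝓘(ℝ, ℂ) P q (modelDeriv 𝓘(ℝ, E) I φ.symm (φ q) v), l v) := by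
    intro v
    have h1 := modelDeriv_comp_coord (I := 𝓘(ℝ, ℂ)) (F := fun y => P (φ.symm y)) (f := id)
      (y := φ q) ((hPφ _ hqU).differentiableAt (by simp)).mdifferentiableAt differentiableAt_id
    have h2 := modelDeriv_comp (I := 𝓘(ℝ, E)) (I₁ := I) (I₂ := 𝓘(ℝ, ℂ)) (x := φ q) (F := φ.symm)
      (f := P) ((hPs _ hqU.2).mdifferentiableAt (by simp)) ((hφs' hyt).mdifferentiableAt (by simp))
    rw [modelDeriv_eq_fderiv, φ.left_inv hqs] at h2
    have h3 := (((hPφ _ hqU).differentiableAt (by simp)).hasFDerivAt.prodMk l.hasFDerivAt)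
    rw [h3.fderiv]
    have h4 : fderiv ℝ (fun y => P (φ.symm y)) (φ q) = _ := h2
    rw [h4]
    rfl
  have hinv : (fderiv ℝ f (φ q)).IsInvertible := by
    refine isInvertible_of_injective ?_ ?_
    · rw [K.dim, Module.finrank_prod, Complex.finrank_real_complex, Module.finrank_self]
    · rw [injective_iff_map_eq_zero]
      intro v hv
      rw [hfd] at hv
      obtain ⟨h1, h2⟩ := Prod.ext_iff.1 hv
      obtain ⟨c, hc⟩ := K.ker_of_coordinates hO hq hζ hs h1
      have h3 : l v = c * l (modelDeriv I 𝓘(ℝ, E) φ q (ξ q)) := by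
        rw [← hid v, hc, map_smul, map_smul, smul_eq_mul]
      have h4 : c = 0 := by
        have : c * l (modelDeriv I 𝓘(ℝ, E) φ q (ξ q)) = 0 := by rw [← h3]; exact h2
        exact (mul_eq_zero.1 this).resolve_right hl
      rw [← hid v, hc, h4, zero_smul, map_zero]
  obtain ⟨e, hef, hqe, hes, hesymm⟩ := exists_smooth_local_inverse hUo hfs hqU hinv
  have hAV : ∀ x ∈ φ.source ∩ φ ⁻¹' e.source, e (φ x) = (P x, T x) := by
    intro x hx
    rw [hef]
    simp only [hf, φ.left_inv hx.1, hT]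
  have hVt : ∀ w ∈ e.target, e.symm w ∈ φ.target := fun w hw => (hes (e.map_target hw)).1
  have hinvmem : ∀ w ∈ e.target, φ.symm (e.symm w) ∈ φ.source ∩ φ ⁻¹' e.source := by
    intro w hw
    refine ⟨φ.map_target (hVt w hw), ?_⟩
    rw [mem_preimage, φ.right_inv (hVt w hw)]
    exact e.map_target hw
  have hval : ∀ w ∈ e.target, (P (φ.symm (e.symm w)), T (φ.symm (e.symm w))) = w := by
    intro w hw
    rw [← hAV _ (hinvmem w hw), φ.right_inv (hVt w hw), e.right_inv hw]
  refine ⟨ζ, O, T, fun w => φ.symm (e.symm w), φ.source ∩ φ ⁻¹' e.source, e.target,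
    ⟨hO, hζ, hζi, isOpen_extChartAt_preimage' q e.open_source, e.open_target, ?_,
      fun x hx => hTs x hx.1, ?_, ?_, ?_, hinvmem, fun w hw => (Prod.ext_iff.1 (hval w hw)).1,
      fun w hw => (Prod.ext_iff.1 (hval w hw)).2⟩, ⟨hqs, hqe⟩, by rw [hTd]; exact hl⟩
  · intro x hx
    have := (hes hx.2).2
    rwa [mem_preimage, φ.left_inv hx.1] at this
  · intro x hx
    have := e.map_source hx.2
    rwa [hAV x hx] at this
  · intro x hx
    change φ.symm (e.symm (P x, T x)) = x
    rw [← hAV x hx, e.left_inv hx.2, φ.left_inv hx.1]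
  · intro w hw
    exact ContMDiffAt.comp w (hφs' (hVt w hw)) (hesymm w hw).contMDiffAt

theorem IsFibreChart.injOn {ζ : B → ℂ} {O : Set B} {T : N → ℝ} {Y : ℂ × ℝ → N} {A : Set N}
    {V : Set (ℂ × ℝ)} (h : IsFibreChart I J Pr ζ O T Y A V) {x x' : N} (hx : x ∈ A) (hx' : x' ∈ A)
    (h1 : Pr x = Pr x') (h2 : T x = T x') : x = x' := by
  rw [← h.left_inv x hx, ← h.left_inv x' hx', h1, h2]

variable [I.Boundaryless] [IsManifold I ∞ N]

/-- Near a point, the fibre is the trajectory of the vertical field. -/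
theorem EktFibration.fibre_eq_trajectory (K : EktFibration I J κ τ g ξ Pr) {c : ℝ → N}
    (hc : ∀ t, ContMDiffAt 𝓘(ℝ, ℝ) I ∞ c t) (hcξ : ∀ t, modelDeriv 𝓘(ℝ, ℝ) I c t 1 = ξ (c t))
    (hcP : ∀ t, Pr (c t) = Pr (c 0)) (t₀ : ℝ) {δ : ℝ} (hδ : 0 < δ) :
    ∀ᶠ x in 𝓝 (c t₀), Pr x = Pr (c t₀) → ∃ t, |t - t₀| < δ ∧ c t = x := by
  obtain ⟨ζ, O, T, Y, A, V, hA, hq, hT⟩ := K.exists_fibreChart (c t₀)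
  have hTc : ContDiffAt ℝ ∞ (fun t => T (c t)) t₀ :=
    ((hA.smooth _ hq).comp t₀ (hc t₀)).contDiffAt
  have hd : deriv (fun t => T (c t)) t₀ ≠ 0 := by
    have h1 := modelDeriv_comp (I := 𝓘(ℝ, ℝ)) (I₁ := I) (I₂ := 𝓘(ℝ, ℝ)) (F := c) (f := T)
      ((hA.smooth _ hq).mdifferentiableAt (by simp)) ((hc t₀).mdifferentiableAt (by simp))
    rw [modelDeriv_eq_fderiv] at h1
    have h2 := congrArg (fun L : ℝ →L[ℝ] ℝ => L 1) h1
    simp only [ContinuousLinearMap.comp_apply, hcξ] at h2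
    have h3 : deriv (fun t => T (c t)) t₀ = _ := h2
    rw [h3]
    exact hT
  have hst := hTc.hasStrictDerivAt (by simp)
  have hmap := hst.map_nhds_eq hd
  have hs : c ⁻¹' A ∩ {t | |t - t₀| < δ} ∈ 𝓝 t₀ := Filter.inter_mem
    ((hc t₀).continuousAt.preimage_mem_nhds (hA.isOpen.mem_nhds hq))
    (Metric.ball_mem_nhds t₀ hδ)
  have h4 : (fun t => T (c t)) '' (c ⁻¹' A ∩ {t | |t - t₀| < δ}) ∈ 𝓝 (T (c t₀)) := by
    rw [← hmap]
    exact Filter.image_mem_map hs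
  filter_upwards [hA.isOpen.mem_nhds hq, (hA.smooth _ hq).continuousAt.preimage_mem_nhds h4]
    with x hx ⟨t, ⟨ht, htδ⟩, htx⟩ hPx
  exact ⟨t, htδ, hA.injOn ht hx (by rw [hPx, hcP, ← hcP t₀]) htx⟩

/-- A closed trajectory of the vertical field is the whole fibre. -/
theorem EktFibration.range_eq_fibre [T2Space N] (K : EktFibration I J κ τ g ξ Pr) {c : ℝ → N}
    (hc : ∀ t, ContMDiffAt 𝓘(ℝ, ℝ) I ∞ c t) (hcξ : ∀ t, modelDeriv 𝓘(ℝ, ℝ) I c t 1 = ξ (c t))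
    (hcP : ∀ t, Pr (c t) = Pr (c 0)) {l : ℝ} (hl : 0 < l) (hper : Function.Periodic c l) :
    range c = Pr ⁻¹' {Pr (c 0)} := by
  refine Subset.antisymm (range_subset_iff.2 hcP) ?_
  have hcc : Continuous c := continuous_iff_continuousAt.2 fun t => (hc t).continuousAt
  have hcl : IsClosed (range c) := by
    rw [← hper.image_Icc hl 0]
    exact (isCompact_Icc.image hcc).isClosed
  have hopen : ∀ t, c t ∈ interior {x | Pr x = Pr (c 0) → x ∈ range c} := fun t => by
    refine mem_interior_iff_mem_nhds.2 ?_
    filter_upwards [K.fibre_eq_trajectory hc hcξ hcP t one_pos] with x hx hx'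
    obtain ⟨t, -, ht⟩ := hx (by rw [hx', hcP t])
    exact ⟨t, ht⟩
  intro x hx
  by_contra hne
  obtain ⟨y, hy, hy', hy''⟩ := K.fibre_connected (c 0) _ _ isOpen_interior hcl.isOpen_compl
    (fun y _ => by
      by_cases h : y ∈ range c
      · obtain ⟨t, rfl⟩ := h
        exact Or.inl (hopen t)
      · exact Or.inr h) ⟨c 0, rfl, hopen 0⟩ ⟨x, hx, hne⟩
  exact hy'' (interior_subset hy' hy)

end Fibration

/-! ### Tori as quotients of the plane -/

section Circles

/-- The branch of the angle on the circle which takes the value `α` at `exp (i α)`. -/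
def angleAt (α : ℝ) (s : Circle) : ℝ := α + Complex.arg ((s * (Circle.exp α)⁻¹ : Circle) : ℂ)

theorem exp_angleAt (α : ℝ) (s : Circle) : Circle.exp (angleAt α s) = s := by
  rw [angleAt, Circle.exp_add, Circle.exp_arg, mul_comm, inv_mul_cancel_right]

theorem angleAt_exp (α : ℝ) : angleAt α (Circle.exp α) = α := by
  simp [angleAt]

theorem angleAt_exp_eventually (α : ℝ) : ∀ᶠ θ in 𝓝 α, angleAt α (Circle.exp θ) = θ := by
  filter_upwards [Ioo_mem_nhds (show α - Real.pi < α by linarith [Real.pi_pos])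
    (show α < α + Real.pi by linarith [Real.pi_pos])] with θ hθ
  rw [angleAt, ← Circle.exp_neg, ← Circle.exp_add,
    Circle.arg_exp (by linarith [hθ.1]) (by linarith [hθ.2])]
  ring

theorem contMDiff_coe_circle : ContMDiff (𝓡 1) 𝓘(ℝ, ℂ) ∞ fun s : Circle => (s : ℂ) := by
  have : Fact (Module.finrank ℝ ℂ = 1 + 1) := ⟨Complex.finrank_real_complex⟩
  exact contMDiff_coe_sphere (E := ℂ) (n := 1)

theorem contMDiffAt_angleAt_of_mem {α : ℝ} {s : Circle}
    (hs : (s : ℂ) * ((Circle.exp α)⁻¹ : Circle) ∈ Complex.slitPlane) :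
    ContMDiffAt (𝓡 1) 𝓘(ℝ, ℝ) ∞ (angleAt α) s := by
  have h1 : ContDiffAt ℝ ∞ (fun z : ℂ => α + (Complex.log (z * ((Circle.exp α)⁻¹ : Circle))).im)
      (s : ℂ) := by
    have : ContDiffAt ℂ ∞ Complex.log (s * ((Circle.exp α)⁻¹ : Circle)) :=
      Complex.contDiffAt_log hs
    have h2 : ContDiffAt ℝ ∞ (fun z : ℂ => Complex.log (z * ((Circle.exp α)⁻¹ : Circle)))
        (s : ℂ) :=
      ContDiffAt.comp (g := Complex.log) (f := fun z : ℂ => z * ((Circle.exp α)⁻¹ : Circle)) _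
        (this.restrict_scalars ℝ) (contDiffAt_id.mul contDiffAt_const)
    exact contDiffAt_const.add (Complex.imCLM.contDiff.contDiffAt.comp _ h2)
  have h3 := ContMDiffAt.comp s h1.contMDiffAt (contMDiff_coe_circle _)
  refine h3.congr_of_eventuallyEq (.of_forall fun s' => ?_)
  simp only [angleAt, Complex.log_im, Circle.coe_mul]
  rfl

theorem exp_mem_slit (α : ℝ) :
    (Circle.exp α : ℂ) * ((Circle.exp α)⁻¹ : Circle) ∈ Complex.slitPlane := by
  rw [← Circle.coe_mul, mul_inv_cancel, Circle.coe_one]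
  simp

theorem contMDiffAt_angleAt (α : ℝ) :
    ContMDiffAt (𝓡 1) 𝓘(ℝ, ℝ) ∞ (angleAt α) (Circle.exp α) :=
  contMDiffAt_angleAt_of_mem (exp_mem_slit α)

variable {E : Type*} [NormedAddCommGroup E] [NormedSpace ℝ E]
  {H : Type*} [TopologicalSpace H] {I : ModelWithCorners ℝ E H}
  {X : Type*} [TopologicalSpace X] [ChartedSpace H X]

/-- The map from the torus which a doubly periodic map of the plane induces. The linear map `e`
takes the lattice generated by `(2π, 0)` and `(0, 2π)` to the lattice of periods. -/
def torusMap (D : ℂ → X) (e : (ℝ × ℝ) ≃L[ℝ] ℂ) (st : Circle × Circle) : X :=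
  D (e (Complex.arg st.1, Complex.arg st.2))

/-- The coordinates on the torus near the image of `(α, β)`. -/
def torusAngles (α β : ℝ) (st : Circle × Circle) : ℝ × ℝ := (angleAt α st.1, angleAt β st.2)

/-- The map from the plane onto the torus. -/
def torusExp (p : ℝ × ℝ) : Circle × Circle := (Circle.exp p.1, Circle.exp p.2)

theorem contMDiffAt_torusAngles (α β : ℝ) : ContMDiffAt ((𝓡 1).prod (𝓡 1)) 𝓘(ℝ, ℝ × ℝ) ∞
    (torusAngles α β) (torusExp (α, β)) :=
  ((contMDiffAt_angleAt α).comp (torusExp (α, β)) contMDiffAt_fst).prodMk_space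
    ((contMDiffAt_angleAt β).comp (torusExp (α, β)) contMDiffAt_snd)

theorem contMDiff_torusExp : ContMDiff 𝓘(ℝ, ℝ × ℝ) ((𝓡 1).prod (𝓡 1)) ∞ torusExp :=
  (contMDiff_circleExp.comp contDiff_fst.contMDiff).prodMk
    (contMDiff_circleExp.comp contDiff_snd.contMDiff)

theorem torusExp_torusAngles (α β : ℝ) (st : Circle × Circle) :
    torusExp (torusAngles α β st) = st := by
  simp [torusExp, torusAngles, exp_angleAt]

theorem torusAngles_torusExp (α β : ℝ) : torusAngles α β (torusExp (α, β)) = (α, β) := by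
  simp [torusExp, torusAngles, angleAt_exp]

theorem torusExp_arg (st : Circle × Circle) :
    torusExp (Complex.arg st.1, Complex.arg st.2) = st := by
  simp [torusExp, Circle.exp_arg]

theorem torusExp_eq_iff {p q : ℝ × ℝ} : torusExp p = torusExp q ↔
    ∃ m n : ℤ, p = q + (m * (2 * Real.pi), n * (2 * Real.pi)) := by
  simp only [torusExp, Prod.ext_iff, Circle.exp_eq_exp, Prod.fst_add, Prod.snd_add]
  exact ⟨fun ⟨⟨m, hm⟩, ⟨n, hn⟩⟩ => ⟨m, n, hm, hn⟩, fun ⟨m, n, hm, hn⟩ => ⟨⟨m, hm⟩, ⟨n, hn⟩⟩⟩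

variable {D : ℂ → X} {e : (ℝ × ℝ) ≃L[ℝ] ℂ}

omit [TopologicalSpace X] in
theorem torusMap_torusExp
    (hp : ∀ (z : ℂ) (m n : ℤ), D (z + e (m * (2 * Real.pi), n * (2 * Real.pi))) = D z)
    (p : ℝ × ℝ) : torusMap D e (torusExp p) = D (e p) := by
  obtain ⟨m, n, h⟩ := torusExp_eq_iff.1 (torusExp_arg (torusExp p))
  rw [torusMap, h, map_add, hp]

omit [TopologicalSpace X] in
theorem torusMap_eq_comp
    (hp : ∀ (z : ℂ) (m n : ℤ), D (z + e (m * (2 * Real.pi), n * (2 * Real.pi))) = D z) (α β : ℝ) :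
    torusMap D e = D ∘ (e ∘ torusAngles α β) := by
  ext st
  conv_lhs => rw [← torusExp_torusAngles α β st]
  exact torusMap_torusExp hp _

theorem contMDiff_torusMap
    (hp : ∀ (z : ℂ) (m n : ℤ), D (z + e (m * (2 * Real.pi), n * (2 * Real.pi))) = D z)
    (hD : ∀ z, ContMDiffAt 𝓘(ℝ, ℂ) I ∞ D z) :
    ContMDiff ((𝓡 1).prod (𝓡 1)) I ∞ (torusMap D e) := by
  intro st
  rw [← torusExp_arg st, torusMap_eq_comp hp (Complex.arg st.1) (Complex.arg st.2)]
  exact (hD _).comp _ (ContMDiffAt.comp _ e.contDiff.contMDiff.contMDiffAt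
    (contMDiffAt_torusAngles _ _))

/-- The derivative of the map from the torus is that of the map from the plane, in the coordinates
of the plane. -/
theorem modelDeriv_torusMap
    (hp : ∀ (z : ℂ) (m n : ℤ), D (z + e (m * (2 * Real.pi), n * (2 * Real.pi))) = D z)
    (hD : ∀ z, ContMDiffAt 𝓘(ℝ, ℂ) I ∞ D z) (p : ℝ × ℝ) :
    ∃ M : EuclideanSpace ℝ (Fin 1) × EuclideanSpace ℝ (Fin 1) →L[ℝ] ℂ, Function.Bijective M ∧
      modelDeriv ((𝓡 1).prod (𝓡 1)) I (torusMap D e) (torusExp p)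
        = (modelDeriv 𝓘(ℝ, ℂ) I D (e p)).comp M := by
  obtain ⟨α, β⟩ := p
  have h1 : ContMDiffAt ((𝓡 1).prod (𝓡 1)) 𝓘(ℝ, ℂ) ∞ (e ∘ torusAngles α β) (torusExp (α, β)) :=
    ContMDiffAt.comp _ e.contDiff.contMDiff.contMDiffAt (contMDiffAt_torusAngles _ _)
  have h2 := modelDeriv_comp (I := (𝓡 1).prod (𝓡 1)) (I₁ := 𝓘(ℝ, ℂ)) (I₂ := I)
    (x := torusExp (α, β)) (F := e ∘ torusAngles α β) (f := D)
    ((hD _).mdifferentiableAt (by simp)) (h1.mdifferentiableAt (by simp))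
  rw [← torusMap_eq_comp hp] at h2
  have h3 : (e ∘ torusAngles α β) (torusExp (α, β)) = e (α, β) := by
    rw [Function.comp_apply, torusAngles_torusExp]
  rw [h3] at h2
  refine ⟨_, ?_, h2⟩
  -- `torusExp ∘ e⁻¹` is a left inverse
  have h4 : ContMDiffAt 𝓘(ℝ, ℂ) ((𝓡 1).prod (𝓡 1)) ∞ (torusExp ∘ e.symm)
      ((e ∘ torusAngles α β) (torusExp (α, β))) :=
    ContMDiffAt.comp _ contMDiff_torusExp.contMDiffAt e.symm.contDiff.contMDiff.contMDiffAt
  have h5 := modelDeriv_comp (I := (𝓡 1).prod (𝓡 1)) (I₁ := 𝓘(ℝ, ℂ)) (I₂ := (𝓡 1).prod (𝓡 1))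
    (x := torusExp (α, β)) (F := e ∘ torusAngles α β) (f := torusExp ∘ e.symm)
    (h4.mdifferentiableAt (by simp)) (h1.mdifferentiableAt (by simp))
  have h6 : (torusExp ∘ e.symm) ∘ e ∘ torusAngles α β = fun st => st := by
    ext st : 1
    simp [torusExp_torusAngles]
  rw [h6, modelDeriv_id] at h5
  have hinj : Function.Injective
      (modelDeriv ((𝓡 1).prod (𝓡 1)) 𝓘(ℝ, ℂ) (e ∘ torusAngles α β) (torusExp (α, β))) := by
    intro u v huv
    have h7 := congrArg (fun L => L u) h5
    have h8 := congrArg (fun L => L v) h5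
    simp only [ContinuousLinearMap.comp_apply, ContinuousLinearMap.id_apply] at h7 h8
    rw [h7, h8, huv]
  refine ⟨hinj, ?_⟩
  have hfin : Module.finrank ℝ (EuclideanSpace ℝ (Fin 1) × EuclideanSpace ℝ (Fin 1))
      = Module.finrank ℝ ℂ := by
    simp [Module.finrank_prod, Complex.finrank_real_complex]
  exact (LinearMap.injective_iff_surjective_of_finrank_eq_finrank (f :=
    (modelDeriv ((𝓡 1).prod (𝓡 1)) 𝓘(ℝ, ℂ) (e ∘ torusAngles α β) (torusExp (α, β))).toLinearMap)
    hfin).1 hinj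

/-- The quotient of the plane by a lattice is a torus. -/
theorem exists_torus_diffeomorph
    (hp : ∀ (z : ℂ) (m n : ℤ), D (z + e (m * (2 * Real.pi), n * (2 * Real.pi))) = D z)
    (hD : ∀ z, ContMDiffAt 𝓘(ℝ, ℂ) I ∞ D z) (hs : Function.Surjective D)
    (hinj : ∀ z z', D z = D z' → ∃ m n : ℤ, z = z' + e (m * (2 * Real.pi), n * (2 * Real.pi)))
    (hloc : ∀ z, ∃ Λ : X → ℂ, ContMDiffAt I 𝓘(ℝ, ℂ) ∞ Λ (D z) ∧ ∀ᶠ x in 𝓝 (D z), D (Λ x) = x) :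
    ∃ ψ : Diffeomorph ((𝓡 1).prod (𝓡 1)) I (Circle × Circle) X ∞, ∀ st, ψ st = torusMap D e st := by
  have hbij : Function.Bijective (torusMap D e) := by
    constructor
    · intro st st' h
      rw [torusMap, torusMap] at h
      obtain ⟨m, n, h1⟩ := hinj _ _ h
      rw [← map_add] at h1
      rw [← torusExp_arg st, ← torusExp_arg st']
      exact torusExp_eq_iff.2 ⟨m, n, e.injective h1⟩
    · intro x
      obtain ⟨z, rfl⟩ := hs x
      refine ⟨torusExp (e.symm z), ?_⟩
      rw [torusMap_torusExp hp, e.apply_symm_apply]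
  refine ⟨⟨Equiv.ofBijective _ hbij, contMDiff_torusMap hp hD, fun x => ?_⟩, fun st => rfl⟩
  obtain ⟨z, rfl⟩ := hs x
  obtain ⟨Λ, h1, h2⟩ := hloc z
  have h3 : ContMDiffAt I ((𝓡 1).prod (𝓡 1)) ∞ (torusExp ∘ (e.symm ∘ Λ)) (D z) :=
    contMDiff_torusExp.contMDiffAt.comp _ (ContMDiffAt.comp _ e.symm.contDiff.contMDiff.contMDiffAt
      h1)
  refine h3.congr_of_eventuallyEq ?_
  filter_upwards [h2] with x hx
  rw [Equiv.symm_apply_eq]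
  change x = torusMap D e (torusExp (e.symm (Λ x)))
  rw [torusMap_torusExp hp, e.apply_symm_apply, hx]

/-- The linear map which takes `(2π, 0)` to `L + i b` and `(0, 2π)` to `i l`. -/
def latticeEquiv (L b l : ℝ) (hL : L ≠ 0) (hl : l ≠ 0) : (ℝ × ℝ) ≃L[ℝ] ℂ :=
  LinearEquiv.toContinuousLinearEquiv
    { toFun := fun p => ⟨p.1 / (2 * Real.pi) * L,
        p.1 / (2 * Real.pi) * b + p.2 / (2 * Real.pi) * l⟩
      map_add' := fun p q => by apply Complex.ext <;> simp <;> ring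
      map_smul' := fun c p => by apply Complex.ext <;> simp <;> ring
      invFun := fun z => (z.re / L * (2 * Real.pi), (z.im - z.re / L * b) / l * (2 * Real.pi))
      left_inv := fun p => by
        have := Real.pi_ne_zero
        ext <;> simp <;> field_simp
        ring
      right_inv := fun z => by
        have := Real.pi_ne_zero
        apply Complex.ext <;> simp <;> field_simp
        ring }

theorem latticeEquiv_apply {L b l : ℝ} (hL : L ≠ 0) (hl : l ≠ 0) (p : ℝ × ℝ) :
    latticeEquiv L b l hL hl p = ⟨p.1 / (2 * Real.pi) * L,
      p.1 / (2 * Real.pi) * b + p.2 / (2 * Real.pi) * l⟩ := rfl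

theorem latticeEquiv_apply_add {L b l : ℝ} (hL : L ≠ 0) (hl : l ≠ 0) (α β : ℝ) :
    latticeEquiv L b l hL hl (α, β)
      = latticeEquiv L b l hL hl (α, 0) + (β / (2 * Real.pi) * l : ℝ) * Complex.I := by
  rw [latticeEquiv_apply, latticeEquiv_apply]
  generalize (β / (2 * Real.pi) : ℝ) = x
  apply Complex.ext <;> simp

theorem latticeEquiv_int {L b l : ℝ} (hL : L ≠ 0) (hl : l ≠ 0) (m n : ℤ) :
    latticeEquiv L b l hL hl (m * (2 * Real.pi), n * (2 * Real.pi)) = ⟨m * L, m * b + n * l⟩ := by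
  rw [latticeEquiv_apply]
  apply Complex.ext <;> simp

/-- A curve with vanishing derivative is constant. -/
theorem eq_of_modelDeriv_eq_zero [IsManifold I ∞ X] {c : ℝ → X}
    (hc : ∀ t, ContMDiffAt 𝓘(ℝ, ℝ) I ∞ c t) (h0 : ∀ t, modelDeriv 𝓘(ℝ, ℝ) I c t = 0) (t t' : ℝ) :
    c t = c t' := by
  have hl : IsLocallyConstant c := by
    rw [IsLocallyConstant.iff_eventually_eq]
    intro t₀
    set φ := extChartAt I (c t₀) with hφ
    have hs : c t₀ ∈ φ.source := mem_extChartAt_source _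
    have hev := (hc t₀).continuousAt.preimage_mem_nhds
      ((isOpen_extChartAt_source (I := I) (c t₀)).mem_nhds hs)
    obtain ⟨r, hr, hball⟩ := Metric.eventually_nhds_iff_ball.1 hev
    have hφc : ∀ t ∈ Metric.ball t₀ r, ContMDiffAt I 𝓘(ℝ, E) ∞ φ (c t) := fun t ht =>
      contMDiffAt_extChartAt_of_mem (hball t ht)
    have hd : ∀ t ∈ Metric.ball t₀ r, HasFDerivAt (φ ∘ c) (0 : ℝ →L[ℝ] E) t := by
      intro t ht
      have h1 : ContDiffAt ℝ ∞ (φ ∘ c) t := ((hφc t ht).comp t (hc t)).contDiffAt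
      have h2 := (h1.differentiableAt (by simp)).hasFDerivAt
      rwa [← modelDeriv_eq_fderiv, modelDeriv_comp ((hφc t ht).mdifferentiableAt (by simp))
        ((hc t).mdifferentiableAt (by simp)), h0, ContinuousLinearMap.comp_zero] at h2
    filter_upwards [Metric.ball_mem_nhds t₀ hr] with t ht
    have h3 := (convex_ball t₀ r).is_const_of_fderivWithin_eq_zero (𝕜 := ℝ)
      (fun t ht => (hd t ht).differentiableAt.differentiableWithinAt)
      (fun t ht => by rw [fderivWithin_of_isOpen Metric.isOpen_ball ht, (hd t ht).fderiv]) ht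
      (Metric.mem_ball_self hr)
    exact φ.injOn (hball t ht) hs h3
  exact hl.apply_eq_of_preconnectedSpace t t'

end Circles

/-! ### Flat compact surfaces are Hopf tori -/

section Lattice

/-- A cocompact group of translations of the plane whose real parts are not dense, and which has
no small imaginary elements, is a lattice. -/
theorem exists_lattice (Γ : AddSubgroup ℂ) {R ε : ℝ} (hR : ∀ z : ℂ, ∃ v ∈ Γ, ‖z - v‖ < R)
    (hre : ¬ Dense (Complex.re '' (Γ : Set ℂ))) (hε : 0 < ε)
    (him : ∀ t : ℝ, |t| < ε → (⟨0, t⟩ : ℂ) ∈ Γ → t = 0) :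
    ∃ L b l : ℝ, L ≠ 0 ∧ 0 < l ∧
      ∀ v, v ∈ Γ ↔ ∃ m n : ℤ, v = ⟨m * L, m * b + n * l⟩ := by
  have hR0 : 0 < R := by
    obtain ⟨v, -, h⟩ := hR 0
    exact (norm_nonneg _).trans_lt h
  set G₁ : AddSubgroup ℝ := Γ.map Complex.reAddGroupHom with hG₁
  have hcyc : ∃ L : ℝ, G₁ = AddSubgroup.closure {L} := by
    refine (AddSubgroup.dense_or_cyclic G₁).resolve_left fun h => hre ?_
    convert! h using 1
  obtain ⟨L, hL⟩ := hcyc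
  have hmem₁ : ∀ v ∈ Γ, ∃ k : ℤ, v.re = k * L := by
    intro v hv
    have : v.re ∈ G₁ := ⟨v, hv, rfl⟩
    rw [hL, AddSubgroup.mem_closure_singleton] at this
    obtain ⟨k, hk⟩ := this
    exact ⟨k, by rw [← hk, zsmul_eq_mul]⟩
  have hL0 : L ≠ 0 := by
    rintro rfl
    obtain ⟨v, hv, h⟩ := hR R
    obtain ⟨k, hk⟩ := hmem₁ v hv
    have h1 := (Complex.abs_re_le_norm _).trans_lt h
    rw [Complex.sub_re, hk, mul_zero, sub_zero, Complex.ofReal_re, abs_of_pos hR0] at h1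
    exact lt_irrefl _ h1
  obtain ⟨v₁, hv₁, hv₁L⟩ : ∃ v ∈ Γ, v.re = L := by
    have : L ∈ G₁ := by rw [hL]; exact AddSubgroup.mem_closure_singleton_self L
    exact this
  set G₂ : AddSubgroup ℝ := Γ.comap
    { toFun := fun t => (⟨0, t⟩ : ℂ), map_zero' := rfl,
      map_add' := fun s t => by apply Complex.ext <;> simp } with hG₂
  have hmemG₂ : ∀ t : ℝ, t ∈ G₂ ↔ (⟨0, t⟩ : ℂ) ∈ Γ := fun t => Iff.rfl
  have hcyc₂ : ∃ l : ℝ, G₂ = AddSubgroup.closure {l} := by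
    refine (AddSubgroup.dense_or_cyclic G₂).resolve_left fun h => ?_
    obtain ⟨t, ht, ht'⟩ := h.exists_mem_open isOpen_Ioo (nonempty_Ioo.2 hε)
    exact ht'.1.ne' (him t (abs_lt.2 ⟨by linarith [ht'.1], ht'.2⟩) ht)
  obtain ⟨l, hl⟩ := hcyc₂
  have hsub : ∀ v ∈ Γ, ∀ k : ℤ, v.re = k * L → v.im - k * v₁.im ∈ G₂ := by
    intro v hv k hk
    rw [hmemG₂]
    convert! Γ.sub_mem hv (Γ.zsmul_mem hv₁ k) using 1
    apply Complex.ext <;> simp [hk, hv₁L]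
  have hl0 : l ≠ 0 := by
    rintro rfl
    have hzero : ∀ t ∈ G₂, t = 0 := by
      intro t ht
      rw [hl, AddSubgroup.mem_closure_singleton] at ht
      obtain ⟨k, hk⟩ := ht
      rw [← hk, smul_zero]
    obtain ⟨v, hv, h⟩ := hR ⟨0, R + R / |L| * |v₁.im|⟩
    obtain ⟨k, hk⟩ := hmem₁ v hv
    have h1 := (Complex.abs_re_le_norm _).trans_lt h
    have h2 := (Complex.abs_im_le_norm _).trans_lt h
    have h3 := hzero _ (hsub v hv k hk)
    rw [Complex.sub_re, hk, zero_sub, abs_neg, abs_mul] at h1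
    rw [Complex.sub_im] at h2
    have h4 : |(k : ℝ)| < R / |L| := (lt_div_iff₀ (abs_pos.2 hL0)).2 h1
    have h5 : v.im ≤ R / |L| * |v₁.im| := by
      rw [sub_eq_zero.1 h3]
      calc (k : ℝ) * v₁.im ≤ |(k : ℝ) * v₁.im| := le_abs_self _
        _ = |(k : ℝ)| * |v₁.im| := abs_mul _ _
        _ ≤ _ := by gcongr
    have h6 := (le_abs_self _).trans_lt h2
    simp only at h6
    linarith
  refine ⟨L, v₁.im, |l|, hL0, abs_pos.2 hl0, fun v => ⟨fun hv => ?_, ?_⟩⟩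
  · obtain ⟨k, hk⟩ := hmem₁ v hv
    have h1 := hsub v hv k hk
    rw [hl, AddSubgroup.mem_closure_singleton] at h1
    obtain ⟨n, hn⟩ := h1
    rw [zsmul_eq_mul] at hn
    rcases abs_choice l with h | h
    · exact ⟨k, n, Complex.ext hk (by simp only [h]; linarith)⟩
    · exact ⟨k, -n, Complex.ext hk (by simp only [h]; push_cast; linarith)⟩
  · rintro ⟨m, n, rfl⟩
    have h1 : |l| ∈ G₂ := by
      have h2 : l ∈ G₂ := by rw [hl]; exact AddSubgroup.mem_closure_singleton_self l
      rcases abs_choice l with h | h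
      · rwa [h]
      · rw [h]; exact G₂.neg_mem h2
    convert! Γ.add_mem (Γ.zsmul_mem hv₁ m) (Γ.zsmul_mem ((hmemG₂ _).1 h1) n) using 1
    apply Complex.ext <;> simp [hv₁L]

end Lattice

section HopfTorus

variable {E : Type*} [NormedAddCommGroup E] [NormedSpace ℝ E]
  {H : Type*} [TopologicalSpace H] {I : ModelWithCorners ℝ E H} [I.Boundaryless]
  {N : Type*} [TopologicalSpace N] [ChartedSpace H N] [IsManifold I ∞ N]
  {E' : Type*} [NormedAddCommGroup E'] [NormedSpace ℝ E']
  {H' : Type*} [TopologicalSpace H'] {J : ModelWithCorners ℝ E' H'}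
  {B : Type*} [TopologicalSpace B] [ChartedSpace H' B]
  {E₂ : Type*} [NormedAddCommGroup E₂] [NormedSpace ℝ E₂] [FiniteDimensional ℝ E₂]
  {H₂ : Type*} [TopologicalSpace H₂] {I₂ : ModelWithCorners ℝ E₂ H₂} [I₂.Boundaryless]
  {S : Type*} [TopologicalSpace S] [ChartedSpace H₂ S] [IsManifold I₂ ∞ S]
  {κ τ : ℝ} {g : N → E →L[ℝ] E →L[ℝ] ℝ} {ξ : N → E} {Pr : N → B}
  {Φ : S → N} {D : ℂ → S}

omit [FiniteDimensional ℝ E₂] [I₂.Boundaryless] [IsManifold I₂ ∞ S] in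
/-- The developing map is transported along with a flat parametrization, which inverts it. -/
theorem exists_local_inverse_flatMap {G : S → E₂ →L[ℝ] E₂ →L[ℝ] ℝ}
    (hS : ∀ x : S, ∃ ρ P Ξ O, IsFlatParam I₂ G x ρ P Ξ O) (hD : ∀ q, IsFlatMapAt I₂ G D q) (z : ℂ) :
    ∃ Λ : S → ℂ, ContMDiffAt I₂ 𝓘(ℝ, ℂ) ∞ Λ (D z) ∧ ∀ᶠ x in 𝓝 (D z), D (Λ x) = x := by
  obtain ⟨ρ, P, Ξ, O, hP⟩ := hS (D z)
  obtain ⟨L, hL⟩ := exists_rigid_of_isFlatMapAt hS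
    (hP.isFlatMapAt (Metric.mem_ball_self hP.pos)) (hD z) hP.map_zero
  have hΞ := hP.smooth_inv _ hP.mem
  have hΞ0 : Ξ (D z) = 0 := by
    rw [← hP.map_zero, hP.left_inv 0 (Metric.mem_ball_self hP.pos)]
  refine ⟨fun x => z + L (Ξ x), ?_, ?_⟩
  · have h1 : ContDiff ℝ ∞ fun w : ℂ => z + L w := contDiff_const.add L.contDiff
    exact ContMDiffAt.comp (g := fun w : ℂ => z + L w) (D z) h1.contMDiff.contMDiffAt hΞ
  · have h1 : ∀ᶠ x in 𝓝 (D z), P (Ξ x) = D (z + L (Ξ x - 0)) := by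
      have h2 := hΞ.continuousAt.tendsto
      rw [hΞ0] at h2
      exact h2.eventually hL
    filter_upwards [h1, hP.isOpen.mem_nhds hP.mem] with x hx hxO
    rw [sub_zero] at hx
    rw [← hx, hP.right_inv x hxO]

omit [I.Boundaryless] [IsManifold I ∞ N] in
theorem injective_modelDeriv_of_isometric (g : N → E →L[ℝ] E →L[ℝ] ℝ) {F : ℂ → N} {q : ℂ}
    (h : ∀ u v, indMetric I g F q u v = inner ℝ u v) :
    Function.Injective (modelDeriv 𝓘(ℝ, ℂ) I F q) := by
  rw [injective_iff_map_eq_zero]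
  intro v hv
  have h1 := h v v
  rw [indMetric_apply, hv, map_zero, real_inner_self_eq_norm_sq] at h1
  simpa using h1.symm

omit [I.Boundaryless] [IsManifold I ∞ N] in
theorem EktFibration.modelDeriv_proj_one (K : EktFibration I J κ τ g ξ Pr) {F : ℂ → N} {q : ℂ}
    (hi : Function.Injective (modelDeriv 𝓘(ℝ, ℂ) I F q)) (hF : ContMDiffAt 𝓘(ℝ, ℂ) I ∞ F q)
    (hv : modelDeriv 𝓘(ℝ, ℂ) I F q Complex.I = ξ (F q)) :
    modelDeriv 𝓘(ℝ, ℂ) J (Pr ∘ F) q Complex.I = 0 ∧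
      ∀ x : ℂ, modelDeriv 𝓘(ℝ, ℂ) J (Pr ∘ F) q x = 0 → x.re = 0 := by
  have h1 := modelDeriv_comp (I := 𝓘(ℝ, ℂ)) (I₁ := I) (I₂ := J) (x := q) (F := F) (f := Pr)
    ((K.smooth_proj _).mdifferentiableAt (by simp)) (hF.mdifferentiableAt (by simp))
  constructor
  · rw [h1, ContinuousLinearMap.comp_apply, hv, K.vertical]
  · intro x h
    rw [h1, ContinuousLinearMap.comp_apply] at h
    obtain ⟨c, hc⟩ := K.ker h
    rw [← hv, ← map_smul] at hc
    rw [hi hc]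
    simp

omit [I.Boundaryless] [IsManifold I ∞ N] in
/-- The vertical lines of the developing map stay in the fibres. -/
theorem EktFibration.proj_add_im (K : EktFibration I J κ τ g ξ Pr) [IsManifold J ∞ B] {F : ℂ → N}
    (hF : ∀ q, ContMDiffAt 𝓘(ℝ, ℂ) I ∞ F q)
    (hv : ∀ q, modelDeriv 𝓘(ℝ, ℂ) I F q Complex.I = ξ (F q)) (z : ℂ) (t : ℝ) :
    Pr (F (z + t * Complex.I)) = Pr (F z) := by
  have hA : ContDiff ℝ ∞ fun t : ℝ => z + t * Complex.I :=
    contDiff_const.add (Complex.ofRealCLM.contDiff.mul contDiff_const)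
  have hA' : ∀ t : ℝ, fderiv ℝ (fun t : ℝ => z + t * Complex.I) t 1 = Complex.I := by
    intro t
    have : HasFDerivAt (fun t : ℝ => z + t * Complex.I)
        ((Complex.ofRealCLM).smulRight Complex.I) t :=
      ((Complex.ofRealCLM.smulRight Complex.I).hasFDerivAt).const_add z
    rw [this.fderiv]
    simp
  have hQ : ∀ q, ContMDiffAt 𝓘(ℝ, ℂ) J ∞ (Pr ∘ F) q := fun q => (K.smooth_proj _).comp q (hF q)
  have := eq_of_modelDeriv_eq_zero (I := J) (c := fun t : ℝ => (Pr ∘ F) (z + t * Complex.I))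
    (fun t => ContMDiffAt.comp (g := Pr ∘ F) (f := fun t : ℝ => z + t * Complex.I) t (hQ _)
      hA.contMDiff.contMDiffAt) (fun t => by
      have h1 := modelDeriv_comp_coord (I := J) (F := Pr ∘ F) (f := fun t : ℝ => z + t * Complex.I)
        (y := t) ((hQ _).mdifferentiableAt (by simp)) (hA.contDiffAt.differentiableAt (by simp))
      refine h1.trans ?_
      ext
      rw [ContinuousLinearMap.comp_apply, hA',
        modelDeriv_comp ((K.smooth_proj _).mdifferentiableAt (by simp))
          ((hF _).mdifferentiableAt (by simp)), ContinuousLinearMap.comp_apply, hv, K.vertical]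
      rfl) t 0
  simpa using this

/-- The closed vertical lines of the developing map cover the fibres. -/
theorem EktFibration.range_vertical_circle (K : EktFibration I J κ τ g ξ Pr) [IsManifold J ∞ B]
    [T2Space N] {F : ℂ → N} (hF : ∀ q, ContMDiffAt 𝓘(ℝ, ℂ) I ∞ F q)
    (hv : ∀ q, modelDeriv 𝓘(ℝ, ℂ) I F q Complex.I = ξ (F q)) {l : ℝ} (hl : 0 < l)
    (hper : ∀ z, F (z + l * Complex.I) = F z) (z₀ : ℂ) :
    range (fun t : Circle => F (z₀ + (Complex.arg t / (2 * Real.pi) * l : ℝ) * Complex.I))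
      = Pr ⁻¹' {Pr (F z₀)} := by
  set c : ℝ → N := F ∘ fun t : ℝ => z₀ + t * Complex.I with hc
  have hA : ContDiff ℝ ∞ fun t : ℝ => z₀ + t * Complex.I :=
    contDiff_const.add (Complex.ofRealCLM.contDiff.mul contDiff_const)
  have hA' : ∀ t : ℝ, HasFDerivAt (fun t : ℝ => z₀ + t * Complex.I)
      (Complex.ofRealCLM.smulRight Complex.I) t := fun t =>
    ((Complex.ofRealCLM.smulRight Complex.I).hasFDerivAt).const_add _
  have hcper : Function.Periodic c l := fun t => by
    have h1 := hper (z₀ + t * Complex.I)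
    rw [add_assoc, ← add_mul, ← Complex.ofReal_add] at h1
    exact h1
  have hc0 : c 0 = F z₀ := by simp [hc]
  rw [← hc0, ← K.range_eq_fibre (c := c)
    (fun t => ContMDiffAt.comp t (hF _) hA.contMDiff.contMDiffAt)
    (fun t => by
      rw [modelDeriv_comp_coord ((hF _).mdifferentiableAt (by simp)) (hA' t).differentiableAt,
        (hA' t).fderiv, ContinuousLinearMap.comp_apply, ContinuousLinearMap.smulRight_apply,
        Complex.ofRealCLM_apply, Complex.ofReal_one, one_smul, hv]
      rfl)
    (fun t => by
      rw [hc0]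
      exact K.proj_add_im hF hv z₀ t) hl hcper]
  refine Subset.antisymm (range_subset_iff.2 fun t => ⟨_, rfl⟩) (range_subset_iff.2 fun t => ?_)
  obtain ⟨m, hm⟩ := Circle.exp_eq_exp.1 (Circle.exp_arg (Circle.exp (t / l * (2 * Real.pi))))
  refine ⟨Circle.exp (t / l * (2 * Real.pi)), ?_⟩
  change c _ = c t
  have h1 := hl.ne'
  have h2 := Real.pi_ne_zero
  rw [hm, show (t / l * (2 * Real.pi) + m * (2 * Real.pi)) / (2 * Real.pi) * l = t + m * l by
    field_simp]
  exact hcper.int_mul m t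

omit [FiniteDimensional ℝ E₂] [I₂.Boundaryless] [IsManifold I₂ ∞ S] [I.Boundaryless]
  [IsManifold I ∞ N] in
/-- The rigid motions preserved by a vertical developing map are translations. -/
theorem EktFibration.translation_of_eq (K : EktFibration I J κ τ g ξ Pr) [IsManifold J ∞ B]
    [T2Space S]
    (hΦ : IsSmoothImmersion I₂ I Φ)
    (hS : ∀ x : S, ∃ ρ P Ξ O, IsFlatParam I₂ (pullMetric I I₂ g Φ) x ρ P Ξ O)
    (hD : ∀ q, IsFlatMapAt I₂ (pullMetric I I₂ g Φ) D q)
    (hv : ∀ q, modelDeriv 𝓘(ℝ, ℂ) I (Φ ∘ D) q Complex.I = ξ (Φ (D q)))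
    {p p' : ℂ} (h : D p = D p') (z : ℂ) : D (z + (p' - p)) = D z := by
  have hDs : ∀ q, ContMDiffAt 𝓘(ℝ, ℂ) I₂ ∞ D q := fun q => (hD q).self_of_nhds.1
  have hF : ∀ q, ContMDiffAt 𝓘(ℝ, ℂ) I ∞ (Φ ∘ D) q := fun q => (hΦ.1 _).comp q (hDs q)
  have hFi : ∀ q, Function.Injective (modelDeriv 𝓘(ℝ, ℂ) I (Φ ∘ D) q) := fun q =>
    injective_modelDeriv_of_isometric g fun u v => by
      rw [← indMetric_pullMetric ((hΦ.1 _).mdifferentiableAt (by simp))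
        ((hDs q).mdifferentiableAt (by simp))]
      exact (hD q).self_of_nhds.2 u v
  obtain ⟨L, hL⟩ := exists_rigid_of_eq hS hD h
  have hA' : ∀ q, HasFDerivAt (fun q : ℂ => p' + L (q - p)) (L.toContinuousLinearEquiv : ℂ →L[ℝ] ℂ)
      q := fun q => ((L.toContinuousLinearEquiv.hasFDerivAt.comp q
        ((hasFDerivAt_id q).sub_const p)).const_add p')
  have hFe : Φ ∘ D = (Φ ∘ D) ∘ fun q => p' + L (q - p) := by
    ext q; exact congrArg Φ (hL q)
  have hFd : ∀ q u, modelDeriv 𝓘(ℝ, ℂ) I (Φ ∘ D) q u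
      = modelDeriv 𝓘(ℝ, ℂ) I (Φ ∘ D) (p' + L (q - p)) (L u) := by
    intro q u
    have h1 := modelDeriv_comp_coord (I := I) (F := Φ ∘ D) (f := fun q => p' + L (q - p))
      (y := q) ((hF _).mdifferentiableAt (by simp)) (hA' q).differentiableAt
    rw [(hA' q).fderiv, ← hFe] at h1
    exact congrArg (fun M : ℂ →L[ℝ] E => M u) h1
  have hLI : L Complex.I = Complex.I := by
    refine hFi (p' + L (p - p)) ?_
    rw [← hFd, hv, hv, ← hL]
  have hL1im : (L 1).im = 0 := by
    have h1 := L.inner_map_map 1 Complex.I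
    rw [hLI] at h1
    simpa [Complex.inner] using h1
  have hL1re : (L 1).re = 1 ∨ (L 1).re = -1 := by
    have h1 := L.norm_map 1
    rw [← Complex.abs_re_eq_norm.2 hL1im, norm_one] at h1
    exact (abs_eq zero_le_one).1 h1
  have hLz : ∀ u : ℂ, L u = u.re * (L 1).re + u.im * Complex.I := by
    intro u
    have h1 : u = u.re • (1 : ℂ) + u.im • Complex.I := by
      apply Complex.ext <;> simp
    conv_lhs => rw [h1]
    rw [map_add, map_smul, map_smul, hLI]
    apply Complex.ext <;> simp [hL1im]
  rcases hL1re with h1 | h1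
  · rw [hL z, hLz, h1]
    congr 1
    apply Complex.ext <;> simp <;> ring
  · exfalso
    set q : ℂ := (((p.re + p'.re) / 2 : ℝ) : ℂ) with hq
    set s : ℝ := p'.im - p.im with hs
    have hAq : p' + L (q - p) = q + s * Complex.I := by
      rw [hLz, h1]
      apply Complex.ext <;> simp [hq, hs] <;> ring
    have hQs : ∀ q, ContMDiffAt 𝓘(ℝ, ℂ) J ∞ (Pr ∘ (Φ ∘ D)) q := fun q =>
      (K.smooth_proj _).comp q (hF q)
    have hQd : ∀ u, modelDeriv 𝓘(ℝ, ℂ) J (Pr ∘ (Φ ∘ D)) q u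
        = modelDeriv 𝓘(ℝ, ℂ) J (Pr ∘ (Φ ∘ D)) (q + s * Complex.I) u := by
      intro u
      have h2 : Pr ∘ (Φ ∘ D) = (Pr ∘ (Φ ∘ D)) ∘ fun q => q + s * Complex.I := by
        ext q; exact (K.proj_add_im hF hv q s).symm
      have h3 : HasFDerivAt (fun q : ℂ => q + s * Complex.I) (ContinuousLinearMap.id ℝ ℂ) q :=
        (hasFDerivAt_id q).add_const _
      have h4 := modelDeriv_comp_coord (I := J) (F := Pr ∘ (Φ ∘ D))
        (f := fun q => q + s * Complex.I) (y := q) ((hQs _).mdifferentiableAt (by simp))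
        h3.differentiableAt
      rw [h3.fderiv, ← h2] at h4
      exact congrArg (fun M : ℂ →L[ℝ] E' => M u) h4
    have hQd' : ∀ u, modelDeriv 𝓘(ℝ, ℂ) J (Pr ∘ (Φ ∘ D)) q u
        = modelDeriv 𝓘(ℝ, ℂ) J (Pr ∘ (Φ ∘ D)) (q + s * Complex.I) (L u) := by
      intro u
      rw [modelDeriv_comp ((K.smooth_proj _).mdifferentiableAt (by simp))
        ((hF _).mdifferentiableAt (by simp)), ContinuousLinearMap.comp_apply, hFd, hAq,
        modelDeriv_comp ((K.smooth_proj _).mdifferentiableAt (by simp))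
        ((hF _).mdifferentiableAt (by simp)), ContinuousLinearMap.comp_apply, ← hAq]
      rw [show (Φ ∘ D) q = (Φ ∘ D) (p' + L (q - p)) from congrFun hFe q]
    have h2 := hQd' 1
    have h3 : L 1 = -1 := Complex.ext (by simp [h1]) (by simp [hL1im])
    rw [h3, map_neg, ← hQd] at h2
    have h4 : (2 : ℝ) • modelDeriv 𝓘(ℝ, ℂ) J (Pr ∘ (Φ ∘ D)) q 1 = 0 := by
      rw [two_smul]
      nth_rewrite 2 [h2]
      exact add_neg_cancel _
    simpa using (K.modelDeriv_proj_one (hFi q) (hF q) (hv q)).2 1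
      ((smul_eq_zero.1 h4).resolve_left two_ne_zero)

theorem injective_modelDeriv_of_comp_circleExp {γ : Circle → B} (hγ : ContMDiff (𝓡 1) J ∞ γ) {α : ℝ}
    (h : modelDeriv 𝓘(ℝ, ℝ) J (γ ∘ Circle.exp) α 1 ≠ 0) :
    Function.Injective (modelDeriv (𝓡 1) J γ (Circle.exp α)) := by
  have h1 := modelDeriv_comp (I := 𝓘(ℝ, ℝ)) (I₁ := 𝓡 1) (I₂ := J) (x := α) (F := Circle.exp)
    (f := γ) ((hγ _).mdifferentiableAt (by simp))
    ((contMDiff_circleExp (m := ∞) α).mdifferentiableAt (by simp))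
  rw [h1, ContinuousLinearMap.comp_apply] at h
  set w : EuclideanSpace ℝ (Fin 1) := modelDeriv 𝓘(ℝ, ℝ) (𝓡 1) Circle.exp α 1
  have hw : w ≠ 0 := fun hw => h (by rw [hw, map_zero])
  rw [injective_iff_map_eq_zero]
  intro v hv
  obtain ⟨c, hc⟩ := (finrank_eq_one_iff_of_nonzero' w hw).1 finrank_euclideanSpace_fin v
  rw [← hc, map_smul, smul_eq_zero] at hv
  rw [← hc, hv.resolve_right h, zero_smul]

/-- The classification of the flat compact surfaces: they are Hopf tori. -/
theorem EktFibration.isHopfTorus_of_isFlatSurface (K : EktFibration I J κ τ g ξ Pr)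
    [IsManifold J ∞ B] [T2Space B] [T2Space N] (hk : κ - 4 * τ ^ 2 ≠ 0)
    [T2Space S] [CompactSpace S] [ConnectedSpace S] (hE : Module.finrank ℝ E₂ = 2)
    (hΦ : IsSmoothImmersion I₂ I Φ) (hflat : IsFlatSurface (I := I) I₂ g Φ) :
    IsHopfTorus J I₂ Pr Φ := by
  have hS := K.exists_flatParam hE hΦ hflat
  obtain ⟨D, hD, hv⟩ := K.exists_vertical_developing_map hk hΦ hS
  have hsurj := surjective_of_isFlatMapAt hS hD
  have hDs : ∀ q, ContMDiffAt 𝓘(ℝ, ℂ) I₂ ∞ D q := fun q => (hD q).self_of_nhds.1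
  have hDc : Continuous D := continuous_iff_continuousAt.2 fun q => (hDs q).continuousAt
  have hF : ∀ q, ContMDiffAt 𝓘(ℝ, ℂ) I ∞ (Φ ∘ D) q := fun q => (hΦ.1 _).comp q (hDs q)
  have hFi : ∀ q, Function.Injective (modelDeriv 𝓘(ℝ, ℂ) I (Φ ∘ D) q) := fun q =>
    injective_modelDeriv_of_isometric g fun u v => by
      rw [← indMetric_pullMetric ((hΦ.1 _).mdifferentiableAt (by simp))
        ((hDs q).mdifferentiableAt (by simp))]
      exact (hD q).self_of_nhds.2 u v
  have hQs : ∀ q, ContMDiffAt 𝓘(ℝ, ℂ) J ∞ (Pr ∘ (Φ ∘ D)) q := fun q =>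
    (K.smooth_proj _).comp q (hF q)
  have htrans := fun {p p'} => K.translation_of_eq hΦ hS hD hv (p := p) (p' := p')
  let Γ : AddSubgroup ℂ :=
    { carrier := {v | ∀ z, D (z + v) = D z}
      zero_mem' := fun z => by rw [add_zero]
      add_mem' := fun {a b} ha hb z => by rw [← add_assoc, hb, ha]
      neg_mem' := fun {a} ha z => by rw [← ha (z + -a), neg_add_cancel_right] }
  obtain ⟨R, hR⟩ := exists_radius hS hD
  obtain ⟨ε, hε, him⟩ : ∃ ε > 0, ∀ t : ℝ, |t| < ε → (⟨0, t⟩ : ℂ) ∈ Γ → t = 0 := by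
    obtain ⟨ρ, P, Ξ, O, hP⟩ := hS (D 0)
    obtain ⟨L, hL⟩ := hP.local_form (hD 0) hP.mem
    obtain ⟨ε, hε, hball⟩ := Metric.eventually_nhds_iff_ball.1 hL
    refine ⟨ε, hε, fun t ht hΓ => ?_⟩
    have h1 : (⟨0, t⟩ : ℂ) = t * Complex.I := by apply Complex.ext <;> simp
    have h2 := (hball (t * Complex.I) (by simpa using ht)).2
    have h3 := hΓ 0
    rw [zero_add, h1] at h3
    rw [h3, left_eq_add, sub_zero, map_eq_zero_iff _ L.injective] at h2
    simpa using h2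
  have hQim := K.proj_add_im hF hv
  obtain ⟨L, b, l, hL, hl, hΓ⟩ := exists_lattice Γ (fun z => by
      obtain ⟨q, hq, hqz⟩ := hR (D z)
      exact ⟨z - q, fun w => htrans hqz w, by simpa using hq⟩) (fun hd => by
      -- otherwise the surface lies over a point
      have hcl : IsClosed {t : ℝ | Pr (Φ (D t)) = Pr (Φ (D 0))} :=
        isClosed_eq (K.smooth_proj.continuous.comp (hΦ.1.continuous.comp
          (hDc.comp Complex.continuous_ofReal))) continuous_const
      have hall : ∀ t : ℝ, Pr (Φ (D t)) = Pr (Φ (D 0)) := by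
        have h1 : Complex.re '' (Γ : Set ℂ) ⊆ {t : ℝ | Pr (Φ (D t)) = Pr (Φ (D 0))} := by
          rintro _ ⟨v, hv, rfl⟩
          have h2 := hv 0
          have h3 := hQim v.re v.im
          rw [Complex.re_add_im] at h3
          rw [zero_add] at h2
          change Pr (Φ (D _)) = Pr (Φ (D _))
          rw [← h2]
          exact h3.symm
        intro t
        have h4 := hcl.closure_subset_iff.2 h1
        rw [hd.closure_eq] at h4
        exact h4 (mem_univ t)
      have hconst : Pr ∘ (Φ ∘ D) = fun _ => Pr (Φ (D 0)) := by
        ext z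
        rw [← hall z.re]
        have h3 := hQim z.re z.im
        rw [Complex.re_add_im] at h3
        exact h3
      have h5 := (K.modelDeriv_proj_one (hFi 0) (hF 0) (hv 0)).2 1 (by
        rw [hconst, modelDeriv, mfderiv_const]; rfl)
      simp at h5) hε him
  set e := latticeEquiv L b l hL hl.ne' with he
  have hp : ∀ (z : ℂ) (m n : ℤ), D (z + e (m * (2 * Real.pi), n * (2 * Real.pi))) = D z := by
    intro z m n
    exact (hΓ _).2 ⟨m, n, latticeEquiv_int hL hl.ne' m n⟩ z
  obtain ⟨ψ, hψ⟩ := exists_torus_diffeomorph hp hDs hsurj (fun z z' h => by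
    obtain ⟨m, n, hmn⟩ := (hΓ (z - z')).1 fun w => htrans h.symm w
    exact ⟨m, n, by rw [he, latticeEquiv_int, ← hmn]; ring⟩)
    (exists_local_inverse_flatMap hS hD)
  have hψe : ∀ α β : ℝ, ψ (Circle.exp α, Circle.exp β) = D (e (α, β)) := fun α β => by
    rw [hψ]; exact torusMap_torusExp hp (α, β)
  have hγs : ContMDiff (𝓡 1) J ∞ fun s : Circle => Pr (Φ (ψ (s, 1))) :=
    K.smooth_proj.comp (hΦ.1.comp (ψ.contMDiff.comp (contMDiff_id.prodMk contMDiff_const)))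
  have hγe : ∀ α : ℝ, Pr (Φ (ψ (Circle.exp α, 1))) = Pr (Φ (D (e (α, 0)))) := fun α => by
    rw [← hψe, Circle.exp_zero]
  refine ⟨fun s => Pr (Φ (ψ (s, 1))), ⟨hγs, fun s => ?_⟩, ψ, fun s => ?_⟩
  · rw [← Circle.exp_arg s]
    set α := Complex.arg s
    have hc : (fun s : Circle => Pr (Φ (ψ (s, 1)))) ∘ Circle.exp
        = (Pr ∘ (Φ ∘ D)) ∘ ((e : ℝ × ℝ →L[ℝ] ℂ).comp (ContinuousLinearMap.inl ℝ ℝ ℝ)) := by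
      ext α
      exact hγe α
    refine injective_modelDeriv_of_comp_circleExp hγs ?_
    rw [hc, modelDeriv_comp_coord ((hQs _).mdifferentiableAt (by simp))
      (ContinuousLinearMap.differentiableAt _), ContinuousLinearMap.fderiv]
    intro h
    have h1 := (K.modelDeriv_proj_one (hFi _) (hF _) (hv _)).2 _ h
    have h2 : (e ((1 : ℝ), (0 : ℝ))).re = 0 := h1
    rw [he, latticeEquiv_apply] at h2
    simp [Real.pi_ne_zero, hL] at h2
  · rw [← Circle.exp_arg s]
    set α := Complex.arg s
    change _ = Pr ⁻¹' {Pr (Φ (ψ (Circle.exp α, 1)))}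
    rw [hγe]
    refine Eq.trans ?_ (K.range_vertical_circle hF hv hl (fun z => ?_) (e (α, 0)))
    · congr 1
      ext t
      conv_lhs => rw [← Circle.exp_arg t]
      rw [hψe, he, latticeEquiv_apply_add]
      rfl
    · refine congrArg Φ ((hΓ (l * Complex.I)).2 ⟨0, 1, ?_⟩ z)
      apply Complex.ext <;> simp

omit [I.Boundaryless] [IsManifold I ∞ N] [FiniteDimensional ℝ E₂] [I₂.Boundaryless]
  [IsManifold I₂ ∞ S] in
/-- A Hopf torus is tangent to the vertical field. -/
theorem EktFibration.vertical_of_isHopfTorus (K : EktFibration I J κ τ g ξ Pr)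
    (hΦ : IsSmoothImmersion I₂ I Φ) (h : IsHopfTorus J I₂ Pr Φ) (x : S) :
    ∃ v, modelDeriv I₂ I Φ x v = ξ (Φ x) := by
  obtain ⟨γ, -, ψ, hψ⟩ := h
  obtain ⟨⟨s, t⟩, rfl⟩ := ψ.surjective x
  obtain ⟨β, rfl⟩ : ∃ β, Circle.exp β = t := ⟨_, Circle.exp_arg t⟩
  set c : ℝ → S := fun θ => ψ (s, Circle.exp θ) with hc
  have hcs : ContMDiff 𝓘(ℝ, ℝ) I₂ ∞ c :=
    ψ.contMDiff.comp (contMDiff_const.prodMk contMDiff_circleExp)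
  have hne : modelDeriv 𝓘(ℝ, ℝ) I₂ c β 1 ≠ 0 := by
    have h1 : ContMDiffAt I₂ 𝓘(ℝ, ℝ) ∞ (fun x => angleAt β (ψ.symm x).2) (c β) := by
      refine ContMDiffAt.comp (g := angleAt β) (f := fun x => (ψ.symm x).2) _ ?_
        (contMDiffAt_snd.comp _ ψ.symm.contMDiff.contMDiffAt)
      rw [hc, ψ.symm_apply_apply]
      exact contMDiffAt_angleAt β
    have h2 := modelDeriv_comp (I := 𝓘(ℝ, ℝ)) (I₁ := I₂) (I₂ := 𝓘(ℝ, ℝ)) (x := β) (F := c)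
      (h1.mdifferentiableAt (by simp)) ((hcs _).mdifferentiableAt (by simp))
    have h3 : (fun x => angleAt β (ψ.symm x).2) ∘ c =ᶠ[𝓝 β] fun θ => θ := by
      filter_upwards [angleAt_exp_eventually β] with θ hθ
      simp only [hc, Function.comp_apply, ψ.symm_apply_apply, hθ]
    rw [modelDeriv_congr h3, modelDeriv_id] at h2
    intro h4
    have h5 := congrArg (fun L : ℝ →L[ℝ] ℝ => L 1) h2
    simp only [ContinuousLinearMap.comp_apply, h4, map_zero] at h5
    exact one_ne_zero h5
  have hΦc : modelDeriv 𝓘(ℝ, ℝ) J (Pr ∘ (Φ ∘ c)) β = 0 := by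
    have h1 : Pr ∘ (Φ ∘ c) = fun _ => γ s := by
      ext θ
      have h2 : Φ (ψ (s, Circle.exp θ)) ∈ Pr ⁻¹' {γ s} := by
        rw [← hψ s]
        exact ⟨_, rfl⟩
      exact h2
    rw [h1, modelDeriv, mfderiv_const]
    rfl
  have hΦd := modelDeriv_comp (I := 𝓘(ℝ, ℝ)) (I₁ := I₂) (I₂ := I) (x := β) (F := c)
      ((hΦ.1 _).mdifferentiableAt (by simp)) ((hcs _).mdifferentiableAt (by simp))
  rw [modelDeriv_comp ((K.smooth_proj _).mdifferentiableAt (by simp))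
    (((hΦ.1 _).comp β (hcs β)).mdifferentiableAt (by simp)), hΦd] at hΦc
  obtain ⟨r, hr⟩ := K.ker (congrArg (fun L : ℝ →L[ℝ] E' => L 1) hΦc)
  have hr' : modelDeriv I₂ I Φ (c β) (modelDeriv 𝓘(ℝ, ℝ) I₂ c β 1) = r • ξ (Φ (c β)) := hr
  have hr0 : r ≠ 0 := by
    rintro rfl
    rw [zero_smul] at hr'
    exact hne ((injective_iff_map_eq_zero _).1 (hΦ.2 (c β)) _ hr')
  refine ⟨r⁻¹ • modelDeriv 𝓘(ℝ, ℝ) I₂ c β 1, ?_⟩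
  rw [map_smul]
  change r⁻¹ • modelDeriv I₂ I Φ (c β) (modelDeriv 𝓘(ℝ, ℝ) I₂ c β 1) = ξ (Φ (c β))
  rw [hr', smul_smul, inv_mul_cancel₀ hr0, one_smul]

theorem EktFibration.flatIffHopfTorus (K : EktFibration I J κ τ g ξ Pr) [IsManifold J ∞ B]
    [T2Space B] [T2Space N] (hk : κ - 4 * τ ^ 2 ≠ 0) :
    FlatIffHopfTorus.{u} (I := I) J g Pr := by
  intro S _ _ _ _ _ _ Φ hΦ
  exact ⟨fun h => K.isHopfTorus_of_isFlatSurface hk (by simp) hΦ h, fun h =>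
    K.isFlatSurface_of_vertical (by simp) hΦ (K.vertical_of_isHopfTorus hΦ h)⟩

omit [I.Boundaryless] [IsManifold I ∞ N] in
theorem EktLike.noFlatCompactSurface (K : EktLike I κ τ g ξ) (hk : κ - 4 * τ ^ 2 ≠ 0)
    {f : N → ℝ} (hf : ContMDiff I 𝓘(ℝ, ℝ) ∞ f)
    (hfξ : ∀ x, modelDeriv I 𝓘(ℝ, ℝ) f x (ξ x) ≠ 0) : NoFlatCompactSurface.{u} (I := I) g := by
  intro S _ _ _ _ _ _ Φ hΦ hflat
  exact K.noFlatCompactSurface_of_monotone hk hf hfξ (by simp) hΦ hflat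

end HopfTorus

/-! ### Lifts to the inverse image of a closed curve -/

section Lifts

variable {E : Type*} [NormedAddCommGroup E] [NormedSpace ℝ E]
  {H : Type*} [TopologicalSpace H] {I : ModelWithCorners ℝ E H}
  {N : Type*} [TopologicalSpace N] [ChartedSpace H N]
  {E' : Type*} [NormedAddCommGroup E'] [NormedSpace ℝ E']
  {H' : Type*} [TopologicalSpace H'] {J : ModelWithCorners ℝ E' H'}
  {B : Type*} [TopologicalSpace B] [ChartedSpace H' B]
  {κ τ : ℝ} {g : N → E →L[ℝ] E →L[ℝ] ℝ} {ξ : N → E} {Pr : N → B} {γ : Circle → B}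
  {D D' : ℂ → N} {p : ℂ}

/-- Near `p`, the map `D` lifts `z ↦ γ (exp (i re z))`, and the form dual to the vertical field
pulls back to `d (im z)`. So `D` follows a horizontal lift of `γ` in the direction of `1`, and the
fibres in the direction of `i`. -/
def IsLiftAt (I : ModelWithCorners ℝ E H) (g : N → E →L[ℝ] E →L[ℝ] ℝ) (ξ : N → E) (Pr : N → B)
    (γ : Circle → B) (D : ℂ → N) (p : ℂ) : Prop :=
  ∀ᶠ q in 𝓝 p, ContMDiffAt 𝓘(ℝ, ℂ) I ∞ D q ∧ Pr (D q) = γ (Circle.exp q.re) ∧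
    ∀ v, vertForm I g ξ D q v = v.im

theorem vertForm_congr {F F' : ℂ → N} {q : ℂ} (h : F =ᶠ[𝓝 q] F') :
    vertForm I g ξ F q = vertForm I g ξ F' q := by
  unfold vertForm
  rw [modelDeriv_congr h, h.self_of_nhds]

theorem vertForm_comp {F : ℂ → N} {f : ℂ → ℂ} {q : ℂ} (hF : MDifferentiableAt 𝓘(ℝ, ℂ) I F (f q))
    (hf : DifferentiableAt ℝ f q) :
    vertForm I g ξ (F ∘ f) q = (vertForm I g ξ F (f q)).comp (fderiv ℝ f q) := by
  unfold vertForm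
  rw [modelDeriv_comp_coord hF hf]
  rfl

omit [TopologicalSpace B] in
theorem IsLiftAt.congr (h : IsLiftAt I g ξ Pr γ D p) (e : D =ᶠ[𝓝 p] D') :
    IsLiftAt I g ξ Pr γ D' p := by
  filter_upwards [h, e.eventuallyEq_nhds] with q h1 h2
  exact ⟨h1.1.congr_of_eventuallyEq h2.symm, by rw [← h2.self_of_nhds, h1.2.1],
    fun v => by rw [← vertForm_congr h2, h1.2.2]⟩

omit [TopologicalSpace B] in
theorem IsLiftAt.translate {c : ℂ} (hc : Circle.exp c.re = 1)
    (h : IsLiftAt I g ξ Pr γ D (p + c)) : IsLiftAt I g ξ Pr γ (fun q => D (q + c)) p := by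
  have hA : ContDiff ℝ ∞ fun q : ℂ => q + c := contDiff_id.add contDiff_const
  have hA' : ∀ q, HasFDerivAt (fun q : ℂ => q + c) (ContinuousLinearMap.id ℝ ℂ) q := fun q =>
    (hasFDerivAt_id q).add_const c
  filter_upwards [hA.continuous.continuousAt.preimage_mem_nhds h] with q hq
  refine ⟨ContMDiffAt.comp (g := D) q hq.1 hA.contMDiff.contMDiffAt, ?_, fun v => ?_⟩
  · rw [hq.2.1, Complex.add_re, Circle.exp_add, hc, mul_one]
  · have h1 := vertForm_comp (I := I) (g := g) (ξ := ξ) (F := D) (f := fun q => q + c) (q := q)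
      (hq.1.mdifferentiableAt (by simp)) (hA' q).differentiableAt
    rw [(hA' q).fderiv] at h1
    exact (congrArg (fun L : ℂ →L[ℝ] ℝ => L v) h1).trans (hq.2.2 v)

/-- The form dual to the vertical field is closed along a surface made of vertical lines. -/
theorem EktLike.closed_vertForm (K : EktLike I κ τ g ξ) {F : ℂ → N}
    (hF : ∀ᶠ q in 𝓝 p, ContMDiffAt 𝓘(ℝ, ℂ) I ∞ F q) {c₀ : ℝ}
    (hv : modelDeriv 𝓘(ℝ, ℂ) I F p Complex.I = c₀ • ξ (F p)) :
    ContDiffAt ℝ ∞ (vertForm I g ξ F) p ∧ ∀ u v, extD (vertForm I g ξ F) p u v = 0 := by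
  obtain ⟨σ, -, a, b, c, ϖ, U, hpU, hc, hg⟩ := (K.coframe (F p)).pull hF
  have hcF : vertForm I g ξ F =ᶠ[𝓝 p] c := by
    filter_upwards [hc.isOpen.mem_nhds hpU] with q hq
    ext v
    exact (hg q hq).2.2 v
  refine ⟨(hc.smooth_c.contDiffAt (hc.isOpen.mem_nhds hpU)).congr_of_eventuallyEq hcF,
    fun u v => ?_⟩
  have h1 : extD (vertForm I g ξ F) p u v = extD c p u v := by
    unfold extD
    rw [hcF.fderiv_eq]
  have h2 := (hg p hpU).2.1 Complex.I Complex.I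
  have h3 := (hg p hpU).2.2 Complex.I
  rw [indMetric_apply, hv] at h2
  rw [hv] at h3
  simp only [map_smul, smul_apply, K.unit, smul_eq_mul, mul_one] at h2 h3
  rw [← h3] at h2
  have ha : a p Complex.I = 0 := by nlinarith [sq_nonneg (a p Complex.I), sq_nonneg (b p Complex.I)]
  have hb : b p Complex.I = 0 := by nlinarith [sq_nonneg (a p Complex.I), sq_nonneg (b p Complex.I)]
  have hexp : ∀ u : ℂ, u = u.re • (1 : ℂ) + u.im • Complex.I := fun u => by
    apply Complex.ext <;> simp
  have hau : ∀ u : ℂ, a p u = u.re * a p 1 := fun u => by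
    conv_lhs => rw [hexp u]
    simp only [map_add, map_smul, ha, smul_eq_mul, mul_zero, add_zero]
  have hbu : ∀ u : ℂ, b p u = u.re * b p 1 := fun u => by
    conv_lhs => rw [hexp u]
    simp only [map_add, map_smul, hb, smul_eq_mul, mul_zero, add_zero]
  rw [h1, hc.d_c p hpU, wedge, hau u, hau v, hbu u, hbu v]
  ring

variable [I.Boundaryless] [IsManifold I ∞ N]

/-- Near a point over `γ (exp (i α₀))`, the lifts are the translates, along the fibres, of one lift
`G`. -/
theorem EktFibration.exists_lift_box (K : EktFibration I J κ τ g ξ Pr)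
    (hγ : ContMDiff (𝓡 1) J ∞ γ) (hγr : range γ ⊆ range Pr) {x₀ : N} {α₀ : ℝ}
    (hx₀ : Pr x₀ = γ (Circle.exp α₀)) :
    ∃ δ > 0, ∃ ρ > 0, ∃ (A : Set N) (G : ℂ → N) (h : N → ℝ → ℝ), IsOpen A ∧ x₀ ∈ A ∧ G α₀ = x₀ ∧
      (∀ z ∈ Metric.ball (α₀ : ℂ) (2 * ρ), IsLiftAt I g ξ Pr γ G z) ∧
      ∀ D p, IsLiftAt I g ξ Pr γ D p → D p ∈ A → |p.re - α₀| < δ →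
        (⟨p.re, h (D p) p.re⟩ : ℂ) ∈ Metric.ball (α₀ : ℂ) ρ ∧
        D =ᶠ[𝓝 p] fun q => G (q + (h (D p) p.re - p.im : ℝ) * Complex.I) := by
  obtain ⟨ζ, O, T, Y, A₀, V, hA, hq, hT⟩ := K.exists_fibreChart x₀
  -- the surface over `γ`, in the coordinates `α` and `T`
  set β : ℂ → B := fun z => γ (Circle.exp z.re) with hβ
  have hβs : ContMDiff 𝓘(ℝ, ℂ) J ∞ β :=
    hγ.comp (contMDiff_circleExp.comp Complex.reCLM.contDiff.contMDiff)
  have hβI : ∀ z, modelDeriv 𝓘(ℝ, ℂ) J β z Complex.I = 0 := by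
    intro z
    have h1 := modelDeriv_comp_coord (I := J) (F := γ ∘ Circle.exp) (f := Complex.reCLM) (y := z)
      ((hγ.comp contMDiff_circleExp _).mdifferentiableAt (by simp))
      Complex.reCLM.differentiableAt
    have h2 := congrArg (fun L : ℂ →L[ℝ] E' => L Complex.I) h1
    simp only [ContinuousLinearMap.comp_apply, ContinuousLinearMap.fderiv, Complex.reCLM_apply,
      Complex.I_re, map_zero] at h2
    exact h2
  set W : Set ℂ := β ⁻¹' O ∩ (fun z => (ζ (β z), z.im)) ⁻¹' V with hW
  have hPs : ∀ z ∈ β ⁻¹' O, ContMDiffAt 𝓘(ℝ, ℂ) 𝓘(ℝ, ℂ × ℝ) ∞ (fun z => (ζ (β z), z.im)) z :=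
    fun z hz => ((hA.smooth_base.contMDiffAt (hA.isOpen_base.mem_nhds hz)).comp z
      (hβs z)).prodMk_space Complex.imCLM.contDiff.contMDiff.contMDiffAt
  have hWo : IsOpen W := ContinuousOn.isOpen_inter_preimage
    (fun z hz => (hPs z hz).continuousAt.continuousWithinAt)
    (hA.isOpen_base.preimage hβs.continuous) hA.isOpen_target
  set Z : ℂ → N := fun z => Y (ζ (β z), z.im) with hZ
  have hZs : ∀ z ∈ W, ContMDiffAt 𝓘(ℝ, ℂ) I ∞ Z z := fun z hz =>
    ContMDiffAt.comp (g := Y) z (hA.smooth_inv _ hz.2) (hPs z hz.1)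
  have hZA : ∀ z ∈ W, Z z ∈ A₀ := fun z hz => hA.inv_mem _ hz.2
  have hZT : ∀ z ∈ W, T (Z z) = z.im := fun z hz => hA.height_inv _ hz.2
  have hZP : ∀ z ∈ W, Pr (Z z) = β z := fun z hz => hA.injOn_base
    ⟨hA.proj_mem _ (hZA z hz), mem_range_self _⟩ ⟨hz.1, hγr (mem_range_self _)⟩
    (hA.proj_inv _ hz.2)
  have hZI : ∀ z ∈ W, ∃ c : ℝ, c ≠ 0 ∧ modelDeriv 𝓘(ℝ, ℂ) I Z z Complex.I = c • ξ (Z z) := by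
    intro z hz
    have h1 := modelDeriv_comp (I := 𝓘(ℝ, ℂ)) (I₁ := I) (I₂ := J) (x := z) (F := Z) (f := Pr)
      ((K.smooth_proj _).mdifferentiableAt (by simp)) ((hZs z hz).mdifferentiableAt (by simp))
    have h2 : Pr ∘ Z =ᶠ[𝓝 z] β := by
      filter_upwards [hWo.mem_nhds hz] with y hy using hZP y hy
    rw [modelDeriv_congr h2] at h1
    have h3 := congrArg (fun L : ℂ →L[ℝ] E' => L Complex.I) h1
    simp only [ContinuousLinearMap.comp_apply, hβI] at h3
    obtain ⟨c, hc⟩ := K.ker h3.symm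
    refine ⟨c, ?_, hc⟩
    rintro rfl
    have h4 := modelDeriv_comp (I := 𝓘(ℝ, ℂ)) (I₁ := I) (I₂ := 𝓘(ℝ, ℝ)) (x := z) (F := Z) (f := T)
      ((hA.smooth _ (hZA z hz)).mdifferentiableAt (by simp))
      ((hZs z hz).mdifferentiableAt (by simp))
    have h5 : T ∘ Z =ᶠ[𝓝 z] Complex.imCLM := by
      filter_upwards [hWo.mem_nhds hz] with y hy using hZT y hy
    rw [modelDeriv_congr h5, modelDeriv_eq_fderiv, ContinuousLinearMap.fderiv] at h4
    have h6 := congrArg (fun L : ℂ →L[ℝ] ℝ => L Complex.I) h4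
    simp only [ContinuousLinearMap.comp_apply, hc, zero_smul, map_zero, Complex.imCLM_apply,
      Complex.I_im] at h6
    exact one_ne_zero h6
  have hZx : ∀ x ∈ A₀, ∀ α : ℝ, Pr x = γ (Circle.exp α) →
      (⟨α, T x⟩ : ℂ) ∈ W ∧ Z ⟨α, T x⟩ = x := by
    intro x hx α h
    refine ⟨⟨?_, ?_⟩, ?_⟩
    · change γ (Circle.exp α) ∈ O
      rw [← h]; exact hA.proj_mem x hx
    · change (ζ (γ (Circle.exp α)), T x) ∈ V
      rw [← h]; exact hA.map_mem x hx
    · change Y (ζ (γ (Circle.exp α)), T x) = x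
      rw [← h]; exact hA.left_inv x hx
  set w₀ : ℂ := ⟨α₀, T x₀⟩ with hw₀
  obtain ⟨hw₀W, hw₀x⟩ := hZx x₀ hq α₀ hx₀
  -- a primitive of the form dual to the vertical field
  have hη : ∀ z ∈ W, ContDiffAt ℝ ∞ (vertForm I g ξ Z) z ∧
      ∀ u v, extD (vertForm I g ξ Z) z u v = 0 := by
    intro z hz
    obtain ⟨c, -, hc⟩ := hZI z hz
    refine K.closed_vertForm ?_ hc
    filter_upwards [hWo.mem_nhds hz] with y hy using hZs y hy
  obtain ⟨r, hr, hrW⟩ := Metric.isOpen_iff.1 hWo w₀ hw₀W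
  obtain ⟨f₀, hf₀, hf₀'⟩ := exists_primitive Metric.isOpen_ball (convex_ball w₀ r)
    (fun y hy => (hη y (hrW hy)).1.contDiffWithinAt) (fun y hy => (hη y (hrW hy)).2)
  set f : ℂ → ℝ := fun z => f₀ z - f₀ w₀ with hf
  have hfs : ContDiffOn ℝ ∞ f (Metric.ball w₀ r) := hf₀.sub contDiffOn_const
  have hf' : ∀ y ∈ Metric.ball w₀ r, HasFDerivAt f (vertForm I g ξ Z y) y := fun y hy =>
    (hf₀' y hy).sub_const _
  have hw₀r : w₀ ∈ Metric.ball w₀ r := Metric.mem_ball_self hr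
  set Θ : ℂ → ℂ := fun z => Complex.equivRealProdCLM.symm (z.re, f z) with hΘ
  have hΘs : ContDiffOn ℝ ∞ Θ (Metric.ball w₀ r) :=
    Complex.equivRealProdCLM.symm.contDiff.comp_contDiffOn
      (Complex.reCLM.contDiff.contDiffOn.prodMk hfs)
  have hΘ' : ∀ y ∈ Metric.ball w₀ r, HasFDerivAt Θ
      ((Complex.equivRealProdCLM.symm : ℝ × ℝ →L[ℝ] ℂ).comp
        (Complex.reCLM.prod (vertForm I g ξ Z y))) y := fun y hy =>
    (Complex.equivRealProdCLM.symm : ℝ × ℝ →L[ℝ] ℂ).hasFDerivAt.comp y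
      (Complex.reCLM.hasFDerivAt.prodMk (hf' y hy))
  have hηI : ∀ z ∈ W, vertForm I g ξ Z z Complex.I ≠ 0 := by
    intro z hz
    obtain ⟨c, hc0, hc⟩ := hZI z hz
    change g (Z z) (ξ (Z z)) (modelDeriv 𝓘(ℝ, ℂ) I Z z Complex.I) ≠ 0
    rw [hc, map_smul, K.unit]
    simpa using hc0
  have hinv : (fderiv ℝ Θ w₀).IsInvertible := by
    refine isInvertible_of_injective rfl ?_
    rw [(hΘ' w₀ hw₀r).fderiv, injective_iff_map_eq_zero]
    intro v hv
    have h1 : v.re = 0 := congrArg Complex.re hv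
    have h2 : vertForm I g ξ Z w₀ v = 0 := congrArg Complex.im hv
    have h3 : v = v.im • Complex.I := by apply Complex.ext <;> simp [h1]
    rw [h3, map_smul, smul_eq_mul, mul_eq_zero] at h2
    rw [h3, h2.resolve_right (hηI w₀ hw₀W), zero_smul]
  obtain ⟨e, heΘ, hwe, hes, hesymm⟩ := exists_smooth_local_inverse Metric.isOpen_ball hΘs hw₀r hinv
  set G : ℂ → N := Z ∘ e.symm with hG
  have hΘ0 : Θ w₀ = α₀ := by
    refine Complex.ext rfl ?_
    change f w₀ = 0
    simp [hf]
  have hΘre : ∀ z, (Θ z).re = z.re := fun z => rfl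
  have hΘim : ∀ z, (Θ z).im = f z := fun z => rfl
  have hαt : (α₀ : ℂ) ∈ e.target := by
    have := e.map_source hwe
    rwa [heΘ, hΘ0] at this
  have hGadm : ∀ z ∈ e.target, IsLiftAt I g ξ Pr γ G z := by
    intro z hz
    filter_upwards [e.open_target.mem_nhds hz] with y hy
    have h1 : e.symm y ∈ Metric.ball w₀ r := hes (e.map_target hy)
    have h2 : Θ (e.symm y) = y := by rw [← heΘ, e.right_inv hy]
    have h3 : (e.symm y).re = y.re := by rw [← hΘre, h2]
    refine ⟨(hZs _ (hrW h1)).comp y (hesymm y hy).contMDiffAt, ?_, fun v => ?_⟩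
    · change Pr (Z (e.symm y)) = _
      rw [hZP _ (hrW h1), hβ]
      simp only [h3]
    · rw [hG, vertForm_comp ((hZs _ (hrW h1)).mdifferentiableAt (by simp))
        ((hesymm y hy).differentiableAt (by simp))]
      have h4 := (hf' _ h1).comp y ((hesymm y hy).differentiableAt (by simp)).hasFDerivAt
      have h5 : f ∘ e.symm =ᶠ[𝓝 y] Complex.imCLM := by
        filter_upwards [e.open_target.mem_nhds hy] with z hz
        change f (e.symm z) = z.im
        rw [← hΘim, ← heΘ, e.right_inv hz]
      rw [← h4.fderiv, h5.fderiv_eq, ContinuousLinearMap.fderiv]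
      rfl
  obtain ⟨ρ, hρ, hρt⟩ := Metric.isOpen_iff.1 e.open_target _ hαt
  have hΘc : ContinuousAt Θ w₀ := (hΘ' w₀ hw₀r).continuousAt
  have hnear : e.source ∩ Θ ⁻¹' Metric.ball (α₀ : ℂ) (ρ / 2) ∈ 𝓝 w₀ :=
    Filter.inter_mem (e.open_source.mem_nhds hwe)
      (hΘc.preimage_mem_nhds (by rw [hΘ0]; exact Metric.ball_mem_nhds _ (by linarith)))
  obtain ⟨r', hr', hr's⟩ := Metric.mem_nhds_iff.1 hnear
  have hAo : IsOpen (A₀ ∩ T ⁻¹' Metric.ball (T x₀) (r' / 2)) := ContinuousOn.isOpen_inter_preimage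
    (fun x hx => (hA.smooth x hx).continuousAt.continuousWithinAt) hA.isOpen Metric.isOpen_ball
  refine ⟨r' / 2, by linarith, ρ / 2, by linarith, _, G, fun x α => f ⟨α, T x⟩, hAo,
    ⟨hq, Metric.mem_ball_self (by linarith)⟩, ?_, fun z hz => hGadm z (hρt ?_), ?_⟩
  · change Z (e.symm α₀) = x₀
    rw [← hΘ0, ← heΘ, e.left_inv hwe, hw₀x]
  · convert! hz using 2; ring
  intro D p hD hpA hpα
  have hmem : ∀ x ∈ A₀ ∩ T ⁻¹' Metric.ball (T x₀) (r' / 2), ∀ α : ℝ, |α - α₀| < r' / 2 →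
      (⟨α, T x⟩ : ℂ) ∈ e.source ∩ Θ ⁻¹' Metric.ball (α₀ : ℂ) (ρ / 2) := by
    intro x hx α hα
    refine hr's ?_
    rw [mem_ball_iff_norm]
    refine (Complex.norm_le_abs_re_add_abs_im _).trans_lt ?_
    have h1 : |T x - T x₀| < r' / 2 := hx.2
    simp only [hw₀, Complex.sub_re, Complex.sub_im]
    linarith
  have hev : ∀ᶠ q in 𝓝 p, D q ∈ A₀ ∩ T ⁻¹' Metric.ball (T x₀) (r' / 2) ∧ |q.re - α₀| < r' / 2 := by
    refine Filter.Eventually.and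
      (hD.self_of_nhds.1.continuousAt.preimage_mem_nhds (hAo.mem_nhds hpA)) ?_
    have h1 : Continuous fun q : ℂ => |q.re - α₀| := by fun_prop
    exact h1.continuousAt.preimage_mem_nhds (Iio_mem_nhds hpα)
  obtain ⟨ε, hε, hball⟩ := Metric.eventually_nhds_iff_ball.1 (hD.and hev)
  set w : ℂ → ℂ := fun q => Complex.equivRealProdCLM.symm (q.re, T (D q)) with hw
  have hwq : ∀ q, w q = ⟨q.re, T (D q)⟩ := fun q => rfl
  have hZw : ∀ q ∈ Metric.ball p ε, Z (w q) = D q := fun q hq =>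
    (hZx (D q) (hball q hq).2.1.1 q.re (hball q hq).1.2.1).2
  have hws : ∀ q ∈ Metric.ball p ε, w q ∈ e.source ∩ Θ ⁻¹' Metric.ball (α₀ : ℂ) (ρ / 2) :=
    fun q hq => hmem _ (hball q hq).2.1 _ (hball q hq).2.2
  have hwd : ∀ q ∈ Metric.ball p ε, DifferentiableAt ℝ w q := by
    intro q hq
    have h1 : ContDiffAt ℝ ∞ (fun q => T (D q)) q :=
      ((hA.smooth _ (hball q hq).2.1.1).comp q (hball q hq).1.1).contDiffAt
    exact Complex.equivRealProdCLM.symm.differentiableAt.comp q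
      (Complex.reCLM.differentiableAt.prodMk (h1.differentiableAt (by simp)))
  have hconst : ∀ q ∈ Metric.ball p ε, f (w q) - q.im = f (w p) - p.im := by
    have hd : ∀ q ∈ Metric.ball p ε, HasFDerivAt (fun q => f (w q) - q.im) (0 : ℂ →L[ℝ] ℝ) q := by
      intro q hq
      have h1 := ((hf' _ (hes (hws q hq).1)).comp q (hwd q hq).hasFDerivAt).sub
        Complex.imCLM.hasFDerivAt
      convert! h1 using 1
      have h2 : D =ᶠ[𝓝 q] Z ∘ w := by
        filter_upwards [Metric.isOpen_ball.mem_nhds hq] with y hy using (hZw y hy).symm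
      have h3 := vertForm_congr (I := I) (g := g) (ξ := ξ) h2
      rw [vertForm_comp ((hZs _ (hrW (hes (hws q hq).1))).mdifferentiableAt (by simp))
        (hwd q hq)] at h3
      rw [← h3]
      ext v
      have h4 := (hball q hq).1.2.2 v
      simp [h4]
    intro q hq
    exact (convex_ball p ε).is_const_of_fderivWithin_eq_zero (𝕜 := ℝ)
      (fun t ht => (hd t ht).differentiableAt.differentiableWithinAt)
      (fun t ht => by rw [fderivWithin_of_isOpen Metric.isOpen_ball ht, (hd t ht).fderiv]) hq
      (Metric.mem_ball_self hε)
  refine ⟨(hws p (Metric.mem_ball_self hε)).2, ?_⟩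
  filter_upwards [Metric.ball_mem_nhds p hε] with q hq
  have h1 : q + (f (w p) - p.im : ℝ) * Complex.I = Θ (w q) := by
    rw [← hconst q hq]
    apply Complex.ext
    · rw [hΘre]; simp [hwq]
    · rw [hΘim]; simp
  change D q = G (q + (f (w p) - p.im : ℝ) * Complex.I)
  rw [h1, ← heΘ]
  change D q = Z (e.symm (e (w q)))
  rw [e.left_inv (hws q hq).1, hZw q hq]

end Lifts

/-! ### The inverse images of closed curves -/

section HopfTorusConstruction

variable {E : Type*} [NormedAddCommGroup E] [NormedSpace ℝ E]
  {H : Type*} [TopologicalSpace H] {I : ModelWithCorners ℝ E H}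
  {N : Type*} [TopologicalSpace N] [ChartedSpace H N]
  {E' : Type*} [NormedAddCommGroup E'] [NormedSpace ℝ E']
  {H' : Type*} [TopologicalSpace H'] {J : ModelWithCorners ℝ E' H'}
  {B : Type*} [TopologicalSpace B] [ChartedSpace H' B]
  {κ τ : ℝ} {g : N → E →L[ℝ] E →L[ℝ] ℝ} {ξ : N → E} {Pr : N → B} {γ : Circle → B}
  {D D' : ℂ → N} {p : ℂ} [I.Boundaryless] [IsManifold I ∞ N]

/-- Lifts are determined by their value at one point. -/
theorem EktFibration.eventuallyEq_of_isLiftAt (K : EktFibration I J κ τ g ξ Pr)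
    (hγ : ContMDiff (𝓡 1) J ∞ γ) (hγr : range γ ⊆ range Pr) (hD : IsLiftAt I g ξ Pr γ D p)
    (hD' : IsLiftAt I g ξ Pr γ D' p) (h : D p = D' p) : D =ᶠ[𝓝 p] D' := by
  obtain ⟨δ, hδ, ρ, hρ, A, G, f, hA, hx, -, -, hG⟩ := K.exists_lift_box hγ hγr
    hD.self_of_nhds.2.1
  have h0 : |p.re - p.re| < δ := by simpa using hδ
  have h1 := (hG D p hD hx h0).2
  have h2 := (hG D' p hD' (h ▸ hx) h0).2
  rw [← h] at h2
  exact h1.trans h2.symm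

/-- The fibres over nearby points of the curve stay near a compact fibre. -/
theorem EktFibration.eventually_fibre_subset [T2Space N] [T2Space B]
    (K : EktFibration I J κ τ g ξ Pr) (hcomp : ∀ x, IsCompact (Pr ⁻¹' {Pr x}))
    (hγ : ContMDiff (𝓡 1) J ∞ γ) (hγr : range γ ⊆ range Pr) {α₀ : ℝ} {U : Set N} (hU : IsOpen U)
    (hs : Pr ⁻¹' {γ (Circle.exp α₀)} ⊆ U) :
    ∀ᶠ α in 𝓝 α₀, Pr ⁻¹' {γ (Circle.exp α)} ⊆ U := by
  have := K.finiteDimensional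
  have : LocallyCompactSpace N := Manifold.locallyCompact_of_finiteDimensional I
  obtain ⟨x₀, hx₀⟩ := hγr (mem_range_self (Circle.exp α₀))
  obtain ⟨L, hL, hfL, hLU⟩ := exists_compact_between (hx₀ ▸ hcomp x₀) hU hs
  obtain ⟨δ, hδ, ρ, hρ, A, G, f, hA, hx, hG0, hG, -⟩ := K.exists_lift_box hγ hγr hx₀
  have hGα₀ := hG α₀ (Metric.mem_ball_self (by linarith))
  have h1 : ∀ᶠ α : ℝ in 𝓝 α₀, Pr (G α) = γ (Circle.exp α) ∧ G α ∈ interior L := by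
    have h2 : ∀ᶠ z in 𝓝 (α₀ : ℂ), Pr (G z) = γ (Circle.exp z.re) ∧ G z ∈ interior L := by
      refine (hGα₀.mono fun z hz => hz.2.1).and ?_
      refine hGα₀.self_of_nhds.1.continuousAt.preimage_mem_nhds (isOpen_interior.mem_nhds ?_)
      exact hfL (by rw [hG0]; exact hx₀)
    exact Complex.continuous_ofReal.continuousAt.eventually h2
  have hfr : IsCompact (frontier L) := hL.of_isClosed_subset isClosed_frontier
    hL.isClosed.frontier_subset
  have h2 : ∀ᶠ α : ℝ in 𝓝 α₀, γ (Circle.exp α) ∉ Pr '' frontier L := by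
    have hcl := (hfr.image K.smooth_proj.continuous).isClosed
    have hc : Continuous fun α : ℝ => γ (Circle.exp α) :=
      hγ.continuous.comp Circle.exp.continuous
    refine hc.continuousAt.preimage_mem_nhds (hcl.isOpen_compl.mem_nhds ?_)
    rintro ⟨y, hy, hy'⟩
    exact hy.2 (hfL hy')
  filter_upwards [h1, h2] with α ⟨hα, hαL⟩ hα2
  rw [← hα] at hα2 ⊢
  intro y hy
  by_contra hyU
  obtain ⟨z, hz, hz1, hz2⟩ := K.fibre_connected (G α) (interior L) Lᶜ isOpen_interior
    hL.isClosed.isOpen_compl (fun z hz => by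
      by_contra h
      simp only [mem_union, not_or, mem_compl_iff, not_not] at h
      exact hα2 ⟨z, ⟨subset_closure h.2, h.1⟩, hz⟩) ⟨G α, rfl, hαL⟩ ⟨y, hy, fun h => hyU (hLU h)⟩
  exact hz2 (interior_subset hz1)

/-- Lifts extend to balls of a fixed radius, if the fibres are compact. -/
theorem EktFibration.exists_uniform_lift [T2Space N] [T2Space B]
    (K : EktFibration I J κ τ g ξ Pr) (hcomp : ∀ x, IsCompact (Pr ⁻¹' {Pr x}))
    (hγ : ContMDiff (𝓡 1) J ∞ γ) (hγr : range γ ⊆ range Pr) :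
    ∃ r > 0, ∀ D p, IsLiftAt I g ξ Pr γ D p → ∃ D', D' =ᶠ[𝓝 p] D ∧
      ∀ q ∈ Metric.ball p r, IsLiftAt I g ξ Pr γ D' q := by
  have hshrink : ∀ {D p} {r r' : ℝ}, r ≤ r' → (∃ D', D' =ᶠ[𝓝 p] D ∧
      ∀ q ∈ Metric.ball p r', IsLiftAt I g ξ Pr γ D' q) → ∃ D', D' =ᶠ[𝓝 p] D ∧
      ∀ q ∈ Metric.ball p r, IsLiftAt I g ξ Pr γ D' q := fun hr ⟨D', h, h'⟩ =>
    ⟨D', h, fun q hq => h' q (Metric.ball_subset_ball hr hq)⟩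
  -- near one fibre
  have hfib : ∀ α₀ : ℝ, ∃ r > 0, ∀ D p, IsLiftAt I g ξ Pr γ D p → |p.re - α₀| < r →
      ∃ D', D' =ᶠ[𝓝 p] D ∧ ∀ q ∈ Metric.ball p r, IsLiftAt I g ξ Pr γ D' q := by
    intro α₀
    obtain ⟨x₀, hx₀⟩ := hγr (mem_range_self (Circle.exp α₀))
    obtain ⟨U, hU, hsU, r, hr, hext⟩ := (hcomp x₀).induction_on
      (p := fun s => ∃ U, IsOpen U ∧ s ⊆ U ∧ ∃ r > 0, ∀ D p, IsLiftAt I g ξ Pr γ D p → D p ∈ U →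
        |p.re - α₀| < r → ∃ D', D' =ᶠ[𝓝 p] D ∧ ∀ q ∈ Metric.ball p r, IsLiftAt I g ξ Pr γ D' q)
      ⟨∅, isOpen_empty, Subset.rfl, 1, one_pos, fun _ _ _ h => h.elim⟩
      (fun s t hst ⟨U, hU, htU, h⟩ => ⟨U, hU, hst.trans htU, h⟩)
      (by
        rintro s t ⟨U, hU, hsU, r, hr, h⟩ ⟨U', hU', htU', r', hr', h'⟩
        refine ⟨U ∪ U', hU.union hU', union_subset_union hsU htU', min r r', lt_min hr hr', ?_⟩
        rintro D p hD (hp | hp) hα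
        · exact hshrink (min_le_left _ _) (h D p hD hp (hα.trans_le (min_le_left _ _)))
        · exact hshrink (min_le_right _ _) (h' D p hD hp (hα.trans_le (min_le_right _ _))))
      (by
        intro x hx
        obtain ⟨δ, hδ, ρ, hρ, A, G, f, hA, hxA, -, hG, hG'⟩ :=
          K.exists_lift_box hγ hγr (x₀ := x) (α₀ := α₀) ((show Pr x = Pr x₀ from hx).trans hx₀)
        refine ⟨A, mem_nhdsWithin_of_mem_nhds (hA.mem_nhds hxA), A, hA, Subset.rfl, min δ ρ,
          lt_min hδ hρ, fun D p hD hpA hα => ?_⟩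
        obtain ⟨h1, h2⟩ := hG' D p hD hpA (hα.trans_le (min_le_left _ _))
        refine ⟨_, h2.symm, fun q hq => IsLiftAt.translate (by simp) (hG _ ?_)⟩
        rw [mem_ball_iff_norm] at h1 hq ⊢
        have h3 : (⟨p.re, f (D p) p.re⟩ : ℂ) = p + (f (D p) p.re - p.im : ℝ) * Complex.I := by
          apply Complex.ext <;> simp
        rw [h3] at h1
        have h4 : q + (f (D p) p.re - p.im : ℝ) * Complex.I - α₀
            = (q - p) + (p + (f (D p) p.re - p.im : ℝ) * Complex.I - α₀) := by ring
        rw [h4]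
        refine (norm_add_le _ _).trans_lt ?_
        linarith [hq.trans_le (min_le_right _ _)])
    obtain ⟨δ, hδ, hδU⟩ := Metric.eventually_nhds_iff_ball.1
      (K.eventually_fibre_subset hcomp hγ hγr hU (hx₀ ▸ hsU))
    refine ⟨min δ r, lt_min hδ hr, fun D p hD hα => hshrink (min_le_right _ _)
      (hext D p hD ?_ (hα.trans_le (min_le_right _ _)))⟩
    exact hδU p.re (hα.trans_le (min_le_left _ _)) hD.self_of_nhds.2.1
  obtain ⟨r, hr, hext⟩ := (isCompact_Icc (a := -Real.pi) (b := Real.pi)).induction_on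
    (p := fun s => ∃ r > 0, ∀ D p, IsLiftAt I g ξ Pr γ D p → p.re ∈ s →
      ∃ D', D' =ᶠ[𝓝 p] D ∧ ∀ q ∈ Metric.ball p r, IsLiftAt I g ξ Pr γ D' q)
    ⟨1, one_pos, fun _ _ _ h => h.elim⟩
    (fun s t hst ⟨r, hr, h⟩ => ⟨r, hr, fun D p hD hp => h D p hD (hst hp)⟩)
    (by
      rintro s t ⟨r, hr, h⟩ ⟨r', hr', h'⟩
      refine ⟨min r r', lt_min hr hr', ?_⟩
      rintro D p hD (hp | hp)
      · exact hshrink (min_le_left _ _) (h D p hD hp)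
      · exact hshrink (min_le_right _ _) (h' D p hD hp))
    (fun α₀ _ => by
      obtain ⟨r, hr, h⟩ := hfib α₀
      exact ⟨_, mem_nhdsWithin_of_mem_nhds (Metric.ball_mem_nhds α₀ hr), r, hr,
        fun D p hD hp => h D p hD hp⟩)
  refine ⟨r, hr, fun D p hD => ?_⟩
  obtain ⟨m, hm⟩ := Circle.exp_eq_exp.1 (Circle.exp_arg (Circle.exp p.re))
  set c : ℂ := ((m * (2 * Real.pi) : ℝ) : ℂ) with hc
  have hexp : Circle.exp (m * (2 * Real.pi)) = 1 := Circle.exp_eq_one.2 ⟨m, rfl⟩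
  have hc1 : Circle.exp c.re = 1 := by rw [hc, Complex.ofReal_re, hexp]
  have hc2 : Circle.exp (-c).re = 1 := by rw [Complex.neg_re, Circle.exp_neg, hc1, inv_one]
  obtain ⟨D', h1, h2⟩ := hext (fun q => D (q + -c)) (p + c)
    (IsLiftAt.translate hc2 (by rwa [add_neg_cancel_right])) (by
      rw [Complex.add_re, hc, Complex.ofReal_re, ← hm]
      exact ⟨(Complex.neg_pi_lt_arg _).le, Complex.arg_le_pi _⟩)
  refine ⟨fun q => D' (q + c), ?_, fun q hq => IsLiftAt.translate hc1 (h2 _ ?_)⟩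
  · have h3 : ∀ᶠ q in 𝓝 p, D' (q + c) = D (q + c + -c) := by
      have h4 : Filter.Tendsto (fun q : ℂ => q + c) (𝓝 p) (𝓝 (p + c)) :=
        (continuous_add_const c).tendsto p
      exact h4.eventually h1
    filter_upwards [h3] with q hq
    rw [hq, add_neg_cancel_right]
  · rw [mem_ball_iff_norm] at hq ⊢
    rwa [add_sub_add_right_eq_sub]

theorem EktFibration.eq_of_isLiftAt [T2Space N] (K : EktFibration I J κ τ g ξ Pr)
    (hγ : ContMDiff (𝓡 1) J ∞ γ) (hγr : range γ ⊆ range Pr) {C : Set ℂ} (hC : IsPreconnected C)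
    (hD : ∀ q ∈ C, IsLiftAt I g ξ Pr γ D q) (hD' : ∀ q ∈ C, IsLiftAt I g ξ Pr γ D' q)
    (hp : p ∈ C) (h : D p = D' p) : ∀ q ∈ C, D q = D' q := fun q hq =>
  (germ_eq_of_isPreconnected (Adm := IsLiftAt I g ξ Pr γ)
    (fun _ _ h => h.self_of_nhds.1.continuousAt)
    (fun _ _ _ h1 h2 h3 => .of_forall fun _ _ => K.eventuallyEq_of_isLiftAt hγ hγr h1 h2 h3)
    hC hD hD' hp (K.eventuallyEq_of_isLiftAt hγ hγr (hD p hp) (hD' p hp) h) q hq).self_of_nhds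

/-- A closed curve in the base has a lift defined on the whole plane, by the monodromy argument that
also gives developing maps. -/
theorem EktFibration.exists_lift [T2Space N] [T2Space B]
    (K : EktFibration I J κ τ g ξ Pr) (hcomp : ∀ x, IsCompact (Pr ⁻¹' {Pr x}))
    (hγ : ContMDiff (𝓡 1) J ∞ γ) (hγr : range γ ⊆ range Pr) :
    ∃ D : ℂ → N, ∀ p, IsLiftAt I g ξ Pr γ D p := by
  obtain ⟨x₀, hx₀⟩ := hγr (mem_range_self (Circle.exp 0))
  obtain ⟨δ, hδ, ρ, hρ, A, G, f, hA, hx, hG0, hG, -⟩ := K.exists_lift_box hγ hγr hx₀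
  obtain ⟨r, hr, hext⟩ := K.exists_uniform_lift hcomp hγ hγr
  obtain ⟨D, -, hD⟩ := exists_development (Adm := IsLiftAt I g ξ Pr γ) (fun _ _ _ e h => h.congr e)
    (fun _ _ h => h.self_of_nhds.1.continuousAt)
    (fun _ _ _ h1 h2 h3 => .of_forall fun _ _ => K.eventuallyEq_of_isLiftAt hγ hγr h1 h2 h3)
    hr hext (D₀ := G) (hG 0 (by simpa using hρ))
  exact ⟨D, hD⟩

/-- Points of a lift over the same point of the curve differ by a period. -/
theorem EktFibration.lift_add_period [T2Space N] (K : EktFibration I J κ τ g ξ Pr)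
    (hγ : ContMDiff (𝓡 1) J ∞ γ) (hγr : range γ ⊆ range Pr)
    (hD : ∀ p, IsLiftAt I g ξ Pr γ D p) {v : ℂ} (hv : Circle.exp v.re = 1) (h : D (p + v) = D p)
    (z : ℂ) : D (z + v) = D z :=
  K.eq_of_isLiftAt (D := fun z => D (z + v)) hγ hγr isPreconnected_univ
    (fun _ _ => (hD _).translate hv) (fun q _ => hD q) (mem_univ p) h z (mem_univ z)

/-- A lift is periodic along the fibres, if these are compact. -/
theorem EktFibration.exists_vertical_period [T2Space N] (K : EktFibration I J κ τ g ξ Pr)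
    (hcomp : ∀ x, IsCompact (Pr ⁻¹' {Pr x})) (hγ : ContMDiff (𝓡 1) J ∞ γ)
    (hγr : range γ ⊆ range Pr) (hD : ∀ p, IsLiftAt I g ξ Pr γ D p) :
    ∃ l : ℝ, l ≠ 0 ∧ ∀ z, D (z + l * Complex.I) = D z := by
  have hP : ∀ t : ℝ, Pr (D (t * Complex.I)) = γ (Circle.exp 0) := fun t => by
    rw [(hD _).self_of_nhds.2.1]; simp
  have hc : IsCompact (Pr ⁻¹' {γ (Circle.exp 0)}) := by
    rw [← hP 0]; exact hcomp _
  obtain ⟨x, hx, hcl⟩ := hc.exists_mapClusterPt (f := (Filter.atTop : Filter ℝ))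
    (u := fun t : ℝ => D (t * Complex.I)) (by
      rw [Filter.le_principal_iff, Filter.mem_map]
      exact Filter.univ_mem' hP)
  obtain ⟨δ, hδ, ρ, hρ, A, G, f, hA, hxA, -, hG, hG'⟩ := K.exists_lift_box hγ hγr hx
  have hfreq := hcl.frequently (hA.mem_nhds hxA)
  obtain ⟨t, -, ht⟩ := Filter.frequently_atTop.1 hfreq 0
  obtain ⟨t', htt', ht'⟩ := Filter.frequently_atTop.1 hfreq (t + 2 * ρ + 1)
  have h0 : ∀ t : ℝ, |((t : ℂ) * Complex.I).re - 0| < δ := fun t => by simpa using hδ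
  obtain ⟨h1, h2⟩ := hG' D (t * Complex.I) (hD _) ht (h0 t)
  obtain ⟨h1', h2'⟩ := hG' D (t' * Complex.I) (hD _) ht' (h0 t')
  set s := f (D (t * Complex.I)) ((t : ℂ) * Complex.I).re with hs
  set s' := f (D (t' * Complex.I)) ((t' : ℂ) * Complex.I).re with hs'
  have him : ∀ t : ℝ, ((t : ℂ) * Complex.I).im = t := fun t => by simp
  have hsρ : ∀ {s t : ℝ}, (⟨((t : ℂ) * Complex.I).re, s⟩ : ℂ) ∈ Metric.ball ((0 : ℝ) : ℂ) ρ →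
      |s| < ρ := by
    intro s t h
    rw [mem_ball_iff_norm] at h
    simpa using (Complex.abs_im_le_norm _).trans_lt h
  have hs1 := abs_lt.1 (hsρ h1)
  have hs1' := abs_lt.1 (hsρ h1')
  rw [him] at h2 h2'
  -- the two lines pass through `A` along the same trajectory
  have h3 := K.eq_of_isLiftAt hγ hγr (C := Metric.ball ((t - s : ℝ) * Complex.I) (2 * ρ))
    (D' := fun q => G (q + (s - t : ℝ) * Complex.I)) (convex_ball _ _).isPreconnected
    (fun q _ => hD q) (fun q hq => IsLiftAt.translate (by simp) (hG _ (by
      rw [mem_ball_iff_norm] at hq ⊢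
      convert! hq using 2
      push_cast; ring))) (p := t * Complex.I) (by
      rw [mem_ball_iff_norm, ← sub_mul, ← Complex.ofReal_sub, norm_mul, Complex.norm_I, mul_one,
        Complex.norm_real, Real.norm_eq_abs, abs_lt]
      constructor <;> linarith) h2.self_of_nhds ((t - s + s' : ℝ) * Complex.I) (by
      rw [mem_ball_iff_norm, ← sub_mul, ← Complex.ofReal_sub, norm_mul, Complex.norm_I, mul_one,
        Complex.norm_real, Real.norm_eq_abs, abs_lt]
      constructor <;> linarith)
  have h4 := h2'.self_of_nhds
  have h5 : D (t' * Complex.I) = D ((t - s + s' : ℝ) * Complex.I) := by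
    rw [h3, h4]
    push_cast; ring_nf
  refine ⟨t' - (t - s + s'), by linarith, fun z => ?_⟩
  refine K.lift_add_period (p := (t - s + s' : ℝ) * Complex.I) hγ hγr hD (by simp) ?_ z
  rw [← h5]
  congr 1
  push_cast; ring

end HopfTorusConstruction

section HopfTorusConstruction

variable {E : Type*} [NormedAddCommGroup E] [NormedSpace ℝ E]
  {H : Type*} [TopologicalSpace H] {I : ModelWithCorners ℝ E H}
  {N : Type*} [TopologicalSpace N] [ChartedSpace H N]
  {E' : Type*} [NormedAddCommGroup E'] [NormedSpace ℝ E']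
  {H' : Type*} [TopologicalSpace H'] {J : ModelWithCorners ℝ E' H'}
  {B : Type*} [TopologicalSpace B] [ChartedSpace H' B]
  {κ τ : ℝ} {g : N → E →L[ℝ] E →L[ℝ] ℝ} {ξ : N → E} {Pr : N → B} {γ : Circle → B}
  {D : ℂ → N} [I.Boundaryless] [IsManifold I ∞ N]

omit [I.Boundaryless] [IsManifold I ∞ N] in
theorem EktFibration.modelDeriv_lift (K : EktFibration I J κ τ g ξ Pr)
    (hγ : IsClosedRegularCurve J γ) (hD : ∀ p, IsLiftAt I g ξ Pr γ D p) (p : ℂ) :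
    modelDeriv 𝓘(ℝ, ℂ) I D p Complex.I = ξ (D p) ∧
      Function.Injective (modelDeriv 𝓘(ℝ, ℂ) I D p) := by
  have hDs := (hD p).self_of_nhds.1
  have hform : ∀ v, g (D p) (ξ (D p)) (modelDeriv 𝓘(ℝ, ℂ) I D p v) = v.im :=
    (hD p).self_of_nhds.2.2
  set w : EuclideanSpace ℝ (Fin 1) := modelDeriv 𝓘(ℝ, ℝ) (𝓡 1) Circle.exp p.re 1 with hw
  have hproj : ∀ v : ℂ, modelDeriv I J Pr (D p) (modelDeriv 𝓘(ℝ, ℂ) I D p v)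
      = v.re • modelDeriv (𝓡 1) J γ (Circle.exp p.re) w := by
    intro v
    have h1 := modelDeriv_comp (I := 𝓘(ℝ, ℂ)) (I₁ := I) (I₂ := J) (x := p) (F := D) (f := Pr)
      ((K.smooth_proj _).mdifferentiableAt (by simp)) (hDs.mdifferentiableAt (by simp))
    have h2 : Pr ∘ D =ᶠ[𝓝 p] (γ ∘ Circle.exp) ∘ Complex.reCLM := (hD p).mono fun q hq => hq.2.1
    have h3 := modelDeriv_comp_coord (I := J) (F := γ ∘ Circle.exp) (f := Complex.reCLM) (y := p)
      ((hγ.1.comp contMDiff_circleExp _).mdifferentiableAt (by simp))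
      Complex.reCLM.differentiableAt
    have h4 := modelDeriv_comp (I := 𝓘(ℝ, ℝ)) (I₁ := 𝓡 1) (I₂ := J) (x := p.re) (F := Circle.exp)
      (f := γ) ((hγ.1 _).mdifferentiableAt (by simp))
      ((contMDiff_circleExp (m := ∞) _).mdifferentiableAt (by simp))
    rw [modelDeriv_congr h2, h3, Complex.reCLM_apply, h4] at h1
    have h5 := congrArg (fun L : ℂ →L[ℝ] E' => L v) h1
    simp only [ContinuousLinearMap.comp_apply, ContinuousLinearMap.fderiv,
      Complex.reCLM_apply] at h5
    rw [← h5]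
    conv_lhs => rw [← mul_one v.re, ← smul_eq_mul, map_smul, map_smul]
  have hγw : modelDeriv (𝓡 1) J γ (Circle.exp p.re) w ≠ 0 := by
    have h1 : w ≠ 0 := by
      have h2 := modelDeriv_comp (I := 𝓘(ℝ, ℝ)) (I₁ := 𝓡 1) (I₂ := 𝓘(ℝ, ℝ)) (x := p.re)
        (F := Circle.exp) (f := angleAt p.re)
        ((contMDiffAt_angleAt p.re).mdifferentiableAt (by simp))
        ((contMDiff_circleExp (m := ∞) _).mdifferentiableAt (by simp))
      have h3 : angleAt p.re ∘ Circle.exp =ᶠ[𝓝 p.re] fun θ => θ := angleAt_exp_eventually p.re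
      rw [modelDeriv_congr h3, modelDeriv_id] at h2
      have h5 := congrArg (fun L : ℝ →L[ℝ] ℝ => L 1) h2
      simp only [ContinuousLinearMap.comp_apply] at h5
      intro h0
      rw [← hw, h0, map_zero] at h5
      exact one_ne_zero h5
    exact fun h => h1 ((injective_iff_map_eq_zero _).1 (hγ.2 (Circle.exp p.re)) w h)
  constructor
  · obtain ⟨c, hc⟩ := K.ker ((hproj Complex.I).trans (by simp))
    have h1 := hform Complex.I
    rw [hc, map_smul, K.unit, smul_eq_mul, mul_one, Complex.I_im] at h1
    rw [hc, h1, one_smul]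
  · rw [injective_iff_map_eq_zero]
    intro v hv
    have h1 := hproj v
    have h2 := hform v
    rw [hv, map_zero, eq_comm] at h1 h2
    exact Complex.ext ((smul_eq_zero.1 h1).resolve_right hγw) h2

/-- The inverse image of a closed curve is a flat torus: it is the quotient of the plane by the
periods of a lift. -/
theorem EktFibration.everyHopfTorusIsFlat [T2Space N] [T2Space B] [IsManifold J ∞ B]
    (K : EktFibration I J κ τ g ξ Pr) (hcomp : ∀ x, IsCompact (Pr ⁻¹' {Pr x})) :
    EveryHopfTorusIsFlat (I := I) J g Pr := by
  intro γ hγ hγr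
  obtain ⟨D, hD⟩ := K.exists_lift hcomp hγ.1 hγr
  have hDs : ∀ q, ContMDiffAt 𝓘(ℝ, ℂ) I ∞ D q := fun q => (hD q).self_of_nhds.1
  have hDc : Continuous D := continuous_iff_continuousAt.2 fun q => (hDs q).continuousAt
  have hDP : ∀ q, Pr (D q) = γ (Circle.exp q.re) := fun q => (hD q).self_of_nhds.2.1
  have hv : ∀ q, modelDeriv 𝓘(ℝ, ℂ) I D q Complex.I = ξ (D q) := fun q =>
    (K.modelDeriv_lift hγ hD q).1
  have hinj : ∀ q, Function.Injective (modelDeriv 𝓘(ℝ, ℂ) I D q) := fun q =>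
    (K.modelDeriv_lift hγ hD q).2
  -- the vertical periods
  let Γ : AddSubgroup ℝ :=
    { carrier := {t | ∀ z : ℂ, D (z + t * Complex.I) = D z}
      zero_mem' := fun z => by simp
      add_mem' := fun {a b} ha hb z => by
        rw [Complex.ofReal_add, add_mul, ← add_assoc, hb, ha]
      neg_mem' := fun {a} ha z => by
        rw [← ha (z + _)]; congr 1; push_cast; ring }
  have hΓ : ∀ t : ℝ, t ∈ Γ ↔ ∀ z : ℂ, D (z + t * Complex.I) = D z := fun t => Iff.rfl
  obtain ⟨l₀, hl₀, hper₀⟩ := K.exists_vertical_period hcomp hγ.1 hγr hD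
  obtain ⟨l₁, hl₁⟩ := (AddSubgroup.dense_or_cyclic Γ).resolve_left (fun hd => by
    have hcl : IsClosed {t : ℝ | D (t * Complex.I) = D 0} :=
      isClosed_eq (hDc.comp (by fun_prop)) continuous_const
    have h1 : (Γ : Set ℝ) ⊆ {t : ℝ | D (t * Complex.I) = D 0} := fun t ht => by
      simpa using ht 0
    have h2 := hcl.closure_subset_iff.2 h1
    rw [hd.closure_eq] at h2
    have h3 : HasFDerivAt (fun t : ℝ => (t : ℂ) * Complex.I)
        (Complex.ofRealCLM.smulRight Complex.I) 0 :=
      (Complex.ofRealCLM.smulRight Complex.I).hasFDerivAt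
    have h4 := modelDeriv_comp_coord (I := I) (F := D) (f := fun t : ℝ => (t : ℂ) * Complex.I)
      ((hDs _).mdifferentiableAt (by simp)) h3.differentiableAt
    have h5 : (D ∘ fun t : ℝ => (t : ℂ) * Complex.I) = fun _ => D 0 := by
      ext t
      exact h2 (mem_univ t)
    rw [h5, h3.fderiv, modelDeriv, mfderiv_const] at h4
    have h6 := congrArg (fun L : ℝ →L[ℝ] E => L 1) h4
    simp only [ContinuousLinearMap.comp_apply, ContinuousLinearMap.smulRight_apply,
      Complex.ofRealCLM_apply, Complex.ofReal_one, one_smul, hv] at h6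
    exact K.ne_zero _ h6.symm)
  have hl₁0 : l₁ ≠ 0 := by
    rintro rfl
    have h1 : l₀ ∈ Γ := hper₀
    rw [hl₁, AddSubgroup.mem_closure_singleton] at h1
    obtain ⟨k, hk⟩ := h1
    exact hl₀ (by rw [← hk, smul_zero])
  obtain ⟨l, hl, hΓl⟩ : ∃ l : ℝ, 0 < l ∧ ∀ t, t ∈ Γ ↔ ∃ k : ℤ, t = k * l := by
    refine ⟨|l₁|, abs_pos.2 hl₁0, fun t => ?_⟩
    rw [hl₁, AddSubgroup.mem_closure_singleton]
    rcases abs_choice l₁ with h | h <;> rw [h]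
    · exact exists_congr fun k => by rw [zsmul_eq_mul, eq_comm]
    · constructor
      · rintro ⟨k, hk⟩; exact ⟨-k, by rw [← hk, zsmul_eq_mul]; push_cast; ring⟩
      · rintro ⟨k, hk⟩; exact ⟨-k, by rw [hk, zsmul_eq_mul]; push_cast; ring⟩
  have hper : ∀ z : ℂ, D (z + l * Complex.I) = D z := (hΓl l).2 ⟨1, by simp⟩
  have hfibre := K.range_vertical_circle hDs hv hl hper
  -- the period along the curve
  obtain ⟨b, hb⟩ : ∃ b : ℝ, D ((2 * Real.pi : ℝ) : ℂ) = D (b * Complex.I) := by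
    have h1 : D ((2 * Real.pi : ℝ) : ℂ) ∈ Pr ⁻¹' {Pr (D 0)} := by
      rw [mem_preimage, hDP, hDP, Complex.ofReal_re, Circle.exp_two_pi]
      simp
    rw [← hfibre 0] at h1
    obtain ⟨t, ht⟩ := h1
    exact ⟨Complex.arg t / (2 * Real.pi) * l, by rw [← ht]; simp⟩
  have hper' : ∀ z, D (z + (⟨2 * Real.pi, -b⟩ : ℂ)) = D z := by
    refine K.lift_add_period (p := b * Complex.I) hγ.1 hγr hD Circle.exp_two_pi ?_
    rw [← hb]
    congr 1
    apply Complex.ext <;> simp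
  have h2π : 2 * Real.pi ≠ 0 := by positivity
  set e := latticeEquiv (2 * Real.pi) (-b) l h2π hl.ne' with he
  have hp : ∀ (z : ℂ) (m n : ℤ), D (z + e (m * (2 * Real.pi), n * (2 * Real.pi))) = D z := by
    let Γ' : AddSubgroup ℂ :=
      { carrier := {v | ∀ z, D (z + v) = D z}
        zero_mem' := fun z => by rw [add_zero]
        add_mem' := fun {a b} ha hb z => by rw [← add_assoc, hb, ha]
        neg_mem' := fun {a} ha z => by rw [← ha (z + -a), neg_add_cancel_right] }
    intro z m n
    have h1 : e (m * (2 * Real.pi), n * (2 * Real.pi)) ∈ Γ' := by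
      convert! Γ'.add_mem (Γ'.zsmul_mem (show (⟨2 * Real.pi, -b⟩ : ℂ) ∈ Γ' from hper') m)
        (Γ'.zsmul_mem (show (l * Complex.I : ℂ) ∈ Γ' from hper) n) using 1
      rw [he, latticeEquiv_int]
      apply Complex.ext <;> simp
    exact h1 z
  have hΦe : ∀ α β : ℝ, torusMap D e (Circle.exp α, Circle.exp β)
      = D (e (α, 0) + (β / (2 * Real.pi) * l : ℝ) * Complex.I) := fun α β => by
    rw [← latticeEquiv_apply_add]
    exact torusMap_torusExp hp (α, β)
  have hΦs : IsSmoothImmersion ((𝓡 1).prod (𝓡 1)) I (torusMap D e) := by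
    refine ⟨contMDiff_torusMap hp hDs, fun st => ?_⟩
    rw [← torusExp_arg st]
    obtain ⟨M, hM, hM'⟩ := modelDeriv_torusMap hp hDs (Complex.arg st.1, Complex.arg st.2)
    change Function.Injective (modelDeriv ((𝓡 1).prod (𝓡 1)) I (torusMap D e) _)
    rw [hM']
    exact (hinj _).comp hM.1
  refine ⟨torusMap D e, hΦs, K.isFlatSurface_of_vertical ?_ hΦs fun st => ?_, fun s => ⟨?_, ?_⟩⟩
  · simp [Module.finrank_prod]
  · rw [← torusExp_arg st]
    obtain ⟨M, hM, hM'⟩ := modelDeriv_torusMap hp hDs (Complex.arg st.1, Complex.arg st.2)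
    obtain ⟨v, hv'⟩ := hM.2 Complex.I
    exact ⟨v, by rw [hM', ContinuousLinearMap.comp_apply, hv', hv, torusMap_torusExp hp]⟩
  · intro t t' htt'
    rw [← Circle.exp_arg s, ← Circle.exp_arg t, ← Circle.exp_arg t'] at htt'
    simp only [hΦe] at htt'
    set x := e (Complex.arg s, 0)
    set y := Complex.arg t / (2 * Real.pi) * l with hy
    set y' := Complex.arg t' / (2 * Real.pi) * l with hy'
    have h1 : y' - y ∈ Γ := by
      refine K.lift_add_period (p := x + y * Complex.I) hγ.1 hγr hD (by simp) ?_
      rw [htt']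
      congr 1
      push_cast; ring
    obtain ⟨k, hk⟩ := (hΓl _).1 h1
    rw [← Circle.exp_arg t, ← Circle.exp_arg t', eq_comm, Circle.exp_eq_exp]
    refine ⟨k, ?_⟩
    rw [hy, hy', ← sub_mul, mul_right_cancel_iff_of_pos hl, ← sub_div, div_eq_iff h2π] at hk
    linarith
  · have h1 := hfibre (e (Complex.arg s, 0))
    rw [hDP, show (e (Complex.arg s, 0)).re = Complex.arg s by
      rw [he, latticeEquiv_apply]; field_simp, Circle.exp_arg] at h1
    rw [← h1]
    congr 1
    ext t
    conv_lhs => rw [← Circle.exp_arg s, ← Circle.exp_arg t]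
    exact hΦe _ _

end HopfTorusConstruction

/-! ### Smooth metrics in coordinates -/

section SmoothMetrics

variable {E : Type*} [NormedAddCommGroup E] [NormedSpace ℝ E]
  {H : Type*} [TopologicalSpace H] {I : ModelWithCorners ℝ E H}
  {N : Type*} [TopologicalSpace N] [ChartedSpace H N] [IsManifold I ∞ N]
  {W : Type*} [NormedAddCommGroup W] [NormedSpace ℝ W]

theorem contMDiffOn_modelDeriv_section {F : W → N} {U : Set W} (hU : IsOpen U)
    (hF : ContMDiffOn 𝓘(ℝ, W) I ∞ F U) (u : W) :
    ContMDiffOn 𝓘(ℝ, W) I.tangent ∞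
      (fun y => (⟨F y, modelDeriv 𝓘(ℝ, W) I F y u⟩ : TangentBundle I N)) U := by
  have : IsManifold I 1 N := IsManifold.of_le (n := ∞) (by simp)
  have h1 := hF.contMDiffOn_tangentMapWithin (m := ∞) (by simp) hU.uniqueMDiffOn
  have h2 : ContMDiffOn 𝓘(ℝ, W) 𝓘(ℝ, W).tangent ∞
      (fun y : W => (⟨y, u⟩ : TangentBundle 𝓘(ℝ, W) W)) U := fun y hy =>
    contMDiffWithinAt_vectorSpace_iff_contDiffWithinAt.2 contDiffWithinAt_const
  refine (h1.comp h2 fun y hy => hy).congr fun y hy => ?_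
  simp only [Function.comp_apply, tangentMapWithin, mfderivWithin_of_isOpen hU hy]
  rfl

/-- A smooth metric in local coordinates. -/
theorem contDiffOn_indMetric [FiniteDimensional ℝ W] (g : SmoothMetric I N) {F : W → N} {U : Set W}
    (hU : IsOpen U) (hF : ContMDiffOn 𝓘(ℝ, W) I ∞ F U) :
    ContDiffOn ℝ ∞ (indMetric I g.inner F) U := by
  rw [contDiffOn_clm_apply]; intro u
  rw [contDiffOn_clm_apply]; intro v
  have h1 := ContMDiffOn.clm_bundle_apply₂ (F₁ := E) (F₂ := E) (F₃ := ℝ)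
    (E₃ := Bundle.Trivial N ℝ) (g.contMDiff.comp_contMDiffOn hF)
    (contMDiffOn_modelDeriv_section hU hF u) (contMDiffOn_modelDeriv_section hU hF v)
  rw [← contMDiffOn_iff_contDiffOn]
  intro y hy
  exact ((contMDiffWithinAt_totalSpace).1 (h1 y hy)).2

theorem contDiffOn_vertForm [FiniteDimensional ℝ W] (g : SmoothMetric I N)
    {ξ : (x : N) → TangentSpace I x}
    (hξ : ContMDiff I I.tangent ∞ (fun x : N => (⟨x, ξ x⟩ : TangentBundle I N)))
    {F : W → N} {U : Set W} (hU : IsOpen U) (hF : ContMDiffOn 𝓘(ℝ, W) I ∞ F U) :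
    ContDiffOn ℝ ∞ (vertForm I g.inner ξ F) U := by
  rw [contDiffOn_clm_apply]; intro v
  have h1 := ContMDiffOn.clm_bundle_apply₂ (F₁ := E) (F₂ := E) (F₃ := ℝ)
    (E₃ := Bundle.Trivial N ℝ) (g.contMDiff.comp_contMDiffOn hF)
    (hξ.comp_contMDiffOn hF) (contMDiffOn_modelDeriv_section hU hF v)
  rw [← contMDiffOn_iff_contDiffOn]
  intro y hy
  exact ((contMDiffWithinAt_totalSpace).1 (h1 y hy)).2

/-- A smooth Riemannian metric, smoothness being expressed in the charts. -/
structure IsMetric (I : ModelWithCorners ℝ E H) (g : N → E →L[ℝ] E →L[ℝ] ℝ) : Prop where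
  symm : ∀ x v w, g x v w = g x w v
  pos : ∀ x v, v ≠ 0 → 0 < g x v v
  smooth : ∀ x, ContDiffOn ℝ ∞ (indMetric I g (extChartAt I x).symm) (extChartAt I x).target

theorem isMetric_of_smoothMetric [I.Boundaryless] [FiniteDimensional ℝ E] (g : SmoothMetric I N) :
    IsMetric I g.inner :=
  ⟨g.symm, g.pos, fun x => contDiffOn_indMetric g (isOpen_extChartAt_target x)
    fun _ hz => (contMDiffAt_extChartAt_symm hz).contMDiffWithinAt⟩

/-- The Gauss curvature can be read in any chart. -/
theorem gaussAt_of_hasGaussCurvatureAt [I.Boundaryless] [FiniteDimensional ℝ E]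
    (hE : Module.finrank ℝ E = 2) {g : N → E →L[ℝ] E →L[ℝ] ℝ} (hg : IsMetric I g) {κ : ℝ}
    (hκ : ∀ x, HasGaussCurvatureAt (I := I) g x κ) {x : N} {y : E}
    (hy : y ∈ (extChartAt I x).target) : GaussAt (indMetric I g (extChartAt I x).symm) y κ := by
  set φ := extChartAt I x with hφ
  set x' := φ.symm y with hx'
  set ψ := extChartAt I x' with hψ
  have hx's : x' ∈ ψ.source := mem_extChartAt_source x'
  have hyt : ψ x' ∈ ψ.target := ψ.map_source hx's
  have hto := isOpen_extChartAt_target (I := I) x'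
  have hd : ∀ z ∈ ψ.target, ContMDiffAt 𝓘(ℝ, E) I ∞ ψ.symm z := fun z hz =>
    contMDiffAt_extChartAt_symm hz
  obtain ⟨Ψ, ϖ, hc⟩ := exists_complexCoframe hE hto
    (hg.smooth x') (fun z hz u v => hg.symm _ _ _) (fun z hz u hu => hg.pos _ _ fun h0 => hu
      ((injective_iff_map_eq_zero _).1 (injective_modelDeriv_extChartAt_symm hz) u h0))
  have hev : ∀ᶠ z in 𝓝 y, z ∈ φ.target ∧ φ.symm z ∈ ψ.source := by
    have hc1 : ContinuousAt φ.symm y := (contMDiffAt_extChartAt_symm hy).continuousAt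
    filter_upwards [(isOpen_extChartAt_target (I := I) x).mem_nhds hy,
      hc1.preimage_mem_nhds ((isOpen_extChartAt_source (I := I) x').mem_nhds hx's)] with z h1 h2
      using ⟨h1, h2⟩
  obtain ⟨A, hA, hAo, hyA⟩ := eventually_nhds_iff.1 hev
  have hsm : ∀ z ∈ A, ContDiffAt ℝ ∞ (ψ ∘ φ.symm) z := fun z hz =>
    ((contMDiffAt_extChartAt_of_mem (hA z hz).2).comp z
      (contMDiffAt_extChartAt_symm (hA z hz).1)).contDiffAt
  have heq : ∀ z ∈ A, φ.symm =ᶠ[𝓝 z] ψ.symm ∘ (ψ ∘ φ.symm) := by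
    intro z hz
    filter_upwards [hAo.mem_nhds hz] with w hw
    simp only [Function.comp_apply]
    rw [ψ.left_inv (hA w hw).2]
  have hmd : ∀ z ∈ A, MDifferentiableAt 𝓘(ℝ, E) I ψ.symm ((ψ ∘ φ.symm) z) := fun z hz =>
    (hd _ (ψ.map_source (hA z hz).2)).mdifferentiableAt (by simp)
  refine GaussAt.pull hc hE hE hAo (fun z hz => (hsm z hz).contDiffWithinAt)
    (fun z hz => ψ.map_source (hA z hz).2) ?_ ?_ hyA (hκ x')
  · intro z hz
    have h1 := injective_modelDeriv_extChartAt_symm (hA z hz).1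
    rw [modelDeriv_congr (heq z hz)] at h1
    intro u v huv
    apply h1
    rw [modelDeriv_comp_coord (hmd z hz) ((hsm z hz).differentiableAt (by simp))]
    exact congrArg (modelDeriv 𝓘(ℝ, E) I ψ.symm ((ψ ∘ φ.symm) z)) huv
  · intro z hz u v
    rw [indMetric_congr (heq z hz), indMetric_comp (hmd z hz)
      ((hsm z hz).differentiableAt (by simp))]

/-- The coordinate frames of a chart and of its inverse are inverse to each other. -/
theorem modelDeriv_symm_extChartAt [I.Boundaryless] {x₀ x : N}
    (hx : x ∈ (extChartAt I x₀).source) (v : E) :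
    modelDeriv 𝓘(ℝ, E) I (extChartAt I x₀).symm (extChartAt I x₀ x)
      (modelDeriv I 𝓘(ℝ, E) (extChartAt I x₀) x v) = v := by
  set φ := extChartAt I x₀
  have h1 := modelDeriv_comp (I := I) (I₁ := 𝓘(ℝ, E)) (I₂ := I) (F := φ) (f := φ.symm) (x := x)
    ((contMDiffAt_extChartAt_symm (φ.map_source hx)).mdifferentiableAt (by simp))
    ((contMDiffAt_extChartAt_of_mem hx).mdifferentiableAt (by simp))
  have h2 : (φ.symm ∘ φ) =ᶠ[𝓝 x] fun x => x := by
    filter_upwards [(isOpen_extChartAt_source (I := I) x₀).mem_nhds hx] with z hz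
      using φ.left_inv hz
  rw [modelDeriv_congr h2, modelDeriv_id] at h1
  exact (congrArg (fun L : E →L[ℝ] E => L v) h1).symm

theorem modelDeriv_extChartAt_symm [I.Boundaryless] {x₀ x : N}
    (hx : x ∈ (extChartAt I x₀).source) (v : E) :
    modelDeriv I 𝓘(ℝ, E) (extChartAt I x₀) x
      (modelDeriv 𝓘(ℝ, E) I (extChartAt I x₀).symm (extChartAt I x₀ x) v) = v := by
  set φ := extChartAt I x₀
  have hy := φ.map_source hx
  have h0 : φ.symm (φ x) = x := φ.left_inv hx
  have h1 := modelDeriv_comp (I := 𝓘(ℝ, E)) (I₁ := I) (I₂ := 𝓘(ℝ, E)) (F := φ.symm) (f := φ)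
    (x := φ x) ((contMDiffAt_extChartAt_of_mem (by rwa [h0])).mdifferentiableAt (by simp))
    ((contMDiffAt_extChartAt_symm hy).mdifferentiableAt (by simp))
  have h2 : (φ ∘ φ.symm) =ᶠ[𝓝 (φ x)] fun x => x := by
    filter_upwards [(isOpen_extChartAt_target (I := I) x₀).mem_nhds hy] with z hz
      using φ.right_inv hz
  rw [modelDeriv_congr h2, modelDeriv_id, h0] at h1
  exact (congrArg (fun L : E →L[ℝ] E => L v) h1).symm

/-- The structure equations of a surface of constant curvature, in a chart. -/
theorem exists_surface_coframe [I.Boundaryless] [FiniteDimensional ℝ E]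
    (hE : Module.finrank ℝ E = 2) {g : N → E →L[ℝ] E →L[ℝ] ℝ} (hg : IsMetric I g) {κ : ℝ}
    (hκ : ∀ x, HasGaussCurvatureAt (I := I) g x κ) (x₀ : N) :
    ∃ a b ϖ : E → E →L[ℝ] ℝ, IsEktCoframeOn κ 0 a b 0 ϖ (extChartAt I x₀).target ∧
      (∀ y ∈ (extChartAt I x₀).target, ∀ u v,
        indMetric I g (extChartAt I x₀).symm y u v = a y u * a y v + b y u * b y v) ∧
      ∀ x ∈ (extChartAt I x₀).source, ∀ u v : E, g x u v
        = a (extChartAt I x₀ x) (modelDeriv I 𝓘(ℝ, E) (extChartAt I x₀) x u)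
            * a (extChartAt I x₀ x) (modelDeriv I 𝓘(ℝ, E) (extChartAt I x₀) x v)
          + b (extChartAt I x₀ x) (modelDeriv I 𝓘(ℝ, E) (extChartAt I x₀) x u)
            * b (extChartAt I x₀ x) (modelDeriv I 𝓘(ℝ, E) (extChartAt I x₀) x v) := by
  set φ := extChartAt I x₀ with hφ
  have hto := isOpen_extChartAt_target (I := I) x₀
  obtain ⟨Ψ, ϖ, hc⟩ := exists_complexCoframe hE hto
    (hg.smooth x₀) (fun z hz u v => hg.symm _ _ _) (fun z hz u hu => hg.pos _ _ fun h0 => hu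
      ((injective_iff_map_eq_zero _).1 (injective_modelDeriv_extChartAt_symm hz) u h0))
  have hmetric : ∀ y ∈ φ.target, ∀ u v, indMetric I g φ.symm y u v
      = (Ψ y u).re * (Ψ y v).re + (Ψ y u).im * (Ψ y v).im := by
    intro y hy u v
    rw [hc.metric y hy, Complex.inner]
    simp [mul_comm]
  have hΨd : ∀ (L : ℂ →L[ℝ] ℝ), ∀ y ∈ φ.target, ∀ u v,
      extD (fun y => L.comp (Ψ y)) y u v = L (extD Ψ y u v) := by
    intro L y hy u v
    have h1 := ((hc.smooth.contDiffAt (hto.mem_nhds hy)).differentiableAt (by simp)).hasFDerivAt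
    have h2 := (hasFDerivAt_const L y).clm_comp h1
    rw [extD, h2.fderiv, extD, map_sub]
    simp
  refine ⟨fun y => Complex.reCLM.comp (Ψ y), fun y => Complex.imCLM.comp (Ψ y), fun y => -ϖ y,
    ⟨hto, contDiffOn_const.clm_comp hc.smooth, contDiffOn_const.clm_comp hc.smooth,
      contDiffOn_const, hc.smooth_connection.neg, ?_, ?_, ?_, ?_⟩, hmetric, ?_⟩
  · intro y hy u v
    rw [hΨd _ y hy, hc.d_eq y hy]
    simp [wedge]; ring
  · intro y hy u v
    rw [hΨd _ y hy, hc.d_eq y hy]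
    simp [wedge]; ring
  · intro y hy u v
    simp [extD]
  · intro y hy u v
    have h1 := (hc.gaussAt_iff hE hy).1 (gaussAt_of_hasGaussCurvatureAt hE hg hκ hy) u v
    have h2 : extD (fun y => -ϖ y) y u v = - extD ϖ y u v := by
      rw [extD, extD, fderiv_fun_neg]
      simp; ring
    rw [h2, h1]
    simp only [wedge, ContinuousLinearMap.comp_apply, Complex.reCLM_apply, Complex.imCLM_apply,
      Complex.mul_im, Complex.conj_re, Complex.conj_im]
    ring
  · intro x hx u v
    have h1 := hmetric (φ x) (φ.map_source hx) (modelDeriv I 𝓘(ℝ, E) φ x u)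
      (modelDeriv I 𝓘(ℝ, E) φ x v)
    rw [indMetric_apply, modelDeriv_symm_extChartAt hx, modelDeriv_symm_extChartAt hx,
      φ.left_inv hx] at h1
    exact h1

end SmoothMetrics

/-! ### The Heisenberg group -/

section Heisenberg

/-- The coframe of the Heisenberg group is `dx`, `dy`, `dz + τ (y dx - x dy)`, over the flat plane. -/
theorem ektLike_nil (τ : ℝ) :
    EktLike (N := ℝ × ℝ × ℝ) 𝓘(ℝ, ℝ × ℝ × ℝ) 0 τ (nilMetric τ) (fun _ => (0, 0, 1)) := by
  set dx : ℝ × ℝ × ℝ →L[ℝ] ℝ := ContinuousLinearMap.fst ℝ ℝ (ℝ × ℝ) with hdx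
  set dy : ℝ × ℝ × ℝ →L[ℝ] ℝ :=
    (ContinuousLinearMap.fst ℝ ℝ ℝ).comp (ContinuousLinearMap.snd ℝ ℝ (ℝ × ℝ)) with hdy
  set dz : ℝ × ℝ × ℝ →L[ℝ] ℝ :=
    (ContinuousLinearMap.snd ℝ ℝ ℝ).comp (ContinuousLinearMap.snd ℝ ℝ (ℝ × ℝ)) with hdz
  set c : ℝ × ℝ × ℝ → ℝ × ℝ × ℝ →L[ℝ] ℝ := fun p => dz + τ • (p.2.1 • dx - p.1 • dy) with hc
  have hg : ∀ p (v w : ℝ × ℝ × ℝ), nilMetric τ p v w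
      = dx v * dx w + dy v * dy w + c p v * c p w := fun p v w => rfl
  have hcs : ContDiff ℝ ∞ c := by
    have h1 : ContDiff ℝ ∞ fun p : ℝ × ℝ × ℝ => dy p • dx - dx p • dy :=
      (dy.contDiff.smul contDiff_const).sub (dx.contDiff.smul contDiff_const)
    exact contDiff_const.add (h1.const_smul τ)
  have hcd : ∀ p u, fderiv ℝ c p u = τ • (dy u • dx - dx u • dy) := by
    intro p u
    have h1 : HasFDerivAt c (τ • (dy.smulRight dx - dx.smulRight dy)) p :=
      (((dy.smulRight dx - dx.smulRight dy).hasFDerivAt (x := p)).const_smul τ).const_add dz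
    rw [h1.fderiv]
    rfl
  have hcof : IsEktCoframeOn 0 (-τ) (fun _ => dx) (fun _ => dy) c (fun _ => 0) univ :=
    ⟨isOpen_univ, contDiffOn_const, contDiffOn_const, hcs.contDiffOn, contDiffOn_const,
      fun y _ u v => by simp [extD, wedge], fun y _ u v => by simp [extD, wedge],
      fun y _ u v => by
        simp only [extD, hcd, wedge, smul_apply, sub_apply, smul_eq_mul]
        ring,
      fun y _ u v => by simp [extD]⟩
  refine ⟨fun p v hv => ?_, fun p => ?_, fun q => ⟨-τ, by ring, fun x => x, univ, _, _, _, _, univ,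
    isOpen_univ, mem_univ _, contMDiff_id.contMDiffOn, mapsTo_univ _ _, hcof, fun x _ => ⟨?_, ?_⟩⟩⟩
  · refine lt_of_lt_of_eq ?_ (hg p v v).symm
    by_contra h
    have h1 : dx v = 0 := by nlinarith [sq_nonneg (dx v), sq_nonneg (dy v), sq_nonneg (c p v)]
    have h2 : dy v = 0 := by nlinarith [sq_nonneg (dx v), sq_nonneg (dy v), sq_nonneg (c p v)]
    have h3 : c p v = 0 := by nlinarith [sq_nonneg (dx v), sq_nonneg (dy v), sq_nonneg (c p v)]
    have h4 : dz v = 0 := by simpa [hc, h1, h2] using h3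
    exact hv (Prod.ext h1 (Prod.ext h2 h4))
  · refine (hg p (0, 0, 1) (0, 0, 1)).trans ?_
    simp [hdx, hdy, hdz, hc]
  · intro v w
    rw [modelDeriv_id]
    exact hg x v w
  · intro v
    rw [modelDeriv_id]
    refine (hg x (0, 0, 1) v).trans ?_
    simp [hdx, hdy, hdz, hc]

/-- The height `z` increases along the vertical field. -/
theorem noFlatCompactSurface_nil {τ : ℝ} (hτ : τ ≠ 0) :
    NoFlatCompactSurface.{u} (nilMetric τ) := by
  set dz : ℝ × ℝ × ℝ →L[ℝ] ℝ :=
    (ContinuousLinearMap.snd ℝ ℝ ℝ).comp (ContinuousLinearMap.snd ℝ ℝ (ℝ × ℝ)) with hdz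
  refine (ektLike_nil τ).noFlatCompactSurface (f := dz) ?_ dz.contDiff.contMDiff fun x => ?_
  · have := sq_pos_of_ne_zero hτ
    linarith
  · rw [modelDeriv_eq_fderiv, dz.fderiv]
    simp [hdz]

end Heisenberg

/-! ### Products -/

section Products

variable {E : Type*} [NormedAddCommGroup E] [NormedSpace ℝ E] [FiniteDimensional ℝ E]
  {H : Type*} [TopologicalSpace H] {I : ModelWithCorners ℝ E H} [I.Boundaryless]
  {M : Type*} [TopologicalSpace M] [ChartedSpace H M] [IsManifold I ∞ M]
  {E' : Type*} [NormedAddCommGroup E'] [NormedSpace ℝ E']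
  {H' : Type*} [TopologicalSpace H'] {I' : ModelWithCorners ℝ E' H'} [I'.Boundaryless]
  {X : Type*} [TopologicalSpace X] [ChartedSpace H' X] [IsManifold I' ∞ X]

/-- The metric `g'` of a curve, with its unit field `ξ'`, in terms of local arc length
parameters `θ`. -/
structure IsLineMetric (I' : ModelWithCorners ℝ E' H') (g' : X → E' →L[ℝ] E' →L[ℝ] ℝ)
    (ξ' : X → E') : Prop where
  pos : ∀ x v, v ≠ 0 → 0 < g' x v v
  param : ∀ x₀, ∃ (θ : X → ℝ) (B : Set X), IsOpen B ∧ x₀ ∈ B ∧ ContMDiffOn I' 𝓘(ℝ, ℝ) ∞ θ B ∧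
    ∀ x ∈ B, (∀ v w, g' x v w = modelDeriv I' 𝓘(ℝ, ℝ) θ x v * modelDeriv I' 𝓘(ℝ, ℝ) θ x w) ∧
      modelDeriv I' 𝓘(ℝ, ℝ) θ x (ξ' x) = 1

omit [FiniteDimensional ℝ E] [I.Boundaryless] [IsManifold I ∞ M] [I'.Boundaryless]
  [IsManifold I' ∞ X] in
theorem modelDeriv_fst_apply (p : M × X) (v : E × E') :
    modelDeriv (I.prod I') I (Prod.fst : M × X → M) p v = v.1 := by
  rw [modelDeriv, mfderiv_fst]
  rfl

omit [FiniteDimensional ℝ E] [I.Boundaryless] [IsManifold I ∞ M] [I'.Boundaryless]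
  [IsManifold I' ∞ X] in
theorem modelDeriv_snd_apply (p : M × X) (v : E × E') :
    modelDeriv (I.prod I') I' (Prod.snd : M × X → X) p v = v.2 := by
  rw [modelDeriv, mfderiv_snd]
  rfl

/-- The coframe of a product consists of a coframe of the surface and the arc length form of the
curve; the bundle curvature is `0`. -/
theorem ektLike_prod (hE : Module.finrank ℝ E = 2) {gM : M → E →L[ℝ] E →L[ℝ] ℝ}
    (hg : IsMetric I gM) {κ : ℝ} (hκ : ∀ x, HasGaussCurvatureAt (I := I) gM x κ)
    {g' : X → E' →L[ℝ] E' →L[ℝ] ℝ} {ξ' : X → E'} (h' : IsLineMetric I' g' ξ') :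
    EktLike (N := M × X) (I.prod I') κ 0 (prodMetric (I := I) (J := I') gM g')
      (fun p => (0, ξ' p.2)) := by
  have happ : ∀ (p : M × X) (v w : E × E'), prodMetric (I := I) (J := I') gM g' p v w
      = gM p.1 v.1 w.1 + g' p.2 v.2 w.2 := by
    intro p v w
    have h1 : prodMetric (I := I) (J := I') gM g' p v w
      = gM p.1 (modelDeriv (I.prod I') I (Prod.fst : M × X → M) p v)
          (modelDeriv (I.prod I') I (Prod.fst : M × X → M) p w)
        + g' p.2 (modelDeriv (I.prod I') I' (Prod.snd : M × X → X) p v)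
          (modelDeriv (I.prod I') I' (Prod.snd : M × X → X) p w) := rfl
    rw [h1]
    simp only [modelDeriv_fst_apply, modelDeriv_snd_apply]
  have hunit : ∀ x, g' x (ξ' x) (ξ' x) = 1 := by
    intro x
    obtain ⟨θ, B, -, hx, -, hB⟩ := h'.param x
    rw [(hB x hx).1, (hB x hx).2, mul_one]
  refine ⟨fun p v hv => ?_, fun p => ?_, fun q => ?_⟩
  · obtain ⟨v₁, v₂⟩ := v
    refine lt_of_lt_of_eq ?_ (happ p (v₁, v₂) (v₁, v₂)).symm
    by_cases h1 : v₁ = 0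
    · subst h1
      have h2 : v₂ ≠ 0 := fun h => hv (by rw [h]; rfl)
      have := h'.pos p.2 v₂ h2
      simpa using this
    · have h2 := hg.pos p.1 v₁ h1
      by_cases h3 : v₂ = 0
      · subst h3; simpa using h2
      · exact add_pos h2 (h'.pos _ _ h3)
  · refine (happ p (0, ξ' p.2) (0, ξ' p.2)).trans ?_
    simp [hunit]
  · obtain ⟨a, b, ϖ, hc, -, hab⟩ := exists_surface_coframe hE hg hκ q.1
    obtain ⟨θ, B, hB, hq, hθ, hθ'⟩ := h'.param q.2
    set φ := extChartAt I q.1 with hφ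
    have hpull := hc.pull (F := (Prod.fst : E × ℝ → E)) (U := φ.target ×ˢ univ)
      ((isOpen_extChartAt_target q.1).prod isOpen_univ) contDiff_fst.contDiffOn
      (fun x hx => hx.1)
    have hco : IsEktCoframeOn κ 0 (pullForm Prod.fst a) (pullForm Prod.fst b)
        (fun _ => ContinuousLinearMap.snd ℝ E ℝ) (pullForm Prod.fst ϖ) (φ.target ×ˢ univ) :=
      ⟨hpull.isOpen, hpull.smooth_a, hpull.smooth_b, contDiffOn_const, hpull.smooth_ϖ, hpull.d_a,
        hpull.d_b, fun y hy u v => by simp [extD], hpull.d_ϖ⟩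
    have hB' : IsOpen (φ.source ×ˢ B) := (isOpen_extChartAt_source (I := I) q.1).prod hB
    have hs1 : ∀ p ∈ φ.source ×ˢ B, ContMDiffAt (I.prod I') 𝓘(ℝ, E) ∞ (φ ∘ Prod.fst) p :=
      fun p hp => (contMDiffAt_extChartAt_of_mem hp.1).comp p contMDiffAt_fst
    have hs2 : ∀ p ∈ φ.source ×ˢ B, ContMDiffAt (I.prod I') 𝓘(ℝ, ℝ) ∞ (θ ∘ Prod.snd) p :=
      fun p hp => (hθ.contMDiffAt (hB.mem_nhds hp.2)).comp p contMDiffAt_snd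
    have hs : ∀ p ∈ φ.source ×ˢ B, ContMDiffAt (I.prod I') 𝓘(ℝ, E × ℝ) ∞
        (fun p : M × X => (φ p.1, θ p.2)) p := fun p hp => (hs1 p hp).prodMk_space (hs2 p hp)
    have hd : ∀ p ∈ φ.source ×ˢ B, ∀ v : E × E', modelDeriv (I.prod I') 𝓘(ℝ, E × ℝ)
        (fun p : M × X => (φ p.1, θ p.2)) p v
        = (modelDeriv I 𝓘(ℝ, E) φ p.1 v.1, modelDeriv I' 𝓘(ℝ, ℝ) θ p.2 v.2) := by
      intro p hp v
      have h1 := modelDeriv_comp (I := I.prod I') (I₁ := 𝓘(ℝ, E × ℝ)) (I₂ := 𝓘(ℝ, E)) (x := p)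
        (F := fun p : M × X => (φ p.1, θ p.2)) (f := ContinuousLinearMap.fst ℝ E ℝ)
        (ContinuousLinearMap.differentiableAt _).mdifferentiableAt
        ((hs p hp).mdifferentiableAt (by simp))
      have h2 := modelDeriv_comp (I := I.prod I') (I₁ := 𝓘(ℝ, E × ℝ)) (I₂ := 𝓘(ℝ, ℝ)) (x := p)
        (F := fun p : M × X => (φ p.1, θ p.2)) (f := ContinuousLinearMap.snd ℝ E ℝ)
        (ContinuousLinearMap.differentiableAt _).mdifferentiableAt
        ((hs p hp).mdifferentiableAt (by simp))
      have h3 := modelDeriv_comp (I := I.prod I') (I₁ := I) (I₂ := 𝓘(ℝ, E)) (x := p)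
        (F := (Prod.fst : M × X → M)) (f := φ)
        ((contMDiffAt_extChartAt_of_mem hp.1).mdifferentiableAt (by simp))
        mdifferentiableAt_fst
      have h4 := modelDeriv_comp (I := I.prod I') (I₁ := I') (I₂ := 𝓘(ℝ, ℝ)) (x := p)
        (F := (Prod.snd : M × X → X)) (f := θ)
        ((hθ.contMDiffAt (hB.mem_nhds hp.2)).mdifferentiableAt (by simp))
        mdifferentiableAt_snd
      rw [modelDeriv_eq_fderiv, ContinuousLinearMap.fderiv] at h1 h2
      have e1 := congrArg (fun L => L v) (h1.symm.trans h3)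
      have e2 := congrArg (fun L => L v) (h2.symm.trans h4)
      simp only [ContinuousLinearMap.comp_apply, modelDeriv_fst_apply, modelDeriv_snd_apply]
        at e1 e2
      exact Prod.ext e1 e2
    have key : HasEktCoframeAt (N := M × X) (I.prod I') (E × ℝ) κ 0
        (prodMetric (I := I) (J := I') gM g') (fun p => (0, ξ' p.2)) q := by
      refine ⟨0, rfl, fun p => (φ p.1, θ p.2), φ.source ×ˢ B,
        _, _, _, _, φ.target ×ˢ univ, hB', ⟨mem_extChartAt_source q.1, hq⟩,
        fun p hp => (hs p hp).contMDiffWithinAt, fun p hp => ⟨φ.map_source hp.1, mem_univ _⟩, hco,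
        fun p hp => ⟨fun v w => ?_, fun v => ?_⟩⟩
      · rw [hd p hp, hd p hp]
        refine (happ p v w).trans ?_
        rw [hab p.1 hp.1, (hθ' p.2 hp.2).1]
        simp [pullForm, fderiv_fst]
      · rw [hd p hp]
        refine (happ p (0, ξ' p.2) v).trans ?_
        rw [(hθ' p.2 hp.2).1, (hθ' p.2 hp.2).2]
        simp
    exact key.toModel

omit [I'.Boundaryless] [IsManifold I' ∞ X] in
/-- Coordinates of a base surface near a point at which the projection is a submersion. -/
theorem exists_base_coordinates (hE : Module.finrank ℝ E = 2) {Pr : X → M} {x : X}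
    (hPr : MDifferentiableAt I' I Pr x) (hs : Function.Surjective (modelDeriv I' I Pr x)) :
    ∃ (ζ : M → ℂ) (O : Set M), IsOpen O ∧ Pr x ∈ O ∧ ContMDiffOn I 𝓘(ℝ, ℂ) ∞ ζ O ∧
      InjOn ζ (O ∩ range Pr) ∧ Function.Surjective (modelDeriv I' 𝓘(ℝ, ℂ) (ζ ∘ Pr) x) := by
  set φ := extChartAt I (Pr x) with hφ
  let L : E ≃L[ℝ] ℂ := ContinuousLinearEquiv.ofFinrankEq (by rw [hE, Complex.finrank_real_complex])
  have hsrc := mem_extChartAt_source (I := I) (Pr x)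
  have hL : ∀ y ∈ φ.source, ContMDiffAt I 𝓘(ℝ, ℂ) ∞ (fun z => L (φ z)) y := fun y hy =>
    ContMDiffAt.comp y L.contDiff.contMDiff.contMDiffAt (contMDiffAt_extChartAt_of_mem hy)
  refine ⟨fun z => L (φ z), φ.source, isOpen_extChartAt_source (Pr x), hsrc,
    fun y hy => (hL y hy).contMDiffWithinAt,
    fun y hy z hz h => φ.injOn hy.1 hz.1 (L.injective h), fun w => ?_⟩
  have h2 := modelDeriv_comp (I := I) (I₁ := 𝓘(ℝ, E)) (I₂ := 𝓘(ℝ, ℂ)) (x := Pr x) (F := φ)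
    (f := L) L.differentiableAt.mdifferentiableAt
    ((contMDiffAt_extChartAt_of_mem hsrc).mdifferentiableAt (by simp))
  have h3 := modelDeriv_comp (I := I') (I₁ := I) (I₂ := 𝓘(ℝ, ℂ)) (x := x)
    (F := Pr) (f := L ∘ φ) ((hL _ hsrc).mdifferentiableAt (by simp)) hPr
  obtain ⟨u, hu⟩ := hs (modelDeriv 𝓘(ℝ, E) I φ.symm (φ (Pr x)) (L.symm w))
  refine ⟨u, (congrArg (fun T : E' →L[ℝ] ℂ => T u) h3).trans ?_⟩
  rw [ContinuousLinearMap.comp_apply, hu, h2, modelDeriv_eq_fderiv, ContinuousLinearMap.comp_apply,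
    modelDeriv_extChartAt_symm hsrc (L.symm w), ContinuousLinearEquiv.fderiv]
  exact L.apply_symm_apply w

theorem ektFibration_prod (hE : Module.finrank ℝ E = 2) (hE' : Module.finrank ℝ E' = 1)
    {gM : M → E →L[ℝ] E →L[ℝ] ℝ}
    (hg : IsMetric I gM) {κ : ℝ} (hκ : ∀ x, HasGaussCurvatureAt (I := I) gM x κ)
    {g' : X → E' →L[ℝ] E' →L[ℝ] ℝ} {ξ' : X → E'} (h' : IsLineMetric I' g' ξ')
    [PreconnectedSpace X] :
    EktFibration (N := M × X) (I.prod I') I κ 0 (prodMetric (I := I) (J := I') gM g')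
      (fun p => (0, ξ' p.2)) Prod.fst := by
  have : FiniteDimensional ℝ E' := FiniteDimensional.of_finrank_pos (by omega)
  refine ⟨ektLike_prod hE hg hκ h', ?_, contMDiff_fst, fun p => modelDeriv_fst_apply p _,
    fun p => ?_, fun p => ?_⟩
  · rw [Module.finrank_prod, hE, hE']
  · rw [preimage_fst_singleton_eq_range]
    exact isPreconnected_range (by fun_prop)
  · exact exists_base_coordinates hE (contMDiff_fst.mdifferentiableAt (by simp : (∞ : WithTop ℕ∞) ≠ 0)) fun w =>
      ⟨(w, 0), modelDeriv_fst_apply p _⟩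

theorem isLineMetric_real :
    IsLineMetric (X := ℝ) 𝓘(ℝ, ℝ) (euclideanMetric ℝ) (fun _ => (1 : ℝ)) := by
  refine ⟨fun x v hv => ?_, fun x₀ => ⟨fun t => t, univ, isOpen_univ, mem_univ _,
    contMDiff_id.contMDiffOn, fun x _ => ⟨fun v w => ?_, ?_⟩⟩⟩
  · exact real_inner_self_pos.2 hv
  · rw [modelDeriv_id]
    exact mul_comm _ _
  · rw [modelDeriv_id]
    rfl

/-- The angle times the radius is an arc length parameter on the circle. -/
theorem isLineMetric_circle {r : ℝ} (hr : 0 < r) : ∃ ξ' : Circle → EuclideanSpace ℝ (Fin 1),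
    IsLineMetric (𝓡 1) (circleMetric r) ξ' := by
  set j : Circle → ℂ := fun s => s with hj
  have hjs : ContMDiff (𝓡 1) 𝓘(ℝ, ℂ) ∞ j := contMDiff_coe_circle
  have happ : ∀ (s : Circle) (v w : EuclideanSpace ℝ (Fin 1)), circleMetric r s v w
      = r ^ 2 * inner ℝ (modelDeriv (𝓡 1) 𝓘(ℝ, ℂ) j s v) (modelDeriv (𝓡 1) 𝓘(ℝ, ℂ) j s w) :=
    fun s v w => rfl
  set e : ℝ → ℂ := fun t => Complex.exp (t * Complex.I) with he
  have hed : ∀ t : ℝ, HasFDerivAt e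
      ((1 : ℝ →L[ℝ] ℝ).smulRight (Complex.exp ((t : ℂ) * Complex.I) * Complex.I)) t := by
    intro t
    have h1 : HasDerivAt (fun t : ℝ => (t : ℂ) * Complex.I) Complex.I t := by
      simpa using (Complex.ofRealCLM.hasDerivAt (x := t)).mul_const Complex.I
    exact h1.cexp.hasFDerivAt
  have hslit : ∀ α : ℝ, ∀ s : Circle, (s : ℂ) * ((Circle.exp α)⁻¹ : Circle) ∈ Complex.slitPlane →
      ∀ v : EuclideanSpace ℝ (Fin 1), modelDeriv (𝓡 1) 𝓘(ℝ, ℂ) j s v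
        = modelDeriv (𝓡 1) 𝓘(ℝ, ℝ) (angleAt α) s v • ((s : ℂ) * Complex.I) := by
    intro α s hs v
    have h1 := modelDeriv_comp (I := 𝓡 1) (I₁ := 𝓘(ℝ, ℝ)) (I₂ := 𝓘(ℝ, ℂ)) (x := s)
      (F := angleAt α) (f := e) (hed _).differentiableAt.mdifferentiableAt
      ((contMDiffAt_angleAt_of_mem hs).mdifferentiableAt (by simp))
    have h2 : e ∘ angleAt α = j := by
      ext s
      change Complex.exp (angleAt α s * Complex.I) = s
      rw [← Circle.coe_exp, exp_angleAt]
    rw [h2, modelDeriv_eq_fderiv, (hed _).fderiv] at h1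
    have h3 : Complex.exp (angleAt α s * Complex.I) = s := by
      rw [← Circle.coe_exp, exp_angleAt]
    rw [h1, h3]
    rfl
  have hinj : ∀ α : ℝ, ∀ s : Circle, (s : ℂ) * ((Circle.exp α)⁻¹ : Circle) ∈ Complex.slitPlane →
      ∀ v : EuclideanSpace ℝ (Fin 1), modelDeriv (𝓡 1) 𝓘(ℝ, ℝ) (angleAt α) s v = 0 → v = 0 := by
    intro α s hs v hv
    have h1 := modelDeriv_comp (I := 𝓡 1) (I₁ := 𝓘(ℝ, ℝ)) (I₂ := 𝓡 1) (x := s)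
      (F := angleAt α) (f := Circle.exp) ((contMDiff_circleExp (m := ∞) _).mdifferentiableAt (by simp))
      ((contMDiffAt_angleAt_of_mem hs).mdifferentiableAt (by simp))
    have h2 : Circle.exp ∘ angleAt α = fun s => s := by
      ext1 s
      exact exp_angleAt α s
    rw [h2, modelDeriv_id] at h1
    have h3 := congrArg (fun L => L v) h1
    simpa [hv] using h3
  have hIs : ∀ s : Circle, ‖(s : ℂ) * Complex.I‖ = 1 := fun s => by simp [Circle.norm_coe]
  refine ⟨fun s => r⁻¹ • modelDeriv 𝓘(ℝ, ℝ) (𝓡 1) Circle.exp (Complex.arg s) 1, ?_, ?_⟩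
  · intro s v hv
    have hs : (s : ℂ) * ((Circle.exp (Complex.arg s))⁻¹ : Circle) ∈ Complex.slitPlane := by
      have h := exp_mem_slit (Complex.arg s)
      rw [Circle.exp_arg] at h ⊢
      exact h
    refine lt_of_lt_of_eq ?_ (happ s v v).symm
    rw [ real_inner_self_eq_norm_sq, hslit _ s hs, norm_smul, hIs, mul_one, Real.norm_eq_abs,
      sq_abs]
    have := sq_pos_of_ne_zero fun h => hv (hinj _ s hs v h)
    positivity
  · intro s₀
    set α := Complex.arg s₀ with hα
    set B : Set Circle := {s | (s : ℂ) * ((Circle.exp α)⁻¹ : Circle) ∈ Complex.slitPlane} with hB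
    have hBo : IsOpen B := Complex.isOpen_slitPlane.preimage (by fun_prop)
    have hθ : ∀ s ∈ B, ∀ v, modelDeriv (𝓡 1) 𝓘(ℝ, ℝ) (fun s => r * angleAt α s) s v
        = r * modelDeriv (𝓡 1) 𝓘(ℝ, ℝ) (angleAt α) s v := by
      intro s hs v
      have h1 := modelDeriv_comp (I := 𝓡 1) (I₁ := 𝓘(ℝ, ℝ)) (I₂ := 𝓘(ℝ, ℝ)) (x := s)
        (F := angleAt α) (f := (r • ContinuousLinearMap.id ℝ ℝ : ℝ →L[ℝ] ℝ))
        (ContinuousLinearMap.differentiableAt _).mdifferentiableAt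
        ((contMDiffAt_angleAt_of_mem hs).mdifferentiableAt (by simp))
      rw [modelDeriv_eq_fderiv, ContinuousLinearMap.fderiv] at h1
      exact congrArg (fun L => L v) h1
    refine ⟨fun s => r * angleAt α s, B, hBo, ?_, fun s hs => ?_, fun s hs => ⟨fun v w => ?_, ?_⟩⟩
    · change (s₀ : ℂ) * ((Circle.exp α)⁻¹ : Circle) ∈ Complex.slitPlane
      have h := exp_mem_slit (Complex.arg s₀)
      rw [hα]
      rw [Circle.exp_arg] at h ⊢
      exact h
    · exact (ContMDiffAt.comp (g := fun t : ℝ => r * t) s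
        (contDiff_const.mul contDiff_id).contMDiff.contMDiffAt
        (contMDiffAt_angleAt_of_mem hs)).contMDiffWithinAt
    · refine (happ s v w).trans ?_
      rw [hslit α s hs, hslit α s hs, hθ s hs, hθ s hs, real_inner_smul_left,
        real_inner_smul_right, real_inner_self_eq_norm_sq, hIs]
      ring
    · have h1 := modelDeriv_comp (I := 𝓘(ℝ, ℝ)) (I₁ := 𝓡 1) (I₂ := 𝓘(ℝ, ℂ)) (x := Complex.arg s)
        (F := Circle.exp) (f := j) ((hjs _).mdifferentiableAt (by simp))
        ((contMDiff_circleExp (m := ∞) _).mdifferentiableAt (by simp))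
      have h2 : j ∘ Circle.exp = e := by
        ext t
        exact Circle.coe_exp t
      rw [h2, modelDeriv_eq_fderiv, (hed _).fderiv, Circle.exp_arg] at h1
      have h3 := congrArg (fun L : ℝ →L[ℝ] ℂ => L 1) h1
      simp only [ContinuousLinearMap.comp_apply, hslit α s hs] at h3
      rw [← Circle.coe_exp, Circle.exp_arg] at h3
      have h4 : modelDeriv (𝓡 1) 𝓘(ℝ, ℝ) (angleAt α) s
          (modelDeriv 𝓘(ℝ, ℝ) (𝓡 1) Circle.exp (Complex.arg s) 1) = 1 := by
        have h5 : (s : ℂ) * Complex.I ≠ 0 := by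
          rw [← norm_ne_zero_iff, hIs]; exact one_ne_zero
        refine (smul_left_injective ℝ h5 ?_).symm
        exact h3
      rw [hθ s hs, map_smul, h4]
      simp [hr.ne']

variable {M : Type*} [TopologicalSpace M] [ChartedSpace (EuclideanSpace ℝ (Fin 2)) M]
  [IsManifold (𝓡 2) ∞ M] {κ : ℝ} {gM : SmoothMetric (𝓡 2) M}

theorem noFlatCompactSurface_prod_real (hκ : κ ≠ 0) (hM : IsSpaceForm κ gM) :
    NoFlatCompactSurface.{u} (prodMetric gM.inner (euclideanMetric ℝ)) := by
  have K := ektLike_prod (by simp) (isMetric_of_smoothMetric gM) hM.2.2 isLineMetric_real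
  refine K.noFlatCompactSurface (f := Prod.snd) (by simpa using hκ) contMDiff_snd fun p => ?_
  rw [modelDeriv_snd_apply]
  exact one_ne_zero

theorem flatIffHopfTorus_prod_circle [T2Space M] (hκ : κ ≠ 0) (hM : IsSpaceForm κ gM) {r : ℝ}
    (hr : 0 < r) :
    FlatIffHopfTorus.{u} (𝓡 2) (prodMetric gM.inner (circleMetric r)) Prod.fst ∧
      EveryHopfTorusIsFlat (𝓡 2) (prodMetric gM.inner (circleMetric r)) Prod.fst := by
  obtain ⟨ξ', hξ'⟩ := isLineMetric_circle hr
  have K := ektFibration_prod (by simp) (by simp) (isMetric_of_smoothMetric gM) hM.2.2 hξ'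
  refine ⟨K.flatIffHopfTorus (by simpa using hκ), K.everyHopfTorusIsFlat fun p => ?_⟩
  rw [preimage_fst_singleton_eq_range]
  exact isCompact_range (by fun_prop)

end Products

/-! ### The structure equations of `E(κ, τ)` -/

section LinearAlgebra

variable {E : Type*} [NormedAddCommGroup E] [NormedSpace ℝ E]

/-- The form dual to a field `X` has the exterior derivative
`(u, v) ↦ ⟨∇_u X, v⟩ - ⟨∇_v X, u⟩`. -/
theorem extD_dual_eq [FiniteDimensional ℝ E] {h : E → E →L[ℝ] E →L[ℝ] ℝ} {X : E → E} {y : E}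
    (hs : ∀ z u v, h z u v = h z v u) (hp : ∀ u, u ≠ 0 → 0 < h y u u)
    (hh : DifferentiableAt ℝ h y) (hX : DifferentiableAt ℝ X y) (u v : E) :
    extD (fun z => h z (X z)) y u v = h y (fderiv ℝ X y u + christoffel h y u (X y)) v
      - h y (fderiv ℝ X y v + christoffel h y v (X y)) u := by
  have hsym : ∀ w u v, fderiv ℝ h y w u v = fderiv ℝ h y w v u := by
    intro w u v
    have h1 := (hh.hasFDerivAt.clm_apply (hasFDerivAt_const u y)).clm_apply (hasFDerivAt_const v y)
    have h2 := (hh.hasFDerivAt.clm_apply (hasFDerivAt_const v y)).clm_apply (hasFDerivAt_const u y)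
    have h3 := h1.congr_of_eventuallyEq (Filter.Eventually.of_forall fun z => hs z v u)
    simpa using congrArg (fun L : E →L[ℝ] ℝ => L w) (h3.unique h2)
  have hch : ∀ u v w, h y (christoffel h y u v) w
      = (1 / 2) * (fderiv ℝ h y u v w + fderiv ℝ h y v u w - fderiv ℝ h y w u v) := by
    intro u v w
    unfold christoffel
    rw [(isInvertible_of_pos hp).self_apply_inverse]
    simp
  rw [extD, (hh.hasFDerivAt.clm_apply hX.hasFDerivAt).fderiv]
  simp only [add_apply, map_add, hch, ContinuousLinearMap.comp_apply, ContinuousLinearMap.flip_apply]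
  rw [hsym v u (X y), hsym u v (X y), hsym (X y) u v]
  ring

/-- If `ξ` is a unit vector of a `3`-space with dual form `c`, then `⟨u ∧ ξ, v⟩` is, up to the
sign which the orientation determines, the area form of the plane orthogonal to `ξ`. -/
theorem inner_cross_eq (hE : Module.finrank ℝ E = 3) {G : E →L[ℝ] E →L[ℝ] ℝ}
    {C : E →L[ℝ] E →L[ℝ] E} {a b c : E →L[ℝ] ℝ} {ξ : E} (hpos : ∀ v, v ≠ 0 → 0 < G v v)
    (hG : ∀ v w, G v w = a v * a w + b v * b w + c v * c w) (hξ : ∀ v, G ξ v = c v)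
    (hC : ∀ u v, G (C u v) u = 0 ∧ G (C u v) v = 0 ∧
      G (C u v) (C u v) = G u u * G v v - G u v ^ 2) :
    (∃ e₁ e₂, wedge a b e₁ e₂ = 1) ∧
      ∃ s : ℝ, s ^ 2 = 1 ∧ ∀ u v, G (C u ξ) v = s * wedge a b u v := by
  have : FiniteDimensional ℝ E := FiniteDimensional.of_finrank_pos (by omega)
  have hzero : ∀ v, a v = 0 → b v = 0 → c v = 0 → v = 0 := by
    intro v h1 h2 h3
    by_contra hne
    have h4 := hpos v hne
    rw [hG, h1, h2, h3] at h4
    simp at h4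
  have hsurj : Function.Surjective (a.prod (b.prod c)) := by
    refine (LinearMap.injective_iff_surjective_of_finrank_eq_finrank
      (f := ((a.prod (b.prod c) : E →L[ℝ] ℝ × ℝ × ℝ) : E →ₗ[ℝ] ℝ × ℝ × ℝ)) ?_).1 ?_
    · simp [hE]
    · rw [injective_iff_map_eq_zero]
      intro v hv
      have hv' : (a v, b v, c v) = ((0, 0, 0) : ℝ × ℝ × ℝ) := hv
      simp only [Prod.mk.injEq] at hv'
      exact hzero v hv'.1 hv'.2.1 hv'.2.2
  obtain ⟨e₁, h1⟩ := hsurj (1, 0, 0)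
  obtain ⟨e₂, h2⟩ := hsurj (0, 1, 0)
  obtain ⟨e₃, h3⟩ := hsurj (0, 0, 1)
  have h1' : (a e₁, b e₁, c e₁) = ((1, 0, 0) : ℝ × ℝ × ℝ) := h1
  have h2' : (a e₂, b e₂, c e₂) = ((0, 1, 0) : ℝ × ℝ × ℝ) := h2
  have h3' : (a e₃, b e₃, c e₃) = ((0, 0, 1) : ℝ × ℝ × ℝ) := h3
  simp only [Prod.mk.injEq] at h1' h2' h3'
  obtain ⟨a1, b1, c1⟩ := h1'
  obtain ⟨a2, b2, c2⟩ := h2'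
  obtain ⟨a3, b3, c3⟩ := h3'
  have aξ : a ξ = 0 := by
    have := hξ e₁
    rwa [hG, a1, b1, c1, mul_one, mul_zero, mul_zero, add_zero, add_zero] at this
  have bξ : b ξ = 0 := by
    have := hξ e₂
    rwa [hG, a2, b2, c2, mul_one, mul_zero, mul_zero, add_zero, zero_add] at this
  have cξ : c ξ = 1 := by
    have := hξ e₃
    rwa [hG, a3, b3, c3, mul_one, mul_zero, mul_zero, zero_add, zero_add] at this
  have hdec : ∀ u, u = a u • e₁ + b u • e₂ + c u • ξ := by
    intro u
    rw [← sub_eq_zero]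
    refine hzero _ ?_ ?_ ?_ <;>
      simp [a1, a2, b1, b2, c1, c2, aξ, bξ, cξ]
  have hξξ : C ξ ξ = 0 := by
    by_contra hne
    have := hpos _ hne
    rw [(hC ξ ξ).2.2] at this
    nlinarith
  have n1 := hC e₁ ξ
  have n2 := hC e₂ ξ
  have n3 := (hC (e₁ + e₂) ξ).1
  have g1 : ∀ v, G v e₁ = a v := fun v => by rw [hG, a1, b1, c1]; ring
  have g2 : ∀ v, G v e₂ = b v := fun v => by rw [hG, a2, b2, c2]; ring
  have g3 : ∀ v, G v ξ = c v := fun v => by rw [hG, aξ, bξ, cξ]; ring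
  simp only [map_add, add_apply, g1, g2, g3] at n1 n2 n3
  refine ⟨⟨e₁, e₂, by simp [wedge, a1, a2, b1, b2]⟩, b (C e₁ ξ), ?_, fun u v => ?_⟩
  · have := n1.2.2
    rw [hG, n1.1, n1.2.1, a1, cξ, c1] at this
    linarith
  · have h4 : C u ξ = a u • C e₁ ξ + b u • C e₂ ξ := by
      conv_lhs => rw [hdec u]
      simp [hξξ]
    have h5 : a (C e₂ ξ) = - b (C e₁ ξ) := by linarith
    rw [h4, hG]
    simp only [map_add, map_smul, n1.1, n1.2.1, n2.1, n2.2.1, h5, smul_eq_mul, wedge]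
    ring

end LinearAlgebra

section VerticalField

variable {E : Type*} [NormedAddCommGroup E] [NormedSpace ℝ E] [FiniteDimensional ℝ E]
  {H : Type*} [TopologicalSpace H] {I : ModelWithCorners ℝ E H} [I.Boundaryless]
  {N : Type*} [TopologicalSpace N] [ChartedSpace H N] [IsManifold I ∞ N]
  {g : N → E →L[ℝ] E →L[ℝ] ℝ} {ξ : N → E}

theorem covDeriv_eq (g : N → E →L[ℝ] E →L[ℝ] ℝ) (ξ : N → E) (x : N) (w : E) :
    covDeriv (I := I) g ξ x w = modelDeriv 𝓘(ℝ, E) I (extChartAt I x).symm (extChartAt I x x)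
      (fderiv ℝ (fun y => modelDeriv I 𝓘(ℝ, E) (extChartAt I x) ((extChartAt I x).symm y)
          (ξ ((extChartAt I x).symm y))) (extChartAt I x x)
            (modelDeriv I 𝓘(ℝ, E) (extChartAt I x) x w)
        + christoffel (indMetric I g (extChartAt I x).symm) (extChartAt I x x)
          (modelDeriv I 𝓘(ℝ, E) (extChartAt I x) x w)
          (modelDeriv I 𝓘(ℝ, E) (extChartAt I x) x (ξ x))) := by
  have hx := mem_extChartAt_source (I := I) x
  have hinv : (modelDeriv I 𝓘(ℝ, E) (extChartAt I x) x).IsInvertible := by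
    refine isInvertible_of_injective rfl fun u v huv => ?_
    rw [← modelDeriv_symm_extChartAt hx u, huv, modelDeriv_symm_extChartAt hx]
  have h0 : (extChartAt I x).symm (extChartAt I x x) = x := (extChartAt I x).left_inv hx
  have h1 : covDeriv (I := I) g ξ x w = (modelDeriv I 𝓘(ℝ, E) (extChartAt I x) x).inverse
      (fderiv ℝ (fun y => modelDeriv I 𝓘(ℝ, E) (extChartAt I x) ((extChartAt I x).symm y)
          (ξ ((extChartAt I x).symm y))) (extChartAt I x x)
            (modelDeriv I 𝓘(ℝ, E) (extChartAt I x) x w)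
        + christoffel (indMetric I g (extChartAt I x).symm) (extChartAt I x x)
          (modelDeriv I 𝓘(ℝ, E) (extChartAt I x) x w)
          (modelDeriv I 𝓘(ℝ, E) (extChartAt I x) ((extChartAt I x).symm (extChartAt I x x))
            (ξ ((extChartAt I x).symm (extChartAt I x x))))) := rfl
  rw [h1, h0]
  exact hinv.inverse_apply_eq.2 (by rw [modelDeriv_extChartAt_symm hx])

/-- The exterior derivative of the form dual to `ξ`, in the chart at `x`. -/
theorem extD_vertForm (hg : IsMetric I g)
    (hξ : ∀ x, ContDiffOn ℝ ∞ (vertForm I g ξ (extChartAt I x).symm) (extChartAt I x).target)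
    (x : N) (u v : E) :
    extD (vertForm I g ξ (extChartAt I x).symm) (extChartAt I x x) u v
      = g x (covDeriv (I := I) g ξ x
          (modelDeriv 𝓘(ℝ, E) I (extChartAt I x).symm (extChartAt I x x) u))
          (modelDeriv 𝓘(ℝ, E) I (extChartAt I x).symm (extChartAt I x x) v)
        - g x (covDeriv (I := I) g ξ x
          (modelDeriv 𝓘(ℝ, E) I (extChartAt I x).symm (extChartAt I x x) v))
          (modelDeriv 𝓘(ℝ, E) I (extChartAt I x).symm (extChartAt I x x) u) := by
  set φ := extChartAt I x with hφ
  have hx : x ∈ φ.source := mem_extChartAt_source (I := I) x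
  have h0 : φ.symm (φ x) = x := φ.left_inv hx
  have hto : IsOpen φ.target := isOpen_extChartAt_target x
  set h := indMetric I g φ.symm with hh
  set X : E → E := fun y => modelDeriv I 𝓘(ℝ, E) φ (φ.symm y) (ξ (φ.symm y)) with hX
  have hpos : ∀ y ∈ φ.target, ∀ u, u ≠ 0 → 0 < h y u u := fun y hy u hu =>
    hg.pos _ _ fun hz => hu
      ((injective_iff_map_eq_zero _).1 (injective_modelDeriv_extChartAt_symm hy) u hz)
  have hvert : ∀ y ∈ φ.target, vertForm I g ξ φ.symm y = h y (X y) := by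
    intro y hy
    ext w
    have h1 := modelDeriv_symm_extChartAt (φ.map_target hy) (ξ (φ.symm y))
    rw [← hφ, φ.right_inv hy] at h1
    rw [hh, indMetric_apply, h1]
    rfl
  have hXd : DifferentiableAt ℝ X (φ x) := by
    obtain ⟨e, he⟩ := isInvertible_of_pos (hpos _ (φ.map_source hx))
    have : CompleteSpace E := FiniteDimensional.complete ℝ E
    have h1 := contDiffAt_map_inverse (n := ∞) e
    rw [he] at h1
    have h2 : DifferentiableAt ℝ (fun y => (h y).inverse) (φ x) :=
      (h1.comp (φ x) ((hg.smooth x).contDiffAt (hto.mem_nhds (φ.map_source hx)))).differentiableAt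
        (by simp)
    have h3 := h2.clm_apply (((hξ x).contDiffAt (hto.mem_nhds (φ.map_source hx))).differentiableAt
      (by simp))
    refine h3.congr_of_eventuallyEq ?_
    filter_upwards [hto.mem_nhds (φ.map_source hx)] with y hy
    exact (((isInvertible_of_pos (hpos y hy)).inverse_apply_eq).2 (hvert y hy)).symm
  have hev : vertForm I g ξ φ.symm =ᶠ[𝓝 (φ x)] fun y => h y (X y) := by
    filter_upwards [hto.mem_nhds (φ.map_source hx)] with y hy using hvert y hy
  have h4 : extD (vertForm I g ξ φ.symm) (φ x) u v = extD (fun y => h y (X y)) (φ x) u v := by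
    simp only [extD, hev.fderiv_eq]
  have h5 := extD_dual_eq (h := h) (X := X) (y := φ x) (fun z u v => hg.symm _ _ _)
    (hpos _ (φ.map_source hx))
    (((hg.smooth x).contDiffAt (hto.mem_nhds (φ.map_source hx))).differentiableAt (by simp)) hXd u v
  have h6 : X (φ x) = modelDeriv I 𝓘(ℝ, E) φ x (ξ x) := by rw [hX]; simp only [h0]
  have h7 : ∀ u v, h (φ x) u v = g x (modelDeriv 𝓘(ℝ, E) I φ.symm (φ x) u)
      (modelDeriv 𝓘(ℝ, E) I φ.symm (φ x) v) := by
    intro u v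
    rw [hh, indMetric_apply, h0]
  rw [h4, h5, h7, h7, covDeriv_eq, covDeriv_eq, ← hφ, modelDeriv_extChartAt_symm hx,
    modelDeriv_extChartAt_symm hx, h6]

/-- The exterior derivative of the form dual to `ξ`, in any chart. -/
theorem extD_vertForm_of_mem (hg : IsMetric I g)
    (hξ : ∀ x, ContDiffOn ℝ ∞ (vertForm I g ξ (extChartAt I x).symm) (extChartAt I x).target)
    {x₀ : N} {y : E} (hy : y ∈ (extChartAt I x₀).target) (u v : E) :
    extD (vertForm I g ξ (extChartAt I x₀).symm) y u v
      = g ((extChartAt I x₀).symm y) (covDeriv (I := I) g ξ ((extChartAt I x₀).symm y)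
          (modelDeriv 𝓘(ℝ, E) I (extChartAt I x₀).symm y u))
          (modelDeriv 𝓘(ℝ, E) I (extChartAt I x₀).symm y v)
        - g ((extChartAt I x₀).symm y) (covDeriv (I := I) g ξ ((extChartAt I x₀).symm y)
          (modelDeriv 𝓘(ℝ, E) I (extChartAt I x₀).symm y v))
          (modelDeriv 𝓘(ℝ, E) I (extChartAt I x₀).symm y u) := by
  set φ := extChartAt I x₀ with hφ
  set x := φ.symm y with hx'
  set ψ := extChartAt I x with hψ
  have hx : x ∈ ψ.source := mem_extChartAt_source (I := I) x
  have hev : ∀ᶠ z in 𝓝 y, z ∈ φ.target ∧ φ.symm z ∈ ψ.source := by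
    have hc1 : ContinuousAt φ.symm y := (contMDiffAt_extChartAt_symm hy).continuousAt
    filter_upwards [(isOpen_extChartAt_target (I := I) x₀).mem_nhds hy,
      hc1.preimage_mem_nhds ((isOpen_extChartAt_source (I := I) x).mem_nhds hx)] with z h1 h2
      using ⟨h1, h2⟩
  have hsm : ContDiffAt ℝ ∞ (ψ ∘ φ.symm) y :=
    ((contMDiffAt_extChartAt_of_mem hx).comp y (contMDiffAt_extChartAt_symm hy)).contDiffAt
  obtain ⟨A, hA, hAo, hyA⟩ := eventually_nhds_iff.1 (Filter.Eventually.and hev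
    (show ∀ᶠ z in 𝓝 y, DifferentiableAt ℝ (ψ ∘ φ.symm) z from by
      filter_upwards [hev] with z hz
      exact ((contMDiffAt_extChartAt_of_mem hz.2).comp z
        (contMDiffAt_extChartAt_symm hz.1)).contDiffAt.differentiableAt (by simp)))
  have heq : ∀ z ∈ A, φ.symm =ᶠ[𝓝 z] ψ.symm ∘ (ψ ∘ φ.symm) := by
    intro z hz
    filter_upwards [hAo.mem_nhds hz] with w hw
    simp only [Function.comp_apply]
    rw [ψ.left_inv (hA w hw).1.2]
  have hd : ∀ z ∈ A, ∀ u, modelDeriv 𝓘(ℝ, E) I φ.symm z u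
      = modelDeriv 𝓘(ℝ, E) I ψ.symm ((ψ ∘ φ.symm) z) (fderiv ℝ (ψ ∘ φ.symm) z u) := by
    intro z hz u
    rw [modelDeriv_congr (heq z hz), modelDeriv_comp_coord (F := ψ.symm)
      (f := ψ ∘ φ.symm) ((contMDiffAt_extChartAt_symm (ψ.map_source (hA z hz).1.2)).mdifferentiableAt (by simp))
      (hA z hz).2]
    rfl
  have hv : vertForm I g ξ φ.symm =ᶠ[𝓝 y] pullForm (ψ ∘ φ.symm) (vertForm I g ξ ψ.symm) := by
    filter_upwards [hAo.mem_nhds hyA] with z hz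
    ext w
    have h1 : ψ.symm ((ψ ∘ φ.symm) z) = φ.symm z := ψ.left_inv (hA z hz).1.2
    simp only [vertForm, pullForm, ContinuousLinearMap.comp_apply, hd z hz, h1]
  have h1 : extD (vertForm I g ξ φ.symm) y u v
      = extD (pullForm (ψ ∘ φ.symm) (vertForm I g ξ ψ.symm)) y u v := by
    simp only [extD, hv.fderiv_eq]
  have h2 := extD_pullForm (F := ψ ∘ φ.symm) (a := vertForm I g ξ ψ.symm) (y := y)
    (hsm.of_le ENat.LEInfty.out) (((hξ x).contDiffAt
      ((isOpen_extChartAt_target x).mem_nhds (ψ.map_source hx))).differentiableAt (by simp)) u v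
  have h3 : (ψ ∘ φ.symm) y = ψ x := rfl
  rw [h1, h2, hd y hyA, hd y hyA, h3, extD_vertForm hg hξ]

end VerticalField

section Submersion

variable {E : Type*} [NormedAddCommGroup E] [NormedSpace ℝ E]
  {H : Type*} [TopologicalSpace H] {I : ModelWithCorners ℝ E H} [I.Boundaryless]
  {N : Type*} [TopologicalSpace N] [ChartedSpace H N] [IsManifold I ∞ N]
  {E' : Type*} [NormedAddCommGroup E'] [NormedSpace ℝ E'] [FiniteDimensional ℝ E']
  {H' : Type*} [TopologicalSpace H'] {J : ModelWithCorners ℝ E' H'} [J.Boundaryless]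
  {M : Type*} [TopologicalSpace M] [ChartedSpace H' M] [IsManifold J ∞ M]

omit [FiniteDimensional ℝ E'] in
/-- The metric of the total space of a Riemannian submersion with fibres tangent to the unit
vector `ξ`. -/
theorem inner_eq_of_submersion [FiniteDimensional ℝ E] (hE : Module.finrank ℝ E = 3)
    (hE' : Module.finrank ℝ E' = 2)
    {G : E →L[ℝ] E →L[ℝ] ℝ} {G' : E' →L[ℝ] E' →L[ℝ] ℝ} {P : E →L[ℝ] E'} {ξ : E}
    (hs : ∀ v w, G v w = G w v) (hP : Function.Surjective P) (hξ : P ξ = 0) (hunit : G ξ ξ = 1)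
    (hsub : ∀ v w, (∀ k, P k = 0 → G v k = 0) → (∀ k, P k = 0 → G w k = 0) →
      G' (P v) (P w) = G v w) (v w : E) :
    G v w = G' (P v) (P w) + G ξ v * G ξ w := by
  have hξ0 : ξ ≠ 0 := by
    rintro rfl
    simp at hunit
  have hker : ∀ k, P k = 0 → ∃ t : ℝ, k = t • ξ := by
    have h1 := LinearMap.finrank_range_add_finrank_ker (P : E →ₗ[ℝ] E')
    rw [LinearMap.range_eq_top.2 hP, finrank_top, hE, hE'] at h1
    have h2 : Module.finrank ℝ (LinearMap.ker (P : E →ₗ[ℝ] E')) = 1 := by omega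
    intro k hk
    obtain ⟨t, ht⟩ := exists_smul_eq_of_finrank_eq_one h2
      (x := (⟨ξ, hξ⟩ : LinearMap.ker (P : E →ₗ[ℝ] E'))) (fun h => hξ0 (congrArg Subtype.val h))
      ⟨k, hk⟩
    exact ⟨t, (congrArg Subtype.val ht).symm⟩
  have hhor : ∀ v k, P k = 0 → G (v - G ξ v • ξ) k = 0 := by
    intro v k hk
    obtain ⟨t, rfl⟩ := hker k hk
    simp [hunit, hs v ξ]
  have h1 := hsub _ _ (hhor v) (hhor w)
  simp only [map_sub, map_smul, hξ, smul_zero, sub_zero, sub_apply, smul_apply, hunit,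
    smul_eq_mul, hs v ξ] at h1
  rw [h1]
  ring

/-- The coframe of a Riemannian submersion onto a surface of curvature `κ`: the horizontal part is
pulled back from the base, and the condition on `∇ξ` gives the exterior derivative of the form dual
to `ξ`, up to a sign that the orientation determines. -/
theorem ektFibration_of_submersion (hE : Module.finrank ℝ E = 3) (hE' : Module.finrank ℝ E' = 2)
    {g : N → E →L[ℝ] E →L[ℝ] ℝ} {gM : M → E' →L[ℝ] E' →L[ℝ] ℝ} (hg : IsMetric I g)
    (hgM : IsMetric J gM) {κ τ : ℝ} (hκ : ∀ x, HasGaussCurvatureAt (I := J) gM x κ)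
    {Pr : N → M} {ξ : N → E} (hPr : ContMDiff I J ∞ Pr)
    (hs : ∀ x, Function.Surjective (modelDeriv I J Pr x))
    (hsub : ∀ x v w, (∀ k, modelDeriv I J Pr x k = 0 → g x v k = 0) →
      (∀ k, modelDeriv I J Pr x k = 0 → g x w k = 0) →
      gM (Pr x) (modelDeriv I J Pr x v) (modelDeriv I J Pr x w) = g x v w)
    (hξ : ∀ x, ContDiffOn ℝ ∞ (vertForm I g ξ (extChartAt I x).symm) (extChartAt I x).target)
    (hunit : ∀ x, g x (ξ x) (ξ x) = 1) (hvert : ∀ x, modelDeriv I J Pr x (ξ x) = 0)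
    {C : N → E →L[ℝ] E →L[ℝ] E}
    (hC : ∀ x u v, g x (C x u v) u = 0 ∧ g x (C x u v) v = 0 ∧
      g x (C x u v) (C x u v) = g x u u * g x v v - g x u v ^ 2)
    (hcov : ∀ x (v : E), covDeriv (I := I) g ξ x v = τ • C x v (ξ x))
    (hconn : ∀ x, IsPreconnected (Pr ⁻¹' {Pr x})) : EktFibration I J κ τ g ξ Pr := by
  have : FiniteDimensional ℝ E := FiniteDimensional.of_finrank_pos (by omega)
  refine ⟨⟨hg.pos, hunit, fun q => ?_⟩, hE, hPr, hvert, hconn, fun x =>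
    exists_base_coordinates hE' (hPr.mdifferentiableAt (by simp)) (hs x)⟩
  set φ := extChartAt I q with hφ
  set ψ := extChartAt J (Pr q) with hψ
  have hq : q ∈ φ.source := mem_extChartAt_source q
  have hto : IsOpen φ.target := isOpen_extChartAt_target q
  obtain ⟨a, b, ϖ, hc, -, hab⟩ := exists_surface_coframe hE' hgM hκ (Pr q)
  rw [← hψ] at hc hab
  -- the horizontal coframe on the tangent spaces of `N`
  set L : N → E →L[ℝ] E' := fun x => (modelDeriv J 𝓘(ℝ, E') ψ (Pr x)).comp (modelDeriv I J Pr x)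
    with hL
  have hmet : ∀ x, Pr x ∈ ψ.source → ∀ v w : E, g x v w
      = (a (ψ (Pr x))).comp (L x) v * (a (ψ (Pr x))).comp (L x) w
        + (b (ψ (Pr x))).comp (L x) v * (b (ψ (Pr x))).comp (L x) w
        + g x (ξ x) v * g x (ξ x) w := by
    intro x hx v w
    rw [inner_eq_of_submersion hE hE' (hg.symm x) (hs x) (hvert x) (hunit x) (hsub x) v w,
      hab _ hx]
    rfl
  have hcross : ∀ x, Pr x ∈ ψ.source →
      (∃ e₁ e₂, wedge ((a (ψ (Pr x))).comp (L x)) ((b (ψ (Pr x))).comp (L x)) e₁ e₂ = 1) ∧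
      ∃ s : ℝ, s ^ 2 = 1 ∧ ∀ u v, g x (C x u (ξ x)) v
        = s * wedge ((a (ψ (Pr x))).comp (L x)) ((b (ψ (Pr x))).comp (L x)) u v := fun x hx =>
    inner_cross_eq hE (hg.pos x) (hmet x hx) (fun v => rfl) (hC x)
  set f : E → E' := ψ ∘ Pr ∘ φ.symm with hf
  set O₁ : Set E := φ.target ∩ φ.symm ⁻¹' (Pr ⁻¹' ψ.source) with hO₁
  have hO₁o : IsOpen O₁ := (continuousOn_extChartAt_symm q).isOpen_inter_preimage hto
    ((isOpen_extChartAt_source (Pr q)).preimage hPr.continuous)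
  have hfs : ∀ y ∈ O₁, ContMDiffAt 𝓘(ℝ, E) 𝓘(ℝ, E') ∞ f y := fun y hy =>
    (contMDiffAt_extChartAt_of_mem hy.2).comp y
      (hPr.contMDiffAt.comp y (contMDiffAt_extChartAt_symm hy.1))
  have hfd : ∀ y ∈ O₁, ∀ u, fderiv ℝ f y u
      = L (φ.symm y) (modelDeriv 𝓘(ℝ, E) I φ.symm y u) := by
    intro y hy u
    have h1 := modelDeriv_comp (I := 𝓘(ℝ, E)) (I₁ := I) (I₂ := J) (F := φ.symm) (f := Pr) (x := y)
      (hPr.mdifferentiableAt (by simp))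
      ((contMDiffAt_extChartAt_symm hy.1).mdifferentiableAt (by simp))
    have h2 := modelDeriv_comp (I := 𝓘(ℝ, E)) (I₁ := J) (I₂ := 𝓘(ℝ, E')) (F := Pr ∘ φ.symm)
      (f := ψ) (x := y) ((contMDiffAt_extChartAt_of_mem hy.2).mdifferentiableAt (by simp))
      ((hPr.contMDiffAt.comp y (contMDiffAt_extChartAt_symm hy.1)).mdifferentiableAt (by simp))
    rw [modelDeriv_eq_fderiv, h1] at h2
    rw [hf, h2]
    rfl
  have hfm : MapsTo f O₁ ψ.target := fun y hy => ψ.map_source hy.2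
  have hpull := hc.pull hO₁o (fun y hy => (hfs y hy).contDiffAt.contDiffWithinAt) hfm
  set c := vertForm I g ξ φ.symm with hcdef
  have hcs : ContDiffOn ℝ ∞ c O₁ := (hξ q).mono inter_subset_left
  have hwedge : ∀ y ∈ O₁, ∀ u v, wedge (pullForm f a y) (pullForm f b y) u v
      = wedge ((a (ψ (Pr (φ.symm y)))).comp (L (φ.symm y)))
        ((b (ψ (Pr (φ.symm y)))).comp (L (φ.symm y)))
        (modelDeriv 𝓘(ℝ, E) I φ.symm y u) (modelDeriv 𝓘(ℝ, E) I φ.symm y v) := by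
    intro y hy u v
    simp only [wedge, pullForm, ContinuousLinearMap.comp_apply, hfd y hy]
    rfl
  have hdc : ∀ y ∈ O₁, ∃ s : ℝ, s ^ 2 = 1 ∧ ∀ u v, extD c y u v
      = 2 * τ * s * wedge (pullForm f a y) (pullForm f b y) u v := by
    intro y hy
    obtain ⟨-, s, hs1, hs2⟩ := hcross (φ.symm y) hy.2
    refine ⟨s, hs1, fun u v => ?_⟩
    rw [hcdef, extD_vertForm_of_mem hg hξ hy.1, hcov, hcov, map_smul, map_smul, smul_apply,
      smul_apply, hs2, hs2, hwedge y hy]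
    simp only [wedge, smul_eq_mul]
    ring
  have hy₀ : φ q ∈ O₁ := ⟨φ.map_source hq, by
    change Pr (φ.symm (φ q)) ∈ ψ.source
    rw [φ.left_inv hq]
    exact mem_extChartAt_source _⟩
  -- the sign of the bundle curvature is constant near `q`
  obtain ⟨σ, hσ, O, hO, hqO, hOs, hdσ⟩ : ∃ σ : ℝ, σ ^ 2 = τ ^ 2 ∧ ∃ O : Set E, IsOpen O ∧
      φ q ∈ O ∧ O ⊆ O₁ ∧ ∀ y ∈ O, ∀ u v, extD c y u v
        = 2 * σ * wedge (pullForm f a y) (pullForm f b y) u v := by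
    by_cases hτ : τ = 0
    · refine ⟨τ, rfl, O₁, hO₁o, hy₀, subset_rfl, fun y hy u v => ?_⟩
      obtain ⟨s, -, h1⟩ := hdc y hy
      rw [h1, hτ]
      ring
    obtain ⟨⟨e₁, e₂, he⟩, -⟩ := hcross q (mem_extChartAt_source _)
    set u₀ := modelDeriv I 𝓘(ℝ, E) φ q e₁ with hu₀
    set v₀ := modelDeriv I 𝓘(ℝ, E) φ q e₂ with hv₀
    set w : E → ℝ := fun y => wedge (pullForm f a y) (pullForm f b y) u₀ v₀ with hw
    have hwc : ContinuousOn w O₁ := by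
      have ha := hpull.smooth_a.continuousOn
      have hb := hpull.smooth_b.continuousOn
      exact ((ha.clm_apply continuousOn_const).mul (hb.clm_apply continuousOn_const)).sub
        ((ha.clm_apply continuousOn_const).mul (hb.clm_apply continuousOn_const))
    have hw0 : w (φ q) ≠ 0 := by
      rw [hw]
      simp only
      rw [hwedge _ hy₀, hu₀, hv₀, modelDeriv_symm_extChartAt hq, modelDeriv_symm_extChartAt hq,
        φ.left_inv hq, he]
      exact one_ne_zero
    obtain ⟨r, hr, hball⟩ := Metric.isOpen_iff.1
      (hwc.isOpen_inter_preimage hO₁o isOpen_compl_singleton) (φ q) ⟨hy₀, hw0⟩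
    have hec : ContinuousOn (fun y => extD c y u₀ v₀) O₁ := by
      have h1 : ContinuousOn (fderiv ℝ c) O₁ := hcs.continuousOn_fderiv_of_isOpen hO₁o (by simp)
      exact ((h1.clm_apply continuousOn_const).clm_apply continuousOn_const).sub
        ((h1.clm_apply continuousOn_const).clm_apply continuousOn_const)
    set s : E → ℝ := fun y => extD c y u₀ v₀ / (2 * τ * w y) with hsdef
    have hsval : ∀ y ∈ Metric.ball (φ q) r, s y ^ 2 = 1 ∧ ∀ u v, extD c y u v
        = 2 * τ * s y * wedge (pullForm f a y) (pullForm f b y) u v := by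
      intro y hy
      obtain ⟨t, ht, h1⟩ := hdc y (hball hy).1
      have hwy : w y ≠ 0 := (hball hy).2
      have h2 : s y = t := by
        rw [hsdef]
        simp only
        rw [h1, div_eq_iff (mul_ne_zero (mul_ne_zero two_ne_zero hτ) hwy)]
        ring
      rw [h2]
      exact ⟨ht, h1⟩
    have hsc : ContinuousOn s (Metric.ball (φ q) r) :=
      (hec.mono fun y hy => (hball hy).1).div
        (continuousOn_const.mul (hwc.mono fun y hy => (hball hy).1))
        fun y hy => mul_ne_zero (mul_ne_zero two_ne_zero hτ) (hball hy).2
    rcases (convex_ball (φ q) r).isPreconnected.eq_one_or_eq_neg_one_of_sq_eq hsc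
      (fun y hy => (hsval y hy).1) with h1 | h1
    · refine ⟨τ, rfl, _, Metric.isOpen_ball, Metric.mem_ball_self hr, fun y hy => (hball hy).1,
        fun y hy u v => ?_⟩
      rw [(hsval y hy).2, h1 hy, Pi.one_apply, mul_one]
    · refine ⟨-τ, neg_sq τ, _, Metric.isOpen_ball, Metric.mem_ball_self hr,
        fun y hy => (hball hy).1, fun y hy u v => ?_⟩
      rw [(hsval y hy).2, h1 hy, Pi.neg_apply, Pi.one_apply]
      ring
  refine ⟨σ, hσ, φ, φ.source ∩ φ ⁻¹' O, pullForm f a, pullForm f b, c, pullForm f ϖ, O,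
    isOpen_extChartAt_preimage' q hO, ⟨hq, hqO⟩,
    fun x hx => (contMDiffAt_extChartAt_of_mem hx.1).contMDiffWithinAt, fun x hx => hx.2,
    ⟨hO, hpull.smooth_a.mono hOs, hpull.smooth_b.mono hOs, hcs.mono hOs, hpull.smooth_ϖ.mono hOs,
      fun y hy => hpull.d_a y (hOs hy), fun y hy => hpull.d_b y (hOs hy), hdσ,
      fun y hy => hpull.d_ϖ y (hOs hy)⟩, ?_⟩
  rintro x ⟨hx, hxO⟩
  have h0 : φ.symm (φ x) = x := φ.left_inv hx
  have hxs : Pr x ∈ ψ.source := by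
    have := (hOs hxO).2
    rwa [mem_preimage, h0] at this
  have hcx : ∀ v : E, c (φ x) (modelDeriv I 𝓘(ℝ, E) φ x v) = g x (ξ x) v := by
    intro v
    have h1 : c (φ x) (modelDeriv I 𝓘(ℝ, E) φ x v) = g (φ.symm (φ x)) (ξ (φ.symm (φ x)))
      (modelDeriv 𝓘(ℝ, E) I φ.symm (φ x) (modelDeriv I 𝓘(ℝ, E) φ x v)) := rfl
    rw [h1, modelDeriv_symm_extChartAt hx, h0]
  have hax : ∀ (α : E' → E' →L[ℝ] ℝ) (v : E), pullForm f α (φ x) (modelDeriv I 𝓘(ℝ, E) φ x v)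
      = (α (ψ (Pr x))).comp (L x) v := by
    intro α v
    have h1 : f (φ x) = ψ (Pr x) := by
      rw [hf]
      simp only [Function.comp_apply, h0]
    rw [pullForm, ContinuousLinearMap.comp_apply, hfd _ (hOs hxO), modelDeriv_symm_extChartAt hx,
      h0, h1]
    rfl
  refine ⟨fun v w => ?_, fun v => (hcx v).symm⟩
  rw [hmet x hxs, hax, hax, hax, hax, hcx, hcx]

end Submersion

section Ekt

variable {E : Type*} [NormedAddCommGroup E] [NormedSpace ℝ E]
  {H : Type*} [TopologicalSpace H] {I : ModelWithCorners ℝ E H} [I.Boundaryless]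
  {N : Type*} [TopologicalSpace N] [ChartedSpace H N] [IsManifold I ∞ N]
  {M : Type*} [TopologicalSpace M] [ChartedSpace (EuclideanSpace ℝ (Fin 2)) M]
  [IsManifold (𝓡 2) ∞ M]

theorem IsEkt.ektFibration {κ τ : ℝ} {g : SmoothMetric I N} {gM : SmoothMetric (𝓡 2) M}
    {Pr : N → M} {ξ : (x : N) → TangentSpace I x}
    {cross : (x : N) → TangentSpace I x →L[ℝ] TangentSpace I x →L[ℝ] TangentSpace I x}
    (h : IsEkt κ τ g gM Pr ξ cross) : EktFibration I (𝓡 2) κ τ g.inner ξ Pr := by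
  have : FiniteDimensional ℝ E := FiniteDimensional.of_finrank_pos (by rw [h.dim]; norm_num)
  exact ektFibration_of_submersion h.dim (by simp) (isMetric_of_smoothMetric g)
    (isMetric_of_smoothMetric gM) h.spaceForm.2.2 h.submersion.1 (fun x => (h.submersion.2.2 x).1)
    (fun x => (h.submersion.2.2 x).2)
    (fun x => contDiffOn_vertForm g h.smooth_field (isOpen_extChartAt_target x)
      fun z hz => (contMDiffAt_extChartAt_symm hz).contMDiffWithinAt)
    h.unit_field h.vertical_field h.vectorProduct.2 h.covDeriv_field
    fun x => (h.fibre_connected _).isPreconnected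

end Ekt

/-! ### Complex coordinates of the quadrics -/

section QuadricAlgebra

variable {κ τ : ℝ}

theorem sign_mul_self_of_ne_zero (hκ : κ ≠ 0) : Real.sign κ * Real.sign κ = 1 := by
  rcases Real.sign_apply_eq_of_ne_zero κ hκ with h | h <;> rw [h] <;> norm_num

theorem signedForm_apply (κ : ℝ) (X Y : ℂ × ℂ) : signedForm κ X Y
    = (X.1.re * Y.1.re + X.1.im * Y.1.im) + Real.sign κ * (X.2.re * Y.2.re + X.2.im * Y.2.im) := by
  have h : signedForm κ X Y = inner ℝ X.1 Y.1 + Real.sign κ * inner ℝ X.2 Y.2 := rfl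
  rw [h, Complex.inner, Complex.inner]
  simp
  ring

theorem quadricMetric_apply (κ τ : ℝ) (p X Y : ℂ × ℂ) : quadricMetric κ τ p X Y
    = 4 / κ * (signedForm κ X Y + (4 * τ ^ 2 / κ - 1)
      * (signedForm κ (Complex.I * p.1, Complex.I * p.2) X
        * signedForm κ (Complex.I * p.1, Complex.I * p.2) Y)) := rfl

theorem mem_quadric_iff {p : ℂ × ℂ} : p ∈ quadric κ ↔ signedForm κ p p = 1 := by
  rw [signedForm_apply]
  change ‖p.1‖ ^ 2 + Real.sign κ * ‖p.2‖ ^ 2 = 1 ↔ _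
  rw [Complex.sq_norm, Complex.sq_norm, Complex.normSq_apply, Complex.normSq_apply]

/-- The length of the vertical field `V`. -/
theorem signedForm_vertical (κ : ℝ) (p : ℂ × ℂ) :
    signedForm κ (Complex.I * p.1, Complex.I * p.2) (Complex.I * p.1, Complex.I * p.2)
      = signedForm κ p p := by
  rw [signedForm_apply, signedForm_apply]
  simp
  ring

theorem signedForm_vertical_self (κ : ℝ) (p : ℂ × ℂ) :
    signedForm κ p (Complex.I * p.1, Complex.I * p.2) = 0 := by
  rw [signedForm_apply]
  simp
  ring

/-- The metric of the quadric: the part orthogonal to the fibres, and the part along them. This is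
Lagrange's identity for the Hermitian form `z z̄' ± w w̄'`. -/
theorem quadricMetric_eq (hκ : κ ≠ 0) {p X Y : ℂ × ℂ} (hp : p ∈ quadric κ)
    (hX : signedForm κ p X = 0) : quadricMetric κ τ p X Y
    = 4 / κ * Real.sign κ * inner ℝ (p.1 * X.2 - p.2 * X.1) (p.1 * Y.2 - p.2 * Y.1)
      + 16 * τ ^ 2 / κ ^ 2 * (signedForm κ (Complex.I * p.1, Complex.I * p.2) X
        * signedForm κ (Complex.I * p.1, Complex.I * p.2) Y) := by
  have he := sign_mul_self_of_ne_zero hκ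
  rw [mem_quadric_iff] at hp
  have key : signedForm κ X Y
      = Real.sign κ * inner ℝ (p.1 * X.2 - p.2 * X.1) (p.1 * Y.2 - p.2 * Y.1)
        + signedForm κ (Complex.I * p.1, Complex.I * p.2) X
          * signedForm κ (Complex.I * p.1, Complex.I * p.2) Y := by
    have h1 : signedForm κ X Y * signedForm κ p p
        = Real.sign κ * inner ℝ (p.1 * X.2 - p.2 * X.1) (p.1 * Y.2 - p.2 * Y.1)
        + signedForm κ p X * signedForm κ p Y
        + signedForm κ (Complex.I * p.1, Complex.I * p.2) X
          * signedForm κ (Complex.I * p.1, Complex.I * p.2) Y := by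
      simp only [signedForm_apply, Complex.inner, Complex.mul_re, Complex.mul_im, Complex.sub_re,
        Complex.sub_im, Complex.conj_re, Complex.conj_im, Complex.I_re, Complex.I_im]
      obtain ⟨⟨z₁, z₂⟩, ⟨w₁, w₂⟩⟩ := p
      obtain ⟨⟨a₁, a₂⟩, ⟨b₁, b₂⟩⟩ := X
      obtain ⟨⟨c₁, c₂⟩, ⟨d₁, d₂⟩⟩ := Y
      simp only
      ring
    rw [hp, hX, zero_mul, add_zero, mul_one] at h1
    exact h1
  rw [quadricMetric_apply, key]
  field_simp
  ring

theorem eq_zero_of_signedForm {p X : ℂ × ℂ} (hκ : κ ≠ 0) (hp : p ∈ quadric κ)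
    (hX : signedForm κ p X = 0) (h1 : p.1 * X.2 - p.2 * X.1 = 0)
    (h2 : signedForm κ (Complex.I * p.1, Complex.I * p.2) X = 0) : X = 0 := by
  rw [mem_quadric_iff] at hp
  have h3 : (starRingEnd ℂ) p.1 * X.1 + (Real.sign κ : ℂ) * ((starRingEnd ℂ) p.2 * X.2) = 0 := by
    rw [signedForm_apply] at hX h2
    apply Complex.ext
    · simp at hX ⊢; linarith
    · simp at h2 ⊢; linarith
  have h4 : p.1 * (starRingEnd ℂ) p.1
      + (Real.sign κ : ℂ) * (p.2 * (starRingEnd ℂ) p.2) = 1 := by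
    rw [signedForm_apply] at hp
    rw [Complex.mul_conj, Complex.mul_conj, Complex.normSq_apply, Complex.normSq_apply]
    exact_mod_cast hp
  have he : (Real.sign κ : ℂ) * Real.sign κ = 1 := by
    exact_mod_cast sign_mul_self_of_ne_zero hκ
  refine Prod.ext ?_ ?_
  · change X.1 = 0
    linear_combination p.1 * h3 - X.1 * h4 - (Real.sign κ : ℂ) * (starRingEnd ℂ) p.2 * h1
  · change X.2 = 0
    linear_combination p.2 * h3 - X.2 * h4 + (starRingEnd ℂ) p.1 * h1

end QuadricAlgebra

section QuadricForms

/-- The function `1 / (1 + ε |ζ|²)` of `(ζ, ℓ)`. -/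
def baseScale (κ : ℝ) (p : ℂ × ℂ) : ℝ := (1 + Real.sign κ * (p.1.re ^ 2 + p.1.im ^ 2))⁻¹

/-- The form `ε Im(ζ̄ dζ) / (1 + ε |ζ|²)` in the coordinates `(ζ, ℓ)`. -/
def baseForm (κ : ℝ) (p : ℂ × ℂ) : ℂ × ℂ →L[ℝ] ℝ :=
  (Real.sign κ * baseScale κ p) • (p.1.re • Complex.imCLM.comp (ContinuousLinearMap.fst ℝ ℂ ℂ)
    - p.1.im • Complex.reCLM.comp (ContinuousLinearMap.fst ℝ ℂ ℂ))

theorem two_div_sqrt_mul_self {κ : ℝ} (hκ : κ ≠ 0) :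
    2 / √|κ| * (2 / √|κ|) = 4 * Real.sign κ / κ := by
  have hk0 : √|κ| ≠ 0 := (Real.sqrt_pos.2 (abs_pos.2 hκ)).ne'
  have hk : √|κ| * √|κ| = Real.sign κ * κ := by
    rw [Real.mul_self_sqrt (abs_nonneg κ)]
    rcases lt_or_gt_of_ne hκ with h | h
    · rw [abs_of_neg h, Real.sign_of_neg h]; ring
    · rw [abs_of_pos h, Real.sign_of_pos h]; ring
  rw [div_mul_div_comm, hk]
  have he := sign_mul_self_of_ne_zero hκ
  have he0 : Real.sign κ ≠ 0 := left_ne_zero_of_mul (a := Real.sign κ) (by rw [he]; exact one_ne_zero)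
  rw [div_eq_div_iff (mul_ne_zero he0 hκ) hκ]
  linear_combination (-4) * κ * he

/-- The coordinates `ζ = x + i y` and `ℓ` on `ℂ × ℂ` stand for `w / z` and a logarithm of `z`. The
base carries the metric `4 |dζ|² / (|κ| (1 + ε |ζ|²)²)`. -/
theorem isEktCoframeOn_quadric {κ : ℝ} (hκ : κ ≠ 0) (τ : ℝ) :
    IsEktCoframeOn κ τ
      (fun p : ℂ × ℂ => (2 / √|κ| * baseScale κ p) •
        Complex.reCLM.comp (ContinuousLinearMap.fst ℝ ℂ ℂ))
      (fun p : ℂ × ℂ => (2 / √|κ| * baseScale κ p) •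
        Complex.imCLM.comp (ContinuousLinearMap.fst ℝ ℂ ℂ))
      (fun p : ℂ × ℂ => (4 * τ / κ) • (Complex.imCLM.comp (ContinuousLinearMap.snd ℝ ℂ ℂ)
        + baseForm κ p))
      (fun p : ℂ × ℂ => (-2 : ℝ) • baseForm κ p)
      {p : ℂ × ℂ | 0 < 1 + Real.sign κ * (p.1.re ^ 2 + p.1.im ^ 2)} := by
  have he := sign_mul_self_of_ne_zero hκ
  have hk := two_div_sqrt_mul_self hκ
  set ε := Real.sign κ with hε
  set k := 2 / √|κ| with hkdef
  set ax : ℂ × ℂ →L[ℝ] ℝ := Complex.reCLM.comp (ContinuousLinearMap.fst ℝ ℂ ℂ) with hax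
  set ay : ℂ × ℂ →L[ℝ] ℝ := Complex.imCLM.comp (ContinuousLinearMap.fst ℝ ℂ ℂ) with hay
  set al : ℂ × ℂ →L[ℝ] ℝ := Complex.imCLM.comp (ContinuousLinearMap.snd ℝ ℂ ℂ) with hal
  set r := baseScale κ with hr
  set lam := baseForm κ with hlam
  set O := {p : ℂ × ℂ | 0 < 1 + ε * (p.1.re ^ 2 + p.1.im ^ 2)} with hO
  have hOo : IsOpen O := isOpen_lt continuous_const (by fun_prop)
  have hxs : ContDiff ℝ ∞ fun p : ℂ × ℂ => p.1.re := ax.contDiff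
  have hys : ContDiff ℝ ∞ fun p : ℂ × ℂ => p.1.im := ay.contDiff
  have hrs : ContDiffOn ℝ ∞ r O := by
    refine ContDiffOn.inv ?_ fun p hp => (ne_of_gt hp)
    exact (contDiff_const.add (contDiff_const.mul ((hxs.pow 2).add (hys.pow 2)))).contDiffOn
  have hxd : ∀ p : ℂ × ℂ, HasFDerivAt (fun p : ℂ × ℂ => p.1.re) ax p := fun p => ax.hasFDerivAt
  have hyd : ∀ p : ℂ × ℂ, HasFDerivAt (fun p : ℂ × ℂ => p.1.im) ay p := fun p => ay.hasFDerivAt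
  have hrd : ∀ p ∈ O, HasFDerivAt r
      ((-(r p) ^ 2 * ε) • ((2 * p.1.re) • ax + (2 * p.1.im) • ay)) p := by
    intro p hp
    have h1 := ((((hxd p).pow 2).add ((hyd p).pow 2)).const_mul ε).const_add 1
    have h2 := (hasDerivAt_inv
      (ne_of_gt hp : (1 + ε * (p.1.re ^ 2 + p.1.im ^ 2)) ≠ 0)).comp_hasFDerivAt p h1
    refine h2.congr_fderiv ?_
    have h3 : (r p) ^ 2 = ((1 + ε * (p.1.re ^ 2 + p.1.im ^ 2)) ^ 2)⁻¹ := by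
      rw [hr, baseScale, inv_pow]
    rw [h3]
    refine ContinuousLinearMap.ext fun v => ?_
    simp only [smul_apply, add_apply, smul_eq_mul, nsmul_eq_mul]
    push_cast
    ring
  have hrr : ∀ p ∈ O, r p * (1 + ε * (p.1.re ^ 2 + p.1.im ^ 2)) = 1 := fun p hp =>
    inv_mul_cancel₀ (ne_of_gt hp)
  have hl : ∀ p, lam p = (ε * r p) • (p.1.re • ay - p.1.im • ax) := fun p => rfl
  clear_value r lam
  have hds : ∀ (f : ℂ × ℂ → ℝ) (f' : ℂ × ℂ →L[ℝ] ℝ) (L : ℂ × ℂ →L[ℝ] ℝ) (p : ℂ × ℂ),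
      HasFDerivAt f f' p → ∀ u v, extD (fun p => f p • L) p u v = f' u * L v - f' v * L u := by
    intro f f' L p hf u v
    rw [extD, (hf.smul_const L).fderiv]
    simp
  have hlams : ContDiffOn ℝ ∞ lam O := by
    refine ContDiffOn.congr (ContDiffOn.smul (contDiffOn_const.mul hrs)
      (((hxs.smul contDiff_const).sub (hys.smul contDiff_const)).contDiffOn)) fun p _ => hl p
  have hlamd : ∀ p ∈ O, ∀ u v, extD lam p u v
      = 2 * ε * r p ^ 2 * (ax u * ay v - ax v * ay u) := by
    intro p hp u v
    have h1 := ((hrd p hp).const_mul ε).fun_smul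
      (((hxd p).smul_const ay).fun_sub ((hyd p).smul_const ax))
    have h2 : lam = fun p => (ε * r p) • (p.1.re • ay - p.1.im • ax) := funext hl
    rw [extD, h2, h1.fderiv]
    have h3 := hrr p hp
    simp only [smul_apply, add_apply, sub_apply, smul_eq_mul, ContinuousLinearMap.smulRight_apply]
    linear_combination (-2 * ε * r p * (ax u * ay v - ax v * ay u)) * h3
  refine ⟨hOo, ?_, ?_, ?_, ?_, ?_, ?_, ?_, ?_⟩
  · exact (contDiffOn_const.mul hrs).smul contDiffOn_const
  · exact (contDiffOn_const.mul hrs).smul contDiffOn_const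
  · exact (contDiffOn_const.add hlams).const_smul _
  · exact hlams.const_smul _
  · intro p hp u v
    rw [hds _ _ ax p ((hrd p hp).const_mul k)]
    simp only [wedge, hl, smul_apply, add_apply, sub_apply, smul_eq_mul]
    ring
  · intro p hp u v
    rw [hds _ _ ay p ((hrd p hp).const_mul k)]
    simp only [wedge, hl, smul_apply, add_apply, sub_apply, smul_eq_mul]
    ring
  · intro p hp u v
    have h1 : extD (fun p => (4 * τ / κ) • (al + lam p)) p u v = 4 * τ / κ * extD lam p u v := by
      have h2 := (((hlams.contDiffAt (hOo.mem_nhds hp)).differentiableAt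
        (by simp)).hasFDerivAt.const_add al).fun_const_smul (4 * τ / κ)
      rw [extD, h2.fderiv, extD]
      simp only [smul_apply, smul_eq_mul]
      ring
    rw [h1, hlamd p hp]
    simp only [wedge, smul_apply, smul_eq_mul]
    linear_combination (-2 * τ * r p ^ 2 * (ax u * ay v - ax v * ay u)) * hk
  · intro p hp u v
    have h1 : extD (fun p => (-2 : ℝ) • lam p) p u v = -2 * extD lam p u v := by
      have h2 := ((hlams.contDiffAt (hOo.mem_nhds hp)).differentiableAt
        (by simp)).hasFDerivAt.fun_const_smul (-2 : ℝ)
      rw [extD, h2.fderiv, extD]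
      simp only [smul_apply, smul_eq_mul]
      ring
    rw [h1, hlamd p hp]
    simp only [wedge, smul_apply, smul_eq_mul]
    have h4 : κ * (k * k) = 4 * ε := by
      rw [hk]
      field_simp
    linear_combination (r p ^ 2 * (ax u * ay v - ax v * ay u)) * h4

end QuadricForms

section QuadricCharts

variable {E : Type*} [NormedAddCommGroup E] [NormedSpace ℝ E]
  {H : Type*} [TopologicalSpace H] {I : ModelWithCorners ℝ E H}
  {N : Type*} [TopologicalSpace N] [ChartedSpace H N]
  {κ τ : ℝ} {g : N → E →L[ℝ] E →L[ℝ] ℝ} {ξ : N → E} {χ : N → ℂ × ℂ} {B : Set N}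

/-- On `B`, the metric `g` and the field `ξ` come by the immersion `χ` from the quadric; the
vertical field of the quadric is normalized to length `1`. -/
structure IsQuadricChart (I : ModelWithCorners ℝ E H) (κ τ : ℝ) (g : N → E →L[ℝ] E →L[ℝ] ℝ)
    (ξ : N → E) (χ : N → ℂ × ℂ) (B : Set N) : Prop where
  isOpen : IsOpen B
  smooth : ∀ x ∈ B, ContMDiffAt I 𝓘(ℝ, ℂ × ℂ) ∞ χ x
  injective : ∀ x ∈ B, Function.Injective (modelDeriv I 𝓘(ℝ, ℂ × ℂ) χ x)
  mem : ∀ x ∈ B, χ x ∈ quadric κ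
  metric : ∀ x ∈ B, ∀ v w : E, g x v w = quadricMetric κ τ (χ x)
    (modelDeriv I 𝓘(ℝ, ℂ × ℂ) χ x v) (modelDeriv I 𝓘(ℝ, ℂ × ℂ) χ x w)
  field : ∀ x ∈ B, modelDeriv I 𝓘(ℝ, ℂ × ℂ) χ x (ξ x)
    = (κ / (4 * τ)) • (Complex.I * (χ x).1, Complex.I * (χ x).2)

theorem hasFDerivAt_signedForm_self (κ : ℝ) (p : ℂ × ℂ) :
    HasFDerivAt (fun p => signedForm κ p p) ((2 : ℝ) • signedForm κ p) p := by
  have h1 := (signedForm κ).hasFDerivAt (x := p)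
  refine (h1.clm_apply (hasFDerivAt_id p)).congr_fderiv ?_
  refine ContinuousLinearMap.ext fun v => ?_
  simp only [add_apply, ContinuousLinearMap.comp_apply, ContinuousLinearMap.flip_apply, smul_apply,
    id_eq, smul_eq_mul, signedForm_apply, ContinuousLinearMap.id_apply]
  ring

theorem signedForm_modelDeriv_eq_zero {x : N} (hχ : MDifferentiableAt I 𝓘(ℝ, ℂ × ℂ) χ x)
    (hm : ∀ᶠ y in 𝓝 x, χ y ∈ quadric κ) (v : E) :
    signedForm κ (χ x) (modelDeriv I 𝓘(ℝ, ℂ × ℂ) χ x v) = 0 := by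
  have h1 := modelDeriv_comp (I := I) (I₁ := 𝓘(ℝ, ℂ × ℂ)) (I₂ := 𝓘(ℝ, ℝ)) (x := x) (F := χ)
    (f := fun p => signedForm κ p p)
    (hasFDerivAt_signedForm_self κ _).differentiableAt.mdifferentiableAt hχ
  have h2 : ((fun p => signedForm κ p p) ∘ χ) =ᶠ[𝓝 x] fun _ => (1 : ℝ) := by
    filter_upwards [hm] with y hy using mem_quadric_iff.1 hy
  have h3 : modelDeriv I 𝓘(ℝ, ℝ) (fun _ : N => (1 : ℝ)) x = 0 := mfderiv_const
  rw [modelDeriv_congr h2, h3, modelDeriv_eq_fderiv,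
    (hasFDerivAt_signedForm_self κ _).fderiv] at h1
  have h4 := congrArg (fun L : E →L[ℝ] ℝ => L v) h1
  have h5 : (0 : ℝ) = 2 * signedForm κ (χ x) (modelDeriv I 𝓘(ℝ, ℂ × ℂ) χ x v) := h4
  linarith

/-- The differential of an immersion of a `3`-manifold into the quadric maps onto the tangent
space. -/
theorem exists_modelDeriv_eq (hE : Module.finrank ℝ E = 3) {x : N}
    (hχ : MDifferentiableAt I 𝓘(ℝ, ℂ × ℂ) χ x)
    (hi : Function.Injective (modelDeriv I 𝓘(ℝ, ℂ × ℂ) χ x))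
    (hm : ∀ᶠ y in 𝓝 x, χ y ∈ quadric κ) {u : ℂ × ℂ} (hu : signedForm κ (χ x) u = 0) :
    ∃ v : E, modelDeriv I 𝓘(ℝ, ℂ × ℂ) χ x v = u := by
  set L : E →ₗ[ℝ] ℂ × ℂ := (modelDeriv I 𝓘(ℝ, ℂ × ℂ) χ x : E →ₗ[ℝ] ℂ × ℂ) with hL
  set T : ℂ × ℂ →ₗ[ℝ] ℝ := (signedForm κ (χ x) : ℂ × ℂ →ₗ[ℝ] ℝ) with hT
  have hle : LinearMap.range L ≤ LinearMap.ker T := by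
    rintro _ ⟨v, rfl⟩
    exact signedForm_modelDeriv_eq_zero hχ hm v
  have hT0 : T ≠ 0 := by
    intro h0
    have h1 : T (χ x) = 1 := mem_quadric_iff.1 hm.self_of_nhds
    rw [h0] at h1
    exact zero_ne_one h1
  have h1 : Module.finrank ℝ (LinearMap.range L) = 3 := by
    rw [LinearMap.finrank_range_of_inj hi, hE]
  have h2 : Module.finrank ℝ (LinearMap.ker T) = 3 := by
    have h3 := Module.Dual.finrank_ker_add_one_of_ne_zero hT0
    have h4 : Module.finrank ℝ (ℂ × ℂ) = 4 := by
      rw [Module.finrank_prod, Complex.finrank_real_complex]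
    omega
  have h3 := Submodule.eq_of_le_of_finrank_eq hle (h1.trans h2.symm)
  have h4 : u ∈ LinearMap.range L := by
    rw [h3]
    exact hu
  exact h4

namespace IsQuadricChart

variable (h : IsQuadricChart I κ τ g ξ χ B)
include h

theorem tangent {x : N} (hx : x ∈ B) (v : E) :
    signedForm κ (χ x) (modelDeriv I 𝓘(ℝ, ℂ × ℂ) χ x v) = 0 :=
  signedForm_modelDeriv_eq_zero ((h.smooth x hx).mdifferentiableAt (by simp))
    (Filter.eventually_of_mem (h.isOpen.mem_nhds hx) h.mem) v

/-- The form dual to the vertical field. -/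
theorem inner_field (hκ : κ ≠ 0) {x : N} (hx : x ∈ B) (v : E) :
    g x (ξ x) v = 4 * τ / κ * signedForm κ (Complex.I * (χ x).1, Complex.I * (χ x).2)
      (modelDeriv I 𝓘(ℝ, ℂ × ℂ) χ x v) := by
  have h1 : signedForm κ (χ x) ((κ / (4 * τ)) • (Complex.I * (χ x).1, Complex.I * (χ x).2)) = 0 := by
    rw [map_smul, signedForm_vertical_self, smul_zero]
  have h2 := mem_quadric_iff.1 (h.mem x hx)
  rw [h.metric x hx, h.field x hx, quadricMetric_eq hκ (h.mem x hx) h1]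
  simp only [Prod.smul_mk]
  have h3 : (χ x).1 * (κ / (4 * τ)) • (Complex.I * (χ x).2)
      - (χ x).2 * (κ / (4 * τ)) • (Complex.I * (χ x).1) = 0 := by
    simp only [Complex.real_smul]
    ring
  rw [h3, inner_zero_left]
  have h4 : signedForm κ (Complex.I * (χ x).1, Complex.I * (χ x).2)
      ((κ / (4 * τ)) • (Complex.I * (χ x).1), (κ / (4 * τ)) • (Complex.I * (χ x).2))
      = κ / (4 * τ) := by
    rw [← Prod.smul_mk, map_smul, signedForm_vertical, h2, smul_eq_mul, mul_one]
  rw [h4]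
  field_simp
  ring

theorem unit (hκ : κ ≠ 0) (hτ : τ ≠ 0) {x : N} (hx : x ∈ B) : g x (ξ x) (ξ x) = 1 := by
  rw [h.inner_field hκ hx, h.field x hx, map_smul, signedForm_vertical,
    mem_quadric_iff.1 (h.mem x hx), smul_eq_mul]
  field_simp

theorem pos (hκ : κ ≠ 0) (hτ : τ ≠ 0) {x : N} (hx : x ∈ B) {v : E} (hv : v ≠ 0) : 0 < g x v v := by
  rw [h.metric x hx, quadricMetric_eq hκ (h.mem x hx) (h.tangent hx v)]
  set X := modelDeriv I 𝓘(ℝ, ℂ × ℂ) χ x v with hX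
  have hX0 : X ≠ 0 := fun h0 => hv ((injective_iff_map_eq_zero _).1 (h.injective x hx) v h0)
  have h1 : 0 < 4 / κ * Real.sign κ := by
    have h2 := two_div_sqrt_mul_self hκ
    have h3 : 0 < 2 / √|κ| := div_pos two_pos (Real.sqrt_pos.2 (abs_pos.2 hκ))
    have h4 := mul_pos h3 h3
    rw [h2] at h4
    convert! h4 using 1
    ring
  rw [real_inner_self_eq_norm_sq]
  by_cases h2 : (χ x).1 * X.2 - (χ x).2 * X.1 = 0
  · have h3 : signedForm κ (Complex.I * (χ x).1, Complex.I * (χ x).2) X ≠ 0 := fun h3 =>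
      hX0 (eq_zero_of_signedForm hκ (h.mem x hx) (h.tangent hx v) h2 h3)
    rw [h2, norm_zero]
    have h4 : 0 < signedForm κ (Complex.I * (χ x).1, Complex.I * (χ x).2) X
      * signedForm κ (Complex.I * (χ x).1, Complex.I * (χ x).2) X := mul_self_pos.2 h3
    positivity
  · have h3 : 0 < ‖(χ x).1 * X.2 - (χ x).2 * X.1‖ := norm_pos_iff.2 h2
    have h4 := mul_self_nonneg (signedForm κ (Complex.I * (χ x).1, Complex.I * (χ x).2) X)
    have h5 : 0 < 4 / κ * Real.sign κ * ‖(χ x).1 * X.2 - (χ x).2 * X.1‖ ^ 2 :=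
      mul_pos h1 (pow_pos h3 2)
    have h6 : 0 ≤ 16 * τ ^ 2 / κ ^ 2 * (signedForm κ (Complex.I * (χ x).1, Complex.I * (χ x).2) X
      * signedForm κ (Complex.I * (χ x).1, Complex.I * (χ x).2) X) :=
      mul_nonneg (by positivity) h4
    linarith

/-- The two coordinates of the sphere can be exchanged. -/
theorem swap (hκ : 0 < κ) : IsQuadricChart I κ τ g ξ (fun x => ((χ x).2, (χ x).1)) B := by
  have hs : Real.sign κ = 1 := Real.sign_of_pos hκ
  have hsf : ∀ p q : ℂ × ℂ, signedForm κ (p.2, p.1) (q.2, q.1) = signedForm κ p q := by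
    intro p q
    rw [signedForm_apply, signedForm_apply, hs]
    ring
  have hd : ∀ x ∈ B, ∀ v : E, modelDeriv I 𝓘(ℝ, ℂ × ℂ) (fun x => ((χ x).2, (χ x).1)) x v
      = ((modelDeriv I 𝓘(ℝ, ℂ × ℂ) χ x v).2, (modelDeriv I 𝓘(ℝ, ℂ × ℂ) χ x v).1) := by
    intro x hx v
    have h1 := modelDeriv_comp (I := I) (I₁ := 𝓘(ℝ, ℂ × ℂ)) (I₂ := 𝓘(ℝ, ℂ × ℂ)) (x := x) (F := χ)
      (f := ContinuousLinearEquiv.prodComm ℝ ℂ ℂ)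
      (ContinuousLinearEquiv.differentiableAt _).mdifferentiableAt
      ((h.smooth x hx).mdifferentiableAt (by simp))
    rw [modelDeriv_eq_fderiv, ContinuousLinearEquiv.fderiv] at h1
    exact congrArg (fun L : E →L[ℝ] ℂ × ℂ => L v) h1
  refine ⟨h.isOpen, fun x hx => ?_, fun x hx u v huv => ?_, fun x hx => ?_, fun x hx v w => ?_,
    fun x hx => ?_⟩
  · exact ContMDiffAt.comp (g := ContinuousLinearEquiv.prodComm ℝ ℂ ℂ) (f := χ) x
      (ContinuousLinearEquiv.contDiff _).contMDiff.contMDiffAt (h.smooth x hx)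
  · rw [hd x hx, hd x hx, Prod.mk.injEq] at huv
    exact h.injective x hx (Prod.ext huv.2 huv.1)
  · rw [mem_quadric_iff, hsf]
    exact mem_quadric_iff.1 (h.mem x hx)
  · have h1 : ∀ q : ℂ × ℂ, signedForm κ (Complex.I * (χ x).2, Complex.I * (χ x).1) (q.2, q.1)
      = signedForm κ (Complex.I * (χ x).1, Complex.I * (χ x).2) q := fun q =>
      hsf (Complex.I * (χ x).1, Complex.I * (χ x).2) q
    rw [hd x hx, hd x hx, h.metric x hx, quadricMetric_apply, quadricMetric_apply, hsf, h1, h1]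
  · rw [hd x hx, h.field x hx]
    rfl

/-- Near a point with `z ≠ 0`, the map `x ↦ (w / z, log (z / z₀))`, in whose coordinates the
structure equations hold. -/
theorem exists_coordinates {x₀ : N} (hx₀ : x₀ ∈ B) (hz₀ : (χ x₀).1 ≠ 0) :
    ∃ (Θ : N → ℂ × ℂ) (B' : Set N), IsOpen B' ∧ x₀ ∈ B' ∧ B' ⊆ B ∧
      (∀ x ∈ B', ContMDiffAt I 𝓘(ℝ, ℂ × ℂ) ∞ Θ x) ∧ ∀ x ∈ B', (χ x).1 ≠ 0 ∧
        Θ x = ((χ x).2 / (χ x).1, Complex.log ((χ x).1 / (χ x₀).1)) ∧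
        ∀ v : E, modelDeriv I 𝓘(ℝ, ℂ × ℂ) Θ x v
          = (((χ x).1 * (modelDeriv I 𝓘(ℝ, ℂ × ℂ) χ x v).2
              - (χ x).2 * (modelDeriv I 𝓘(ℝ, ℂ × ℂ) χ x v).1) / (χ x).1 ^ 2,
            (modelDeriv I 𝓘(ℝ, ℂ × ℂ) χ x v).1 / (χ x).1) := by
  set z₀ := (χ x₀).1 with hz₀'
  set T : ℂ × ℂ → ℂ × ℂ := fun p => (p.2 / p.1, Complex.log (p.1 / z₀)) with hT
  have hne : ∀ p : ℂ × ℂ, p.1 / z₀ ∈ Complex.slitPlane → p.1 ≠ 0 := by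
    rintro p hp h0
    rw [h0, zero_div] at hp
    exact Complex.slitPlane_ne_zero hp rfl
  have hTs : ∀ p : ℂ × ℂ, p.1 / z₀ ∈ Complex.slitPlane → ContDiffAt ℝ ∞ T p := by
    intro p hp
    have h1 : ContDiffAt ℂ ∞ T p := by
      refine ContDiffAt.prodMk (contDiffAt_snd.div contDiffAt_fst (hne p hp)) ?_
      exact (Complex.contDiffAt_log hp).comp p (contDiffAt_fst.div_const z₀)
    exact h1.restrict_scalars ℝ
  have hTd : ∀ p : ℂ × ℂ, p.1 / z₀ ∈ Complex.slitPlane → ∀ X : ℂ × ℂ,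
      fderiv ℝ T p X = ((p.1 * X.2 - p.2 * X.1) / p.1 ^ 2, X.1 / p.1) := by
    intro p hp X
    have hp0 := hne p hp
    have h1 : HasFDerivAt (fun p : ℂ × ℂ => p.2 * p.1⁻¹) _ p :=
      (hasFDerivAt_snd (𝕜 := ℂ) (E := ℂ) (F := ℂ) (p := p)).mul
        ((hasDerivAt_inv hp0).comp_hasFDerivAt p
          (hasFDerivAt_fst (𝕜 := ℂ) (E := ℂ) (F := ℂ) (p := p)))
    have h2 : HasFDerivAt (fun p : ℂ × ℂ => Complex.log (p.1 * z₀⁻¹)) _ p :=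
      ((hasFDerivAt_fst (𝕜 := ℂ) (E := ℂ) (F := ℂ) (p := p)).mul_const z₀⁻¹).clog
        (by rwa [← div_eq_mul_inv])
    have h3 : HasFDerivAt T _ p := h1.prodMk h2
    rw [(h3.restrictScalars ℝ).fderiv]
    refine Prod.ext ?_ ?_
    · simp
      field_simp
      ring
    · simp
      field_simp
  refine ⟨T ∘ χ, B ∩ {x | x ∈ B ∧ (χ x).1 / z₀ ∈ Complex.slitPlane}, ?_, ?_, inter_subset_left,
    fun x hx => ?_, fun x hx => ⟨hne _ hx.2.2, rfl, fun v => ?_⟩⟩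
  · rw [isOpen_iff_mem_nhds]
    rintro x ⟨hx, -, hx'⟩
    have hc : ContinuousAt (fun x => (χ x).1 / z₀) x :=
      ((h.smooth x hx).continuousAt.fst).div_const z₀
    filter_upwards [h.isOpen.mem_nhds hx,
      hc.preimage_mem_nhds (Complex.isOpen_slitPlane.mem_nhds hx')] with y h1 h2
      using ⟨h1, h1, h2⟩
  · refine ⟨hx₀, hx₀, ?_⟩
    rw [← hz₀', div_self hz₀]
    exact Complex.one_mem_slitPlane
  · exact ContMDiffAt.comp (g := T) (f := χ) x (hTs _ hx.2.2).contMDiffAt (h.smooth x hx.1)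
  · have h1 := modelDeriv_comp (I := I) (I₁ := 𝓘(ℝ, ℂ × ℂ)) (I₂ := 𝓘(ℝ, ℂ × ℂ)) (x := x) (F := χ)
      (f := T) ((hTs _ hx.2.2).differentiableAt (by simp)).mdifferentiableAt
      ((h.smooth x hx.1).mdifferentiableAt (by simp))
    rw [modelDeriv_eq_fderiv] at h1
    rw [h1, ContinuousLinearMap.comp_apply, hTd _ hx.2.2]

theorem hasEktCoframeAt_of_ne_zero (hκ : κ ≠ 0) {x₀ : N} (hx₀ : x₀ ∈ B)
    (hz₀ : (χ x₀).1 ≠ 0) : HasEktCoframeAt I (ℂ × ℂ) κ τ g ξ x₀ := by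
  obtain ⟨Θ, B', hB', hx₀', hsub, hΘ, hΘd⟩ := h.exists_coordinates hx₀ hz₀
  have hscale : ∀ x ∈ B', 1 + Real.sign κ * ((Θ x).1.re ^ 2 + (Θ x).1.im ^ 2)
      = (‖(χ x).1‖ ^ 2)⁻¹ := by
    intro x hx
    obtain ⟨h0, h1, -⟩ := hΘd x hx
    have h2 := h.mem x (hsub hx)
    have h3 : (Θ x).1.re ^ 2 + (Θ x).1.im ^ 2 = ‖(χ x).2‖ ^ 2 / ‖(χ x).1‖ ^ 2 := by
      rw [h1, ← div_pow, ← norm_div, Complex.sq_norm, Complex.normSq_apply]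
      ring
    have h4 : ‖(χ x).1‖ ^ 2 ≠ 0 := pow_ne_zero 2 (norm_ne_zero_iff.2 h0)
    have h5 : ‖(χ x).1‖ ^ 2 + Real.sign κ * ‖(χ x).2‖ ^ 2 = 1 := h2
    refine eq_inv_of_mul_eq_one_left ?_
    rw [h3, add_mul, one_mul, mul_assoc, div_mul_cancel₀ _ h4, h5]
  -- the form `c` is `Im (dz / z) + ε Im (ζ̄ dζ) / (1 + ε |ζ|²)`
  have hvert : ∀ x ∈ B', ∀ v : E, ((modelDeriv I 𝓘(ℝ, ℂ × ℂ) Θ x v).2.im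
      + baseForm κ (Θ x) (modelDeriv I 𝓘(ℝ, ℂ × ℂ) Θ x v))
      = signedForm κ (Complex.I * (χ x).1, Complex.I * (χ x).2)
        (modelDeriv I 𝓘(ℝ, ℂ × ℂ) χ x v) := by
    intro x hx v
    obtain ⟨h0, h1, h2⟩ := hΘd x hx
    have h3 : baseForm κ (Θ x) (modelDeriv I 𝓘(ℝ, ℂ × ℂ) Θ x v) = Real.sign κ * ‖(χ x).1‖ ^ 2 *
        ((starRingEnd ℂ) (Θ x).1 * (modelDeriv I 𝓘(ℝ, ℂ × ℂ) Θ x v).1).im := by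
      have h4 : baseForm κ (Θ x) (modelDeriv I 𝓘(ℝ, ℂ × ℂ) Θ x v)
        = (Real.sign κ * (1 + Real.sign κ * ((Θ x).1.re ^ 2 + (Θ x).1.im ^ 2))⁻¹)
          * ((Θ x).1.re * (modelDeriv I 𝓘(ℝ, ℂ × ℂ) Θ x v).1.im
            - (Θ x).1.im * (modelDeriv I 𝓘(ℝ, ℂ × ℂ) Θ x v).1.re) := rfl
      rw [h4, hscale x hx, inv_inv, Complex.mul_im, Complex.conj_re, Complex.conj_im]
      ring
    have hp := mem_quadric_iff.1 (h.mem x (hsub hx))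
    rw [h3, h2, h1]
    set X := modelDeriv I 𝓘(ℝ, ℂ × ℂ) χ x v
    set z := (χ x).1
    set w := (χ x).2
    have h5 : ((‖z‖ ^ 2 : ℝ) : ℂ) = z * (starRingEnd ℂ) z := by
      rw [Complex.mul_conj, Complex.normSq_eq_norm_sq]
    have h6 : ((‖z‖ ^ 2 : ℝ) : ℂ) * ((starRingEnd ℂ) (w / z) * ((z * X.2 - w * X.1) / z ^ 2))
        = (starRingEnd ℂ) w * X.2 - ((‖w‖ ^ 2 : ℝ) : ℂ) * (X.1 / z) := by
      have h7 : ((‖w‖ ^ 2 : ℝ) : ℂ) = w * (starRingEnd ℂ) w := by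
        rw [Complex.mul_conj, Complex.normSq_eq_norm_sq]
      have h8 : (starRingEnd ℂ) z ≠ 0 := (map_ne_zero _).2 h0
      rw [h5, h7, map_div₀]
      field_simp
    have h9 : ((‖z‖ ^ 2 : ℝ) : ℂ) * (X.1 / z) = (starRingEnd ℂ) z * X.1 := by
      rw [h5]
      field_simp
    have h10 := congrArg Complex.im h6
    have h11 := congrArg Complex.im h9
    rw [Complex.sub_im, Complex.im_ofReal_mul, Complex.im_ofReal_mul] at h10
    rw [Complex.im_ofReal_mul] at h11
    have h12 : ‖z‖ ^ 2 + Real.sign κ * ‖w‖ ^ 2 = 1 := h.mem x (hsub hx)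
    rw [signedForm_apply]
    simp only [Complex.mul_im, Complex.mul_re, Complex.I_re, Complex.I_im, Complex.conj_re,
      Complex.conj_im] at h10 h11 ⊢
    linear_combination Real.sign κ * h10 + h11 - (X.1 / z).im * h12
  have hhor : ∀ x ∈ B', ∀ v w : E,
      (2 / √|κ| * baseScale κ (Θ x)) * (modelDeriv I 𝓘(ℝ, ℂ × ℂ) Θ x v).1.re
        * ((2 / √|κ| * baseScale κ (Θ x)) * (modelDeriv I 𝓘(ℝ, ℂ × ℂ) Θ x w).1.re)
      + (2 / √|κ| * baseScale κ (Θ x)) * (modelDeriv I 𝓘(ℝ, ℂ × ℂ) Θ x v).1.im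
        * ((2 / √|κ| * baseScale κ (Θ x)) * (modelDeriv I 𝓘(ℝ, ℂ × ℂ) Θ x w).1.im)
      = 4 / κ * Real.sign κ * inner ℝ
        ((χ x).1 * (modelDeriv I 𝓘(ℝ, ℂ × ℂ) χ x v).2
          - (χ x).2 * (modelDeriv I 𝓘(ℝ, ℂ × ℂ) χ x v).1)
        ((χ x).1 * (modelDeriv I 𝓘(ℝ, ℂ × ℂ) χ x w).2
          - (χ x).2 * (modelDeriv I 𝓘(ℝ, ℂ × ℂ) χ x w).1) := by
    intro x hx v w
    obtain ⟨h0, h1, h2⟩ := hΘd x hx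
    have h3 : baseScale κ (Θ x) = ‖(χ x).1‖ ^ 2 := by
      rw [baseScale, hscale x hx, inv_inv]
    have hk := two_div_sqrt_mul_self hκ
    have h4 : ∀ a b z : ℂ, z ≠ 0 → ‖z‖ ^ 2 * ‖z‖ ^ 2 * ((a / z ^ 2).re * (b / z ^ 2).re
        + (a / z ^ 2).im * (b / z ^ 2).im) = inner ℝ a b := by
      intro a b z hz
      have h5 : ((‖z‖ ^ 2 * ‖z‖ ^ 2 : ℝ) : ℂ) * ((starRingEnd ℂ) (a / z ^ 2) * (b / z ^ 2))
          = (starRingEnd ℂ) a * b := by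
        have h6 : ((‖z‖ ^ 2 : ℝ) : ℂ) = z * (starRingEnd ℂ) z := by
          rw [Complex.mul_conj, Complex.normSq_eq_norm_sq]
        have h8 : (starRingEnd ℂ) z ≠ 0 := (map_ne_zero _).2 hz
        rw [Complex.ofReal_mul, h6, map_div₀, map_pow]
        field_simp
      have h9 := congrArg Complex.re h5
      rw [Complex.re_ofReal_mul] at h9
      rw [Complex.inner, mul_comm b, ← h9]
      simp only [Complex.mul_re, Complex.conj_re, Complex.conj_im]
      ring
    rw [h3, h2, h2, ← h4 _ _ _ h0]
    generalize ((χ x).1 * (modelDeriv I 𝓘(ℝ, ℂ × ℂ) χ x v).2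
      - (χ x).2 * (modelDeriv I 𝓘(ℝ, ℂ × ℂ) χ x v).1) / (χ x).1 ^ 2 = α
    generalize ((χ x).1 * (modelDeriv I 𝓘(ℝ, ℂ × ℂ) χ x w).2
      - (χ x).2 * (modelDeriv I 𝓘(ℝ, ℂ × ℂ) χ x w).1) / (χ x).1 ^ 2 = β
    simp only
    linear_combination (‖(χ x).1‖ ^ 2 * ‖(χ x).1‖ ^ 2 * (α.re * β.re + α.im * β.im)) * hk
  refine ⟨τ, rfl, Θ, B', _, _, _, _, _, hB', hx₀', fun x hx => (hΘ x hx).contMDiffWithinAt,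
    fun x hx => ?_, isEktCoframeOn_quadric hκ τ, fun x hx => ⟨fun v w => ?_, fun v => ?_⟩⟩
  · change 0 < 1 + Real.sign κ * ((Θ x).1.re ^ 2 + (Θ x).1.im ^ 2)
    rw [hscale x hx]
    have := norm_pos_iff.2 (hΘd x hx).1
    positivity
  · have h1 := hhor x hx v w
    have h2 := hvert x hx v
    have h3 := hvert x hx w
    rw [h.metric x (hsub hx), quadricMetric_eq hκ (h.mem x (hsub hx)) (h.tangent (hsub hx) v), ← h1,
      ← h2, ← h3]
    simp only [smul_apply, add_apply, ContinuousLinearMap.comp_apply, Complex.reCLM_apply,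
      Complex.imCLM_apply, smul_eq_mul, ContinuousLinearMap.coe_fst', ContinuousLinearMap.coe_snd']
    ring
  · rw [h.inner_field hκ (hsub hx), ← hvert x hx v]
    rfl

/-- Only the sphere has points with `z = 0`. -/
theorem pos_of_eq_zero (hκ : κ ≠ 0) {x : N} (hx : x ∈ B) (hz : (χ x).1 = 0) :
    0 < κ ∧ (χ x).2 ≠ 0 := by
  have h1 : ‖(χ x).1‖ ^ 2 + Real.sign κ * ‖(χ x).2‖ ^ 2 = 1 := h.mem x hx
  rw [hz, norm_zero] at h1
  refine ⟨?_, fun h0 => ?_⟩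
  · by_contra hneg
    rw [Real.sign_of_neg (lt_of_le_of_ne (not_lt.1 hneg) hκ)] at h1
    nlinarith [sq_nonneg ‖(χ x).2‖]
  · rw [h0, norm_zero] at h1
    norm_num at h1

theorem hasEktCoframeAt (hκ : κ ≠ 0) {x : N} (hx : x ∈ B) :
    HasEktCoframeAt I (ℂ × ℂ) κ τ g ξ x := by
  by_cases hz : (χ x).1 = 0
  · obtain ⟨hκ', h2⟩ := h.pos_of_eq_zero hκ hx hz
    exact (h.swap hκ').hasEktCoframeAt_of_ne_zero hκ hx h2
  · exact h.hasEktCoframeAt_of_ne_zero hκ hx hz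

end IsQuadricChart

end QuadricCharts

/-! ### The Hopf fibration -/

section HopfMap

variable {κ : ℝ}

theorem contDiff_hopfMap (κ : ℝ) : ContDiff ℝ ∞ (hopfMap κ) := by
  have h1 : ContDiff ℝ ∞ fun p : ℂ × ℂ => (starRingEnd ℂ) p.1 :=
    Complex.conjCLE.contDiff.comp contDiff_fst
  exact ((contDiff_const.mul contDiff_snd).mul h1).prodMk
    ((contDiff_fst.norm_sq ℝ).sub (contDiff_const.mul (contDiff_snd.norm_sq ℝ)))

theorem hopfMap_smul (κ : ℝ) {s : ℂ} (hs : ‖s‖ = 1) (p : ℂ × ℂ) :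
    hopfMap κ (s * p.1, s * p.2) = hopfMap κ p := by
  have h1 : s * (starRingEnd ℂ) s = 1 := by
    rw [Complex.mul_conj, Complex.normSq_eq_norm_sq, hs]
    norm_num
  refine Prod.ext ?_ ?_
  · change 2 * (s * p.2) * (starRingEnd ℂ) (s * p.1) = 2 * p.2 * (starRingEnd ℂ) p.1
    rw [map_mul]
    linear_combination 2 * p.2 * (starRingEnd ℂ) p.1 * h1
  · change ‖s * p.1‖ ^ 2 - Real.sign κ * ‖s * p.2‖ ^ 2 = ‖p.1‖ ^ 2 - Real.sign κ * ‖p.2‖ ^ 2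
    rw [norm_mul, norm_mul, hs, one_mul, one_mul]

theorem fderiv_hopfMap_vertical (κ : ℝ) (p : ℂ × ℂ) :
    fderiv ℝ (hopfMap κ) p (Complex.I * p.1, Complex.I * p.2) = 0 := by
  have h0 : HasDerivAt (fun t : ℝ => Complex.exp (t * Complex.I)) Complex.I 0 := by
    have h1 : HasDerivAt (fun t : ℝ => (t : ℂ) * Complex.I) Complex.I 0 := by
      simpa using (Complex.ofRealCLM.hasDerivAt (x := (0 : ℝ))).mul_const Complex.I
    simpa using h1.cexp
  have h1 : HasDerivAt (fun t : ℝ => (Complex.exp (t * Complex.I) * p.1,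
      Complex.exp (t * Complex.I) * p.2)) (Complex.I * p.1, Complex.I * p.2) 0 :=
    (h0.mul_const p.1).prodMk (h0.mul_const p.2)
  have h2 : HasFDerivAt (hopfMap κ) (fderiv ℝ (hopfMap κ) p)
      (Complex.exp ((0 : ℝ) * Complex.I) * p.1, Complex.exp ((0 : ℝ) * Complex.I) * p.2) := by
    simpa using ((contDiff_hopfMap κ).differentiable (by simp) p).hasFDerivAt
  have h3 := h2.comp_hasDerivAt (0 : ℝ) h1
  have h4 : (hopfMap κ ∘ fun t : ℝ => (Complex.exp (t * Complex.I) * p.1,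
      Complex.exp (t * Complex.I) * p.2)) = fun _ => hopfMap κ p :=
    funext fun t => hopfMap_smul κ (Complex.norm_exp_ofReal_mul_I t) p
  rw [h4] at h3
  exact h3.unique (hasDerivAt_const _ _)

/-- The equation of the base in `ℂ × ℝ`. -/
theorem norm_sq_hopfMap {p : ℂ × ℂ} (hκ : κ ≠ 0) (hp : p ∈ quadric κ) :
    ‖(hopfMap κ p).1‖ ^ 2 = Real.sign κ * (1 - (hopfMap κ p).2 ^ 2) := by
  have h1 : ‖p.1‖ ^ 2 + Real.sign κ * ‖p.2‖ ^ 2 = 1 := hp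
  have he := sign_mul_self_of_ne_zero hκ
  change ‖2 * p.2 * (starRingEnd ℂ) p.1‖ ^ 2
    = Real.sign κ * (1 - (‖p.1‖ ^ 2 - Real.sign κ * ‖p.2‖ ^ 2) ^ 2)
  rw [norm_mul, norm_mul, RCLike.norm_conj]
  simp only [RCLike.norm_ofNat]
  linear_combination (Real.sign κ * (‖p.1‖ ^ 2 + Real.sign κ * ‖p.2‖ ^ 2 + 1)) * h1
    - 4 * ‖p.1‖ ^ 2 * ‖p.2‖ ^ 2 * he

theorem one_add_hopfMap {p : ℂ × ℂ} (hp : p ∈ quadric κ) :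
    1 + (hopfMap κ p).2 = 2 * ‖p.1‖ ^ 2 := by
  have h1 : ‖p.1‖ ^ 2 + Real.sign κ * ‖p.2‖ ^ 2 = 1 := hp
  change 1 + (‖p.1‖ ^ 2 - Real.sign κ * ‖p.2‖ ^ 2) = 2 * ‖p.1‖ ^ 2
  linarith

/-- The fibres of the Hopf map are the orbits of the circle. -/
theorem exists_circle_of_hopfMap_eq (hκ : κ ≠ 0) {p q : ℂ × ℂ} (hp : p ∈ quadric κ)
    (hq : q ∈ quadric κ)
    (h : hopfMap κ q = hopfMap κ p) : ∃ s : Circle, q = ((s : ℂ) * p.1, (s : ℂ) * p.2) := by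
  have he := sign_mul_self_of_ne_zero hκ
  have h1 : ‖p.1‖ ^ 2 + Real.sign κ * ‖p.2‖ ^ 2 = 1 := hp
  have h2 : ‖q.1‖ ^ 2 + Real.sign κ * ‖q.2‖ ^ 2 = 1 := hq
  have h3 : ‖q.1‖ ^ 2 = ‖p.1‖ ^ 2 := by
    have h4 := one_add_hopfMap hp
    rw [← h, one_add_hopfMap hq] at h4
    linarith
  have h3' : ‖q.2‖ ^ 2 = ‖p.2‖ ^ 2 := by
    have h5 : Real.sign κ * ‖q.2‖ ^ 2 = Real.sign κ * ‖p.2‖ ^ 2 := by linarith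
    linear_combination Real.sign κ * h5 - (‖q.2‖ ^ 2 - ‖p.2‖ ^ 2) * he
  have h4 : ‖q.1‖ = ‖p.1‖ := (sq_eq_sq₀ (norm_nonneg _) (norm_nonneg _)).1 h3
  have h4' : ‖q.2‖ = ‖p.2‖ := (sq_eq_sq₀ (norm_nonneg _) (norm_nonneg _)).1 h3'
  have h5 : q.2 * (starRingEnd ℂ) q.1 = p.2 * (starRingEnd ℂ) p.1 := by
    have h6 : 2 * q.2 * (starRingEnd ℂ) q.1 = 2 * p.2 * (starRingEnd ℂ) p.1 :=
      congrArg Prod.fst h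
    linear_combination (1 / 2) * h6
  by_cases hz : p.1 = 0
  · have hz' : q.1 = 0 := by rw [← norm_eq_zero, h4, hz, norm_zero]
    have hw : p.2 ≠ 0 := by
      intro h0
      rw [hz, h0, norm_zero] at h1
      norm_num at h1
    refine ⟨⟨q.2 / p.2, mem_sphere_zero_iff_norm.2 ?_⟩, Prod.ext ?_ ?_⟩
    · rw [norm_div, h4', div_self (norm_ne_zero_iff.2 hw)]
    · simp [hz, hz']
    · change q.2 = q.2 / p.2 * p.2
      rw [div_mul_cancel₀ _ hw]
  · refine ⟨⟨q.1 / p.1, mem_sphere_zero_iff_norm.2 ?_⟩, Prod.ext ?_ ?_⟩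
    · rw [norm_div, h4, div_self (norm_ne_zero_iff.2 hz)]
    · change q.1 = q.1 / p.1 * p.1
      rw [div_mul_cancel₀ _ hz]
    · change q.2 = q.1 / p.1 * p.2
      have hq0 : q.1 ≠ 0 := by rwa [← norm_ne_zero_iff, h4, norm_ne_zero_iff]
      have h7 : q.1 * (starRingEnd ℂ) q.1 = p.1 * (starRingEnd ℂ) p.1 := by
        rw [Complex.mul_conj, Complex.mul_conj, Complex.normSq_eq_norm_sq,
          Complex.normSq_eq_norm_sq, h4]
      have h8 : (starRingEnd ℂ) q.1 ≠ 0 := (map_ne_zero _).2 hq0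
      refine mul_right_cancel₀ h8 ?_
      rw [h5, div_mul_eq_mul_div, div_mul_eq_mul_div, eq_div_iff hz]
      linear_combination (-p.2) * h7

/-- The quotient `w / z` as a function on the base. -/
theorem hopfMap_div {p : ℂ × ℂ} (hp : p ∈ quadric κ) (hz : p.1 ≠ 0) :
    (hopfMap κ p).1 / ((1 + (hopfMap κ p).2 : ℝ) : ℂ) = p.2 / p.1 := by
  have h1 : ((2 * ‖p.1‖ ^ 2 : ℝ) : ℂ) = 2 * (p.1 * (starRingEnd ℂ) p.1) := by
    rw [Complex.mul_conj, Complex.normSq_eq_norm_sq]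
    push_cast
    rfl
  have h8 : (starRingEnd ℂ) p.1 ≠ 0 := (map_ne_zero _).2 hz
  rw [one_add_hopfMap hp, h1]
  change 2 * p.2 * (starRingEnd ℂ) p.1 / _ = _
  field_simp

end HopfMap

section QuadricFibration

variable {E : Type*} [NormedAddCommGroup E] [NormedSpace ℝ E]
  {H : Type*} [TopologicalSpace H] {I : ModelWithCorners ℝ E H}
  {N : Type*} [TopologicalSpace N] [ChartedSpace H N]
  {κ τ : ℝ} {g : N → E →L[ℝ] E →L[ℝ] ℝ} {ξ : N → E} {χ : N → ℂ × ℂ} {B : Set N}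
  {Pr : N → ℂ × ℝ}

namespace IsQuadricChart

variable (h : IsQuadricChart I κ τ g ξ χ B)
include h

theorem contMDiffAt_proj (hPr : ∀ x ∈ B, Pr x = hopfMap κ (χ x)) {x : N} (hx : x ∈ B) :
    ContMDiffAt I 𝓘(ℝ, ℂ × ℝ) ∞ Pr x := by
  have h1 : ContMDiffAt I 𝓘(ℝ, ℂ × ℝ) ∞ (hopfMap κ ∘ χ) x :=
    (contDiff_hopfMap κ).contMDiff.contMDiffAt.comp x (h.smooth x hx)
  refine h1.congr_of_eventuallyEq ?_
  filter_upwards [h.isOpen.mem_nhds hx] with y hy using hPr y hy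

theorem modelDeriv_proj_field (hPr : ∀ x ∈ B, Pr x = hopfMap κ (χ x)) {x : N} (hx : x ∈ B) :
    modelDeriv I 𝓘(ℝ, ℂ × ℝ) Pr x (ξ x) = 0 := by
  have h1 : Pr =ᶠ[𝓝 x] hopfMap κ ∘ χ := by
    filter_upwards [h.isOpen.mem_nhds hx] with y hy using hPr y hy
  rw [modelDeriv_congr h1, modelDeriv_comp (I₁ := 𝓘(ℝ, ℂ × ℂ)) (F := χ) (f := hopfMap κ)
    ((contDiff_hopfMap κ).differentiable (by simp) _).mdifferentiableAt
    ((h.smooth x hx).mdifferentiableAt (by simp)), ContinuousLinearMap.comp_apply, h.field x hx,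
    map_smul, modelDeriv_eq_fderiv, fderiv_hopfMap_vertical, smul_zero]

theorem base_coordinates_of_ne_zero (hE : Module.finrank ℝ E = 3) (hκ : κ ≠ 0)
    (hPr : ∀ x ∈ B, Pr x = hopfMap κ (χ x)) (hr : ∀ x, Pr x ∈ hopfMap κ '' quadric κ)
    {x₀ : N} (hx₀ : x₀ ∈ B) (hz₀ : (χ x₀).1 ≠ 0) :
    ∃ (ζ : ℂ × ℝ → ℂ) (O : Set (ℂ × ℝ)), IsOpen O ∧ Pr x₀ ∈ O ∧
      ContMDiffOn 𝓘(ℝ, ℂ × ℝ) 𝓘(ℝ, ℂ) ∞ ζ O ∧ InjOn ζ (O ∩ range Pr) ∧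
      Function.Surjective (modelDeriv I 𝓘(ℝ, ℂ) (ζ ∘ Pr) x₀) := by
  have he := sign_mul_self_of_ne_zero hκ
  obtain ⟨Θ, B', hB', hx₀', hsub, hΘ, hΘd⟩ := h.exists_coordinates hx₀ hz₀
  have hden : ContDiff ℝ ∞ fun y : ℂ × ℝ => ((1 + y.2 : ℝ) : ℂ) :=
    Complex.ofRealCLM.contDiff.comp (contDiff_const.add contDiff_snd)
  refine ⟨fun y => y.1 / ((1 + y.2 : ℝ) : ℂ), {y | 1 + y.2 ≠ 0},
    isOpen_ne_fun (by fun_prop) continuous_const, ?_, ?_, ?_, fun η => ?_⟩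
  · change 1 + (Pr x₀).2 ≠ 0
    rw [hPr x₀ hx₀, one_add_hopfMap (h.mem x₀ hx₀)]
    have := norm_pos_iff.2 hz₀
    positivity
  · refine ContDiffOn.contMDiffOn fun y hy => ContDiffAt.contDiffWithinAt ?_
    have h0 : ((1 + y.2 : ℝ) : ℂ) ≠ 0 := Complex.ofReal_ne_zero.2 hy
    have h1 : ContDiffAt ℝ ∞ (fun y : ℂ × ℝ => ((1 + y.2 : ℝ) : ℂ)⁻¹) y := hden.contDiffAt.inv h0
    exact contDiffAt_fst.mul h1
  · rintro _ ⟨hy, x, rfl⟩ _ ⟨hy', x', rfl⟩ heq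
    have hq : ∀ x, ‖(Pr x).1‖ ^ 2 = Real.sign κ * (1 - (Pr x).2 ^ 2) := by
      intro x
      obtain ⟨p, hp, hpx⟩ := hr x
      rw [← hpx, norm_sq_hopfMap hκ hp]
    have h1 : 1 + (Pr x).2 ≠ 0 := hy
    have h2 : 1 + (Pr x').2 ≠ 0 := hy'
    have h3 : (Pr x).1 / ((1 + (Pr x).2 : ℝ) : ℂ) = (Pr x').1 / ((1 + (Pr x').2 : ℝ) : ℂ) := heq
    have h4 : (Pr x).1 * ((1 + (Pr x').2 : ℝ) : ℂ) = (Pr x').1 * ((1 + (Pr x).2 : ℝ) : ℂ) :=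
      (div_eq_div_iff (Complex.ofReal_ne_zero.2 h1) (Complex.ofReal_ne_zero.2 h2)).1 h3
    have h5 := congrArg (fun z : ℂ => ‖z‖ ^ 2) h4
    simp only [norm_mul, mul_pow, hq, Complex.norm_real, Real.norm_eq_abs, sq_abs] at h5
    have h6 : (Pr x).2 = (Pr x').2 := by
      have h7 : ((1 + (Pr x).2) * (1 + (Pr x').2)) * ((Pr x).2 - (Pr x').2) = 0 := by
        linear_combination (-Real.sign κ / 2) * h5 - ((1 + (Pr x).2) * (1 + (Pr x').2)
          * ((Pr x).2 - (Pr x').2)) * he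
      rcases mul_eq_zero.1 h7 with h8 | h8
      · exact absurd h8 (mul_ne_zero h1 h2)
      · exact sub_eq_zero.1 h8
    refine Prod.ext ?_ h6
    rw [h6] at h4
    exact mul_right_cancel₀ (Complex.ofReal_ne_zero.2 h2) h4
  · set z := (χ x₀).1 with hz
    set w := (χ x₀).2 with hw
    have h1 : ((fun y : ℂ × ℝ => y.1 / ((1 + y.2 : ℝ) : ℂ)) ∘ Pr) =ᶠ[𝓝 x₀]
        ContinuousLinearMap.fst ℝ ℂ ℂ ∘ Θ := by
      filter_upwards [hB'.mem_nhds hx₀'] with y hy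
      simp only [Function.comp_apply]
      rw [hPr y (hsub hy), hopfMap_div (h.mem y (hsub hy)) (hΘd y hy).1, (hΘd y hy).2.1]
      rfl
    have h2 := modelDeriv_comp (I := I) (I₁ := 𝓘(ℝ, ℂ × ℂ)) (I₂ := 𝓘(ℝ, ℂ)) (x := x₀) (F := Θ)
      (f := ContinuousLinearMap.fst ℝ ℂ ℂ)
      (ContinuousLinearMap.differentiableAt _).mdifferentiableAt
      ((hΘ x₀ hx₀').mdifferentiableAt (by simp))
    rw [modelDeriv_eq_fderiv, ContinuousLinearMap.fderiv] at h2
    have hp : z * (starRingEnd ℂ) z + (Real.sign κ : ℂ) * (w * (starRingEnd ℂ) w) = 1 := by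
      have h4 : ‖z‖ ^ 2 + Real.sign κ * ‖w‖ ^ 2 = 1 := h.mem x₀ hx₀
      rw [Complex.mul_conj, Complex.mul_conj, Complex.normSq_eq_norm_sq, Complex.normSq_eq_norm_sq]
      exact_mod_cast h4
    -- the horizontal vector over `η`
    obtain ⟨v, hv⟩ := exists_modelDeriv_eq (κ := κ) hE
      ((h.smooth x₀ hx₀).mdifferentiableAt (by simp)) (h.injective x₀ hx₀)
      (Filter.eventually_of_mem (h.isOpen.mem_nhds hx₀) h.mem)
      (u := (-(Real.sign κ : ℂ) * (starRingEnd ℂ) w * (z ^ 2 * η), (starRingEnd ℂ) z * (z ^ 2 * η)))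
      (by
        rw [signedForm_apply]
        generalize z ^ 2 * η = m
        simp [← hz, ← hw]
        ring)
    refine ⟨v, ?_⟩
    rw [modelDeriv_congr h1, h2, ContinuousLinearMap.comp_apply, (hΘd x₀ hx₀').2.2, hv]
    change (z * ((starRingEnd ℂ) z * (z ^ 2 * η))
      - w * (-(Real.sign κ : ℂ) * (starRingEnd ℂ) w * (z ^ 2 * η))) / z ^ 2 = η
    rw [div_eq_iff (pow_ne_zero 2 hz₀)]
    linear_combination (z ^ 2 * η) * hp

/-- Coordinates of the base are given by `w / z`, or by `z / w` where `z = 0`. -/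
theorem base_coordinates (hE : Module.finrank ℝ E = 3) (hκ : κ ≠ 0)
    (hPr : ∀ x ∈ B, Pr x = hopfMap κ (χ x)) (hr : ∀ x, Pr x ∈ hopfMap κ '' quadric κ)
    {x₀ : N} (hx₀ : x₀ ∈ B) :
    ∃ (ζ : ℂ × ℝ → ℂ) (O : Set (ℂ × ℝ)), IsOpen O ∧ Pr x₀ ∈ O ∧
      ContMDiffOn 𝓘(ℝ, ℂ × ℝ) 𝓘(ℝ, ℂ) ∞ ζ O ∧ InjOn ζ (O ∩ range Pr) ∧
      Function.Surjective (modelDeriv I 𝓘(ℝ, ℂ) (ζ ∘ Pr) x₀) := by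
  by_cases hz : (χ x₀).1 = 0
  · obtain ⟨hκ', h2⟩ := h.pos_of_eq_zero hκ hx₀ hz
    -- on the sphere the two coordinates can be exchanged
    let ρ : (ℂ × ℝ) ≃L[ℝ] ℂ × ℝ :=
      Complex.conjCLE.prodCongr (ContinuousLinearEquiv.neg ℝ)
    have hρ : ∀ p : ℂ × ℂ, ρ (hopfMap κ p) = hopfMap κ (p.2, p.1) := by
      intro p
      refine Prod.ext ?_ ?_
      · change (starRingEnd ℂ) (2 * p.2 * (starRingEnd ℂ) p.1) = 2 * p.1 * (starRingEnd ℂ) p.2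
        rw [map_mul, map_mul, Complex.conj_conj, map_ofNat]
        ring
      · change -(‖p.1‖ ^ 2 - Real.sign κ * ‖p.2‖ ^ 2) = ‖p.2‖ ^ 2 - Real.sign κ * ‖p.1‖ ^ 2
        rw [Real.sign_of_pos hκ']
        ring
    obtain ⟨ζ, O, hO, hxO, hζ, hinj, hs⟩ := (h.swap hκ').base_coordinates_of_ne_zero
      (Pr := ρ ∘ Pr) hE hκ (fun x hx => by rw [Function.comp_apply, hPr x hx, hρ])
      (fun x => by
        obtain ⟨p, hp, hpx⟩ := hr x
        refine ⟨(p.2, p.1), ?_, by rw [Function.comp_apply, ← hpx, hρ]⟩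
        have h3 : ‖p.1‖ ^ 2 + Real.sign κ * ‖p.2‖ ^ 2 = 1 := hp
        change ‖p.2‖ ^ 2 + Real.sign κ * ‖p.1‖ ^ 2 = 1
        rw [Real.sign_of_pos hκ'] at h3 ⊢
        linarith) hx₀ h2
    refine ⟨ζ ∘ ρ, ρ ⁻¹' O, hO.preimage ρ.continuous, hxO,
      hζ.comp ρ.contDiff.contMDiff.contMDiffOn fun y hy => hy, ?_, hs⟩
    rintro _ ⟨hy, x, rfl⟩ _ ⟨hy', x', rfl⟩ heq
    exact ρ.injective (hinj ⟨hy, x, rfl⟩ ⟨hy', x', rfl⟩ heq)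
  · exact h.base_coordinates_of_ne_zero hE hκ hPr hr hx₀ hz

end IsQuadricChart

end QuadricFibration

/-! ### The universal cover of `Sl(2, ℝ)` -/

section QuadricModels

variable {Q : Type*} [TopologicalSpace Q] [ChartedSpace (EuclideanSpace ℝ (Fin 3)) Q]
  {N : Type*} [TopologicalSpace N] [ChartedSpace (EuclideanSpace ℝ (Fin 3)) N]
  {κ τ : ℝ} {g : Q → EuclideanSpace ℝ (Fin 3) →L[ℝ] EuclideanSpace ℝ (Fin 3) →L[ℝ] ℝ}
  {P : Q → ℂ × ℂ}
  {gN : N → EuclideanSpace ℝ (Fin 3) →L[ℝ] EuclideanSpace ℝ (Fin 3) →L[ℝ] ℝ}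

theorem IsQuadric.metric (hQ : IsQuadric κ τ g P) (x : Q) (v w : EuclideanSpace ℝ (Fin 3)) :
    g x v w = quadricMetric κ τ (P x) (modelDeriv (𝓡 3) 𝓘(ℝ, ℂ × ℂ) P x v)
      (modelDeriv (𝓡 3) 𝓘(ℝ, ℂ × ℂ) P x w) :=
  DFunLike.congr_fun (DFunLike.congr_fun (hQ.2.2.2 x) v) w

theorem IsQuadric.mem (hQ : IsQuadric κ τ g P) (x : Q) : P x ∈ quadric κ := by
  rw [← hQ.2.2.1]
  exact mem_range_self x

/-- A continuous argument of a non-vanishing function is smooth where the function is. -/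
theorem eventually_eq_argument {X : Type*} [TopologicalSpace X] {f : X → ℝ} {z : X → ℂ} {q : X}
    (hf : ContinuousAt f q) (hz : ContinuousAt z q) (hz0 : z q ≠ 0)
    (hfz : ∀ x, (‖z x‖ : ℂ) * Circle.exp (f x) = z x) :
    ∀ᶠ x in 𝓝 q, f x = f q + (Complex.log (z x / z q)).im := by
  set α := f q with hα
  have h1 : ∀ᶠ x in 𝓝 q, angleAt α (Circle.exp (f x)) = f x :=
    hf.tendsto.eventually (angleAt_exp_eventually α)
  have hc : ContinuousAt (fun x => α + (Complex.log (z x / z q)).im) q := by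
    have h2 : ContinuousAt (fun x => Complex.log (z x / z q)) q :=
      ContinuousAt.clog (hz.div_const _) (by rw [div_self hz0]; exact Complex.one_mem_slitPlane)
    exact continuousAt_const.add (Complex.continuous_im.continuousAt.comp h2)
  have h2 : ∀ᶠ x in 𝓝 q, angleAt α (Circle.exp (α + (Complex.log (z x / z q)).im))
      = α + (Complex.log (z x / z q)).im := by
    refine hc.tendsto.eventually (p := fun t => angleAt α (Circle.exp t) = t) ?_
    simp only [div_self hz0, Complex.log_one, Complex.zero_im, add_zero]
    exact angleAt_exp_eventually α
  filter_upwards [h1, h2, hz.eventually_ne hz0] with x hx1 hx2 hx0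
  have h3 : Circle.exp (α + (Complex.log (z x / z q)).im) = Circle.exp (f x) := by
    refine Circle.ext ?_
    have h4 := Complex.norm_mul_exp_arg_mul_I (z x / z q)
    rw [Circle.exp_add, Circle.coe_mul, Complex.log_im, Circle.coe_exp (Complex.arg _)]
    have h5 : (‖z x‖ : ℂ) ≠ 0 := Complex.ofReal_ne_zero.2 (norm_ne_zero_iff.2 hx0)
    have h6 : (‖z q‖ : ℂ) ≠ 0 := Complex.ofReal_ne_zero.2 (norm_ne_zero_iff.2 hz0)
    refine mul_left_cancel₀ h5 ?_
    rw [norm_div, Complex.ofReal_div] at h4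
    have h7 := hfz q
    rw [hfz x]
    rw [← hα] at h7
    generalize Complex.exp (Complex.arg (z x / z q) * Complex.I) = e at h4 ⊢
    have h8 : (‖z x‖ : ℂ) * e = (‖z q‖ : ℂ) * (z x / z q) := by
      rw [← h4]
      field_simp
    calc (‖z x‖ : ℂ) * (Circle.exp α * e) = Circle.exp α * ((‖z x‖ : ℂ) * e) := by ring
      _ = ((‖z q‖ : ℂ) * Circle.exp α) * (z x / z q) := by rw [h8]; ring
      _ = z x := by rw [h7]; field_simp
  rw [← hx2, h3, hx1]

/-- The argument of `z`, which is defined on the universal cover because `z` has no zero, is monotone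
along the fibres. -/
theorem noFlatCompactSurface_universalCover [IsManifold (𝓡 3) ∞ N] (hκ : κ < 0) (hτ : τ ≠ 0)
    (hQ : IsQuadric κ τ g P) {F : N → Q} (hF : IsUniversalCover g gN F) :
    NoFlatCompactSurface.{u} (I := 𝓡 3) gN := by
  obtain ⟨hsc, -, -, ⟨hFs, hFi⟩, hFg⟩ := hF
  have hPs := hQ.1.1
  have hPi := hQ.1.2
  set χ : N → ℂ × ℂ := P ∘ F with hχ
  have hχs : ContMDiff (𝓡 3) 𝓘(ℝ, ℂ × ℂ) ∞ χ := hPs.comp hFs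
  have hd : ∀ x, modelDeriv (𝓡 3) 𝓘(ℝ, ℂ × ℂ) χ x
      = (modelDeriv (𝓡 3) 𝓘(ℝ, ℂ × ℂ) P (F x)).comp (modelDeriv (𝓡 3) (𝓡 3) F x) := fun x =>
    modelDeriv_comp (hPs.mdifferentiableAt (by simp)) (hFs.mdifferentiableAt (by simp))
  have hinj : ∀ x, Function.Injective (modelDeriv (𝓡 3) 𝓘(ℝ, ℂ × ℂ) χ x) := by
    intro x
    rw [hd]
    exact (hPi (F x)).comp (hFi x)
  have hm : ∀ x, χ x ∈ quadric κ := fun x => hQ.mem (F x)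
  have hex : ∀ x, ∃ v : EuclideanSpace ℝ (Fin 3), modelDeriv (𝓡 3) 𝓘(ℝ, ℂ × ℂ) χ x v
      = (κ / (4 * τ)) • (Complex.I * (χ x).1, Complex.I * (χ x).2) := fun x =>
    exists_modelDeriv_eq (κ := κ) (by simp) (hχs.mdifferentiableAt (by simp)) (hinj x)
      (Filter.Eventually.of_forall hm) (by rw [map_smul, signedForm_vertical_self, smul_zero])
  choose ξ hξ using hex
  have h : IsQuadricChart (𝓡 3) κ τ gN ξ χ univ :=
    ⟨isOpen_univ, fun x _ => hχs x, fun x _ => hinj x, fun x _ => hm x, fun x _ v w => by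
      have h1 : gN x v w = g (F x) (modelDeriv (𝓡 3) (𝓡 3) F x v) (modelDeriv (𝓡 3) (𝓡 3) F x w) :=
        (DFunLike.congr_fun (DFunLike.congr_fun (hFg x) v) w).symm
      rw [h1, hQ.metric, hd]
      rfl, fun x _ => hξ x⟩
  have K : EktLike (𝓡 3) κ τ gN ξ := ⟨fun x v hv => h.pos hκ.ne hτ (mem_univ x) hv,
    fun x => h.unit hκ.ne hτ (mem_univ x),
    fun x => (h.hasEktCoframeAt hκ.ne (mem_univ x)).toModel⟩
  have hz : ∀ x, (χ x).1 ≠ 0 := fun x hx =>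
    absurd (h.pos_of_eq_zero hκ.ne (mem_univ x) hx).1 (not_lt.2 hκ.le)
  -- a continuous argument of `z`
  have : LocallyPathConnectedSpace N :=
    ChartedSpace.locallyPathConnectedSpace (EuclideanSpace ℝ (Fin 3)) N
  have hzc : Continuous fun x => (χ x).1 := hχs.continuous.fst
  let φ : C(N, Circle) := ⟨fun x => ⟨(χ x).1 / (‖(χ x).1‖ : ℂ), mem_sphere_zero_iff_norm.2 (by
    rw [norm_div, Complex.norm_real, norm_norm, div_self (norm_ne_zero_iff.2 (hz x))])⟩, Continuous.subtype_mk (hzc.div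
        (Complex.continuous_ofReal.comp hzc.norm)
        fun x => Complex.ofReal_ne_zero.2 (norm_ne_zero_iff.2 (hz x))) _⟩
  obtain ⟨x₀⟩ : Nonempty N := inferInstance
  obtain ⟨t₀, ht₀⟩ := Circle.exp_surjective (φ x₀)
  obtain ⟨f, ⟨-, hf⟩, -⟩ := Circle.isCoveringMap_exp.existsUnique_continuousMap_lifts φ x₀ t₀ ht₀
  have hfz : ∀ x, (‖(χ x).1‖ : ℂ) * Circle.exp (f x) = (χ x).1 := by
    intro x
    have h1 : Circle.exp (f x) = φ x := congrFun hf x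
    rw [h1]
    exact mul_div_cancel₀ _ (Complex.ofReal_ne_zero.2 (norm_ne_zero_iff.2 (hz x)))
  have hloc : ∀ q, ∃ Θ : N → ℂ × ℂ, ContMDiffAt (𝓡 3) 𝓘(ℝ, ℂ × ℂ) ∞ Θ q ∧
      f =ᶠ[𝓝 q] (fun p : ℂ × ℂ => f q + p.2.im) ∘ Θ ∧
      (modelDeriv (𝓡 3) 𝓘(ℝ, ℂ × ℂ) Θ q (ξ q)).2 = ((κ / (4 * τ) : ℝ) : ℂ) * Complex.I := by
    intro q
    obtain ⟨Θ, B', hB', hq, -, hΘ, hΘd⟩ := h.exists_coordinates (mem_univ q) (hz q)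
    refine ⟨Θ, hΘ q hq, ?_, ?_⟩
    · filter_upwards [eventually_eq_argument f.continuous.continuousAt hzc.continuousAt (hz q) hfz,
        hB'.mem_nhds hq] with x hx hxB
      rw [hx, Function.comp_apply, (hΘd x hxB).2.1]
    · rw [(hΘd q hq).2.2, hξ]
      change (κ / (4 * τ)) • (Complex.I * (χ q).1) / (χ q).1 = _
      rw [Complex.real_smul]
      have := hz q
      field_simp
  have hL : ∀ (a : ℝ) (p : ℂ × ℂ), HasFDerivAt (fun p : ℂ × ℂ => a + p.2.im)
      (Complex.imCLM.comp (ContinuousLinearMap.snd ℝ ℂ ℂ)) p := fun a p =>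
    ((Complex.imCLM.comp (ContinuousLinearMap.snd ℝ ℂ ℂ)).hasFDerivAt).const_add a
  have hLs : ∀ a : ℝ, ContDiff ℝ ∞ fun p : ℂ × ℂ => a + p.2.im := fun a =>
    contDiff_const.add (Complex.imCLM.comp (ContinuousLinearMap.snd ℝ ℂ ℂ)).contDiff
  refine K.noFlatCompactSurface (f := f) (by nlinarith [sq_nonneg τ]) (fun q => ?_) fun q => ?_
  · obtain ⟨Θ, hΘ, hfΘ, -⟩ := hloc q
    exact ((hLs (f q)).contMDiff.contMDiffAt.comp q hΘ).congr_of_eventuallyEq hfΘ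
  · obtain ⟨Θ, hΘ, hfΘ, hΘd⟩ := hloc q
    rw [modelDeriv_congr hfΘ, modelDeriv_comp (F := Θ) (f := fun p : ℂ × ℂ => f q + p.2.im)
      (hL _ _).differentiableAt.mdifferentiableAt (hΘ.mdifferentiableAt (by simp)),
      modelDeriv_eq_fderiv, (hL _ _).fderiv]
    change (modelDeriv (𝓡 3) 𝓘(ℝ, ℂ × ℂ) Θ q (ξ q)).2.im ≠ 0
    rw [hΘd, Complex.im_ofReal_mul, Complex.I_im, mul_one]
    exact div_ne_zero hκ.ne (mul_ne_zero four_ne_zero hτ)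

/-! ### The Berger spheres, `Sl(2, ℝ)` and their quotients -/

/-- A local section of a local diffeomorphism. -/
theorem exists_local_section {E : Type*} [NormedAddCommGroup E] [NormedSpace ℝ E]
    [FiniteDimensional ℝ E] {H : Type*} [TopologicalSpace H] {I : ModelWithCorners ℝ E H}
    [I.Boundaryless] {X Y : Type*} [TopologicalSpace X] [ChartedSpace H X] [IsManifold I ∞ X]
    [TopologicalSpace Y] [ChartedSpace H Y] [IsManifold I ∞ Y] {F : X → Y}
    (hF : ContMDiff I I ∞ F) {x : X} (hi : Function.Injective (modelDeriv I I F x)) :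
    ∃ (G : Y → X) (B : Set Y), IsOpen B ∧ F x ∈ B ∧ G (F x) = x ∧
      ∀ q ∈ B, ContMDiffAt I I ∞ G q ∧ F (G q) = q := by
  set φ := extChartAt I x with hφ
  set ψ := extChartAt I (F x) with hψ
  have hx : x ∈ φ.source := mem_extChartAt_source x
  have hy : F x ∈ ψ.source := mem_extChartAt_source (F x)
  set U : Set E := φ.target ∩ φ.symm ⁻¹' (F ⁻¹' ψ.source) with hU
  have hUo : IsOpen U := (continuousOn_extChartAt_symm x).isOpen_inter_preimage
    (isOpen_extChartAt_target x) ((isOpen_extChartAt_source (F x)).preimage hF.continuous)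
  set f : E → E := ψ ∘ F ∘ φ.symm with hf
  have hfs : ∀ z ∈ U, ContMDiffAt 𝓘(ℝ, E) 𝓘(ℝ, E) ∞ f z := fun z hz =>
    (contMDiffAt_extChartAt_of_mem hz.2).comp z
      (hF.contMDiffAt.comp z (contMDiffAt_extChartAt_symm hz.1))
  have h0 : φ.symm (φ x) = x := φ.left_inv hx
  have hxU : φ x ∈ U := ⟨φ.map_source hx, by
    change F (φ.symm (φ x)) ∈ ψ.source
    rwa [h0]⟩
  have hinv : (fderiv ℝ f (φ x)).IsInvertible := by
    refine isInvertible_of_injective rfl ?_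
    have h1 := modelDeriv_comp (I := 𝓘(ℝ, E)) (I₁ := I) (I₂ := I) (F := φ.symm) (f := F) (x := φ x)
      (hF.mdifferentiableAt (by simp))
      ((contMDiffAt_extChartAt_symm hxU.1).mdifferentiableAt (by simp))
    have h2 := modelDeriv_comp (I := 𝓘(ℝ, E)) (I₁ := I) (I₂ := 𝓘(ℝ, E)) (F := F ∘ φ.symm)
      (f := ψ) (x := φ x) ((contMDiffAt_extChartAt_of_mem hxU.2).mdifferentiableAt (by simp))
      ((hF.contMDiffAt.comp (φ x) (contMDiffAt_extChartAt_symm hxU.1)).mdifferentiableAt (by simp))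
    rw [modelDeriv_eq_fderiv, h1] at h2
    rw [hf, h2]
    simp only [Function.comp_apply, h0]
    refine Function.Injective.comp (g := modelDeriv I 𝓘(ℝ, E) ψ (F x)) ?_
      (hi.comp (injective_modelDeriv_extChartAt_symm hxU.1))
    intro u v huv
    rw [← modelDeriv_symm_extChartAt hy u, ← hψ, huv, modelDeriv_symm_extChartAt hy]
  obtain ⟨e, hef, hxe, heU, hes⟩ := exists_smooth_local_inverse hUo
    (fun z hz => (hfs z hz).contDiffAt.contDiffWithinAt) hxU hinv
  have hfx : e (φ x) = ψ (F x) := by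
    rw [hef, hf]
    simp only [Function.comp_apply, h0]
  refine ⟨φ.symm ∘ e.symm ∘ ψ, ψ.source ∩ ψ ⁻¹' e.target,
    isOpen_extChartAt_preimage' (F x) e.open_target, ⟨hy, ?_⟩, ?_, ?_⟩
  · change ψ (F x) ∈ e.target
    rw [← hfx]
    exact e.map_source hxe
  · simp only [Function.comp_apply]
    rw [← hfx, e.left_inv hxe, h0]
  · rintro q ⟨hq, hqe⟩
    have h1 : e.symm (ψ q) ∈ U := heU (e.map_target hqe)
    refine ⟨(contMDiffAt_extChartAt_symm h1.1).comp q
      ((hes _ hqe).contMDiffAt.comp q (contMDiffAt_extChartAt_of_mem hq)), ?_⟩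
    have h2 : ψ (F (φ.symm (e.symm (ψ q)))) = ψ q := by
      have h3 := e.right_inv hqe
      rw [hef] at h3
      exact h3
    exact ψ.injOn h1.2 hq h2

/-- Two local maps to `ℂ × ℂ` that differ by roots of unity differ by a constant factor. -/
theorem eventually_eq_const_smul {X : Type*} [TopologicalSpace X] {n : ℕ} (hn : 1 ≤ n)
    {χ χ' : X → ℂ × ℂ} {q : X} (hχ : ContinuousAt χ q) (hχ' : ContinuousAt χ' q) (h0 : χ' q ≠ 0)
    (h : ∀ᶠ x in 𝓝 q, ∃ ζ : ℂ, ζ ^ n = 1 ∧ χ x = (ζ * (χ' x).1, ζ * (χ' x).2)) :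
    ∃ ζ : ℂ, ∀ᶠ x in 𝓝 q, χ x = (ζ * (χ' x).1, ζ * (χ' x).2) := by
  set d : X → ℂ := fun x =>
    (starRingEnd ℂ) (χ' x).1 * (χ' x).1 + (starRingEnd ℂ) (χ' x).2 * (χ' x).2 with hd
  set r : X → ℂ := fun x =>
    ((starRingEnd ℂ) (χ' x).1 * (χ x).1 + (starRingEnd ℂ) (χ' x).2 * (χ x).2) / d x with hr
  have hd0 : d q ≠ 0 := by
    intro hz
    have h1 : d q = ((Complex.normSq (χ' q).1 + Complex.normSq (χ' q).2 : ℝ) : ℂ) := by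
      rw [hd]
      simp only [mul_comm ((starRingEnd ℂ) _), Complex.mul_conj]
      push_cast
      rfl
    rw [h1, Complex.ofReal_eq_zero] at hz
    have h2 := Complex.normSq_nonneg (χ' q).1
    have h3 := Complex.normSq_nonneg (χ' q).2
    refine h0 (Prod.ext (Complex.normSq_eq_zero.1 ?_) (Complex.normSq_eq_zero.1 ?_)) <;> linarith
  have hc : ∀ {z : X → ℂ}, ContinuousAt z q → ContinuousAt (fun x => (starRingEnd ℂ) (z x)) q :=
    fun hz => Complex.continuous_conj.continuousAt.comp hz
  have hdc : ContinuousAt d q :=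
    ((hc hχ'.fst).mul hχ'.fst).add ((hc hχ'.snd).mul hχ'.snd)
  have hrc : ContinuousAt r q :=
    (((hc hχ'.fst).mul hχ.fst).add ((hc hχ'.snd).mul hχ.snd)).div hdc hd0
  have hval : ∀ᶠ x in 𝓝 q, (r x) ^ n = 1 ∧ χ x = (r x * (χ' x).1, r x * (χ' x).2) := by
    filter_upwards [h, hdc.eventually_ne hd0] with x hx hdx
    obtain ⟨ζ, hζ, hx⟩ := hx
    have h1 : r x = ζ := by
      rw [hr]
      simp only
      rw [div_eq_iff hdx, hx, hd]
      ring
    rw [h1]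
    exact ⟨hζ, hx⟩
  have hfin : {ζ : ℂ | ζ ^ n = 1}.Finite := by
    refine (Polynomial.nthRootsFinset n (1 : ℂ)).finite_toSet.subset fun ζ hζ => ?_
    exact (Polynomial.mem_nthRootsFinset hn 1).2 hζ
  have hopen : ({ζ : ℂ | ζ ^ n = 1} \ {r q})ᶜ ∈ 𝓝 (r q) :=
    (hfin.subset sdiff_subset).isClosed.isOpen_compl.mem_nhds fun hmem => hmem.2 rfl
  refine ⟨r q, ?_⟩
  filter_upwards [hval, hrc.preimage_mem_nhds hopen] with x hx hx'
  have h1 : r x = r q := by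
    by_contra hne
    exact hx' ⟨hx.1, hne⟩
  rw [← h1]
  exact hx.2

/-- The quotients of the quadrics by roots of unity are locally isometric to the quadrics, compatibly
with the Hopf map. Their fibres are images of the orbits of the circle, hence compact and connected. -/
theorem exists_ektFibration_quotient [IsManifold (𝓡 3) ∞ Q] [IsManifold (𝓡 3) ∞ N] {n : ℕ}
    {F : Q → N} {Pr : N → ℂ × ℝ} (hκ : κ ≠ 0) (hτ : τ ≠ 0) (hn : 1 ≤ n) (hQ : IsQuadric κ τ g P)
    (hF : IsCyclicQuotient n g P gN F) (hPr : ∀ q, Pr (F q) = hopfMap κ (P q)) :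
    (∃ ξ, EktFibration (𝓡 3) 𝓘(ℝ, ℂ × ℝ) κ τ gN ξ Pr) ∧
      ∀ q, IsCompact (Pr ⁻¹' {Pr q}) := by
  obtain ⟨⟨⟨hFs, hFi⟩, hFg⟩, hsurj, hfib⟩ := hF
  have hPs := hQ.1.1
  have hPi := hQ.1.2
  have hFi' : ∀ x, Function.Injective (modelDeriv (𝓡 3) (𝓡 3) F x) := hFi
  -- the fibres are the images of the orbits of the circle
  have hfibre : ∀ q, ∃ o : Circle → N, Continuous o ∧ Pr ⁻¹' {Pr q} = range o := by
    intro q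
    obtain ⟨x, rfl⟩ := hsurj q
    have horb : ∀ s : Circle, ∃ y, P y = ((s : ℂ) * (P x).1, (s : ℂ) * (P x).2) := by
      intro s
      have h1 : ((s : ℂ) * (P x).1, (s : ℂ) * (P x).2) ∈ quadric κ := by
        have h2 : ‖(P x).1‖ ^ 2 + Real.sign κ * ‖(P x).2‖ ^ 2 = 1 := hQ.mem x
        change ‖(s : ℂ) * (P x).1‖ ^ 2 + Real.sign κ * ‖(s : ℂ) * (P x).2‖ ^ 2 = 1
        rwa [norm_mul, norm_mul, Circle.norm_coe, one_mul, one_mul]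
      rw [← hQ.2.2.1] at h1
      exact h1
    choose o ho using horb
    have hoc : Continuous o := by
      rw [hQ.2.1.isInducing.continuous_iff]
      have h1 : P ∘ o = fun s : Circle => ((s : ℂ) * (P x).1, (s : ℂ) * (P x).2) := funext ho
      rw [h1]
      fun_prop
    refine ⟨F ∘ o, hFs.continuous.comp hoc, ?_⟩
    ext p
    constructor
    · intro hp
      obtain ⟨y, rfl⟩ := hsurj p
      have h1 : Pr (F y) = Pr (F x) := hp
      rw [hPr, hPr] at h1
      obtain ⟨s, hs⟩ := exists_circle_of_hopfMap_eq hκ (hQ.mem x) (hQ.mem y) h1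
      have h2 : o s = y := hQ.2.1.injective (by rw [ho, hs])
      exact ⟨s, congrArg F h2⟩
    · rintro ⟨s, rfl⟩
      change Pr (F (o s)) = Pr (F x)
      rw [hPr, hPr, ho, hopfMap_smul κ (Circle.norm_coe s)]
  refine ⟨?_, fun q => ?_⟩
  swap
  · obtain ⟨o, ho, hq⟩ := hfibre q
    rw [hq]
    exact isCompact_range ho
  -- the vertical field of the quadric, and its image in the quotient
  have hex : ∀ x, ∃ v : EuclideanSpace ℝ (Fin 3), modelDeriv (𝓡 3) 𝓘(ℝ, ℂ × ℂ) P x v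
      = (κ / (4 * τ)) • (Complex.I * (P x).1, Complex.I * (P x).2) := fun x =>
    exists_modelDeriv_eq (κ := κ) (by simp) (hPs.mdifferentiableAt (by simp)) (hPi x)
      (Filter.Eventually.of_forall hQ.mem) (by rw [map_smul, signedForm_vertical_self, smul_zero])
  choose ξQ hξQ using hex
  choose lift hlift using hsurj
  set ξ : N → EuclideanSpace ℝ (Fin 3) := fun q => modelDeriv (𝓡 3) (𝓡 3) F (lift q) (ξQ (lift q))
    with hξ
  have hsec : ∀ {G : N → Q} {B : Set N}, IsOpen B →
      (∀ q ∈ B, ContMDiffAt (𝓡 3) (𝓡 3) ∞ G q ∧ F (G q) = q) → ∀ q ∈ B,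
      (∀ v, modelDeriv (𝓡 3) (𝓡 3) F (G q) (modelDeriv (𝓡 3) (𝓡 3) G q v) = v) ∧
      modelDeriv (𝓡 3) 𝓘(ℝ, ℂ × ℂ) (P ∘ G) q = (modelDeriv (𝓡 3) 𝓘(ℝ, ℂ × ℂ) P (G q)).comp
        (modelDeriv (𝓡 3) (𝓡 3) G q) := by
    intro G B hB hG q hq
    refine ⟨fun v => ?_, modelDeriv_comp (hPs.mdifferentiableAt (by simp))
      ((hG q hq).1.mdifferentiableAt (by simp))⟩
    have h1 := modelDeriv_comp (I := 𝓡 3) (I₁ := 𝓡 3) (I₂ := 𝓡 3) (x := q) (F := G) (f := F)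
      (hFs.mdifferentiableAt (by simp)) ((hG q hq).1.mdifferentiableAt (by simp))
    have h2 : (F ∘ G) =ᶠ[𝓝 q] fun p => p := by
      filter_upwards [hB.mem_nhds hq] with p hp using (hG p hp).2
    rw [modelDeriv_congr h2, modelDeriv_id] at h1
    exact (DFunLike.congr_fun h1 v).symm
  have hchart : ∀ q, ∃ (χ : N → ℂ × ℂ) (B : Set N), q ∈ B ∧
      IsQuadricChart (𝓡 3) κ τ gN ξ χ B ∧ ∀ p ∈ B, Pr p = hopfMap κ (χ p) := by
    intro q
    obtain ⟨G, B, hB, hqB, -, hG⟩ := exists_local_section hFs (hFi' (lift q))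
    rw [hlift] at hqB
    refine ⟨P ∘ G, B, hqB, ⟨hB, fun p hp => hPs.contMDiffAt.comp p (hG p hp).1, fun p hp => ?_,
      fun p hp => hQ.mem (G p), fun p hp v w => ?_, fun p hp => ?_⟩, fun p hp => ?_⟩
    · rw [(hsec hB hG p hp).2]
      refine (hPi (G p)).comp fun u v huv => ?_
      exact ((hsec hB hG p hp).1 u).symm.trans
        ((congrArg (modelDeriv (𝓡 3) (𝓡 3) F (G p)) huv).trans ((hsec hB hG p hp).1 v))
    · have h1 : ∀ v w : EuclideanSpace ℝ (Fin 3), gN (F (G p))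
          (modelDeriv (𝓡 3) (𝓡 3) F (G p) v) (modelDeriv (𝓡 3) (𝓡 3) F (G p) w) = g (G p) v w :=
        fun v w => DFunLike.congr_fun (DFunLike.congr_fun (hFg (G p)) v) w
      have h2 := h1 (modelDeriv (𝓡 3) (𝓡 3) G p v) (modelDeriv (𝓡 3) (𝓡 3) G p w)
      rw [(hsec hB hG p hp).1, (hsec hB hG p hp).1, (hG p hp).2] at h2
      rw [h2, hQ.metric, (hsec hB hG p hp).2]
      rfl
    · -- another section, through the chosen preimage of `p`
      obtain ⟨G', B', hB', hpB', hGp, hG'⟩ := exists_local_section hFs (hFi' (lift p))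
      rw [hlift] at hpB' hGp
      have h1 : modelDeriv (𝓡 3) 𝓘(ℝ, ℂ × ℂ) (P ∘ G') p (ξ p)
          = (κ / (4 * τ)) • (Complex.I * (P (G' p)).1, Complex.I * (P (G' p)).2) := by
        rw [(hsec hB' hG' p hpB').2, ContinuousLinearMap.comp_apply]
        have h2 : modelDeriv (𝓡 3) (𝓡 3) G' p (ξ p) = ξQ (lift p) := by
          refine hFi' (lift p) ?_
          have h3 := (hsec hB' hG' p hpB').1 (ξ p)
          rw [hGp] at h3
          exact h3
        rw [h2, hGp, hξQ]
      obtain ⟨ζ, hζ⟩ := eventually_eq_const_smul (χ := P ∘ G) (χ' := P ∘ G') hn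
        (hPs.continuous.continuousAt.comp (hG p hp).1.continuousAt)
        (hPs.continuous.continuousAt.comp (hG' p hpB').1.continuousAt)
        (fun h0 => by
          have h2 := mem_quadric_iff.1 (hQ.mem (G' p))
          rw [show P (G' p) = 0 from h0, map_zero] at h2
          exact zero_ne_one h2)
        (by
          filter_upwards [hB.mem_nhds hp, hB'.mem_nhds hpB'] with p' h2 h3
          exact (hfib _ _).1 (((hG' p' h3).2).trans ((hG p' h2).2).symm))
      let L : ℂ × ℂ →L[ℝ] ℂ × ℂ := ζ • ContinuousLinearMap.id ℝ (ℂ × ℂ)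
      have h2 : (P ∘ G) =ᶠ[𝓝 p] L ∘ (P ∘ G') := hζ
      have h3 := modelDeriv_comp (I := 𝓡 3) (I₁ := 𝓘(ℝ, ℂ × ℂ)) (I₂ := 𝓘(ℝ, ℂ × ℂ)) (x := p)
        (F := P ∘ G') (f := L) L.differentiableAt.mdifferentiableAt
        ((hPs.contMDiffAt.comp p (hG' p hpB').1).mdifferentiableAt (by simp))
      rw [modelDeriv_congr h2, h3, modelDeriv_eq_fderiv, ContinuousLinearMap.fderiv,
        ContinuousLinearMap.comp_apply, h1, map_smul, h2.self_of_nhds]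
      congr 1
      refine Prod.ext ?_ ?_
      · change ζ * (Complex.I * (P (G' p)).1) = Complex.I * (ζ * (P (G' p)).1)
        ring
      · change ζ * (Complex.I * (P (G' p)).2) = Complex.I * (ζ * (P (G' p)).2)
        ring
    · have h1 := hPr (G p)
      rw [(hG p hp).2] at h1
      exact h1
  have hr : ∀ q, Pr q ∈ hopfMap κ '' quadric κ := by
    intro q
    refine ⟨P (lift q), hQ.mem _, ?_⟩
    rw [← hPr, hlift]
  refine ⟨ξ, ⟨⟨fun q v hv => ?_, fun q => ?_, fun q => ?_⟩, by simp, fun q => ?_, fun q => ?_,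
    fun q => ?_, fun q => ?_⟩⟩
  · obtain ⟨χ, B, hq, h, -⟩ := hchart q
    exact h.pos hκ hτ hq hv
  · obtain ⟨χ, B, hq, h, -⟩ := hchart q
    exact h.unit hκ hτ hq
  · obtain ⟨χ, B, hq, h, -⟩ := hchart q
    exact (h.hasEktCoframeAt hκ hq).toModel
  · obtain ⟨χ, B, hq, h, h'⟩ := hchart q
    exact h.contMDiffAt_proj h' hq
  · obtain ⟨χ, B, hq, h, h'⟩ := hchart q
    exact h.modelDeriv_proj_field h' hq
  · obtain ⟨o, ho, hq⟩ := hfibre q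
    rw [hq]
    exact isPreconnected_range ho
  · obtain ⟨χ, B, hq, h, h'⟩ := hchart q
    exact h.base_coordinates (by simp) hκ h' hr hq

end QuadricModels

end

end HopfTori

theorem theorem1 :
    -- the flat compact surfaces of `E(κ, τ)` are the Hopf tori
    (∀ (κ τ : ℝ) (E : Type v) [NormedAddCommGroup E] [NormedSpace ℝ E]
      (H : Type w) [TopologicalSpace H] (I : ModelWithCorners ℝ E H) [I.Boundaryless]
      (N : Type x) [TopologicalSpace N] [T2Space N] [SecondCountableTopology N]
      [ChartedSpace H N] [IsManifold I ∞ N]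
      (M : Type y) [TopologicalSpace M] [T2Space M] [SecondCountableTopology M]
      [ChartedSpace (EuclideanSpace ℝ (Fin 2)) M] [IsManifold (𝓡 2) ∞ M]
      (g : SmoothMetric I N) (gM : SmoothMetric (𝓡 2) M) (Pr : N → M)
      (ξ : (p : N) → TangentSpace I p)
      (cross : (p : N) → TangentSpace I p →L[ℝ] TangentSpace I p →L[ℝ] TangentSpace I p),
      IsEkt κ τ g gM Pr ξ cross →
        FlatIffHopfTorus.{u} (𝓡 2) g.inner Pr ∧
        ((∀ b, IsCompact (Pr ⁻¹' {b})) → EveryHopfTorusIsFlat (𝓡 2) g.inner Pr)) ∧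
    -- `M²(κ) × ℝ` and `M²(κ) × 𝕊¹`, for a circle of any radius `r`
    (∀ (κ : ℝ) (M : Type y) [TopologicalSpace M] [T2Space M] [SecondCountableTopology M]
      [ChartedSpace (EuclideanSpace ℝ (Fin 2)) M] [IsManifold (𝓡 2) ∞ M]
      (gM : SmoothMetric (𝓡 2) M), κ ≠ 0 → IsSpaceForm κ gM →
        NoFlatCompactSurface.{u} (prodMetric gM.inner (euclideanMetric ℝ)) ∧
        ∀ r : ℝ, 0 < r →
          FlatIffHopfTorus.{u} (𝓡 2) (prodMetric gM.inner (circleMetric r)) Prod.fst ∧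
          EveryHopfTorusIsFlat (𝓡 2) (prodMetric gM.inner (circleMetric r)) Prod.fst) ∧
    -- the Heisenberg group
    (∀ τ : ℝ, τ ≠ 0 → NoFlatCompactSurface.{u} (nilMetric τ)) ∧
    -- the universal cover of `Sl(2, ℝ)`
    (∀ (κ τ : ℝ)
      (Q : Type x) [TopologicalSpace Q] [ChartedSpace (EuclideanSpace ℝ (Fin 3)) Q]
      [IsManifold (𝓡 3) ∞ Q]
      (N : Type x) [TopologicalSpace N] [ChartedSpace (EuclideanSpace ℝ (Fin 3)) N]
      [IsManifold (𝓡 3) ∞ N]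
      (g : MetricField (𝓡 3) Q) (P : Q → ℂ × ℂ) (gN : MetricField (𝓡 3) N) (F : N → Q),
      κ < 0 → τ ≠ 0 → IsQuadric κ τ g P → IsUniversalCover g gN F →
        NoFlatCompactSurface.{u} gN) ∧
    -- Berger spheres, `Sl(2, ℝ)` (both with `n = 1`), and their quotients by `ℤ_n`
    (∀ (κ τ : ℝ) (n : ℕ)
      (Q : Type x) [TopologicalSpace Q] [ChartedSpace (EuclideanSpace ℝ (Fin 3)) Q]
      [IsManifold (𝓡 3) ∞ Q]
      (N : Type x) [TopologicalSpace N] [T2Space N] [ChartedSpace (EuclideanSpace ℝ (Fin 3)) N]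
      [IsManifold (𝓡 3) ∞ N]
      (g : MetricField (𝓡 3) Q) (P : Q → ℂ × ℂ) (gN : MetricField (𝓡 3) N) (F : Q → N)
      (Pr : N → ℂ × ℝ),
      κ ≠ 0 → τ ≠ 0 → κ - 4 * τ ^ 2 ≠ 0 → 1 ≤ n → IsQuadric κ τ g P →
      IsCyclicQuotient n g P gN F → (∀ q, Pr (F q) = hopfMap κ (P q)) →
        FlatIffHopfTorus.{u} 𝓘(ℝ, ℂ × ℝ) gN Pr ∧
        EveryHopfTorusIsFlat 𝓘(ℝ, ℂ × ℝ) gN Pr) := by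
  refine ⟨?_, ?_, fun τ hτ => noFlatCompactSurface_nil hτ, ?_, ?_⟩
  · intro κ τ E _ _ H _ I _ N _ _ _ _ _ M _ _ _ _ _ g gM Pr ξ cross h
    exact ⟨h.ektFibration.flatIffHopfTorus h.ne,
      fun hc => h.ektFibration.everyHopfTorusIsFlat fun x => hc (Pr x)⟩
  · intro κ M _ _ _ _ _ gM hκ hM
    exact ⟨noFlatCompactSurface_prod_real hκ hM, fun r hr => flatIffHopfTorus_prod_circle hκ hM hr⟩
  · intro κ τ Q _ _ _ N _ _ _ g P gN F hκ hτ hQ hF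
    exact noFlatCompactSurface_universalCover hκ hτ hQ hF
  · intro κ τ n Q _ _ _ N _ _ _ _ g P gN F Pr hκ hτ hk hn hQ hF hPr
    obtain ⟨⟨ξ, K⟩, hc⟩ := exists_ektFibration_quotient hκ hτ hn hQ hF hPr
    exact ⟨K.flatIffHopfTorus hk, K.everyHopfTorusIsFlat hc⟩
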